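/- Let $n\ge 0$ be an integer and $\lambda\in\mathbb R$. Put $\eta_\lambda(r)=\frac{e^{2\lambda r}-1}{2\lambda}$ ($\eta_0(r)=r$), $e(t)=e^{2\pi i t}$, $\bar e(t)=e^{-2\pi i t}$, and let $\beta$ be the usual inner product on $\mathbb R^n$. Let $\mathcal H=L^2(\mathbb R^n\times\mathbb R^n\times\mathbb R)$, with variables $(x,y,r)$, let $\Sigma$ be the flip on $\mathcal H\otimes\mathcal H$, and let $U_A$ be the unitary operator on $\mathcal H\otimes\mathcal H$ given by $$U_A\xi(x,y,r;x',y',r')=(e^{-\lambda r'})^n\,\bar e\bigl[\eta_\lambda(r')\beta(e^{-\lambda r'}x,\,y'-e^{-\lambda r'}y)\bigr]\,\xi(e^{-\lambda r'}x,e^{-\lambda r'}y,r+r';\,x'-e^{-\lambda r'}x,y'-e^{-\lambda r'}y,r').$$ Let $J\xi(x,y,r)=\bar e[\eta_\lambda(r)\beta(x,y)]\,\overline{\xi(-x,-y,r)}$, $\hat J\xi(x,y,r)=(e^{\lambda r})^n\,\overline{\xi(e^{\lambda r}x,e^{\lambda r}y,-r)}$, $j=\hat JJ$, and $$Y=\Sigma(j\otimes1)U_A(j\otimes1)\Sigma,\qquad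 X=\Sigma Y^*\Sigma,\qquad Z=Y^*(j\otimes j)Y(j\otimes j),\qquad V_D=Z_{12}Y_{24}Z_{12}^*X_{13}.$$ Consider the following algebras of operators with comultiplications, where $\omega$ runs through $\mathcal B(\mathcal H)_*$ and $\Omega$ through $\mathcal B(\mathcal H\otimes\mathcal H)_*$: * $A=\overline{\{(\omega\otimes\mathrm{id})(U_A)\}}$ with $\Delta(a)=U_A(a\otimes1)U_A^*$; * $\hat A=\overline{\{(\mathrm{id}\otimes\omega)(U_A)\}}$ with $\hat\Delta(b)=U_A^*(1\otimes b)U_A$; * $\hat A^{\rm op}=\overline{\{(\mathrm{id}\otimes\omega)(X)\}}$ with $\hat\Delta(b)=X^*(1\otimes b)X$; * $A^{\rm op}=\{Ja^*J:a\in A\}$, the opposite algebra of $A$ realized on $\mathcal H$, with $\Delta$ carried over from $A$ along $a\mapsto Ja^*J$; * $\widehat{A_D}=\overline{\{(\Omega\otimes\mathrm{id}\otimes\mathrm{id})(V_D)\}}\subset\mathcal B(\mathcal H\otimes\mathcal H)$ with $\widehat{\Delta_D}(y)=V_D(y\otimes1\otimes1)V_D^*$. Let $\Delta^{\rm cop}=\Sigma\Delta(\cdot)\Sigma$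 and $\hat\Delta^{\rm cop}=\Sigma\hat\Delta(\cdot)\Sigma$. A $C^*$-bialgebra is a (nondegenerate, concrete) $C^*$-algebra $B$ with a nondegenerate coassociative $*$-homomorphism $\delta:B\to M(B\otimes B)$; an isomorphism of $C^*$-bialgebras is a $*$-isomorphism intertwining the comultiplications; tensor products are spatial. An inversion on $C^*$-bialgebras $(B,\delta_B)$, $(C,\delta_C)$ is a $*$-isomorphism $\tau:B\otimes C\to C\otimes B$ with $$(\tau\otimes\mathrm{id}_B)(\mathrm{id}_B\otimes\tau)(\delta_B\otimes\mathrm{id}_C)=(\mathrm{id}_C\otimes\delta_B)\tau,\qquad(\mathrm{id}_C\otimes\tau)(\tau\otimes\mathrm{id}_C)(\mathrm{id}_B\otimes\delta_C)=(\delta_C\otimes\mathrm{id}_B)\tau .$$ **Proposition.** The map $\tau(p)=\Sigma ZpZ^*\Sigma$ is an inversion $A\otimes\hat A^{\rm op}\to\hat A^{\rm op}\otimes A$ on $(A,\Delta^{\rm cop})$ and $(\hat A^{\rm op},\hat\Delta^{\rm cop})$, and $\tau'(q)=\Sigma Z^*qZ\Sigma$ is an inversion $A^{\rm op}\otimes\hat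 A\to\hat A\otimes A^{\rm op}$ on $(A^{\rm op},\Delta)$ and $(\hat A,\hat\Delta)$. With $$\delta_\tau=(\mathrm{id}\otimes\tau\otimes\mathrm{id})(\Delta^{\rm cop}\otimes\hat\Delta^{\rm cop}),\qquad\delta_{\tau'}=(\mathrm{id}\otimes\tau'\otimes\mathrm{id})(\Delta\otimes\hat\Delta),$$ the pairs $(\widehat{A_D},\widehat{\Delta_D})$, $(A\otimes\hat A^{\rm op},\delta_\tau)$ and $(A^{\rm op}\otimes\hat A,\delta_{\tau'})$ are $C^*$-bialgebras, and there are $C^*$-bialgebra isomorphisms $$(\widehat{A_D},\widehat{\Delta_D})\cong(A\otimes\hat A^{\rm op},\delta_\tau)\cong(A^{\rm op}\otimes\hat A,\delta_{\tau'}).$$ -/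

import Mathlib

open MeasureTheory

noncomputable section

namespace QDouble

/-! ### Hilbert spaces, legs, slices

`H` is `L²` of the space `ℝⁿ × ℝⁿ × ℝ` of triples `(x, y, r)`.  For a finite index type `ι`, the
tensor power of `H` indexed by `ι` is realized as `L²` of the space of `ι`-indexed families of
triples; thus `H = HH n Unit` and `H ⊗ H = HH n (Unit ⊕ Unit)`. -/

/-- The space of triples `(x, y, r)` with Lebesgue measure. -/
abbrev G (n : ℕ) : Type := EuclideanSpace ℝ (Fin n) × EuclideanSpace ℝ (Fin n) × ℝ

/-- The Hilbert space `L²((ℝⁿ × ℝⁿ × ℝ)^ι)`, i.e. the tensor power `H^{⊗ι}`. -/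
abbrev HH (n : ℕ) (ι : Type) [Fintype ι] : Type := Lp ℂ 2 (volume : Measure (ι → G n))

/-- Bounded operators on `H^{⊗ι}`. -/
abbrev Op (n : ℕ) (ι : Type) [Fintype ι] : Type := HH n ι →L[ℂ] HH n ι

variable {n : ℕ}

open scoped Classical in
/-- The element of `L²` given by a square-integrable function. -/
def toL2 {ι : Type} [Fintype ι] (f : (ι → G n) → ℂ) : HH n ι :=
  if h : MemLp f 2 (volume : Measure (ι → G n)) then h.toLp f else 0

open scoped Classical in
/-- The bounded operator given by a bounded linear map. -/
def opOf {ι : Type} [Fintype ι] (F : HH n ι → HH n ι) : Op n ι :=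
  if h : ∃ T : Op n ι, ∀ ξ, T ξ = F ξ then h.choose else 0

open scoped Classical in
/-- For an injection `e : ι → κ`, the simple tensor with `ξ` in the legs `e i` and `ζ` in the
remaining legs. -/
def simpleTensor {ι κ : Type} [Fintype ι] [Fintype κ] (e : ι → κ)
    (ξ : HH n ι) (ζ : HH n {k : κ // k ∉ Set.range e}) : HH n κ :=
  toL2 fun p => ξ (fun i => p (e i)) * ζ (fun k => p k.1)

open scoped Classical in
/-- Leg notation: for an injection `e : ι → κ` and an operator `T` on `H^{⊗ι}`, the (unique)
bounded operator on `H^{⊗κ}` acting as `T` on the legs `e i` and as the identity on the others. -/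
def leg {ι κ : Type} [Fintype ι] [Fintype κ] (e : ι → κ) (T : Op n ι) : Op n κ :=
  if h : ∃ S : Op n κ, ∀ ξ ζ, S (simpleTensor e ξ ζ) = simpleTensor e (T ξ) ζ then h.choose else 0

/-- `a ⊗ b` for operators. -/
def tmulOp {ι κ : Type} [Fintype ι] [Fintype κ] (a : Op n ι) (b : Op n κ) : Op n (ι ⊕ κ) :=
  leg Sum.inl a * leg Sum.inr b

/-- `ξ ⊗ ζ` for vectors. -/
def tmulVec {ι κ : Type} [Fintype ι] [Fintype κ] (ξ : HH n ι) (ζ : HH n κ) : HH n (ι ⊕ κ) :=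
  toL2 fun p => ξ (fun i => p (Sum.inl i)) * ζ (fun k => p (Sum.inr k))

/-- Renaming of the legs along a bijection of index types (used only for re-bracketing). -/
def reindex {ι κ : Type} [Fintype ι] [Fintype κ] (e : ι ≃ κ) (T : Op n ι) : Op n κ := leg e T

/-- `{(ω ⊗ id)(V) : ω normal}`: a normal functional is
`ω(T) = ∑ᵢ ⟨ηᵢ, T ξᵢ⟩` with square-summable norms. -/
def leftSlices {ι κ : Type} [Fintype ι] [Fintype κ] (V : Op n (ι ⊕ κ)) : Set (Op n κ) :=
  {S | ∃ ξ η : ℕ → HH n ι, Summable (fun i => ‖ξ i‖ ^ 2) ∧ Summable (fun i => ‖η i‖ ^ 2) ∧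
    ∀ ζ ζ' : HH n κ,
      HasSum (fun i => inner ℂ (tmulVec (η i) ζ') (V (tmulVec (ξ i) ζ))) (inner ℂ ζ' (S ζ))}

/-- `{(id ⊗ ω)(V) : ω normal}`. -/
def rightSlices {ι κ : Type} [Fintype ι] [Fintype κ] (V : Op n (ι ⊕ κ)) : Set (Op n ι) :=
  {S | ∃ ξ η : ℕ → HH n κ, Summable (fun i => ‖ξ i‖ ^ 2) ∧ Summable (fun i => ‖η i‖ ^ 2) ∧
    ∀ ζ ζ' : HH n ι,
      HasSum (fun i => inner ℂ (tmulVec ζ' (η i)) (V (tmulVec ζ (ξ i)))) (inner ℂ ζ' (S ζ))}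

/-! ### Concrete `C*`-algebras, multipliers, morphisms -/

/-- `A` is a norm-closed `*`-subalgebra of `B(H^{⊗ι})` acting nondegenerately. -/
def IsCStarAlg {ι : Type} [Fintype ι] (A : Set (Op n ι)) : Prop :=
  (∃ S : NonUnitalStarSubalgebra ℂ (Op n ι), (S : Set (Op n ι)) = A) ∧ IsClosed A ∧
    Dense (Submodule.span ℂ {v : HH n ι | ∃ a ∈ A, ∃ ξ, v = a ξ} : Set (HH n ι))

/-- The multiplier algebra `M(A)`, realized as the idealizer of `A` in the bounded operators. -/
def Mult {ι : Type} [Fintype ι] (A : Set (Op n ι)) : Set (Op n ι) :=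
  {T | ∀ a ∈ A, T * a ∈ A ∧ a * T ∈ A}

/-- The spatial (minimal) tensor product `A ⊗ B`. -/
def tens {ι κ : Type} [Fintype ι] [Fintype κ] (A : Set (Op n ι)) (B : Set (Op n κ)) :
    Set (Op n (ι ⊕ κ)) :=
  closure (Submodule.span ℂ {T : Op n (ι ⊕ κ) | ∃ a ∈ A, ∃ b ∈ B, T = tmulOp a b} :
    Set (Op n (ι ⊕ κ)))

/-- `φ` is a nondegenerate `*`-homomorphism `A → M(B)`, given together with its (unique) extension
`M(A) → M(B)`.  Only the values of `φ` on `M(A)` matter. -/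
structure IsMorphism {ι κ : Type} [Fintype ι] [Fintype κ] (A : Set (Op n ι)) (B : Set (Op n κ))
    (φ : Op n ι → Op n κ) : Prop where
  mapsTo : Set.MapsTo φ (Mult A) (Mult B)
  map_add : ∀ S ∈ Mult A, ∀ T ∈ Mult A, φ (S + T) = φ S + φ T
  map_smul : ∀ (c : ℂ), ∀ T ∈ Mult A, φ (c • T) = c • φ T
  map_mul : ∀ S ∈ Mult A, ∀ T ∈ Mult A, φ (S * T) = φ S * φ T
  map_star : ∀ T ∈ Mult A, φ (star T) = star (φ T)
  nondegenerate :
    closure (Submodule.span ℂ {T : Op n κ | ∃ a ∈ A, ∃ b ∈ B, T = φ a * b} : Set (Op n κ)) = B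

/-- `φ` is (the extension to multipliers of) a `*`-isomorphism of `A` onto `B`. -/
def IsIso {ι κ : Type} [Fintype ι] [Fintype κ] (A : Set (Op n ι)) (B : Set (Op n κ))
    (φ : Op n ι → Op n κ) : Prop :=
  IsMorphism A B φ ∧ Set.BijOn φ A B

/-- `Φ = φ ⊗ ψ : M(A ⊗ B) → M(A' ⊗ B')`, for `φ : A → M(A')` and `ψ : B → M(B')`. -/
def IsTensorMap {ι κ ι' κ' : Type} [Fintype ι] [Fintype κ] [Fintype ι'] [Fintype κ']
    (A : Set (Op n ι)) (A' : Set (Op n ι')) (B : Set (Op n κ)) (B' : Set (Op n κ'))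
    (φ : Op n ι → Op n ι') (ψ : Op n κ → Op n κ') (Φ : Op n (ι ⊕ κ) → Op n (ι' ⊕ κ')) : Prop :=
  IsMorphism (tens A B) (tens A' B') Φ ∧
    ∀ a ∈ A, ∀ b ∈ B, Φ (tmulOp a b) = tmulOp (φ a) (ψ b)

/-! ### `C*`-bialgebras, inversions, twisted comultiplications -/

/-- An algebra of operators with a comultiplication (of which only the values on `M(alg)`
matter). -/
structure BialgData (n : ℕ) (ι : Type) [Fintype ι] where
  alg : Set (Op n ι)
  comul : Op n ι → Op n (ι ⊕ ι)

/-- `(A, δ)` is a `C*`-bialgebra: `δ : A → M(A ⊗ A)` is a nondegenerate `*`-homomorphism with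
`(δ ⊗ id) δ = (id ⊗ δ) δ`. -/
def IsCStarBialgebra {ι : Type} [Fintype ι] (P : BialgData n ι) : Prop :=
  IsCStarAlg P.alg ∧ IsMorphism P.alg (tens P.alg P.alg) P.comul ∧
  ∃ (Φ : Op n (ι ⊕ ι) → Op n ((ι ⊕ ι) ⊕ ι)) (Ψ : Op n (ι ⊕ ι) → Op n (ι ⊕ (ι ⊕ ι))),
    IsTensorMap P.alg (tens P.alg P.alg) P.alg P.alg P.comul id Φ ∧
    IsTensorMap P.alg P.alg P.alg (tens P.alg P.alg) id P.comul Ψ ∧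
    ∀ a ∈ P.alg, reindex (Equiv.sumAssoc ι ι ι) (Φ (P.comul a)) = Ψ (P.comul a)

/-- `(A, δ_A) ≅ (B, δ_B)`: a `*`-isomorphism `φ : A → B` with `(φ ⊗ φ) δ_A = δ_B φ`. -/
def BialgIso {ι κ : Type} [Fintype ι] [Fintype κ] (P : BialgData n ι) (Q : BialgData n κ) : Prop :=
  ∃ (φ : Op n ι → Op n κ) (Φ : Op n (ι ⊕ ι) → Op n (κ ⊕ κ)),
    IsIso P.alg Q.alg φ ∧ IsTensorMap P.alg Q.alg P.alg Q.alg φ φ Φ ∧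
    ∀ a ∈ P.alg, Φ (P.comul a) = Q.comul (φ a)

/-- `τ : A ⊗ B → B ⊗ A` is an inversion on the `C*`-bialgebras `P = (A, δ_A)`, `Q = (B, δ_B)`. -/
structure IsInversion {ι κ : Type} [Fintype ι] [Fintype κ] (P : BialgData n ι) (Q : BialgData n κ)
    (τ : Op n (ι ⊕ κ) → Op n (κ ⊕ ι)) : Prop where
  left_bialgebra : IsCStarBialgebra P
  right_bialgebra : IsCStarBialgebra Q
  iso : IsIso (tens P.alg Q.alg) (tens Q.alg P.alg) τ
  /-- `(τ ⊗ id_A)(id_A ⊗ τ)(δ_A ⊗ id_B) = (id_B ⊗ δ_A) τ` -/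
  left_hexagon : ∃ (Φ₁ : Op n (ι ⊕ κ) → Op n ((ι ⊕ ι) ⊕ κ))
      (Φ₂ : Op n (ι ⊕ (ι ⊕ κ)) → Op n (ι ⊕ (κ ⊕ ι)))
      (Φ₃ : Op n ((ι ⊕ κ) ⊕ ι) → Op n ((κ ⊕ ι) ⊕ ι))
      (Φ₄ : Op n (κ ⊕ ι) → Op n (κ ⊕ (ι ⊕ ι))),
    IsTensorMap P.alg (tens P.alg P.alg) Q.alg Q.alg P.comul id Φ₁ ∧
    IsTensorMap P.alg P.alg (tens P.alg Q.alg) (tens Q.alg P.alg) id τ Φ₂ ∧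
    IsTensorMap (tens P.alg Q.alg) (tens Q.alg P.alg) P.alg P.alg τ id Φ₃ ∧
    IsTensorMap Q.alg Q.alg P.alg (tens P.alg P.alg) id P.comul Φ₄ ∧
    ∀ p ∈ tens P.alg Q.alg,
      reindex (Equiv.sumAssoc κ ι ι)
          (Φ₃ (reindex (Equiv.sumAssoc ι κ ι).symm
            (Φ₂ (reindex (Equiv.sumAssoc ι ι κ) (Φ₁ p))))) =
        Φ₄ (τ p)
  /-- `(id_B ⊗ τ)(τ ⊗ id_B)(id_A ⊗ δ_B) = (δ_B ⊗ id_A) τ` -/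
  right_hexagon : ∃ (Φ₁ : Op n (ι ⊕ κ) → Op n (ι ⊕ (κ ⊕ κ)))
      (Φ₂ : Op n ((ι ⊕ κ) ⊕ κ) → Op n ((κ ⊕ ι) ⊕ κ))
      (Φ₃ : Op n (κ ⊕ (ι ⊕ κ)) → Op n (κ ⊕ (κ ⊕ ι)))
      (Φ₄ : Op n (κ ⊕ ι) → Op n ((κ ⊕ κ) ⊕ ι)),
    IsTensorMap P.alg P.alg Q.alg (tens Q.alg Q.alg) id Q.comul Φ₁ ∧
    IsTensorMap (tens P.alg Q.alg) (tens Q.alg P.alg) Q.alg Q.alg τ id Φ₂ ∧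
    IsTensorMap Q.alg Q.alg (tens P.alg Q.alg) (tens Q.alg P.alg) id τ Φ₃ ∧
    IsTensorMap Q.alg (tens Q.alg Q.alg) P.alg P.alg Q.comul id Φ₄ ∧
    ∀ p ∈ tens P.alg Q.alg,
      reindex (Equiv.sumAssoc κ κ ι).symm
          (Φ₃ (reindex (Equiv.sumAssoc κ ι κ)
            (Φ₂ (reindex (Equiv.sumAssoc ι κ κ).symm (Φ₁ p))))) =
        Φ₄ (τ p)

/-- Re-bracketing `(A ⊗ A) ⊗ (B ⊗ B)` as `A ⊗ ((A ⊗ B) ⊗ B)`; no legs are permuted. -/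
def bracketIn (ι κ : Type) : (ι ⊕ ι) ⊕ (κ ⊕ κ) ≃ ι ⊕ ((ι ⊕ κ) ⊕ κ) :=
  (Equiv.sumAssoc ι ι (κ ⊕ κ)).trans
    (Equiv.sumCongr (Equiv.refl ι) (Equiv.sumAssoc ι κ κ).symm)

/-- Re-bracketing `A ⊗ ((B ⊗ A) ⊗ B)` as `(A ⊗ B) ⊗ (A ⊗ B)`; no legs are permuted. -/
def bracketOut (ι κ : Type) : ι ⊕ ((κ ⊕ ι) ⊕ κ) ≃ (ι ⊕ κ) ⊕ (ι ⊕ κ) :=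
  (Equiv.sumCongr (Equiv.refl ι) (Equiv.sumAssoc κ ι κ)).trans
    (Equiv.sumAssoc ι κ (ι ⊕ κ)).symm

/-- `δ` is (on `M(A ⊗ B)`) the map `δ_τ = (id_A ⊗ τ ⊗ id_B)(δ_A ⊗ δ_B)`. -/
def IsTwistedComul {ι κ : Type} [Fintype ι] [Fintype κ] (P : BialgData n ι) (Q : BialgData n κ)
    (τ : Op n (ι ⊕ κ) → Op n (κ ⊕ ι)) (δ : Op n (ι ⊕ κ) → Op n ((ι ⊕ κ) ⊕ (ι ⊕ κ))) : Prop :=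
  ∃ (Φ : Op n (ι ⊕ κ) → Op n ((ι ⊕ ι) ⊕ (κ ⊕ κ)))
    (Ψ₀ : Op n ((ι ⊕ κ) ⊕ κ) → Op n ((κ ⊕ ι) ⊕ κ))
    (Ψ : Op n (ι ⊕ ((ι ⊕ κ) ⊕ κ)) → Op n (ι ⊕ ((κ ⊕ ι) ⊕ κ))),
    IsTensorMap P.alg (tens P.alg P.alg) Q.alg (tens Q.alg Q.alg) P.comul Q.comul Φ ∧
    IsTensorMap (tens P.alg Q.alg) (tens Q.alg P.alg) Q.alg Q.alg τ id Ψ₀ ∧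
    IsTensorMap P.alg P.alg (tens (tens P.alg Q.alg) Q.alg) (tens (tens Q.alg P.alg) Q.alg)
      id Ψ₀ Ψ ∧
    ∀ p ∈ Mult (tens P.alg Q.alg),
      δ p = reindex (bracketOut ι κ) (Ψ (reindex (bracketIn ι κ) (Φ p)))

/-! ### The quantum Heisenberg group algebra and its relatives -/

/-- `H`, `H ⊗ H` and `(H ⊗ H) ⊗ (H ⊗ H)` as index types. -/
abbrev I₁ : Type := Unit
abbrev I₂ : Type := Unit ⊕ Unit
abbrev I₄ : Type := I₂ ⊕ I₂

/-- `e(t) = exp(2πit)`; its conjugate is `e(-t)`. -/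
def ch (t : ℝ) : ℂ := Complex.exp (2 * Real.pi * Complex.I * t)

/-- `η_λ(r) = (e^{2λr} - 1) / (2λ)`, and `η_0(r) = r`. -/
def eta (lam r : ℝ) : ℝ := if lam = 0 then r else (Real.exp (2 * lam * r) - 1) / (2 * lam)

/-- The multiplicative unitary operator `U_A` on `H ⊗ H`. -/
def UA (n : ℕ) (lam : ℝ) : Op n I₂ :=
  opOf fun ξ => toL2 fun p =>
    let x := (p (Sum.inl ())).1
    let y := (p (Sum.inl ())).2.1
    let r := (p (Sum.inl ())).2.2
    let x' := (p (Sum.inr ())).1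
    let y' := (p (Sum.inr ())).2.1
    let r' := (p (Sum.inr ())).2.2
    let s := Real.exp (-lam * r')
    ((s ^ n : ℝ) : ℂ) * ch (-(eta lam r' * inner ℝ (s • x) (y' - s • y))) *
      ξ (Sum.elim (fun _ => (s • x, s • y, r + r')) (fun _ => (x' - s • x, y' - s • y, r')))

/-- The antiunitary operator `J^{⊗ι}` on `H^{⊗ι}`, where
`Jξ(x,y,r) = ē[η_λ(r) β(x,y)] conj(ξ(-x,-y,r))`. -/
def J (lam : ℝ) {ι : Type} [Fintype ι] (ξ : HH n ι) : HH n ι :=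
  toL2 fun p =>
    (∏ i, ch (-(eta lam (p i).2.2 * inner ℝ (p i).1 (p i).2.1))) *
      starRingEnd ℂ (ξ fun i => (-(p i).1, -(p i).2.1, (p i).2.2))

/-- The antiunitary operator `Ĵ` on `H`:
`Ĵξ(x,y,r) = (e^{λr})^n conj(ξ(e^{λr}x, e^{λr}y, -r))`. -/
def Jhat (lam : ℝ) (ξ : HH n I₁) : HH n I₁ :=
  toL2 fun p =>
    let s := Real.exp (lam * (p ()).2.2)
    ((s ^ n : ℝ) : ℂ) *
      starRingEnd ℂ (ξ fun _ => (s • (p ()).1, s • (p ()).2.1, -(p ()).2.2))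

/-- The involutive unitary `j = Ĵ J`. -/
def jOp (n : ℕ) (lam : ℝ) : Op n I₁ := opOf fun ξ => Jhat lam (J lam ξ)

/-- The flip `Σ` on `H ⊗ H`. -/
def flipOp (n : ℕ) : Op n I₂ := opOf fun ξ => toL2 fun p => ξ fun i => p i.swap

/-- `Û_A = Σ (j ⊗ 1) U_A (j ⊗ 1) Σ`. -/
def UAhat (n : ℕ) (lam : ℝ) : Op n I₂ :=
  flipOp n * leg Sum.inl (jOp n lam) * UA n lam * leg Sum.inl (jOp n lam) * flipOp n

/-- `X = Σ Û_A^* Σ`. -/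
def X (n : ℕ) (lam : ℝ) : Op n I₂ := flipOp n * star (UAhat n lam) * flipOp n

/-- `Y = Σ X^* Σ = Û_A`. -/
def Y (n : ℕ) (lam : ℝ) : Op n I₂ := flipOp n * star (X n lam) * flipOp n

/-- The second dual version of `Y`, namely `(j ⊗ j) Y (j ⊗ j)`. -/
def Yhathat (n : ℕ) (lam : ℝ) : Op n I₂ :=
  tmulOp (jOp n lam) (jOp n lam) * Y n lam * tmulOp (jOp n lam) (jOp n lam)

/-- `Z = Y^* (j ⊗ j) Y (j ⊗ j)`. -/
def Z (n : ℕ) (lam : ℝ) : Op n I₂ := star (Y n lam) * Yhathat n lam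

/-- `(A, Δ)`: `A` is the norm closure of the left slices of `U_A`, `Δ a = U_A (a ⊗ 1) U_A^*`. -/
def bA (n : ℕ) (lam : ℝ) : BialgData n I₁ where
  alg := closure (leftSlices (UA n lam))
  comul a := UA n lam * leg Sum.inl a * star (UA n lam)

/-- `(Â, Δ̂)`: `Â` is the norm closure of the right slices of `U_A`, `Δ̂ b = U_A^* (1 ⊗ b) U_A`. -/
def bAhat (n : ℕ) (lam : ℝ) : BialgData n I₁ where
  alg := closure (rightSlices (UA n lam))
  comul b := star (UA n lam) * leg Sum.inr b * UA n lam

/-- `(Â^op, Δ̂)`, realized on `H` through the multiplicative unitary `X`. -/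
def bAhatOp (n : ℕ) (lam : ℝ) : BialgData n I₁ where
  alg := closure (rightSlices (X n lam))
  comul b := star (X n lam) * leg Sum.inr b * X n lam

/-- The linear, `*`-preserving, antimultiplicative involution `T ↦ J^{⊗ι} T^* J^{⊗ι}`. -/
def opp (lam : ℝ) {ι : Type} [Fintype ι] (T : Op n ι) : Op n ι :=
  opOf fun ξ => J lam (star T (J lam ξ))

/-- `(A^op, Δ)`: the opposite algebra, realized on `H` as `{J a^* J : a ∈ A}` (which is also
`j A j`), with the comultiplication of `A` carried over along `a ↦ J a^* J`. -/
def bAop (n : ℕ) (lam : ℝ) : BialgData n I₁ where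
  alg := opp lam '' (bA n lam).alg
  comul a := opp lam ((bA n lam).comul (opp lam a))

/-- The co-opposite `(A, Δ^cop)`, where `Δ^cop a = Σ Δ(a) Σ`. -/
def cop (P : BialgData n I₁) : BialgData n I₁ where
  alg := P.alg
  comul a := flipOp n * P.comul a * flipOp n

/-- `τ(p) = Σ Z p Z^* Σ`. -/
def tau (n : ℕ) (lam : ℝ) (p : Op n I₂) : Op n I₂ :=
  flipOp n * Z n lam * p * star (Z n lam) * flipOp n

/-- `τ'(q) = Σ Z^* q Z Σ`. -/
def tau' (n : ℕ) (lam : ℝ) (q : Op n I₂) : Op n I₂ :=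
  flipOp n * star (Z n lam) * q * Z n lam * flipOp n

/-! ### The dual of the quantum double -/

/-- The four legs of `(H ⊗ H) ⊗ (H ⊗ H)`. -/
def ℓ₁ : I₄ := Sum.inl (Sum.inl ())
def ℓ₂ : I₄ := Sum.inl (Sum.inr ())
def ℓ₃ : I₄ := Sum.inr (Sum.inl ())
def ℓ₄ : I₄ := Sum.inr (Sum.inr ())

/-- `T_{kl}` on `H ⊗ H ⊗ H ⊗ H`. -/
def legs (k l : I₄) (T : Op n I₂) : Op n I₄ := leg (Sum.elim (fun _ => k) (fun _ => l)) T

/-- `V_D = Z₁₂ Y₂₄ Z₁₂^* X₁₃`. -/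
def VD (n : ℕ) (lam : ℝ) : Op n I₄ :=
  legs ℓ₁ ℓ₂ (Z n lam) * legs ℓ₂ ℓ₄ (Y n lam) * star (legs ℓ₁ ℓ₂ (Z n lam)) *
    legs ℓ₁ ℓ₃ (X n lam)

/-- `(Â_D, Δ̂_D)`: the norm closure of the left slices of `V_D`, with
`Δ̂_D(y) = V_D (y ⊗ 1 ⊗ 1) V_D^*`. -/
def bADhat (n : ℕ) (lam : ℝ) : BialgData n I₂ where
  alg := closure (leftSlices (VD n lam))
  comul y := VD n lam * leg Sum.inl y * star (VD n lam)

end QDouble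

end

open QDouble

open MeasureTheory

noncomputable section

namespace QDouble

variable {n : ℕ}

set_option linter.unusedSectionVars false

/-! ### Tensor products of `L²` functions -/

section Rectangles

variable {α β : Type*} [MeasurableSpace α] [MeasurableSpace β] {μ : Measure α} {ν : Measure β}
  [SigmaFinite μ] [SigmaFinite ν]

/-! Everything is governed by the single unitary Y, called `u` below. It is a regular multiplicative
unitary. With X = ΣY*Σ (`dualU u`), the closed spans of the slices of X and of Y along their first
legs (`sl`) are A and Â^op, and on these algebras Δ^cop and Δ̂^cop are a ↦ X(a ⊗ 1)X* and b ↦ Y(b ⊗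
1)Y*. The operator Ŷ = (j ⊗ j)Y(j ⊗ j) (`conjJ j u`) commutes with A ⊗ Â^op, so that Z = Y*Ŷ may be
replaced by Y* and τ is p ↦ ΣY*pYΣ. Both hexagons then become the pentagon equation
(`IsMultUnitary.isInversion`). The comultiplication δ_τ is implemented by X₂₃X₁₃Y₂₄, and its
coassociativity follows from four pentagons (`IsMultUnitary.twist_coassoc`).

For the dual of the double, the relation between U_A and Y together with the pentagon gives V_D =
Y₁₄Y₂₄W₁₄X₁₃ with W = (j ⊗ 1)Y(j ⊗ 1) (`DoubleData.doubleU_eq`). Compressing by compact operators in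
legs 1 and 2 shows that its slices span A ⊗ Â^op (`DoubleData.slices_doubleU`). The factor W₁₄ has
no effect on the comultiplication of A ⊗ Â^op, and what remains, Y₁₄Y₂₄X₁₃, is carried to X₂₃X₁₃Y₂₄
by p ↦ YpY* (`DoubleData.doubleV_eq`). This is the first isomorphism.

The algebras A^op and Â with Δ and Δ̂ arise from Ŷ exactly as A and Â^op with their co-opposites
arise from Y, and Y commutes with A^op ⊗ Â, so that τ' is the inversion attached to Ŷ. All general
results therefore apply a second time, and conjugation by j ⊗ j gives the second isomorphism
(`IsMultUnitary.bialgIso_conjJ`).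

The argument has three layers. The first is the theory of regular multiplicative unitaries. Closed
subspaces of operators form a monoid under closed span of products, and (K ⊗ 1)V(K ⊗ 1) = K ⊗
(slices of V), where K denotes the compact operators and can be cancelled. Statements on slice
algebras thereby become word identities, derived from the pentagon, from regularity and from
absorption of unitaries by K. The second layer observes that every map needed is, on the relevant
algebra, T ↦ W(T ⊗ 1)W* for a unitary W (`ad`); such maps are defined on all bounded operators, so
extensions to multipliers and tensor products of maps come for free. The third layer is concrete:
U_A, Y and j are weighted changes of variables on L² (`Mon`), for which the pentagon and the four
relations of `DoubleData` are comparisons of weights and of point maps, while regularity follows by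
exhibiting a Hilbert–Schmidt kernel. -/

theorem setIntegral_eq_zero_of_rectangles {f : α × β → ℂ} {A : Set α} {B : Set β}
    (hA : MeasurableSet A) (hB : MeasurableSet B)
    (hf : IntegrableOn f (A ×ˢ B) (μ.prod ν))
    (h : ∀ A' B', MeasurableSet A' → MeasurableSet B' → A' ⊆ A → B' ⊆ B →
      ∫ x in A' ×ˢ B', f x ∂μ.prod ν = 0) {s : Set (α × β)} (hs : MeasurableSet s) :
    ∫ x in s ∩ A ×ˢ B, f x ∂μ.prod ν = 0 := by
  have hR : MeasurableSet (A ×ˢ B) := hA.prod hB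
  have huniv : ∫ x in A ×ˢ B, f x ∂μ.prod ν = 0 := h A B hA hB subset_rfl subset_rfl
  induction s, hs using MeasurableSpace.induction_on_inter generateFrom_prod.symm
    isPiSystem_prod with
  | empty => simp
  | basic t ht =>
    obtain ⟨A', hA', B', hB', rfl⟩ := ht
    simp only [Set.mem_ofPred_eq] at hA' hB'
    rw [Set.prod_inter_prod]
    exact h _ _ (hA'.inter hA) (hB'.inter hB) Set.inter_subset_right Set.inter_subset_right
  | compl t ht ih =>
    have h1 := integral_inter_add_sdiff (μ := μ.prod ν) (f := f) (s := A ×ˢ B) ht hf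
    rw [Set.inter_comm, ih, huniv, zero_add] at h1
    rw [Set.inter_comm, ← Set.sdiff_eq, h1]
  | iUnion t hd ht ih =>
    rw [Set.iUnion_inter, integral_iUnion (fun i => (ht i).inter hR)]
    · simp [ih]
    · exact fun i j hij => (hd hij).mono Set.inter_subset_left Set.inter_subset_left
    · exact hf.mono_set (Set.iUnion_subset fun i => Set.inter_subset_right)

/-- Rectangles form a π-system generating the product σ-algebra, so the vanishing extends to
measurable subsets of a finite rectangle, and then to sets of finite measure by exhausting the space
with products of spanning sets. -/
theorem ae_eq_zero_of_rectangles {f : α × β → ℂ} (hf : MemLp f 2 (μ.prod ν))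
    (h : ∀ A B, MeasurableSet A → MeasurableSet B → μ A < ⊤ → ν B < ⊤ →
      ∫ x in A ×ˢ B, f x ∂μ.prod ν = 0) : f =ᵐ[μ.prod ν] 0 := by
  have hint : ∀ s, MeasurableSet s → μ.prod ν s < ⊤ → IntegrableOn f s (μ.prod ν) := by
    intro s _ hs
    have : IsFiniteMeasure ((μ.prod ν).restrict s) := ⟨by simpa using hs⟩
    exact (hf.restrict s).integrable (by norm_num)
  suffices hz : ∀ s, MeasurableSet s → μ.prod ν s < ⊤ → ∫ x in s, f x ∂μ.prod ν = 0 by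
    have h1 := Lp.ae_eq_zero_of_forall_setIntegral_eq_zero (hf.toLp f) (by norm_num)
      (by norm_num) (fun s hs hs' => ?_) (fun s hs hs' => ?_)
    · exact hf.coeFn_toLp.symm.trans h1
    · exact (hint s hs hs').congr (ae_restrict_of_ae hf.coeFn_toLp.symm)
    · rw [← hz s hs hs']
      exact integral_congr_ae (ae_restrict_of_ae hf.coeFn_toLp)
  intro s hs hs'
  let R : ℕ → Set (α × β) := fun k => spanningSets μ k ×ˢ spanningSets ν k
  have hRm : ∀ k, MeasurableSet (R k) := fun k =>
    (measurableSet_spanningSets μ k).prod (measurableSet_spanningSets ν k)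
  have hmono : Monotone fun k => s ∩ R k := fun i j hij =>
    Set.inter_subset_inter_right _
      (Set.prod_mono (monotone_spanningSets μ hij) (monotone_spanningSets ν hij))
  have hU : ⋃ k, s ∩ R k = s := by
    rw [← Set.inter_iUnion]
    refine Set.inter_eq_left.2 fun p _ => ?_
    obtain ⟨i, hi⟩ := Set.mem_iUnion.1 ((iUnion_spanningSets μ).symm ▸ Set.mem_univ p.1)
    obtain ⟨j, hj⟩ := Set.mem_iUnion.1 ((iUnion_spanningSets ν).symm ▸ Set.mem_univ p.2)
    exact Set.mem_iUnion.2 ⟨max i j, monotone_spanningSets μ (le_max_left i j) hi,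
      monotone_spanningSets ν (le_max_right i j) hj⟩
  have hz : ∀ k, ∫ x in s ∩ R k, f x ∂μ.prod ν = 0 := by
    intro k
    refine setIntegral_eq_zero_of_rectangles (measurableSet_spanningSets μ k)
      (measurableSet_spanningSets ν k) (hint _ (hRm k) ?_) ?_ hs
    · rw [Measure.prod_prod]
      exact ENNReal.mul_lt_top (measure_spanningSets_lt_top μ k) (measure_spanningSets_lt_top ν k)
    · intro A B hA hB hA' hB'
      exact h A B hA hB ((measure_mono hA').trans_lt (measure_spanningSets_lt_top μ k))
        ((measure_mono hB').trans_lt (measure_spanningSets_lt_top ν k))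
  have ht := tendsto_setIntegral_of_monotone (μ := μ.prod ν) (f := f)
    (fun k => hs.inter (hRm k)) hmono (by rw [hU]; exact hint s hs hs')
  rw [hU] at ht
  exact tendsto_nhds_unique ht (by simp [hz])

end Rectangles

section Tensor

variable {ι κ ρ σ : Type} [Fintype ι] [Fintype κ] [Fintype ρ] [Fintype σ]

instance : SigmaFinite (volume : Measure (G n)) := inferInstance

instance : SigmaFinite (volume : Measure (ι → G n)) :=
  Measure.pi.sigmaFinite (μ := fun _ : ι => (volume : Measure (G n)))

instance : (volume : Measure (G n)).IsOpenPosMeasure := inferInstance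

instance : (volume : Measure (ι → G n)).IsOpenPosMeasure :=
  Measure.pi.isOpenPosMeasure (fun _ : ι => (volume : Measure (G n)))

theorem toL2_of_memLp {f : (ι → G n) → ℂ} (h : MemLp f 2 (volume : Measure (ι → G n))) :
    toL2 f = h.toLp f := dif_pos h

theorem coeFn_toL2 {f : (ι → G n) → ℂ} (h : MemLp f 2 (volume : Measure (ι → G n))) :
    ⇑(toL2 f) =ᵐ[volume] f := by
  rw [toL2_of_memLp h]; exact h.coeFn_toLp

theorem toL2_congr {f g : (ι → G n) → ℂ} (h : f =ᵐ[volume] g) : toL2 f = toL2 g := by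
  by_cases hf : MemLp f 2 (volume : Measure (ι → G n))
  · have hg := (memLp_congr_ae h).1 hf
    rw [toL2_of_memLp hf, toL2_of_memLp hg]
    exact (MemLp.toLp_eq_toLp_iff hf hg).2 h
  · have hg := mt (memLp_congr_ae h).2 hf
    simp [toL2, hf, hg]

theorem toL2_coeFn (ξ : HH n ι) : toL2 (⇑ξ) = ξ := by
  rw [toL2_of_memLp (Lp.memLp ξ)]; exact Lp.toLp_coeFn ξ (Lp.memLp ξ)

/-- A bijection `ι ⊕ ρ ≃ κ` splits the points of `κ → G` into two blocks. -/
def split (n : ℕ) (s : ι ⊕ ρ ≃ κ) : (κ → G n) ≃ᵐ (ι → G n) × (ρ → G n) :=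
  (MeasurableEquiv.arrowCongr' s.symm (MeasurableEquiv.refl (G n))).trans
    (MeasurableEquiv.sumPiEquivProdPi fun _ => G n)

theorem split_apply (s : ι ⊕ ρ ≃ κ) (p : κ → G n) :
    split n s p = (fun i => p (s (Sum.inl i)), fun k => p (s (Sum.inr k))) := rfl

theorem measurePreserving_split (s : ι ⊕ ρ ≃ κ) :
    MeasurePreserving (split n s) volume (volume.prod volume) :=
  (measurePreserving_sumPiEquivProdPi (fun _ => volume)).comp
    (volume_preserving_arrowCongr' s.symm (MeasurableEquiv.refl (G n))
      (MeasurePreserving.id volume))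

theorem quasi_inl (s : ι ⊕ ρ ≃ κ) :
    Measure.QuasiMeasurePreserving (fun (p : κ → G n) i => p (s (Sum.inl i))) :=
  Measure.quasiMeasurePreserving_fst.comp (measurePreserving_split s).quasiMeasurePreserving

theorem quasi_inr (s : ι ⊕ ρ ≃ κ) :
    Measure.QuasiMeasurePreserving (fun (p : κ → G n) i => p (s (Sum.inr i))) :=
  Measure.quasiMeasurePreserving_snd.comp (measurePreserving_split s).quasiMeasurePreserving

/-- The simple tensor `ξ ⊗ ζ`, with the legs placed along `s`. -/
def tensor (s : ι ⊕ ρ ≃ κ) (ξ : HH n ι) (ζ : HH n ρ) : HH n κ :=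
  toL2 fun p => ξ (fun i => p (s (Sum.inl i))) * ζ (fun k => p (s (Sum.inr k)))

theorem memLp_mul_prod {α β : Type*} [MeasurableSpace α] [MeasurableSpace β] {μ : Measure α}
    {ν : Measure β} [SFinite μ] [SFinite ν] {f : α → ℂ} {g : β → ℂ} (hf : MemLp f 2 μ)
    (hg : MemLp g 2 ν) : MemLp (fun p : α × β => f p.1 * g p.2) 2 (μ.prod ν) := by
  have hm : AEStronglyMeasurable (fun p : α × β => f p.1 * g p.2) (μ.prod ν) :=
    hf.1.comp_fst.mul hg.1.comp_snd
  rw [memLp_two_iff_integrable_sq_norm hm]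
  simp only [norm_mul, mul_pow]
  exact ((memLp_two_iff_integrable_sq_norm hf.1).1 hf).mul_prod
    ((memLp_two_iff_integrable_sq_norm hg.1).1 hg)

theorem memLp_tensor (s : ι ⊕ ρ ≃ κ) {f : (ι → G n) → ℂ} {g : (ρ → G n) → ℂ}
    (hf : MemLp f 2 volume) (hg : MemLp g 2 volume) :
    MemLp (fun p : κ → G n => f (fun i => p (s (Sum.inl i))) * g (fun k => p (s (Sum.inr k)))) 2
      volume :=
  (memLp_mul_prod hf hg).comp_measurePreserving (measurePreserving_split s)

theorem coeFn_tensor (s : ι ⊕ ρ ≃ κ) (ξ : HH n ι) (ζ : HH n ρ) :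
    ⇑(tensor s ξ ζ) =ᵐ[volume]
      fun p => ξ (fun i => p (s (Sum.inl i))) * ζ (fun k => p (s (Sum.inr k))) :=
  coeFn_toL2 (memLp_tensor s (Lp.memLp ξ) (Lp.memLp ζ))

theorem inner_tensor (s : ι ⊕ ρ ≃ κ) (ξ ξ' : HH n ι) (ζ ζ' : HH n ρ) :
    inner ℂ (tensor s ξ ζ) (tensor s ξ' ζ') = inner ℂ ξ ξ' * inner ℂ ζ ζ' := by
  simp only [L2.inner_def]
  rw [← integral_prod_mul, ← (measurePreserving_split s).integral_comp'
    (g := fun z => inner ℂ (ξ z.1) (ξ' z.1) * inner ℂ (ζ z.2) (ζ' z.2))]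
  refine integral_congr_ae ?_
  filter_upwards [coeFn_tensor s ξ ζ, coeFn_tensor s ξ' ζ'] with p h1 h2
  rw [h1, h2]
  simp only [split_apply, RCLike.inner_apply, map_mul]
  ring

theorem norm_tensor (s : ι ⊕ ρ ≃ κ) (ξ : HH n ι) (ζ : HH n ρ) :
    ‖tensor s ξ ζ‖ = ‖ξ‖ * ‖ζ‖ := by
  have h : ‖tensor s ξ ζ‖ ^ 2 = (‖ξ‖ * ‖ζ‖) ^ 2 := by
    have := inner_tensor s ξ ξ ζ ζ
    simp only [inner_self_eq_norm_sq_to_K] at this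
    rw [mul_pow]
    exact_mod_cast this
  exact (pow_left_inj₀ (norm_nonneg _) (by positivity) two_ne_zero).1 h

/-- `tensor` as a bounded bilinear map. -/
def tensorL (s : ι ⊕ ρ ≃ κ) : HH n ι →L[ℂ] HH n ρ →L[ℂ] HH n κ :=
  LinearMap.mkContinuous₂
    (LinearMap.mk₂ ℂ (tensor s)
      (fun ξ ξ' ζ => Lp.ext <| by
        filter_upwards [coeFn_tensor s (ξ + ξ') ζ, coeFn_tensor s ξ ζ, coeFn_tensor s ξ' ζ,
          Lp.coeFn_add (tensor s ξ ζ) (tensor s ξ' ζ),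
          (quasi_inl s).ae_eq_comp (Lp.coeFn_add ξ ξ')] with p h1 h2 h3 h4 h5
        simp only [Function.comp_apply, Pi.add_apply] at h4 h5
        rw [h4, h1, h2, h3, h5]; ring)
      (fun c ξ ζ => Lp.ext <| by
        filter_upwards [coeFn_tensor s (c • ξ) ζ, coeFn_tensor s ξ ζ,
          Lp.coeFn_smul c (tensor s ξ ζ),
          (quasi_inl s).ae_eq_comp (Lp.coeFn_smul c ξ)] with p h1 h2 h4 h5
        simp only [Function.comp_apply, Pi.smul_apply, smul_eq_mul] at h4 h5
        rw [h4, h1, h2, h5]; ring)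
      (fun ξ ζ ζ' => Lp.ext <| by
        filter_upwards [coeFn_tensor s ξ (ζ + ζ'), coeFn_tensor s ξ ζ, coeFn_tensor s ξ ζ',
          Lp.coeFn_add (tensor s ξ ζ) (tensor s ξ ζ'),
          (quasi_inr s).ae_eq_comp (Lp.coeFn_add ζ ζ')] with p h1 h2 h3 h4 h5
        simp only [Function.comp_apply, Pi.add_apply] at h4 h5
        rw [h4, h1, h2, h3, h5]; ring)
      (fun c ξ ζ => Lp.ext <| by
        filter_upwards [coeFn_tensor s ξ (c • ζ), coeFn_tensor s ξ ζ,
          Lp.coeFn_smul c (tensor s ξ ζ),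
          (quasi_inr s).ae_eq_comp (Lp.coeFn_smul c ζ)] with p h1 h2 h4 h5
        simp only [Function.comp_apply, Pi.smul_apply, smul_eq_mul] at h4 h5
        rw [h4, h1, h2, h5]; ring))
    1 (fun ξ ζ => by simp [norm_tensor])

@[simp] theorem tensorL_apply (s : ι ⊕ ρ ≃ κ) (ξ : HH n ι) (ζ : HH n ρ) :
    tensorL s ξ ζ = tensor s ξ ζ := rfl

theorem tensor_add_left (s : ι ⊕ ρ ≃ κ) (ξ ξ' : HH n ι) (ζ : HH n ρ) :
    tensor s (ξ + ξ') ζ = tensor s ξ ζ + tensor s ξ' ζ := by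
  simp only [← tensorL_apply, map_add, add_apply]

theorem tensor_smul_left (s : ι ⊕ ρ ≃ κ) (c : ℂ) (ξ : HH n ι) (ζ : HH n ρ) :
    tensor s (c • ξ) ζ = c • tensor s ξ ζ := by
  simp only [← tensorL_apply, map_smul, smul_apply]

theorem tensor_smul_right (s : ι ⊕ ρ ≃ κ) (c : ℂ) (ξ : HH n ι) (ζ : HH n ρ) :
    tensor s ξ (c • ζ) = c • tensor s ξ ζ := by
  simp only [← tensorL_apply, map_smul]

@[simp] theorem tensor_zero_left (s : ι ⊕ ρ ≃ κ) (ζ : HH n ρ) :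
    tensor s (0 : HH n ι) ζ = 0 := by
  simp only [← tensorL_apply, map_zero, zero_apply]

/-- A vector orthogonal to all tensors of indicator functions has integral zero over every rectangle
with sides of finite measure, hence vanishes almost everywhere. -/
theorem dense_tensor (s : ι ⊕ ρ ≃ κ) :
    (Submodule.span ℂ {v : HH n κ | ∃ ξ ζ, v = tensor s ξ ζ}).topologicalClosure = ⊤ := by
  rw [Submodule.topologicalClosure_eq_top_iff, Submodule.eq_bot_iff]
  intro g hg
  have hg' : ∀ ξ ζ, inner ℂ (tensor s ξ ζ) g = 0 := fun ξ ζ =>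
    (Submodule.mem_orthogonal _ _).1 hg _ (Submodule.subset_span ⟨ξ, ζ, rfl⟩)
  have hmp := (measurePreserving_split (n := n) s).symm
  have hG : MemLp (g ∘ (split n s).symm) 2 (volume.prod volume) :=
    (Lp.memLp g).comp_measurePreserving hmp
  have hz := ae_eq_zero_of_rectangles hG (fun A B hA hB hA' hB' => by
    have h0 := hg' (indicatorConstLp 2 hA hA'.ne 1) (indicatorConstLp 2 hB hB'.ne 1)
    rw [L2.inner_def, ← hmp.integral_comp'] at h0
    rw [← h0, ← integral_indicator (hA.prod hB)]
    refine integral_congr_ae ?_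
    have e1 := hmp.quasiMeasurePreserving.ae_eq_comp
      (coeFn_tensor s (indicatorConstLp 2 hA hA'.ne 1) (indicatorConstLp 2 hB hB'.ne 1))
    have e2 := (Measure.quasiMeasurePreserving_fst (μ := volume)
      (ν := (volume : Measure (ρ → G n)))).ae_eq_comp
      (indicatorConstLp_coeFn (p := 2) (hs := hA) (hμs := hA'.ne) (c := (1 : ℂ)))
    have e3 := (Measure.quasiMeasurePreserving_snd
      (μ := (volume : Measure (ι → G n))) (ν := volume)).ae_eq_comp
      (indicatorConstLp_coeFn (p := 2) (hs := hB) (hμs := hB'.ne) (c := (1 : ℂ)))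
    filter_upwards [e1, e2, e3] with z h1 h2 h3
    obtain ⟨p, rfl⟩ := (split n s).surjective z
    simp only [Function.comp_apply, split_apply] at h1 h2 h3
    have h4 : (split n s).symm (fun i => p (s (Sum.inl i)), fun k => p (s (Sum.inr k))) = p :=
      (split n s).symm_apply_apply p
    rw [h4] at h1
    simp only [h1, h2, h3, split_apply, h4]
    by_cases hpA : (fun i => p (s (Sum.inl i))) ∈ A <;>
      by_cases hpB : (fun k => p (s (Sum.inr k))) ∈ B <;>
      simp [Set.indicator, hpA, hpB, h4])
  refine Lp.ext ?_
  have := (measurePreserving_split (n := n) s).quasiMeasurePreserving.ae_eq_comp hz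
  filter_upwards [this, Lp.coeFn_zero ℂ 2 (volume : Measure (κ → G n))] with p h1 h2
  rw [h2]; simpa using h1

theorem ext_tensor {E : Type*} [TopologicalSpace E] [T2Space E] [AddCommMonoid E] [Module ℂ E]
    (s : ι ⊕ ρ ≃ κ) {S T : HH n κ →L[ℂ] E} (h : ∀ ξ ζ, S (tensor s ξ ζ) = T (tensor s ξ ζ)) :
    S = T := by
  refine ContinuousLinearMap.ext_on (s := {v : HH n κ | ∃ ξ ζ, v = tensor s ξ ζ}) ?_ ?_
  · exact Submodule.dense_iff_topologicalClosure_eq_top.2 (dense_tensor s)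
  · rintro _ ⟨ξ, ζ, rfl⟩
    exact h ξ ζ

theorem tensor_assoc {τ υ : Type} [Fintype τ] [Fintype υ] (s : ι ⊕ ρ ≃ κ) (t : κ ⊕ σ ≃ τ)
    (u : ρ ⊕ σ ≃ υ) (v : ι ⊕ υ ≃ τ) (h₁ : ∀ i, t (Sum.inl (s (Sum.inl i))) = v (Sum.inl i))
    (h₂ : ∀ i, t (Sum.inl (s (Sum.inr i))) = v (Sum.inr (u (Sum.inl i))))
    (h₃ : ∀ i, t (Sum.inr i) = v (Sum.inr (u (Sum.inr i)))) (ξ : HH n ι) (ζ : HH n ρ)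
    (ω : HH n σ) : tensor t (tensor s ξ ζ) ω = tensor v ξ (tensor u ζ ω) := by
  refine toL2_congr ?_
  filter_upwards [(quasi_inl t).ae_eq_comp (coeFn_tensor s ξ ζ),
    (quasi_inr v).ae_eq_comp (coeFn_tensor u ζ ω)] with p h4 h5
  simp only [Function.comp_apply] at h4 h5
  rw [h4, h5]
  simp only [h₁, h₂, h₃, mul_assoc]

theorem tensor_swap (s : ι ⊕ ρ ≃ κ) (t : ρ ⊕ ι ≃ κ) (h : ∀ x, s x.swap = t x) (ξ : HH n ι)
    (ζ : HH n ρ) : tensor s ξ ζ = tensor t ζ ξ := by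
  refine toL2_congr (Filter.Eventually.of_forall fun p => ?_)
  have h1 : ∀ i, s (Sum.inl i) = t (Sum.inr i) := fun i => h (Sum.inr i)
  have h2 : ∀ i, s (Sum.inr i) = t (Sum.inl i) := fun i => h (Sum.inl i)
  simp only [h1, h2, mul_comm]

end Tensor

/-! ### Amplifications -/

section Leg

variable {ι κ ρ σ : Type} [Fintype ι] [Fintype κ] [Fintype ρ] [Fintype σ]

open scoped TensorProduct

/-- The isometric embedding of the algebraic tensor product. -/
def tensorIsometry (s : ι ⊕ ρ ≃ κ) : HH n ι ⊗[ℂ] HH n ρ →ₗᵢ[ℂ] HH n κ :=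
  LinearMap.isometryOfInner (TensorProduct.lift (tensorL s).toLinearMap₁₂) (by
    intro x y
    induction x using TensorProduct.induction_on with
    | zero => simp
    | add x x' hx hx' => simp only [map_add, inner_add_left, hx, hx']
    | tmul ξ ζ =>
      induction y using TensorProduct.induction_on with
      | zero => simp
      | add y y' hy hy' => simp only [map_add, inner_add_right, hy, hy']
      | tmul ξ' ζ' => simp [inner_tensor])

theorem tensorIsometry_tmul (s : ι ⊕ ρ ≃ κ) (ξ : HH n ι) (ζ : HH n ρ) :
    tensorIsometry s (ξ ⊗ₜ ζ) = tensor s ξ ζ := by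
  simp [tensorIsometry]

theorem denseRange_tensorIsometry (s : ι ⊕ ρ ≃ κ) :
    DenseRange (tensorIsometry (n := n) s) := by
  refine Dense.mono ?_ (Submodule.dense_iff_topologicalClosure_eq_top.2 (dense_tensor s))
  have : Submodule.span ℂ {v : HH n κ | ∃ ξ ζ, v = tensor s ξ ζ} ≤
      LinearMap.range (tensorIsometry (n := n) s).toLinearMap := by
    rw [Submodule.span_le]
    rintro _ ⟨ξ, ζ, rfl⟩
    exact ⟨ξ ⊗ₜ ζ, tensorIsometry_tmul s ξ ζ⟩
  exact this

/-- Boundedness of T ⊗ 1 on the algebraic tensor product is immediate when T is an isometry, and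
every bounded operator is a linear combination of unitaries. -/
theorem exists_amplification (s : ι ⊕ ρ ≃ κ) (T : Op n ι) :
    ∃ S : Op n κ, ∀ ξ ζ, S (tensor s ξ ζ) = tensor s (T ξ) ζ := by
  have hT : T ∈ Submodule.span ℂ (unitary (Op n ι) : Set (Op n ι)) := by
    rw [CStarAlgebra.span_unitary]; trivial
  induction hT using Submodule.span_induction with
  | zero => exact ⟨0, fun ξ ζ => by simp⟩
  | add T T' _ _ h h' =>
    obtain ⟨S, hS⟩ := h
    obtain ⟨S', hS'⟩ := h'
    exact ⟨S + S', fun ξ ζ => by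
      simp only [add_apply, hS, hS', tensor_add_left]⟩
  | smul c T _ h =>
    obtain ⟨S, hS⟩ := h
    exact ⟨c • S, fun ξ ζ => by
      simp only [smul_apply, hS, tensor_smul_left]⟩
  | mem u hu =>
    let v : HH n ι →ₗᵢ[ℂ] HH n ι := (Unitary.linearIsometryEquiv ⟨u, hu⟩).toLinearIsometry
    let F : HH n ι ⊗[ℂ] HH n ρ →L[ℂ] HH n κ :=
      ((tensorIsometry s).comp (v.rTensor (HH n ρ))).toContinuousLinearMap
    refine ⟨F.extend (tensorIsometry s).toContinuousLinearMap, fun ξ ζ => ?_⟩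
    have := F.extend_eq (e := (tensorIsometry s).toContinuousLinearMap)
      (denseRange_tensorIsometry s) (tensorIsometry s).isometry.isUniformInducing (ξ ⊗ₜ ζ)
    simp only [LinearIsometry.coe_toContinuousLinearMap, tensorIsometry_tmul] at this
    rw [this]
    simp only [F, v, LinearIsometry.coe_toContinuousLinearMap, LinearIsometry.coe_comp,
      Function.comp_apply, LinearIsometry.rTensor_apply, LinearMap.rTensor_tmul,
      tensorIsometry_tmul]
    rfl

/-- Renaming of legs, for vectors. -/
def rename (f : ρ ≃ σ) (ζ : HH n ρ) : HH n σ := toL2 fun p => ζ fun k => p (f k)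

theorem coeFn_rename (f : ρ ≃ σ) (ζ : HH n ρ) :
    ⇑(rename f ζ) =ᵐ[volume] fun p => ζ fun k => p (f k) :=
  coeFn_toL2 ((Lp.memLp ζ).comp_measurePreserving
    (volume_preserving_arrowCongr' f.symm (MeasurableEquiv.refl (G n))
      (MeasurePreserving.id volume)))

theorem tensor_rename (s : ι ⊕ ρ ≃ κ) (t : ι ⊕ σ ≃ κ) (f : ρ ≃ σ)
    (h₁ : ∀ i, s (Sum.inl i) = t (Sum.inl i)) (h₂ : ∀ k, s (Sum.inr k) = t (Sum.inr (f k)))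
    (ξ : HH n ι) (ζ : HH n ρ) : tensor s ξ ζ = tensor t ξ (rename f ζ) := by
  refine toL2_congr ?_
  filter_upwards [(quasi_inr t).ae_eq_comp (coeFn_rename f ζ)] with p h
  simp only [Function.comp_apply] at h
  rw [h]
  simp only [h₁, h₂]

open scoped Classical in
/-- The legs in the range of `e`, followed by the remaining legs. -/
def splitOf (e : ι ↪ κ) : ι ⊕ {k : κ // k ∉ Set.range e} ≃ κ :=
  (Equiv.sumCongr (Equiv.ofInjective e e.injective) (Equiv.refl _)).trans
    (Equiv.Set.sumCompl (Set.range e))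

/-- The choice in `leg` is made with the canonical complement of the range of `e`. Any other listing
of the remaining legs differs from it by a renaming that does not touch the legs on which `T` acts.
-/
theorem leg_apply_tensor (e : ι ↪ κ) (s : ι ⊕ ρ ≃ κ) (h : ∀ i, s (Sum.inl i) = e i) (T : Op n ι)
    (ξ : HH n ι) (ζ : HH n ρ) : leg e T (tensor s ξ ζ) = tensor s (T ξ) ζ := by
  classical
  have hex : ∃ S : Op n κ, ∀ ξ ζ, S (simpleTensor e ξ ζ) = simpleTensor e (T ξ) ζ :=
    exists_amplification (splitOf e) T
  have hleg : ∀ ξ ζ, leg e T (simpleTensor e ξ ζ) = simpleTensor e (T ξ) ζ := by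
    unfold leg
    rw [dif_pos hex]
    exact hex.choose_spec
  have hmem : ∀ k : ρ, s (Sum.inr k) ∉ Set.range e := by
    rintro k ⟨i, hi⟩
    rw [← h i] at hi
    simpa using s.injective hi
  let f : ρ ≃ {k : κ // k ∉ Set.range e} := Equiv.ofBijective
    (fun k => ⟨s (Sum.inr k), hmem k⟩) ⟨fun k l hkl => by simpa using hkl, fun ⟨k, hk⟩ => by
      obtain ⟨x, rfl⟩ := s.surjective k
      rcases x with i | x
      · exact absurd ⟨i, (h i).symm⟩ hk
      · exact ⟨x, rfl⟩⟩
  have key : ∀ ξ : HH n ι, tensor s ξ ζ = simpleTensor e ξ (rename f ζ) := fun ξ =>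
    tensor_rename s (splitOf e) f (fun i => h i) (fun k => rfl) ξ ζ
  rw [key, key, hleg]

theorem ext_inner_tensor (s : ι ⊕ ρ ≃ κ) {S T : Op n κ}
    (h : ∀ ξ ζ ξ' ζ', inner ℂ (tensor s ξ' ζ') (S (tensor s ξ ζ)) =
      inner ℂ (tensor s ξ' ζ') (T (tensor s ξ ζ))) : S = T := by
  refine ext_tensor s fun ξ ζ => ?_
  refine (InnerProductSpace.toDual ℂ (HH n κ)).injective ?_
  refine ext_tensor s fun ξ' ζ' => ?_
  simp only [InnerProductSpace.toDual_apply_apply]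
  rw [← inner_conj_symm, h, inner_conj_symm]

theorem exists_split (e : ι ↪ κ) :
    ∃ (ρ : Type) (_ : Fintype ρ) (s : ι ⊕ ρ ≃ κ), ∀ i, s (Sum.inl i) = e i := by
  classical
  exact ⟨_, inferInstance, splitOf e, fun _ => rfl⟩

/-- `leg e` as a unital `*`-homomorphism. -/
def legHom (e : ι ↪ κ) : Op n ι →⋆ₐ[ℂ] Op n κ where
  toFun := leg e
  map_one' := by
    obtain ⟨ρ, _, s, hs⟩ := exists_split e
    exact ext_tensor s fun ξ ζ => by simp [leg_apply_tensor e s hs]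
  map_mul' S T := by
    obtain ⟨ρ, _, s, hs⟩ := exists_split e
    exact ext_tensor s fun ξ ζ => by simp [leg_apply_tensor e s hs]
  map_zero' := by
    obtain ⟨ρ, _, s, hs⟩ := exists_split e
    exact ext_tensor s fun ξ ζ => by simp [leg_apply_tensor e s hs]
  map_add' S T := by
    obtain ⟨ρ, _, s, hs⟩ := exists_split e
    exact ext_tensor s fun ξ ζ => by simp [leg_apply_tensor e s hs, tensor_add_left]
  commutes' c := by
    obtain ⟨ρ, _, s, hs⟩ := exists_split e
    exact ext_tensor s fun ξ ζ => by
      simp [leg_apply_tensor e s hs, tensor_smul_left, Algebra.algebraMap_eq_smul_one]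
  map_star' T := by
    obtain ⟨ρ, _, s, hs⟩ := exists_split e
    refine ext_inner_tensor s fun ξ ζ ξ' ζ' => ?_
    rw [ContinuousLinearMap.star_eq_adjoint, ContinuousLinearMap.star_eq_adjoint,
      ContinuousLinearMap.adjoint_inner_right, leg_apply_tensor e s hs, leg_apply_tensor e s hs,
      inner_tensor, inner_tensor, ContinuousLinearMap.adjoint_inner_right]

theorem legHom_tensor (e : ι ↪ κ) (s : ι ⊕ ρ ≃ κ) (h : ∀ i, s (Sum.inl i) = e i) (T : Op n ι)
    (ξ : HH n ι) (ζ : HH n ρ) : legHom e T (tensor s ξ ζ) = tensor s (T ξ) ζ :=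
  leg_apply_tensor e s h T ξ ζ

theorem ext_tensor₃ {E : Type*} [TopologicalSpace E] [T2Space E] [AddCommMonoid E] [Module ℂ E]
    {τ : Type} [Fintype τ] (t : κ ⊕ σ ≃ τ) (s : ι ⊕ ρ ≃ κ) {S T : HH n τ →L[ℂ] E}
    (h : ∀ ξ ζ ω, S (tensor t (tensor s ξ ζ) ω) = T (tensor t (tensor s ξ ζ) ω)) : S = T := by
  refine ext_tensor t fun x ω => ?_
  have : S.comp ((tensorL t).flip ω) = T.comp ((tensorL t).flip ω) :=
    ext_tensor s fun ξ ζ => h ξ ζ ω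
  exact congrArg (fun F => F x) this

theorem legHom_legHom {μ : Type} [Fintype μ] (f : κ ↪ μ) (e : ι ↪ κ) (T : Op n ι) :
    legHom f (legHom e T) = legHom (e.trans f) T := by
  obtain ⟨ρ, _, s, hs⟩ := exists_split e
  obtain ⟨σ, _, t, ht⟩ := exists_split f
  let v : ι ⊕ (ρ ⊕ σ) ≃ μ :=
    (Equiv.sumAssoc ι ρ σ).symm.trans ((Equiv.sumCongr s (Equiv.refl σ)).trans t)
  have hv : ∀ i, v (Sum.inl i) = (e.trans f) i := fun i => by simp [v, hs, ht]
  have key : ∀ (ξ : HH n ι) ζ ω, tensor t (tensor s ξ ζ) ω =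
      tensor v ξ (tensor (Equiv.refl _) ζ ω) :=
    tensor_assoc s t (Equiv.refl _) v (fun i => by simp [v]) (fun i => by simp [v])
      (fun i => by simp [v])
  refine ext_tensor₃ t s fun ξ ζ ω => ?_
  rw [legHom_tensor f t ht, legHom_tensor e s hs, key, key, legHom_tensor _ v hv]

theorem legHom_refl (T : Op n ι) : legHom (Function.Embedding.refl ι) T = T :=
  ext_tensor (Equiv.sumEmpty ι Empty) fun ξ ζ => by
    rw [legHom_tensor _ (Equiv.sumEmpty ι Empty) (fun i => rfl)]
    -- The complement is empty, so `ζ` is a function on the one-point space `Empty → G n` and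
    -- tensoring with it is multiplication by a scalar.
    have key : ∀ ξ : HH n ι, tensor (Equiv.sumEmpty ι Empty) ξ ζ = (ζ default) • ξ := by
      intro ξ
      refine Lp.ext ?_
      filter_upwards [coeFn_tensor (Equiv.sumEmpty ι Empty) ξ ζ,
        Lp.coeFn_smul (ζ default) ξ] with p h1 h2
      rw [h1, h2]
      simp only [Pi.smul_apply, smul_eq_mul, mul_comm]
      congr 2
      exact Subsingleton.elim _ _
    rw [key, key, map_smul]

theorem legHom_inr_tensor (s : ι ⊕ ρ ≃ κ) (e : ρ ↪ κ) (h : ∀ i, s (Sum.inr i) = e i) (T : Op n ρ)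
    (ξ : HH n ι) (ζ : HH n ρ) : legHom e T (tensor s ξ ζ) = tensor s ξ (T ζ) := by
  let t : ρ ⊕ ι ≃ κ := (Equiv.sumComm ρ ι).trans s
  have key : ∀ (ξ : HH n ι) ζ, tensor s ξ ζ = tensor t ζ ξ :=
    tensor_swap s t (fun x => by simp [t])
  rw [key, key, legHom_tensor e t (fun i => by simp [t, h])]

theorem legHom_commute {μ : Type} [Fintype μ] (e : ι ↪ μ) (f : κ ↪ μ)
    (h : ∀ i k, e i ≠ f k) (S : Op n ι) (T : Op n κ) :
    Commute (legHom e S) (legHom f T) := by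
  let g : ι ⊕ κ ↪ μ := ⟨Sum.elim e f, by
    rintro (i | i) (k | k) hik
    · simpa using hik
    · exact absurd hik (h i k)
    · exact absurd hik.symm (h k i)
    · simpa using hik⟩
  have he : e = Function.Embedding.inl.trans g := by ext i; rfl
  have hf : f = Function.Embedding.inr.trans g := by ext i; rfl
  have hc : Commute (legHom (n := n) (Function.Embedding.inl (β := κ)) S)
      (legHom (Function.Embedding.inr (α := ι)) T) :=
    ext_tensor (Equiv.refl (ι ⊕ κ)) fun ξ ζ => by
      simp only [mul_apply_eq_comp]
      rw [legHom_inr_tensor _ _ (fun _ => rfl), legHom_tensor _ _ (fun _ => rfl),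
        legHom_tensor _ _ (fun _ => rfl), legHom_inr_tensor _ _ (fun _ => rfl)]
  rw [he, hf, ← legHom_legHom, ← legHom_legHom]
  exact hc.map (legHom g)

end Leg

/-! ### The monoid of closed subspaces of a `C*`-algebra -/

section ClosedSubspaces

variable {A B C : Type*} [CStarAlgebra A] [CStarAlgebra B] [CStarAlgebra C]

/-- The closed subspaces of a `C*`-algebra. -/
abbrev CS (A : Type*) [CStarAlgebra A] : Type _ := ClosedSubmodule ℂ A

/-- The closed linear span of a set. -/
def cspan (S : Set A) : CS A := (Submodule.span ℂ S).closure

theorem cspan_le {S : Set A} {M : CS A} : cspan S ≤ M ↔ ∀ a ∈ S, a ∈ M := by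
  rw [cspan, Submodule.closure_le, Submodule.span_le]; rfl

theorem subset_cspan {S : Set A} {a : A} (h : a ∈ S) : a ∈ cspan S := cspan_le.1 le_rfl a h

theorem coe_cspan (S : Set A) : (cspan S : Set A) = closure (Submodule.span ℂ S : Set A) := rfl

theorem cspan_coe (M : CS A) : cspan (M : Set A) = M :=
  le_antisymm (cspan_le.2 fun _ h => h) fun _ h => subset_cspan h

theorem cspan_mono {S T : Set A} (h : S ⊆ T) : cspan S ≤ cspan T :=
  cspan_le.2 fun _ ha => subset_cspan (h ha)

theorem cspan_induction {S : Set A} (f : A →L[ℂ] B) {M : CS B}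
    (h : ∀ a ∈ S, f a ∈ M) {a : A} (ha : a ∈ cspan S) : f a ∈ M :=
  (cspan_le (M := M.comap f)).2 h ha

/-- Taking closed spans of products makes the closed subspaces a monoid with unit ℂ1. Lines spanned
by unitaries are invertible in it, and `push` along a *-homomorphism is multiplicative, so leg
computations with algebras can be carried out like leg computations with operators. -/
instance : Mul (CS A) where
  mul M N := cspan {x | ∃ a ∈ M, ∃ b ∈ N, x = a * b}

theorem mul_mem_mul {M N : CS A} {a b : A} (ha : a ∈ M) (hb : b ∈ N) :
    a * b ∈ M * N := subset_cspan ⟨a, ha, b, hb, rfl⟩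

theorem mul_le {M N P : CS A} : M * N ≤ P ↔ ∀ a ∈ M, ∀ b ∈ N, a * b ∈ P := by
  refine cspan_le.trans ⟨fun h a ha b hb => h _ ⟨a, ha, b, hb, rfl⟩, ?_⟩
  rintro h _ ⟨a, ha, b, hb, rfl⟩
  exact h a ha b hb

theorem cspan_mul_cspan (S T : Set A) :
    cspan S * cspan T = cspan {x | ∃ a ∈ S, ∃ b ∈ T, x = a * b} := by
  refine le_antisymm (mul_le.2 fun a ha b hb => ?_) (cspan_le.2 ?_)
  · refine cspan_induction ((ContinuousLinearMap.mul ℂ A).flip b) (fun a ha => ?_) ha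
    refine cspan_induction (ContinuousLinearMap.mul ℂ A a) (fun b hb => ?_) hb
    exact subset_cspan ⟨a, ha, b, hb, rfl⟩
  · rintro _ ⟨a, ha, b, hb, rfl⟩
    exact mul_mem_mul (subset_cspan ha) (subset_cspan hb)

instance : One (CS A) where
  one := cspan {1}

theorem cspan_mul_assoc (S T U : Set A) :
    cspan S * cspan T * cspan U = cspan S * (cspan T * cspan U) := by
  simp only [cspan_mul_cspan]
  congr 1
  ext x
  constructor
  · rintro ⟨_, ⟨a, ha, b, hb, rfl⟩, c, hc, rfl⟩
    exact ⟨a, ha, _, ⟨b, hb, c, hc, rfl⟩, mul_assoc a b c⟩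
  · rintro ⟨a, ha, _, ⟨b, hb, c, hc, rfl⟩, rfl⟩
    exact ⟨_, ⟨a, ha, b, hb, rfl⟩, c, hc, (mul_assoc a b c).symm⟩

theorem one_mul_cspan (S : Set A) : cspan {1} * cspan S = cspan S := by
  rw [cspan_mul_cspan]
  congr 1
  ext x
  simp

theorem cspan_mul_one (S : Set A) : cspan S * cspan {1} = cspan S := by
  rw [cspan_mul_cspan]
  congr 1
  ext x
  simp

instance : Monoid (CS A) where
  mul_assoc M N P := by
    simpa only [cspan_coe] using cspan_mul_assoc (M : Set A) N P
  one_mul M := by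
    have := one_mul_cspan (M : Set A)
    rwa [cspan_coe] at this
  mul_one M := by
    have := cspan_mul_one (M : Set A)
    rwa [cspan_coe] at this

theorem mul_mono {M M' N N' : CS A} (h : M ≤ M') (h' : N ≤ N') :
    M * N ≤ M' * N' :=
  mul_le.2 fun _ ha _ hb => mul_mem_mul (h ha) (h' hb)

/-- The line spanned by an element. -/
def line : A →* CS A where
  toFun a := cspan {a}
  map_one' := rfl
  map_mul' a b := by rw [cspan_mul_cspan]; simp

theorem line_apply (a : A) : line a = cspan {a} := rfl

theorem line_le {a : A} {M : CS A} : line a ≤ M ↔ a ∈ M := by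
  rw [line_apply, cspan_le]; simp

/-- The line spanned by a unitary, as an invertible closed subspace. -/
def uline : unitary A →* (CS A)ˣ :=
  (Units.map line).comp Unitary.toUnits

theorem coe_uline (u : unitary A) : (uline u : CS A) = line (u : A) := rfl

instance : Star (CS A) where
  star M :=
    { carrier := {a | star a ∈ M}
      add_mem' := fun {a b} ha hb => by
        rw [Set.mem_ofPred_eq, star_add]; exact add_mem ha hb
      zero_mem' := by rw [Set.mem_ofPred_eq, star_zero]; exact zero_mem M
      smul_mem' := fun c a ha => by
        rw [Set.mem_ofPred_eq, star_smul]
        exact M.toSubmodule.smul_mem _ ha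
      isClosed' := M.isClosed.preimage continuous_star }

theorem mem_star {M : CS A} {a : A} : a ∈ star M ↔ star a ∈ M := Iff.rfl

theorem star_mono {M N : CS A} (h : M ≤ N) : star M ≤ star N := fun _ ha => h ha

instance : StarMul (CS A) where
  star_involutive M := SetLike.ext fun a => by simp [mem_star]
  star_mul M N := by
    have key : ∀ M N : CS A, star N * star M ≤ star (M * N) := fun M N =>
      mul_le.2 fun a ha b hb => by
        rw [mem_star, star_mul]; exact mul_mem_mul hb ha
    have hinv : ∀ M : CS A, star (star M) = M := fun M =>
      SetLike.ext fun a => by simp [mem_star]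
    refine le_antisymm ?_ (key M N)
    have := star_mono (key (star N) (star M))
    rwa [hinv, hinv, hinv] at this

theorem star_cspan (S : Set A) : star (cspan S) = cspan (star '' S) := by
  have key : ∀ S : Set A, cspan (star '' S) ≤ star (cspan S) := fun S => cspan_le.2 <| by
    rintro _ ⟨a, ha, rfl⟩
    rw [mem_star, star_star]; exact subset_cspan ha
  refine le_antisymm ?_ (key S)
  have := star_mono (key (star '' S))
  simpa only [star_star, Set.image_image, Set.image_id'] using this

theorem star_line (a : A) : star (line a) = line (star a) := by
  rw [line_apply, star_cspan, Set.image_singleton]; rfl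

/-- A `*`-homomorphism as a bounded linear map. -/
def starHomL (f : A →⋆ₐ[ℂ] B) : A →L[ℂ] B :=
  f.toAlgHom.toLinearMap.mkContinuous 1 fun a => by
    simpa using NonUnitalStarAlgHom.norm_apply_le f a

/-- The closed image of a closed subspace under a `*`-homomorphism. -/
def push (f : A →⋆ₐ[ℂ] B) : CS A →* CS B where
  toFun M := cspan (f '' M)
  map_one' := by
    have : cspan (f '' (cspan {1} : CS A)) = cspan {1} := by
      refine le_antisymm (cspan_le.2 ?_) (cspan_le.2 ?_)
      · rintro _ ⟨a, ha, rfl⟩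
        refine cspan_induction (starHomL f) ?_ ha
        rintro _ rfl
        exact subset_cspan (map_one f)
      · rintro _ rfl
        exact subset_cspan ⟨1, subset_cspan rfl, map_one f⟩
    exact this
  map_mul' M N := by
    rw [cspan_mul_cspan]
    refine le_antisymm (cspan_le.2 ?_) (cspan_le.2 ?_)
    · rintro _ ⟨a, ha, rfl⟩
      refine cspan_induction (starHomL f) ?_ ha
      rintro _ ⟨a, ha, b, hb, rfl⟩
      exact subset_cspan ⟨_, ⟨a, ha, rfl⟩, _, ⟨b, hb, rfl⟩, map_mul f a b⟩
    · rintro _ ⟨_, ⟨a, ha, rfl⟩, _, ⟨b, hb, rfl⟩, rfl⟩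
      exact subset_cspan ⟨a * b, mul_mem_mul ha hb, map_mul f a b⟩

theorem push_le {f : A →⋆ₐ[ℂ] B} {M : CS A} {N : CS B} :
    push f M ≤ N ↔ ∀ a ∈ M, f a ∈ N :=
  cspan_le.trans Set.forall_mem_image

theorem mem_push {f : A →⋆ₐ[ℂ] B} {M : CS A} {a : A} (h : a ∈ M) :
    f a ∈ push f M := subset_cspan ⟨a, h, rfl⟩

theorem push_cspan (f : A →⋆ₐ[ℂ] B) (S : Set A) : push f (cspan S) = cspan (f '' S) := by
  refine le_antisymm (push_le.2 fun a ha => ?_) (cspan_mono (Set.image_mono fun _ h =>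
    subset_cspan h))
  refine cspan_induction (starHomL f) (fun a ha => ?_) ha
  exact subset_cspan ⟨a, ha, rfl⟩

theorem push_line (f : A →⋆ₐ[ℂ] B) (a : A) : push f (line a) = line (f a) := by
  rw [line_apply, push_cspan, Set.image_singleton]; rfl

theorem push_push (g : B →⋆ₐ[ℂ] C) (f : A →⋆ₐ[ℂ] B) (M : CS A) :
    push g (push f M) = push (g.comp f) M := by
  rw [← cspan_coe M]
  simp only [push_cspan]
  rw [← Set.image_comp]
  rfl

theorem push_congr {f g : A →⋆ₐ[ℂ] B} {M : CS A} (h : ∀ a ∈ M, f a = g a) :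
    push f M = push g M :=
  congrArg cspan (Set.image_congr h)

theorem push_mul_push_induction {D : Type*} [CStarAlgebra D] {f : A →⋆ₐ[ℂ] C} {g : B →⋆ₐ[ℂ] C}
    (φ : C →L[ℂ] D) {M : CS A} {N : CS B} {P : CS D}
    (h : ∀ a ∈ M, ∀ b ∈ N, φ (f a * g b) ∈ P) {x : C} (hx : x ∈ push f M * push g N) :
    φ x ∈ P := by
  have : push f M * push g N ≤ P.comap φ := by
    refine (cspan_mul_cspan _ _).trans_le (cspan_le.2 ?_)
    rintro _ ⟨_, ⟨a, ha, rfl⟩, _, ⟨b, hb, rfl⟩, rfl⟩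
    exact h a ha b hb
  exact this hx

theorem star_push (f : A →⋆ₐ[ℂ] B) (M : CS A) :
    star (push f M) = push f (star M) := by
  rw [← cspan_coe M]
  simp only [push_cspan, star_cspan, ← Set.image_comp]
  congr 2
  ext a
  simp [map_star]

theorem commute_push {f : A →⋆ₐ[ℂ] C} {g : B →⋆ₐ[ℂ] C} (h : ∀ a b, Commute (f a) (g b))
    (M : CS A) (N : CS B) : Commute (push f M) (push g N) := by
  rw [← cspan_coe M, ← cspan_coe N, push_cspan, push_cspan, Commute, SemiconjBy,
    cspan_mul_cspan, cspan_mul_cspan]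
  congr 1
  ext x
  constructor
  · rintro ⟨_, ⟨a, ha, rfl⟩, _, ⟨b, hb, rfl⟩, rfl⟩
    exact ⟨_, ⟨b, hb, rfl⟩, _, ⟨a, ha, rfl⟩, h a b⟩
  · rintro ⟨_, ⟨a, ha, rfl⟩, _, ⟨b, hb, rfl⟩, rfl⟩
    exact ⟨_, ⟨b, hb, rfl⟩, _, ⟨a, ha, rfl⟩, (h b a).symm⟩

end ClosedSubspaces

/-! ### Compact operators and slices -/

section Slices

open InnerProductSpace (rankOne)

variable {ι κ ρ : Type} [Fintype ι] [Fintype κ] [Fintype ρ]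

/-- The first block of legs. -/
def embL (s : ι ⊕ ρ ≃ κ) : ι ↪ κ := Function.Embedding.inl.trans s.toEmbedding

/-- The second block of legs. -/
def embR (s : ι ⊕ ρ ≃ κ) : ρ ↪ κ := Function.Embedding.inr.trans s.toEmbedding

theorem legHom_embL_tensor (s : ι ⊕ ρ ≃ κ) (T : Op n ι) (ξ : HH n ι) (ζ : HH n ρ) :
    legHom (embL s) T (tensor s ξ ζ) = tensor s (T ξ) ζ :=
  legHom_tensor _ s (fun _ => rfl) T ξ ζ

theorem legHom_embR_tensor (s : ι ⊕ ρ ≃ κ) (T : Op n ρ) (ξ : HH n ι) (ζ : HH n ρ) :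
    legHom (embR s) T (tensor s ξ ζ) = tensor s ξ (T ζ) :=
  legHom_inr_tensor s _ (fun _ => rfl) T ξ ζ

theorem commute_embL_embR (s : ι ⊕ ρ ≃ κ) (S : Op n ι) (T : Op n ρ) :
    Commute (legHom (embL s) S) (legHom (embR s) T) :=
  legHom_commute _ _ (fun i k h => by simpa using s.injective h) S T

theorem inner_apply_eq_star (T : Op n κ) (x y : HH n κ) :
    inner ℂ x (T y) = inner ℂ (star T x) y := by
  rw [ContinuousLinearMap.star_eq_adjoint, ContinuousLinearMap.adjoint_inner_left]

theorem star_rankOne (x y : HH n ι) : star (rankOne ℂ x y : Op n ι) = rankOne ℂ y x := by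
  rw [ContinuousLinearMap.star_eq_adjoint]
  exact InnerProductSpace.adjoint_rankOne x y

/-- The slice `(ω_{η,ξ} ⊗ id)(V)`. -/
def slice (s : ι ⊕ ρ ≃ κ) (η ξ : HH n ι) : Op n κ →L[ℂ] Op n ρ :=
  (ContinuousLinearMap.compL ℂ (HH n ρ) (HH n κ) (HH n ρ)
      (ContinuousLinearMap.adjoint (tensorL s η))).comp
    ((ContinuousLinearMap.compL ℂ (HH n ρ) (HH n κ) (HH n κ)).flip (tensorL s ξ))

theorem slice_apply (s : ι ⊕ ρ ≃ κ) (η ξ : HH n ι) (V : Op n κ) (ζ : HH n ρ) :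
    slice s η ξ V ζ = ContinuousLinearMap.adjoint (tensorL s η) (V (tensor s ξ ζ)) := rfl

theorem inner_slice (s : ι ⊕ ρ ≃ κ) (η ξ : HH n ι) (V : Op n κ) (ζ ζ' : HH n ρ) :
    inner ℂ ζ' (slice s η ξ V ζ) = inner ℂ (tensor s η ζ') (V (tensor s ξ ζ)) := by
  rw [slice_apply, ContinuousLinearMap.adjoint_inner_right]; rfl

theorem slice_eq_of_inner (s : ι ⊕ ρ ≃ κ) {η ξ : HH n ι} {V : Op n κ} {S : Op n ρ}
    (h : ∀ ζ ζ', inner ℂ (tensor s η ζ') (V (tensor s ξ ζ)) = inner ℂ ζ' (S ζ)) :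
    slice s η ξ V = S := by
  ext1 ζ
  exact ext_inner_left ℂ fun ζ' => by rw [inner_slice, h]

theorem slice_legs (s : ι ⊕ ρ ≃ κ) (η ξ : HH n ι) (S : Op n ι) (T : Op n ρ) :
    slice s η ξ (legHom (embL s) S * legHom (embR s) T) = inner ℂ η (S ξ) • T :=
  slice_eq_of_inner s fun ζ ζ' => by
    rw [mul_apply_eq_comp, legHom_embR_tensor, legHom_embL_tensor, inner_tensor, smul_apply,
      inner_smul_right]

/-- Slicing is compression by rank-one operators: this identity is the bridge from slices to
products in the monoid of closed subspaces. -/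
theorem rankOne_mul_mul_rankOne (s : ι ⊕ ρ ≃ κ) (f η ξ g : HH n ι) (V : Op n κ) :
    legHom (embL s) (rankOne ℂ f η) * V * legHom (embL s) (rankOne ℂ ξ g) =
      legHom (embL s) (rankOne ℂ f g) * legHom (embR s) (slice s η ξ V) := by
  refine ext_inner_tensor s fun a b a' b' => ?_
  simp only [mul_apply_eq_comp]
  rw [inner_apply_eq_star, ← map_star, star_rankOne, legHom_embL_tensor, legHom_embL_tensor,
    legHom_embR_tensor, legHom_embL_tensor]
  simp only [InnerProductSpace.rankOne_apply, tensor_smul_left, inner_smul_left,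
    inner_smul_right, map_smul, inner_tensor, inner_slice]
  rw [inner_conj_symm]

/-- The compact operators. -/
def cpt (n : ℕ) (ι : Type) [Fintype ι] : CS (Op n ι) :=
  cspan {T | ∃ x y : HH n ι, T = rankOne ℂ x y}

theorem rankOne_mem_cpt (x y : HH n ι) : (rankOne ℂ x y : Op n ι) ∈ cpt n ι :=
  subset_cspan ⟨x, y, rfl⟩

theorem mul_rankOne (T : Op n ι) (x y : HH n ι) :
    T * rankOne ℂ x y = rankOne ℂ (T x) y := by
  ext1 z; simp

theorem star_cpt : star (cpt n ι) = cpt n ι := by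
  rw [cpt, star_cspan]
  congr 1
  ext T
  constructor
  · rintro ⟨_, ⟨x, y, rfl⟩, rfl⟩; exact ⟨y, x, star_rankOne x y⟩
  · rintro ⟨x, y, rfl⟩; exact ⟨_, ⟨y, x, rfl⟩, star_rankOne y x⟩

theorem mul_mem_cpt (T : Op n ι) {k : Op n ι} (hk : k ∈ cpt n ι) : T * k ∈ cpt n ι := by
  refine cspan_induction (ContinuousLinearMap.mul ℂ (Op n ι) T) ?_ hk
  rintro _ ⟨x, y, rfl⟩
  rw [ContinuousLinearMap.mul_apply', mul_rankOne]
  exact rankOne_mem_cpt _ _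

theorem uline_mul_cpt (u : unitary (Op n ι)) : ↑(uline u) * cpt n ι = cpt n ι := by
  have key : ∀ u : unitary (Op n ι), ↑(uline u) * cpt n ι ≤ cpt n ι := fun u => by
    rw [coe_uline]
    refine mul_le.2 fun a ha b hb => ?_
    refine cspan_induction ((ContinuousLinearMap.mul ℂ (Op n ι)).flip b) ?_ ha
    rintro _ rfl
    exact mul_mem_cpt _ hb
  refine le_antisymm (key u) ?_
  have := mul_mono (le_refl (uline u : CS (Op n ι))) (key u⁻¹)
  rwa [← mul_assoc, ← Units.val_mul, ← map_mul, mul_inv_cancel, map_one, Units.val_one,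
    one_mul] at this

theorem star_uline (u : unitary (Op n ι)) :
    star (uline u : CS (Op n ι)) = ↑(uline u⁻¹) := by
  rw [coe_uline, star_line, coe_uline, ← Unitary.star_eq_inv, Unitary.coe_star]

theorem cpt_mul_uline (u : unitary (Op n ι)) : cpt n ι * ↑(uline u) = cpt n ι := by
  have := congrArg star (uline_mul_cpt (u⁻¹))
  rwa [star_mul, star_cpt, star_uline, inv_inv] at this

theorem exists_ne_zero (n : ℕ) (ι : Type) [Fintype ι] : ∃ x : HH n ι, x ≠ 0 := by
  have hpos : (volume (Metric.ball (0 : ι → G n) 1)) ≠ 0 :=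
    (Metric.measure_ball_pos volume _ one_pos).ne'
  have hfin : volume (Metric.ball (0 : ι → G n) 1) ≠ ⊤ := Metric.isBounded_ball.measure_lt_top.ne
  refine ⟨indicatorConstLp 2 Metric.isOpen_ball.measurableSet hfin 1, fun h => ?_⟩
  have := congrArg norm h
  rw [norm_indicatorConstLp two_ne_zero (by norm_num), norm_zero] at this
  simp [Measure.real, ENNReal.toReal_eq_zero_iff, hpos, hfin] at this

theorem cpt_ne_bot : cpt n ι ≠ ⊥ := by
  obtain ⟨x, hx⟩ := exists_ne_zero n ι
  intro h
  have := rankOne_mem_cpt x x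
  rw [h, ClosedSubmodule.mem_bot, InnerProductSpace.rankOne_eq_zero] at this
  simp [hx] at this

theorem cpt_mul_cpt : cpt n ι * cpt n ι = cpt n ι := by
  refine le_antisymm (mul_le.2 fun a _ b hb => mul_mem_cpt a hb) (cspan_le.2 ?_)
  rintro _ ⟨x, y, rfl⟩
  obtain ⟨z, hz⟩ := exists_ne_zero n ι
  have h0 : inner ℂ z z ≠ 0 := by simpa using hz
  have : (rankOne ℂ x y : Op n ι) = rankOne ℂ ((inner ℂ z z)⁻¹ • x) z * rankOne ℂ z y := by
    rw [mul_rankOne, InnerProductSpace.rankOne_apply, smul_smul, mul_inv_cancel₀ h0, one_smul]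
  rw [this]
  exact mul_mem_mul (rankOne_mem_cpt _ _) (rankOne_mem_cpt _ _)

/-- `leg`, for closed subspaces of operators. -/
abbrev legC (e : ι ↪ κ) : CS (Op n ι) →* CS (Op n κ) :=
  push (legHom e)

/-- A vector functional that does not vanish on some element of `R` slices the first leg away and
recovers the second factor. Cancelling a leg of compact operators rests on this. -/
theorem le_of_legC_mul_le (s : ι ⊕ ρ ≃ κ) {R R' : CS (Op n ι)} (hR : R ≠ ⊥)
    {M N : CS (Op n ρ)}
    (h : legC (embL s) R * legC (embR s) M ≤ legC (embL s) R' * legC (embR s) N) : M ≤ N := by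
  obtain ⟨r, hr, hr0⟩ : ∃ r ∈ R, r ≠ 0 := by
    by_contra! hcon
    exact hR (le_antisymm (fun x hx => by simpa using hcon x hx) bot_le)
  obtain ⟨ξ, hξ⟩ : ∃ ξ, r ξ ≠ 0 := by
    by_contra! hcon
    exact hr0 (ContinuousLinearMap.ext hcon)
  intro m hm
  have h1 : slice s (r ξ) ξ (legHom (embL s) r * legHom (embR s) m) ∈ N := by
    refine push_mul_push_induction (slice s (r ξ) ξ) (fun r' _ n' hn' => ?_)
      (h (mul_mem_mul (mem_push hr) (mem_push hm)))
    rw [slice_legs]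
    exact N.toSubmodule.smul_mem _ hn'
  rw [slice_legs] at h1
  have h0 : inner ℂ (r ξ) (r ξ) ≠ 0 := by simpa using hξ
  have := N.toSubmodule.smul_mem (inner ℂ (r ξ) (r ξ))⁻¹ h1
  rwa [smul_smul, inv_mul_cancel₀ h0, one_smul] at this

theorem eq_of_legC_mul_eq (s : ι ⊕ ρ ≃ κ) {M N : CS (Op n ρ)}
    (h : legC (embL s) (cpt n ι) * legC (embR s) M = legC (embL s) (cpt n ι) * legC (embR s) N) :
    M = N :=
  le_antisymm (le_of_legC_mul_le s cpt_ne_bot h.le) (le_of_legC_mul_le s cpt_ne_bot h.ge)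

/-- The closed span of the slices of `V` along the first block. -/
def slices (s : ι ⊕ ρ ≃ κ) (V : Op n κ) : CS (Op n ρ) :=
  cspan {T | ∃ η ξ, T = slice s η ξ V}

/-- Since the compact leg can be cancelled, this identity determines the slices. Slice algebras are
handled almost exclusively through it. -/
theorem cpt_mul_line_mul_cpt (s : ι ⊕ ρ ≃ κ) (V : Op n κ) :
    legC (embL s) (cpt n ι) * line V * legC (embL s) (cpt n ι) =
      legC (embL s) (cpt n ι) * legC (embR s) (slices s V) := by
  simp only [cpt, slices, push_cspan, line_apply, cspan_mul_cspan]
  congr 1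
  ext T
  constructor
  · rintro ⟨_, ⟨_, ⟨_, ⟨f, η, rfl⟩, rfl⟩, _, rfl, rfl⟩, _, ⟨_, ⟨ξ, g, rfl⟩, rfl⟩, rfl⟩
    rw [rankOne_mul_mul_rankOne]
    exact ⟨_, ⟨_, ⟨f, g, rfl⟩, rfl⟩, _, ⟨_, ⟨η, ξ, rfl⟩, rfl⟩, rfl⟩
  · rintro ⟨_, ⟨_, ⟨f, g, rfl⟩, rfl⟩, _, ⟨_, ⟨η, ξ, rfl⟩, rfl⟩, rfl⟩
    rw [← rankOne_mul_mul_rankOne]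
    exact ⟨_, ⟨_, ⟨_, ⟨f, η, rfl⟩, rfl⟩, _, rfl, rfl⟩, _, ⟨_, ⟨ξ, g, rfl⟩, rfl⟩, rfl⟩

theorem slices_eq (s : ι ⊕ ρ ≃ κ) {V : Op n κ} {M : CS (Op n ρ)}
    (h : legC (embL s) (cpt n ι) * line V * legC (embL s) (cpt n ι) =
      legC (embL s) (cpt n ι) * legC (embR s) M) : slices s V = M :=
  eq_of_legC_mul_eq s ((cpt_mul_line_mul_cpt s V).symm.trans h)

theorem cpt_sum (s : ι ⊕ ρ ≃ κ) :
    legC (embL s) (cpt n ι) * legC (embR s) (cpt n ρ) = cpt n κ := by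
  have hgen : ∀ (x x' : HH n ι) (y y' : HH n ρ),
      legHom (embL s) (rankOne ℂ x x') * legHom (embR s) (rankOne ℂ y y') =
        rankOne ℂ (tensor s x y) (tensor s x' y') := fun x x' y y' =>
    ext_tensor s fun a b => by
      rw [mul_apply_eq_comp, legHom_embR_tensor, legHom_embL_tensor]
      simp only [InnerProductSpace.rankOne_apply, tensor_smul_left, tensor_smul_right,
        smul_smul, inner_tensor, mul_comm]
  have hset : legC (embL s) (cpt n ι) * legC (embR s) (cpt n ρ) =
      cspan {T | ∃ x y x' y', T = rankOne ℂ (tensor s x y) (tensor s x' y')} := by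
    simp only [cpt, push_cspan, cspan_mul_cspan]
    congr 1
    ext T
    constructor
    · rintro ⟨_, ⟨_, ⟨x, x', rfl⟩, rfl⟩, _, ⟨_, ⟨y, y', rfl⟩, rfl⟩, rfl⟩
      exact ⟨x, y, x', y', hgen _ _ _ _⟩
    · rintro ⟨x, y, x', y', rfl⟩
      exact ⟨_, ⟨_, ⟨x, x', rfl⟩, rfl⟩, _, ⟨_, ⟨y, y', rfl⟩, rfl⟩, (hgen _ _ _ _).symm⟩
  set M := legC (embL s) (cpt n ι) * legC (embR s) (cpt n ρ) with hM
  have hstar : star M = M := by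
    rw [hM, star_mul, star_push, star_push, star_cpt, star_cpt]
    exact (commute_push (commute_embL_embR s) _ _).symm
  have hdense : ∀ (P : Submodule ℂ (HH n κ)), IsClosed (P : Set (HH n κ)) →
      (∀ x y, tensor s x y ∈ P) → ∀ v, v ∈ P := by
    intro P hP h v
    have h1 : (Submodule.span ℂ {v : HH n κ | ∃ ξ ζ, v = tensor s ξ ζ}).topologicalClosure ≤ P :=
      Submodule.topologicalClosure_minimal _
        (Submodule.span_le.2 (by rintro _ ⟨x, y, rfl⟩; exact h x y)) hP
    rw [dense_tensor] at h1
    exact h1 trivial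
  -- Density of simple tensors is used in one vector at a time. As `M` is self-adjoint, passing to
  -- adjoints exchanges the two vectors of a rank-one operator, so the argument for the first serves
  -- also for the second.
  have hleft : ∀ w, (∀ x y, (rankOne ℂ (tensor s x y) w : Op n κ) ∈ M) →
      ∀ v, (rankOne ℂ v w : Op n κ) ∈ M := fun w h =>
    hdense (M.comap ((rankOne ℂ : HH n κ →L[ℂ] _).flip w)).toSubmodule
      (M.comap ((rankOne ℂ : HH n κ →L[ℂ] _).flip w)).isClosed h
  refine le_antisymm ?_ (cspan_le.2 ?_)
  · rw [hset]
    exact cspan_mono (by rintro _ ⟨x, y, x', y', rfl⟩; exact ⟨_, _, rfl⟩)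
  · rintro _ ⟨v, w, rfl⟩
    refine hleft w (fun x y => ?_) v
    rw [← hstar, mem_star, star_rankOne]
    refine hleft _ (fun x' y' => ?_) w
    rw [hset]
    exact subset_cspan ⟨_, _, _, _, rfl⟩

end Slices

/-! ### Words in a monoid -/

section Words

variable {M : Type*} [Monoid M]

theorem mul_swap {a b : M} (h : a * b = b * a) (t : M) : a * (b * t) = b * (a * t) := by
  rw [← mul_assoc, h, mul_assoc]

/-- Conventions for the words: `ka`, `kb`, `kc` are compact operators in one leg, `vab` and the like
are lines spanned by a unitary placed in two legs, primes denote inverses or adjoints, and the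
remaining letters are slice algebras. The hypothesis `pent` is a form of the pentagon, `reg` is
regularity, `ab` is absorption of a unitary by the compact operators in both of its legs, and the
numbered `c` are commutations of disjoint legs. -/
theorem word_star_mul {ka kb b b' vac' vbc vab' : M} (c1 : kb * b' = b' * kb)
    (h1 : ka * vac' * ka = ka * b') (h2 : kb * vbc * kb = kb * b) (reg : kb * vab' * ka = ka * kb)
    (c2 : kb * vac' = vac' * kb) (c3 : ka * vbc = vbc * ka) (c4 : ka * kb = kb * ka)
    (pent : vac' * vab' * vbc = vbc * vab') (ab : vab' * (ka * kb) = ka * kb)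
    (kk : ka * ka = ka) : ka * kb * (b' * b) = ka * kb * b := by
  calc ka * kb * (b' * b) = (ka * b') * (kb * b) := by simp only [mul_assoc, mul_swap c1]
    _ = (ka * vac' * ka) * (kb * vbc * kb) := by rw [h1, h2]
    _ = ka * vac' * (ka * kb) * vbc * kb := by simp only [mul_assoc]
    _ = ka * vac' * (kb * vab' * ka) * vbc * kb := by rw [reg]
    _ = ka * kb * (vac' * vab' * vbc) * (ka * kb) := by
      simp only [mul_assoc, mul_swap c2, mul_swap c3]
    _ = ka * kb * vbc * (vab' * (ka * kb)) := by rw [pent]; simp only [mul_assoc]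
    _ = (ka * ka) * (kb * vbc * kb) := by
      rw [ab]; simp only [mul_assoc, ← mul_swap c3, mul_swap c4]
    _ = ka * kb * b := by rw [kk, h2, mul_assoc]

theorem word_mul_left {ka kc b vab vac vac' vcb : M} (c1 : kc * b = b * kc)
    (c2 : kc * vab = vab * kc) (c3 : ka * vcb = vcb * ka) (c4 : ka * kc = kc * ka)
    (h : kc * vcb * kc = kc * b) (pent : vab * vcb = vac' * vcb * vac)
    (ab : vac * (ka * kc) = ka * kc) (reg : kc * vac' * ka = ka * kc) :
    vab * (ka * b) * kc = ka * b * kc := by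
  calc vab * (ka * b) * kc = vab * ka * (kc * b) := by simp only [mul_assoc, c1]
    _ = vab * ka * (kc * vcb * kc) := by rw [h]
    _ = kc * (vab * vcb) * (ka * kc) := by
      simp only [mul_assoc, ← mul_swap c3, mul_swap c2]
      simp only [mul_swap c4]
    _ = kc * vac' * vcb * (vac * (ka * kc)) := by rw [pent]; simp only [mul_assoc]
    _ = (kc * vac' * ka) * vcb * kc := by rw [ab]; simp only [mul_assoc, mul_swap c3]
    _ = ka * (kc * vcb * kc) := by rw [reg]; simp only [mul_assoc]
    _ = ka * b * kc := by rw [h, c1, mul_assoc]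

theorem word_mul_right {ka kc b vab' vac vac' vcb' : M} (c1 : kc * b = b * kc)
    (c2 : kc * vab' = vab' * kc) (c3 : ka * vcb' = vcb' * ka) (c4 : ka * kc = kc * ka)
    (c5 : ka * b = b * ka)
    (h : kc * vcb' * kc = kc * b) (pent : vcb' * vab' = vac' * vcb' * vac)
    (ab : vac * (ka * kc) = ka * kc) (reg : kc * vac' * ka = ka * kc) :
    b * vab' * ka * kc = b * ka * kc := by
  calc b * vab' * ka * kc = (kc * b) * vab' * ka := by
        simp only [c1, mul_assoc, mul_swap c2, c4]
    _ = (kc * vcb' * kc) * vab' * ka := by rw [h]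
    _ = kc * (vcb' * vab') * (ka * kc) := by simp only [mul_assoc, mul_swap c2, c4]
    _ = kc * vac' * vcb' * (vac * (ka * kc)) := by rw [pent]; simp only [mul_assoc]
    _ = (kc * vac' * ka) * vcb' * kc := by rw [ab]; simp only [mul_assoc, mul_swap c3]
    _ = ka * (kc * vcb' * kc) := by rw [reg]; simp only [mul_assoc]
    _ = b * ka * kc := by rw [h, c1, ← mul_assoc, c5]

theorem word_mul_tensor {kb a c vab vab' vbc vbc' vac : M} (c1 : kb * a = a * kb)
    (c2 : kb * c = c * kb) (c4 : vbc * a = a * vbc) (c4' : vbc' * a = a * vbc')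
    (pent : vac = vab' * vbc * vab * vbc')
    (h1 : vbc * (kb * c) = kb * c) (h1' : vbc' * (kb * c) = kb * c)
    (h2 : vab * (kb * a) = kb * a) (h2' : vab' * (kb * a) = kb * a) :
    vac * (a * c) * kb = a * c * kb := by
  calc vac * (a * c) * kb = vab' * vbc * vab * a * (vbc' * (kb * c)) := by
        rw [pent]; simp only [mul_assoc, mul_swap c4', c2]
    _ = vab' * vbc * (vab * (kb * a)) * c := by rw [h1']; simp only [mul_assoc, mul_swap c1]
    _ = vab' * a * (vbc * (kb * c)) := by
      rw [h2]; simp only [mul_assoc, mul_swap c1, mul_swap c4]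
    _ = (vab' * (kb * a)) * c := by rw [h1]; simp only [mul_assoc, mul_swap c1]
    _ = a * c * kb := by rw [h2', c1, mul_assoc, c2, mul_assoc]

theorem word_comul {ka b c vab vac vbc vbc' : M} (c1 : ka * vbc = vbc * ka)
    (c2 : ka * vbc' = vbc' * ka)
    (h : ka * vab * ka = ka * b) (pent : vbc * vab * vbc' = vab * vac)
    (hm : vac * (ka * c) = ka * c) :
    ka * (vbc * b * vbc' * c) = ka * (b * c) := by
  calc ka * (vbc * b * vbc' * c) = vbc * (ka * b) * vbc' * c := by
        simp only [mul_assoc, mul_swap c1]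
    _ = vbc * (ka * vab * ka) * vbc' * c := by rw [h]
    _ = ka * (vbc * vab * vbc') * (ka * c) := by
        simp only [mul_assoc, mul_swap c1, mul_swap c2]
    _ = ka * vab * (vac * (ka * c)) := by rw [pent]; simp only [mul_assoc]
    _ = (ka * vab * ka) * c := by rw [hm]; simp only [mul_assoc]
    _ = ka * (b * c) := by rw [h, mul_assoc]

end Words

/-! ### Legs of operators on `H ⊗ H` -/

section Legs

variable {κ μ : Type} [Fintype κ] [Fintype μ]

/-- The inclusion of one leg. -/
def sg (i : κ) : Unit ↪ κ := ⟨fun _ => i, fun _ _ _ => rfl⟩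

/-- The inclusion of two legs. -/
def pr (i j : κ) (h : i ≠ j) : I₂ ↪ κ :=
  ⟨Sum.elim (fun _ => i) (fun _ => j), by
    rintro (_ | _) (_ | _) h'
    · rfl
    · exact absurd h' h
    · exact absurd h'.symm h
    · rfl⟩

theorem pr_trans (i j : κ) (h : i ≠ j) (f : κ ↪ μ) :
    (pr i j h).trans f = pr (f i) (f j) (f.injective.ne h) := by
  ext (_ | _) <;> rfl

theorem legC_legC {ι : Type} [Fintype ι] (f : κ ↪ μ) (e : ι ↪ κ) (M : CS (Op n ι)) :
    legC f (legC e M) = legC (e.trans f) M := by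
  rw [push_push]
  exact push_congr fun a _ => legHom_legHom f e a

theorem legC_commute {ι ρ : Type} [Fintype ι] [Fintype ρ] (e : ι ↪ μ) (f : ρ ↪ μ)
    (h : ∀ i k, e i ≠ f k) (M : CS (Op n ι)) (N : CS (Op n ρ)) :
    legC e M * legC f N = legC f N * legC e M :=
  commute_push (legHom_commute e f h) M N

theorem legC_refl {ι : Type} [Fintype ι] (M : CS (Op n ι)) :
    legC (Function.Embedding.refl ι) M = M := by
  rw [legC, push_congr (g := StarAlgHom.id ℂ _) fun a _ => legHom_refl a]
  rw [← cspan_coe M, push_cspan]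
  congr 1
  exact Set.image_id _

/-- `u_{ij}`, for a unitary on `H ⊗ H`. -/
def lu (i j : κ) (h : i ≠ j) : unitary (Op n I₂) →* unitary (Op n κ) where
  toFun u := ⟨legHom (pr i j h) u, Unitary.map_mem (legHom (n := n) (pr i j h)) u.2⟩
  map_one' := Subtype.ext (map_one _)
  map_mul' _ _ := Subtype.ext (map_mul _ _ _)

theorem coe_lu (i j : κ) (h : i ≠ j) (u : unitary (Op n I₂)) :
    (lu i j h u : Op n κ) = legHom (pr i j h) u := rfl

/-- `u_{ij}`, as a line of operators. -/
def uv (i j : κ) (h : i ≠ j) (u : unitary (Op n I₂)) : CS (Op n κ) := uline (lu i j h u)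

theorem uv_eq (i j : κ) (h : i ≠ j) (u : unitary (Op n I₂)) :
    uv i j h u = legC (pr i j h) (uline u) := by
  rw [uv, coe_uline, coe_uline, push_line, coe_lu]

theorem legC_uv (f : κ ↪ μ) (i j : κ) (h : i ≠ j) (u : unitary (Op n I₂)) :
    legC f (uv i j h u) = uv (f i) (f j) (f.injective.ne h) u := by
  rw [uv_eq, uv_eq, legC_legC, pr_trans]

theorem uv_inv_mul (i j : κ) (h : i ≠ j) (u : unitary (Op n I₂)) :
    uv i j h u⁻¹ * uv i j h u = 1 := by
  simp [uv]

theorem star_uv (i j : κ) (h : i ≠ j) (u : unitary (Op n I₂)) :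
    star (uv i j h u) = uv i j h u⁻¹ := by
  rw [uv, star_uline, ← map_inv]; rfl

/-- `M` in the leg `i`. -/
abbrev lc (i : κ) (M : CS (Op n Unit)) : CS (Op n κ) := legC (sg i) M

theorem legC_lc (f : κ ↪ μ) (i : κ) (M : CS (Op n Unit)) : legC f (lc i M) = lc (f i) M :=
  legC_legC f (sg i) M

/-- The compact operators in the leg `i`. -/
abbrev kc (i : κ) : CS (Op n κ) := lc i (cpt n Unit)

theorem lc_comm {i j : κ} (h : i ≠ j) (M N : CS (Op n Unit)) : lc i M * lc j N = lc j N * lc i M :=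
  legC_commute _ _ (fun _ _ => h) M N

theorem lc_uv_comm {i j k : κ} (hj : i ≠ j) (hk : i ≠ k) (h : j ≠ k) (M : CS (Op n Unit))
    (u : unitary (Op n I₂)) : lc i M * uv j k h u = uv j k h u * lc i M := by
  rw [uv_eq]
  refine legC_commute _ _ ?_ M _
  rintro _ (_ | _)
  · exact hj
  · exact hk

theorem kc_mul_kc (i : κ) : kc i * kc i = (kc i : CS (Op n κ)) := by
  rw [← map_mul, cpt_mul_cpt]

theorem star_lc (i : κ) (M : CS (Op n Unit)) : star (lc i M) = lc i (star M) := star_push _ _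

theorem kc_mul_kc_eq {i j : κ} (h : i ≠ j) :
    kc i * kc j = legC (pr i j h) (cpt n I₂) := by
  rw [← cpt_sum (Equiv.refl I₂), map_mul, legC_legC, legC_legC]
  rfl

theorem uv_mul_kc {i j : κ} (h : i ≠ j) (u : unitary (Op n I₂)) :
    uv i j h u * (kc i * kc j) = kc i * kc j := by
  rw [kc_mul_kc_eq h, uv_eq, ← map_mul, uline_mul_cpt]

theorem kc_mul_slices {i j : κ} (h : i ≠ j) (u : unitary (Op n I₂)) :
    kc i * uv i j h u * kc i = kc i * lc j (slices (Equiv.refl I₂) (u : Op n I₂)) := by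
  have := congrArg (legC (pr i j h)) (cpt_mul_line_mul_cpt (Equiv.refl I₂) (u : Op n I₂))
  rw [map_mul, map_mul, map_mul, ← coe_uline, ← uv_eq, legC_legC, legC_legC] at this
  exact this

theorem kc_inv_slices {i j : κ} (h : i ≠ j) (u : unitary (Op n I₂)) :
    kc i * uv i j h u⁻¹ * kc i = kc i * lc j (star (slices (Equiv.refl I₂) (u : Op n I₂))) := by
  have := congrArg star (kc_mul_slices h u)
  rw [star_mul, star_mul, star_mul, star_uv, star_lc, star_lc, star_cpt, ← mul_assoc] at this
  rw [this, lc_comm h.symm]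

/-- Legs other than `j` and `k` may be present. The leg `j` is cancelled first, and then the block
of all remaining ones, after filling it with compact operators. -/
theorem lc_cancel {j k : κ} (h : j ≠ k) {M N : CS (Op n Unit)}
    (hMN : kc j * lc k M = kc j * lc k N) : M = N := by
  obtain ⟨ρ, _, s, hs⟩ := exists_split (pr j k h)
  let t : Unit ⊕ (ρ ⊕ Unit) ≃ κ := (Equiv.sumCongr (Equiv.refl _) (Equiv.sumComm _ _)).trans
    ((Equiv.sumAssoc Unit Unit ρ).symm.trans s)
  have h1 : embL t = sg j := by
    ext; exact hs (Sum.inl ())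
  have h2 : (sg (Sum.inr ())).trans (embR t) = sg k := by
    ext; exact hs (Sum.inr ())
  have h3 : lc (Sum.inr () : ρ ⊕ Unit) M = lc (Sum.inr ()) N := by
    refine eq_of_legC_mul_eq t ?_
    rw [h1, legC_legC, legC_legC, h2]
    exact hMN
  let t' : ρ ⊕ Unit ≃ ρ ⊕ Unit := Equiv.refl _
  refine eq_of_legC_mul_eq t' ?_
  exact congrArg (legC (embL t') (cpt n ρ) * ·) h3

end Legs

/-! ### Regular multiplicative unitaries -/

section MultUnitary

variable {κ : Type} [Fintype κ]

/-- Three legs of `H^{⊗κ}`. -/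
def tri (i j k : κ) (hij : i ≠ j) (hik : i ≠ k) (hjk : j ≠ k) : I₂ ⊕ Unit ↪ κ :=
  ⟨Sum.elim (pr i j hij) (fun _ => k), by
    rintro ((_ | _) | _) ((_ | _) | _) h <;> first | rfl | skip
    · exact absurd h hij
    · exact absurd h hik
    · exact absurd h.symm hij
    · exact absurd h hjk
    · exact absurd h.symm hik
    · exact absurd h.symm hjk⟩

/-- The image of a unitary under an amplification. -/
def legU {ι : Type} [Fintype ι] (e : ι ↪ κ) : unitary (Op n ι) →* unitary (Op n κ) where
  toFun u := ⟨legHom e u, Unitary.map_mem (legHom (n := n) e) u.2⟩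
  map_one' := Subtype.ext (map_one _)
  map_mul' _ _ := Subtype.ext (map_mul _ _ _)

theorem legU_lu {μ : Type} [Fintype μ] (f : κ ↪ μ) (i j : κ) (h : i ≠ j)
    (u : unitary (Op n I₂)) : legU f (lu i j h u) = lu (f i) (f j) (f.injective.ne h) u :=
  Subtype.ext ((legHom_legHom f (pr i j h) (u : Op n I₂)).trans (by rw [pr_trans]; rfl))

theorem lu_inl_inr (u : unitary (Op n I₂)) : lu (Sum.inl ()) (Sum.inr ()) (by simp) u = u := by
  refine Subtype.ext ?_
  rw [coe_lu]
  have : pr (Sum.inl () : I₂) (Sum.inr ()) (by simp) = Function.Embedding.refl I₂ := by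
    ext (_ | _) <;> rfl
  rw [this, legHom_refl]

theorem uv_inl_inr (u : unitary (Op n I₂)) :
    uv (Sum.inl ()) (Sum.inr ()) (by simp) u = uline u := by
  rw [uv, lu_inl_inr]

/-- A regular multiplicative unitary. -/
structure IsMultUnitary (u : unitary (Op n I₂)) : Prop where
  pentagon' : lu (κ := I₂ ⊕ Unit) (Sum.inl (Sum.inl ())) (Sum.inl (Sum.inr ())) (by simp) u *
    lu (Sum.inl (Sum.inl ())) (Sum.inr ()) (by simp) u *
    lu (Sum.inl (Sum.inr ())) (Sum.inr ()) (by simp) u =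
    lu (Sum.inl (Sum.inr ())) (Sum.inr ()) (by simp) u *
    lu (Sum.inl (Sum.inl ())) (Sum.inl (Sum.inr ())) (by simp) u
  -- This is the adjoint of the regularity condition (K ⊗ 1)u(1 ⊗ K) = K ⊗ K.
  regular' : kc (Sum.inr ()) * (uline u⁻¹ : CS (Op n I₂)) * kc (Sum.inl ()) =
    kc (Sum.inl ()) * kc (Sum.inr ())

/-- The opposite inverse `Σ u^* Σ`. -/
def dualU (u : unitary (Op n I₂)) : unitary (Op n I₂) :=
  lu (Sum.inr ()) (Sum.inl ()) (by simp) u⁻¹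

theorem lu_dualU (i j : κ) (h : i ≠ j) (u : unitary (Op n I₂)) :
    lu i j h (dualU u) = lu j i h.symm u⁻¹ :=
  legU_lu (pr i j h) _ _ _ _

theorem dualU_dualU (u : unitary (Op n I₂)) : dualU (dualU u) = u := by
  rw [dualU, map_inv, lu_dualU, ← map_inv, inv_inv, lu_inl_inr]

theorem uv_dualU (i j : κ) (h : i ≠ j) (u : unitary (Op n I₂)) :
    uv i j h (dualU u) = uv j i h.symm u⁻¹ := by
  rw [uv, lu_dualU]; rfl

theorem uv_dualU_inv (i j : κ) (h : i ≠ j) (u : unitary (Op n I₂)) :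
    uv i j h (dualU u)⁻¹ = uv j i h.symm u := by
  rw [uv, map_inv, lu_dualU, ← map_inv, inv_inv]; rfl

/-- The closed span of the slices along the first leg. -/
def sl (u : unitary (Op n I₂)) : CS (Op n Unit) := slices (Equiv.refl I₂) (u : Op n I₂)

theorem kc_mul_sl {i j : κ} (h : i ≠ j) (u : unitary (Op n I₂)) :
    kc i * uv i j h u * kc i = kc i * lc j (sl u) := kc_mul_slices h u

theorem kc_mul_star_sl {i j : κ} (h : i ≠ j) (u : unitary (Op n I₂)) :
    kc i * uv i j h u⁻¹ * kc i = kc i * lc j (star (sl u)) := kc_inv_slices h u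

theorem legC_pr_uv (i j : κ) (h : i ≠ j) (h' : (Sum.inl () : I₂) ≠ Sum.inr ())
    (u : unitary (Op n I₂)) : legC (pr i j h) (uv (Sum.inl ()) (Sum.inr ()) h' u) = uv i j h u :=
  legC_uv _ _ _ _ _

theorem legC_pr_inl (i j : κ) (h : i ≠ j) (M : CS (Op n Unit)) :
    legC (pr i j h) (lc (Sum.inl ()) M) = lc i M := legC_lc _ _ _

theorem legC_pr_inr (i j : κ) (h : i ≠ j) (M : CS (Op n Unit)) :
    legC (pr i j h) (lc (Sum.inr ()) M) = lc j M := legC_lc _ _ _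

/-- An identity in two legs may be verified after adjoining a third leg of compact operators, which
gives the pentagon room to act. -/
theorem lc_cancel₂ {i j k : κ} (hij : i ≠ j) (hik : i ≠ k) (hjk : j ≠ k) {M N : CS (Op n I₂)}
    (h : legC (pr i j hij) M * kc k = legC (pr i j hij) N * kc k) : M = N := by
  obtain ⟨ρ, _, s, hs⟩ := exists_split (tri i j k hij hik hjk)
  let t : Unit ⊕ (ρ ⊕ I₂) ≃ κ := (Equiv.sumCongr (Equiv.refl _) (Equiv.sumComm _ _)).trans
    ((Equiv.sumAssoc Unit I₂ ρ).symm.trans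
      ((Equiv.sumCongr (Equiv.sumComm _ _) (Equiv.refl _)).trans s))
  have h1 : embL t = sg k := by
    ext; exact hs (Sum.inr ())
  have h2 : Function.Embedding.inr.trans (embR t) = pr i j hij := by
    ext x; exact (hs (Sum.inl x)).trans rfl
  have h3 : legC (Function.Embedding.inr : I₂ ↪ ρ ⊕ I₂) M = legC Function.Embedding.inr N := by
    refine eq_of_legC_mul_eq t ?_
    have hc : ∀ M : CS (Op n I₂), kc k * legC (pr i j hij) M = legC (pr i j hij) M * kc k :=
      legC_commute _ _ (by rintro _ (_ | _); exacts [hik.symm, hjk.symm]) _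
    rw [h1, legC_legC, legC_legC, h2, hc, hc]
    exact h
  refine eq_of_legC_mul_eq (Equiv.refl (ρ ⊕ I₂)) ?_
  exact congrArg (legC (embL (Equiv.refl (ρ ⊕ I₂))) (cpt n ρ) * ·) h3

namespace IsMultUnitary

variable {u : unitary (Op n I₂)} {i j k : κ} (hij : i ≠ j) (hik : i ≠ k) (hjk : j ≠ k)

theorem pentagon (hu : IsMultUnitary u) : lu i j hij u * lu i k hik u * lu j k hjk u = lu j k hjk u * lu i j hij u := by
  have := congrArg (legU (tri i j k hij hik hjk)) hu.pentagon'
  simp only [MonoidHom.map_mul, legU_lu] at this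
  exact this

theorem regular (hu : IsMultUnitary u) : kc j * uv i j hij u⁻¹ * kc i = (kc i * kc j : CS (Op n κ)) := by
  have := congrArg (legC (pr i j hij)) hu.regular'
  rw [map_mul, map_mul, map_mul, ← uv_eq, legC_lc, legC_lc] at this
  exact this

theorem regular_star (hu : IsMultUnitary u) : kc i * uv i j hij u * kc j = (kc i * kc j : CS (Op n κ)) := by
  have := congrArg star (hu.regular hij)
  rw [star_mul, star_mul, star_mul, star_uv, star_lc, star_lc, star_cpt, inv_inv,
    ← mul_assoc] at this
  rw [this, lc_comm hij.symm]

/-- Inverting the pentagon reverses the order of its factors and flipping reverses the order of the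
legs, which together restore its shape. Regularity passes to its adjoint form. -/
theorem dual (hu : IsMultUnitary u) : IsMultUnitary (dualU u) where
  pentagon' := by
    simp only [lu_dualU]
    have := congrArg (·⁻¹) (hu.pentagon (κ := I₂ ⊕ Unit) (i := Sum.inr ())
      (j := Sum.inl (Sum.inr ())) (k := Sum.inl (Sum.inl ())) (by simp) (by simp) (by simp))
    simpa only [mul_inv_rev, ← map_inv, ← mul_assoc] using this
  regular' := by
    rw [← uv_inl_inr, uv_dualU_inv, hu.regular_star, lc_comm (by simp)]

/-- Over compact operators in legs 1 and 2, the product is built from u₁₃* and u₂₃ in leg 3.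
Regularity allows u₁₂* to be inserted between them, and the pentagon contracts u₁₃*u₁₂*u₂₃ to
u₂₃u₁₂*, whose last factor is absorbed by the compact operators. -/
theorem star_mul_sl (hu : IsMultUnitary u) : star (sl u) * sl u = sl u := by
  have h12 : (Sum.inl (Sum.inl ()) : I₂ ⊕ Unit) ≠ Sum.inl (Sum.inr ()) := by simp
  have h13 : (Sum.inl (Sum.inl ()) : I₂ ⊕ Unit) ≠ Sum.inr () := by simp
  have h23 : (Sum.inl (Sum.inr ()) : I₂ ⊕ Unit) ≠ Sum.inr () := by simp
  have pent : uv _ _ h13 u⁻¹ * uv _ _ h12 u⁻¹ * uv _ _ h23 u = uv _ _ h23 u * uv _ _ h12 u⁻¹ := by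
    simp only [uv, ← Units.val_mul, ← map_mul]
    congr 2
    have := hu.pentagon h12 h13 h23
    simp only [map_inv]
    rw [eq_mul_inv_iff_mul_eq, mul_assoc, mul_assoc, ← this]
    group
  have key := word_star_mul (lc_comm h23 _ _) (kc_mul_star_sl h13 u) (kc_mul_sl h23 u)
    (hu.regular h12) (lc_uv_comm h12.symm h23 h13 _ _) (lc_uv_comm h12 h13 h23 _ _)
    (lc_comm h12 _ _) pent (uv_mul_kc h12 _) (kc_mul_kc _)
  have hpr : pr _ _ h12 = embL (Equiv.refl (I₂ ⊕ Unit)) := by ext (_ | _) <;> rfl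
  rw [kc_mul_kc_eq h12, ← map_mul, hpr] at key
  exact eq_of_legC_mul_eq (Equiv.refl (I₂ ⊕ Unit)) key

/-- The slices of a regular multiplicative unitary form a self-adjoint space. -/
theorem star_sl (hu : IsMultUnitary u) : star (sl u) = sl u := by
  -- S*S is self-adjoint whatever S is, so S*S = S forces S* = S.
  have := congrArg star hu.star_mul_sl
  rwa [star_mul, star_star, hu.star_mul_sl, eq_comm] at this

theorem sl_mul_sl (hu : IsMultUnitary u) : sl u * sl u = sl u := by
  simpa only [hu.star_sl] using hu.star_mul_sl

/-- Nondegeneracy of the slice space needs neither pentagon nor regularity: compact operators in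
both legs absorb the unitary. -/
theorem sl_mul_cpt (u : unitary (Op n I₂)) : sl u * cpt n Unit = cpt n Unit := by
  have h12 : (Sum.inl () : I₂) ≠ Sum.inr () := by simp
  refine lc_cancel h12 ?_
  have hm : lc (Sum.inr () : I₂) (sl u * cpt n Unit) = lc (Sum.inr ()) (sl u) * kc (Sum.inr ()) :=
    map_mul _ _ _
  rw [hm, ← mul_assoc, ← kc_mul_sl h12 u, mul_assoc, mul_assoc, uv_mul_kc,
    ← mul_assoc, kc_mul_kc]

/-- Here `u` is seen to multiply K ⊗ S, where S is the slice algebra. With an auxiliary leg 3, S in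
leg 2 consists of slices of u₃₂, and u₁₂u₃₂ = u₁₃*u₃₂u₁₃. The right factor is absorbed by the
compact operators in legs 1 and 3, and the left one disappears by regularity. -/
theorem uv_mul_lc (hu : IsMultUnitary u) :
    uv i j hij u * (kc i * lc j (sl u)) = kc i * lc j (sl u) := by
  have h12 : (Sum.inl (Sum.inl ()) : I₂ ⊕ Unit) ≠ Sum.inl (Sum.inr ()) := by simp
  have h13 : (Sum.inl (Sum.inl ()) : I₂ ⊕ Unit) ≠ Sum.inr () := by simp
  have h23 : (Sum.inl (Sum.inr ()) : I₂ ⊕ Unit) ≠ Sum.inr () := by simp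
  have h0 : (Sum.inl () : I₂) ≠ Sum.inr () := by simp
  suffices h : uv _ _ h0 u * (kc (Sum.inl ()) * lc (Sum.inr ()) (sl u)) =
      kc (Sum.inl ()) * lc (Sum.inr ()) (sl u) by
    have := congrArg (legC (pr i j hij)) h
    rwa [map_mul, map_mul, legC_pr_uv, legC_pr_inl, legC_pr_inr] at this
  refine lc_cancel₂ h12 h13 h23 ?_
  have pent : uv _ _ h12 u * uv _ _ h23.symm u =
      uv _ _ h13 u⁻¹ * uv _ _ h23.symm u * uv _ _ h13 u := by
    simp only [uv, ← Units.val_mul, ← map_mul]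
    congr 2
    rw [map_inv, mul_assoc, ← hu.pentagon h13 h12 h23.symm]
    group
  rw [map_mul, map_mul, legC_pr_uv, legC_pr_inl, legC_pr_inr]
  exact word_mul_left (lc_comm h23.symm _ _) (lc_uv_comm h13.symm h23.symm h12 _ _)
    (lc_uv_comm h13 h12 h23.symm _ _) (lc_comm h13 _ _) (kc_mul_sl h23.symm u) pent
    (uv_mul_kc h13 _) (hu.regular h13)

theorem uv_inv_mul_lc (hu : IsMultUnitary u) :
    uv i j hij u⁻¹ * (kc i * lc j (sl u)) = kc i * lc j (sl u) := by
  conv_lhs => rw [← hu.uv_mul_lc hij]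
  rw [← mul_assoc, uv_inv_mul, one_mul]

/-- A one-sided variant of `uv_inv_mul_lc`: the compact operators and the slice algebra stand on
opposite sides of the unitary. Its adjoint `kc_mul_uv_mul_lc` is used to compute the slices of V_D.
-/
theorem lc_mul_uv_inv (hu : IsMultUnitary u) :
    lc j (sl u) * uv i j hij u⁻¹ * kc i = lc j (sl u) * kc i := by
  have h12 : (Sum.inl (Sum.inl ()) : I₂ ⊕ Unit) ≠ Sum.inl (Sum.inr ()) := by simp
  have h13 : (Sum.inl (Sum.inl ()) : I₂ ⊕ Unit) ≠ Sum.inr () := by simp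
  have h23 : (Sum.inl (Sum.inr ()) : I₂ ⊕ Unit) ≠ Sum.inr () := by simp
  have h0 : (Sum.inl () : I₂) ≠ Sum.inr () := by simp
  suffices h : lc (Sum.inr ()) (sl u) * uv _ _ h0 u⁻¹ * kc (Sum.inl ()) =
      lc (Sum.inr ()) (sl u) * kc (Sum.inl ()) by
    have := congrArg (legC (pr i j hij)) h
    rwa [map_mul, map_mul, map_mul, legC_pr_uv, legC_pr_inl, legC_pr_inr] at this
  refine lc_cancel₂ h12 h13 h23 ?_
  have pent : uv _ _ h23.symm u⁻¹ * uv _ _ h12 u⁻¹ =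
      uv _ _ h13 u⁻¹ * uv _ _ h23.symm u⁻¹ * uv _ _ h13 u := by
    simp only [uv, ← Units.val_mul, ← map_mul]
    congr 2
    have := hu.pentagon h13 h12 h23.symm
    rw [map_inv, map_inv, map_inv, eq_comm, ← eq_mul_inv_iff_mul_eq, ← inv_inj]
    simp only [mul_inv_rev, inv_inv]
    rw [← this, mul_assoc]
  rw [map_mul, map_mul, map_mul, legC_pr_uv, legC_pr_inl, legC_pr_inr]
  have h' := kc_mul_star_sl h23.symm u
  rw [hu.star_sl] at h'
  exact word_mul_right (lc_comm h23.symm _ _) (lc_uv_comm h13.symm h23.symm h12 _ _)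
    (lc_uv_comm h13 h12 h23.symm _ _) (lc_comm h13 _ _) (lc_comm h12 _ _) h' pent
    (uv_mul_kc h13 _) (hu.regular h13)

theorem kc_mul_uv_mul_lc (hu : IsMultUnitary u) :
    kc i * uv i j hij u * lc j (sl u) = kc i * lc j (sl u) := by
  have := congrArg star (hu.lc_mul_uv_inv hij)
  simpa only [star_mul, star_lc, star_uv, inv_inv, star_cpt, hu.star_sl, mul_assoc] using this

theorem inv_mul_lc_dual (hu : IsMultUnitary u) :
    uv i j hij u⁻¹ * (kc j * lc i (sl (dualU u))) = kc j * lc i (sl (dualU u)) := by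
  have := hu.dual.uv_mul_lc hij.symm
  rwa [uv_dualU] at this

theorem mul_lc_dual (hu : IsMultUnitary u) :
    uv i j hij u * (kc j * lc i (sl (dualU u))) = kc j * lc i (sl (dualU u)) := by
  have := hu.dual.uv_inv_mul_lc hij.symm
  rwa [uv_dualU_inv] at this

/-- The pentagon solved for u₁₂, with leg 3 auxiliary, reads u₁₂ = u₁₃*u₃₂u₁₃u₃₂*. Each factor meets
only one of the two algebras and is absorbed by it together with the compact operators in leg 3. -/
theorem uv_mul_tensor (hu : IsMultUnitary u) :
    uv i j hij u * (lc i (sl (dualU u)) * lc j (sl u)) = lc i (sl (dualU u)) * lc j (sl u) := by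
  have h12 : (Sum.inl (Sum.inl ()) : I₂ ⊕ Unit) ≠ Sum.inl (Sum.inr ()) := by simp
  have h13 : (Sum.inl (Sum.inl ()) : I₂ ⊕ Unit) ≠ Sum.inr () := by simp
  have h23 : (Sum.inl (Sum.inr ()) : I₂ ⊕ Unit) ≠ Sum.inr () := by simp
  have h0 : (Sum.inl () : I₂) ≠ Sum.inr () := by simp
  suffices h : uv _ _ h0 u * (lc (Sum.inl ()) (sl (dualU u)) * lc (Sum.inr ()) (sl u)) =
      lc (Sum.inl ()) (sl (dualU u)) * lc (Sum.inr ()) (sl u) by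
    have := congrArg (legC (pr i j hij)) h
    rwa [map_mul, map_mul, legC_pr_uv, legC_pr_inl, legC_pr_inr] at this
  refine lc_cancel₂ h12 h13 h23 ?_
  have pent : uv _ _ h12 u = uv _ _ h13 u⁻¹ * uv _ _ h23.symm u * uv _ _ h13 u *
      uv _ _ h23.symm u⁻¹ := by
    simp only [uv, ← Units.val_mul, ← map_mul]
    congr 2
    have := hu.pentagon h13 h12 h23.symm
    rw [map_inv, map_inv, eq_mul_inv_iff_mul_eq, mul_assoc, ← this]
    group
  rw [map_mul, map_mul, legC_pr_uv, legC_pr_inl, legC_pr_inr]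
  exact word_mul_tensor (lc_comm h13.symm _ _) (lc_comm h23.symm _ _)
    (lc_uv_comm h13 h12 h23.symm _ _).symm (lc_uv_comm h13 h12 h23.symm _ _).symm pent
    (hu.uv_mul_lc _) (hu.uv_inv_mul_lc _) (hu.mul_lc_dual _) (hu.inv_mul_lc_dual _)

theorem uv_inv_mul_tensor (hu : IsMultUnitary u) :
    uv i j hij u⁻¹ * (lc i (sl (dualU u)) * lc j (sl u)) = lc i (sl (dualU u)) * lc j (sl u) := by
  conv_lhs => rw [← hu.uv_mul_tensor hij]
  rw [← mul_assoc, uv_inv_mul, one_mul]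

/-- The algebra in leg `i` is obtained by slicing u₃₁, with leg 3 auxiliary. Conjugation by u₁₂
turns u₃₁ into u₃₁u₃₂, and K ⊗ S absorbs u₃₂. -/
theorem comul_sl (hu : IsMultUnitary u) :
    uv i j hij u * lc i (sl u) * uv i j hij u⁻¹ * lc j (sl u) = lc i (sl u) * lc j (sl u) := by
  have h12 : (Sum.inl (Sum.inl ()) : I₂ ⊕ Unit) ≠ Sum.inl (Sum.inr ()) := by simp
  have h13 : (Sum.inl (Sum.inl ()) : I₂ ⊕ Unit) ≠ Sum.inr () := by simp
  have h23 : (Sum.inl (Sum.inr ()) : I₂ ⊕ Unit) ≠ Sum.inr () := by simp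
  have h0 : (Sum.inl () : I₂) ≠ Sum.inr () := by simp
  suffices h : uv _ _ h0 u * lc (Sum.inl ()) (sl u) * uv _ _ h0 u⁻¹ * lc (Sum.inr ()) (sl u) =
      lc (Sum.inl ()) (sl u) * lc (Sum.inr ()) (sl u) by
    have := congrArg (legC (pr i j hij)) h
    rwa [map_mul, map_mul, map_mul, map_mul, legC_pr_uv, legC_pr_inl, legC_pr_inr,
      legC_pr_uv] at this
  have pent : uv _ _ h12 u * uv _ _ h13.symm u * uv _ _ h12 u⁻¹ =
      uv _ _ h13.symm u * uv _ _ h23.symm u := by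
    simp only [uv, ← Units.val_mul, ← map_mul]
    congr 2
    rw [map_inv, ← hu.pentagon h13.symm h23.symm h12]
    group
  have key := word_comul (lc_uv_comm h13.symm h23.symm h12 _ _)
    (lc_uv_comm h13.symm h23.symm h12 _ _) (kc_mul_sl h13.symm u) pent (hu.uv_mul_lc h23.symm)
  refine lc_cancel₂ h12 h13 h23 ?_
  have hc : ∀ M : CS (Op n I₂), legC (pr _ _ h12) M * kc (Sum.inr ()) =
      kc (Sum.inr ()) * legC (pr _ _ h12) M := fun M =>
    legC_commute _ _ (by rintro (_ | _) _; exacts [h13, h23]) M _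
  rw [hc, hc]
  simp only [MonoidHom.map_mul]
  rw [legC_pr_uv, legC_pr_inl, legC_pr_inr, legC_pr_uv]
  exact key

end IsMultUnitary
end MultUnitary

/-! ### Concrete `C*`-algebras and morphisms between them -/

section Morphisms

variable {ι κ ι' κ' μ ν : Type} [Fintype ι] [Fintype κ] [Fintype ι'] [Fintype κ'] [Fintype μ]
  [Fintype ν]

/-- A nondegenerate concrete `C*`-algebra. -/
structure IsCStar (M : CS (Op n ι)) : Prop where
  star_eq : star M = M
  mul_self : M * M = M
  mul_cpt : M * cpt n ι = cpt n ι

theorem IsCStar.isCStarAlg {M : CS (Op n ι)} (h : IsCStar M) : IsCStarAlg (M : Set (Op n ι)) := by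
  refine ⟨⟨{ carrier := M
             add_mem' := fun ha hb => add_mem ha hb
             zero_mem' := zero_mem M
             mul_mem' := fun {a b} ha hb => ?_
             smul_mem' := fun c a ha => M.toSubmodule.smul_mem c ha
             star_mem' := fun {a} ha => ?_ }, rfl⟩, M.isClosed, ?_⟩
  · have := mul_mem_mul ha hb
    rwa [h.mul_self] at this
  · change star a ∈ M
    rw [← mem_star, h.star_eq]; exact ha
  · intro v
    obtain ⟨z, hz⟩ := exists_ne_zero n ι
    have h0 : inner ℂ z z ≠ 0 := by simpa using hz
    set P := (Submodule.span ℂ {v : HH n ι | ∃ a ∈ (M : Set (Op n ι)), ∃ ξ, v = a ξ}).closure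
    have hle : M * cpt n ι ≤ P.comap (ContinuousLinearMap.apply ℂ (HH n ι) z) :=
      mul_le.2 fun a ha b _ => _root_.subset_closure (Submodule.subset_span ⟨a, ha, b z, rfl⟩)
    rw [h.mul_cpt] at hle
    have h1 : (InnerProductSpace.rankOne ℂ v z : Op n ι) z ∈ P := hle (rankOne_mem_cpt v z)
    rw [InnerProductSpace.rankOne_apply] at h1
    have := P.toSubmodule.smul_mem (inner ℂ z z)⁻¹ h1
    rw [smul_smul, inv_mul_cancel₀ h0, one_smul] at this
    exact this

theorem eq_zero_of_mul_cpt {T : Op n ι} (h : ∀ k ∈ cpt n ι, T * k = 0) : T = 0 := by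
  ext1 v
  obtain ⟨z, hz⟩ := exists_ne_zero n ι
  have h0 : inner ℂ z z ≠ 0 := by simpa using hz
  have := congrArg (fun F : Op n ι => F z) (h _ (rankOne_mem_cpt v z))
  simp only [mul_rankOne, InnerProductSpace.rankOne_apply, zero_apply, smul_eq_zero, h0,
    false_or] at this
  exact this

theorem eq_of_mul_eq {N : CS (Op n ι)} (hN : N * cpt n ι = cpt n ι) {S T : Op n ι}
    (h : ∀ m ∈ N, S * m = T * m) : S = T := by
  rw [← sub_eq_zero]
  refine eq_zero_of_mul_cpt fun k hk => ?_
  rw [← hN] at hk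
  have : N * cpt n ι ≤ (⊥ : CS (Op n ι)).comap (ContinuousLinearMap.mul ℂ (Op n ι) (S - T)) :=
    mul_le.2 fun a ha b _ => by
      change (S - T) * (a * b) ∈ (⊥ : CS (Op n ι))
      rw [ClosedSubmodule.mem_bot, ← mul_assoc, sub_mul, h a ha, sub_self, zero_mul]
  have h3 := this hk
  change (S - T) * k ∈ (⊥ : CS (Op n ι)) at h3
  rwa [ClosedSubmodule.mem_bot] at h3

/-- `M ⊗ N`. -/
def ten (M : CS (Op n ι)) (N : CS (Op n κ)) : CS (Op n (ι ⊕ κ)) :=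
  legC Function.Embedding.inl M * legC Function.Embedding.inr N

theorem coe_ten (M : CS (Op n ι)) (N : CS (Op n κ)) :
    (ten M N : Set (Op n (ι ⊕ κ))) = tens M N := by
  have : ten M N = cspan {T | ∃ a ∈ (M : Set (Op n ι)), ∃ b ∈ (N : Set (Op n κ)),
      T = tmulOp a b} := by
    rw [ten, ← cspan_coe M, ← cspan_coe N, push_cspan, push_cspan, cspan_mul_cspan, cspan_coe,
      cspan_coe]
    congr 1
    ext T
    constructor
    · rintro ⟨_, ⟨a, ha, rfl⟩, _, ⟨b, hb, rfl⟩, rfl⟩; exact ⟨a, ha, b, hb, rfl⟩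
    · rintro ⟨a, ha, b, hb, rfl⟩; exact ⟨_, ⟨a, ha, rfl⟩, _, ⟨b, hb, rfl⟩, rfl⟩
  rw [this, coe_cspan]; rfl

theorem inl_inr_comm (M : CS (Op n ι)) (N : CS (Op n κ)) :
    legC Function.Embedding.inl M * legC Function.Embedding.inr N =
      legC Function.Embedding.inr N * legC (Function.Embedding.inl : ι ↪ ι ⊕ κ) M :=
  legC_commute _ _ (fun _ _ => Sum.inl_ne_inr) M N

theorem ten_mul_ten (M M' : CS (Op n ι)) (N N' : CS (Op n κ)) :
    ten M N * ten M' N' = ten (M * M') (N * N') := by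
  rw [ten, ten, ten, map_mul, map_mul, mul_assoc, mul_swap (inl_inr_comm M' N).symm]
  simp only [mul_assoc]

theorem star_ten (M : CS (Op n ι)) (N : CS (Op n κ)) : star (ten M N) = ten (star M) (star N) := by
  rw [ten, star_mul, star_push, star_push, ← inl_inr_comm]; rfl

theorem ten_cpt : ten (cpt n ι) (cpt n κ) = cpt n (ι ⊕ κ) := cpt_sum (Equiv.refl _)

theorem IsCStar.ten {M : CS (Op n ι)} {N : CS (Op n κ)} (hM : IsCStar M) (hN : IsCStar N) :
    IsCStar (ten M N) where
  star_eq := by rw [star_ten, hM.star_eq, hN.star_eq]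
  mul_self := by rw [ten_mul_ten, hM.mul_self, hN.mul_self]
  mul_cpt := by rw [← ten_cpt, ten_mul_ten, hM.mul_cpt, hN.mul_cpt]

/-- Multipliers are concrete operators, so a *-homomorphism of the full operator algebras already
contains its extension. Nondegeneracy writes an element of `N` through products f(a)c, and then
f(T)f(a)c = f(Ta)c. -/
theorem isMorphism_of_push {M : CS (Op n ι)} {N : CS (Op n κ)} (hM : star M = M) (hN : star N = N)
    (f : Op n ι →⋆ₐ[ℂ] Op n κ) (h : push f M * N = N) :
    IsMorphism (M : Set (Op n ι)) (N : Set (Op n κ)) f where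
  mapsTo T hT b hb := by
    have hleft : ∀ T ∈ Mult (M : Set (Op n ι)), ∀ b ∈ N, f T * b ∈ N := fun T hT b hb => by
      have : push f M * N ≤ N.comap (ContinuousLinearMap.mul ℂ (Op n κ) (f T)) := by
        rw [← cspan_coe M, push_cspan, ← cspan_coe N, cspan_mul_cspan, cspan_coe]
        refine cspan_le.2 ?_
        rintro _ ⟨_, ⟨a, ha, rfl⟩, c, hc, rfl⟩
        change f T * (f a * c) ∈ N
        rw [← mul_assoc, ← map_mul, ← h]
        exact mul_mem_mul (mem_push (hT a ha).1) hc
      rw [h] at this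
      exact this hb
    refine ⟨hleft T hT b hb, ?_⟩
    -- Right multiplication is reduced to left multiplication by taking adjoints.
    have h2 : star T ∈ Mult (M : Set (Op n ι)) := fun a ha => by
      have ha' : star a ∈ (M : Set (Op n ι)) := by
        change star a ∈ M
        rw [← mem_star, hM]; exact ha
      refine ⟨?_, ?_⟩
      · have := (hT _ ha').2
        change _ ∈ M at this ⊢
        rwa [← hM, mem_star, star_mul, star_star]
      · have := (hT _ ha').1
        change _ ∈ M at this ⊢
        rwa [← hM, mem_star, star_mul, star_star]
    have h3 := hleft _ h2 (star b) (by rw [← mem_star, hN]; exact hb)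
    change _ ∈ N
    rwa [← hN, mem_star, star_mul, ← map_star]
  map_add S _ T _ := map_add f S T
  map_smul c T _ := map_smul f c T
  map_mul S _ T _ := map_mul f S T
  map_star T _ := map_star f T
  nondegenerate := by
    have hset : {T | ∃ a ∈ (M : Set (Op n ι)), ∃ b ∈ (N : Set (Op n κ)), T = f a * b} =
        {T | ∃ a ∈ f '' (M : Set (Op n ι)), ∃ b ∈ (N : Set (Op n κ)), T = a * b} := by
      ext T
      constructor
      · rintro ⟨a, ha, b, hb, rfl⟩; exact ⟨_, ⟨a, ha, rfl⟩, b, hb, rfl⟩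
      · rintro ⟨_, ⟨a, ha, rfl⟩, b, hb, rfl⟩; exact ⟨a, ha, b, hb, rfl⟩
    rw [hset, ← coe_cspan, ← cspan_mul_cspan, ← push_cspan, cspan_coe, cspan_coe, h]

/-- The map `T ↦ W (T ⊗ 1) W^*`, with `T` in the legs given by `e`. -/
def ad (e : ι ↪ κ) (W : unitary (Op n κ)) : Op n ι →⋆ₐ[ℂ] Op n κ where
  toFun T := W * legHom e T * star (W : Op n κ)
  map_one' := by simp
  map_mul' S T := by
    rw [map_mul]
    simp only [mul_assoc]
    rw [← mul_assoc (star (W : Op n κ)) (W : Op n κ), Unitary.star_mul_self_of_mem W.2, one_mul]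
  map_zero' := by simp
  map_add' S T := by rw [map_add, mul_add, add_mul]
  commutes' c := by
    rw [AlgHomClass.commutes, ← Algebra.commutes, mul_assoc, Unitary.mul_star_self_of_mem W.2, mul_one]
  map_star' T := by simp only [map_star, star_mul, star_star, mul_assoc]

theorem ad_apply (e : ι ↪ κ) (W : unitary (Op n κ)) (T : Op n ι) :
    ad e W T = W * legHom e T * star (W : Op n κ) := rfl

theorem ad_one (e : ι ↪ κ) (T : Op n ι) : ad e 1 T = legHom e T := by
  rw [ad_apply]; simp

theorem ad_refl_one (T : Op n ι) : ad (Function.Embedding.refl ι) 1 T = T := by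
  rw [ad_one, legHom_refl]

theorem coe_legU (e : ι ↪ κ) (W : unitary (Op n ι)) : (legU e W : Op n κ) = legHom e W := rfl

theorem legU_legU (f : κ ↪ μ) (e : ι ↪ κ) (W : unitary (Op n ι)) :
    legU f (legU e W) = legU (e.trans f) W := Subtype.ext (legHom_legHom f e _)

theorem legU_refl (W : unitary (Op n ι)) : legU (Function.Embedding.refl ι) W = W :=
  Subtype.ext (legHom_refl _)

theorem ad_ad (f : κ ↪ μ) (V : unitary (Op n μ)) (e : ι ↪ κ) (W : unitary (Op n κ)) (T : Op n ι) :
    ad f V (ad e W T) = ad (e.trans f) (V * legU f W) T := by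
  rw [ad_apply f V, ad_apply e W, ad_apply (e.trans f), map_mul, map_mul, legHom_legHom, map_star,
    Submonoid.coe_mul, star_mul, coe_legU]
  simp only [mul_assoc]

theorem legHom_ad (f : κ ↪ μ) (e : ι ↪ κ) (W : unitary (Op n κ)) (T : Op n ι) :
    legHom f (ad e W T) = ad (e.trans f) (legU f W) T := by
  rw [← ad_one, ad_ad, one_mul]

theorem reindex_ad (f : κ ≃ μ) (e : ι ↪ κ) (W : unitary (Op n κ)) (T : Op n ι) :
    reindex f (ad e W T) = ad (e.trans f.toEmbedding) (legU f.toEmbedding W) T :=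
  legHom_ad f.toEmbedding e W T

/-- The implementing unitary matters only up to a right factor commuting with the image. This
freedom lets different unitaries implement the same comultiplication. -/
theorem ad_mul_of_commute (e : ι ↪ κ) (W C : unitary (Op n κ)) {T : Op n ι}
    (h : Commute (C : Op n κ) (legHom e T)) : ad e (W * C) T = ad e W T := by
  rw [ad_apply, ad_apply, Submonoid.coe_mul, star_mul, mul_assoc (W : Op n κ), h.eq]
  simp only [mul_assoc]
  rw [← mul_assoc (C : Op n κ), Unitary.mul_star_self_of_mem C.2, one_mul]

theorem push_ad (e : ι ↪ κ) (W : unitary (Op n κ)) (M : CS (Op n ι)) :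
    push (ad e W) M = ↑(uline W) * legC e M * ↑(uline W⁻¹) := by
  rw [coe_uline, coe_uline, ← cspan_coe M, push_cspan, push_cspan, line_apply, line_apply,
    cspan_mul_cspan, cspan_mul_cspan]
  congr 1
  ext T
  constructor
  · rintro ⟨a, ha, rfl⟩
    exact ⟨_, ⟨_, rfl, _, ⟨a, ha, rfl⟩, rfl⟩, _, rfl, rfl⟩
  · rintro ⟨_, ⟨_, rfl, _, ⟨a, ha, rfl⟩, rfl⟩, _, rfl, rfl⟩
    exact ⟨a, ha, rfl⟩

/-- The tensor product of two unitaries. -/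
def tenU (W : unitary (Op n ι)) (V : unitary (Op n κ)) : unitary (Op n (ι ⊕ κ)) :=
  legU Function.Embedding.inl W * legU Function.Embedding.inr V

theorem ad_sumMap_inl (e : ι ↪ ι') (e' : κ ↪ κ') (W : unitary (Op n ι')) (V : unitary (Op n κ'))
    (T : Op n ι) : ad (e.sumMap e') (tenU W V) (legHom Function.Embedding.inl T) =
      legHom Function.Embedding.inl (ad e W T) := by
  rw [legHom_ad, ← ad_one, ad_ad, map_one, mul_one, tenU]
  refine ad_mul_of_commute (Function.Embedding.inl.trans (e.sumMap e')) _ _ ?_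
  exact legHom_commute _ _ (fun _ _ => Sum.inr_ne_inl) _ _

theorem ad_sumMap_inr (e : ι ↪ ι') (e' : κ ↪ κ') (W : unitary (Op n ι')) (V : unitary (Op n κ'))
    (T : Op n κ) : ad (e.sumMap e') (tenU W V) (legHom Function.Embedding.inr T) =
      legHom Function.Embedding.inr (ad e' V T) := by
  have hc : tenU W V = legU Function.Embedding.inr V * legU Function.Embedding.inl W :=
    Subtype.ext (legHom_commute _ _ (fun _ _ => Sum.inl_ne_inr) _ _)
  rw [legHom_ad, ← ad_one, ad_ad, map_one, mul_one, hc]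
  refine ad_mul_of_commute (Function.Embedding.inr.trans (e.sumMap e')) _ _ ?_
  exact legHom_commute _ _ (fun _ _ => Sum.inl_ne_inr) _ _

theorem push_ad_ten (e : ι ↪ ι') (e' : κ ↪ κ') (W : unitary (Op n ι')) (V : unitary (Op n κ'))
    (M : CS (Op n ι)) (N : CS (Op n κ)) : push (ad (e.sumMap e') (tenU W V)) (ten M N) =
      ten (push (ad e W) M) (push (ad e' V) N) := by
  rw [ten, map_mul, push_push, push_push, ten, push_push, push_push]
  congr 1
  · exact push_congr fun a _ => ad_sumMap_inl e e' W V a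
  · exact push_congr fun a _ => ad_sumMap_inr e e' W V a

/-- The tensor product of two implemented maps is implemented by the tensor product of the
unitaries, so the tensor maps demanded by the definitions never have to be built by extension. The
given maps need to be implemented only on the algebras themselves. -/
theorem isTensorMap_ad {M : CS (Op n ι)} {M' : CS (Op n ι')} {N : CS (Op n κ)}
    {N' : CS (Op n κ')} (hM : star M = M) (hM' : star M' = M') (hN : star N = N)
    (hN' : star N' = N') {φ : Op n ι → Op n ι'} {ψ : Op n κ → Op n κ'} (e : ι ↪ ι') (e' : κ ↪ κ')
    (W : unitary (Op n ι')) (V : unitary (Op n κ')) (hφ : ∀ a ∈ M, φ a = ad e W a)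
    (hψ : ∀ b ∈ N, ψ b = ad e' V b) (h : push (ad e W) M * M' = M')
    (h' : push (ad e' V) N * N' = N') :
    IsTensorMap (M : Set (Op n ι)) (M' : Set (Op n ι')) (N : Set (Op n κ)) (N' : Set (Op n κ')) φ ψ
      (ad (e.sumMap e') (tenU W V)) := by
  refine ⟨?_, fun a ha b hb => ?_⟩
  · rw [← coe_ten, ← coe_ten]
    refine isMorphism_of_push ?_ ?_ _ ?_
    · rw [star_ten, hM, hN]
    · rw [star_ten, hM', hN']
    · rw [push_ad_ten, ten_mul_ten, h, h']
  · rw [hφ a ha, hψ b hb]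
    have key : ad (e.sumMap e') (tenU W V) (legHom Function.Embedding.inl a *
        legHom Function.Embedding.inr b) = legHom Function.Embedding.inl (ad e W a) *
          legHom Function.Embedding.inr (ad e' V b) := by
      rw [map_mul, ad_sumMap_inl, ad_sumMap_inr]
    exact key

theorem push_refl_mul {M : CS (Op n ι)} (h : M * M = M) :
    push (ad (Function.Embedding.refl ι) (1 : unitary (Op n ι))) M * M = M := by
  have : push (ad (Function.Embedding.refl ι) (1 : unitary (Op n ι))) M = M := by
    rw [push_ad, legC_refl]; simp
  rw [this, h]

theorem isIso_ad {M : CS (Op n ι)} {N : CS (Op n κ)} (hM : star M = M) (hN : star N = N)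
    (hNN : N * N = N) (e : ι ≃ κ) (W : unitary (Op n κ)) (h : push (ad e.toEmbedding W) M = N)
    {φ : Op n ι → Op n κ} (f : Op n ι →⋆ₐ[ℂ] Op n κ) (hf : ∀ T, φ T = f T)
    (hφ : ∀ a ∈ M, φ a = ad e.toEmbedding W a) :
    IsIso (M : Set (Op n ι)) (N : Set (Op n κ)) φ := by
  obtain rfl : φ = f := funext hf
  have hp : push f M = N := by
    rw [push_congr hφ, h]
  refine ⟨isMorphism_of_push hM hN f (by rw [hp, hNN]), ?_⟩
  have hinv : ∀ T, ad e.symm.toEmbedding (legU e.symm.toEmbedding W⁻¹) (ad e.toEmbedding W T) =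
      T := fun T => by
    rw [ad_ad, ← MonoidHom.map_mul, inv_mul_cancel, MonoidHom.map_one]
    have : e.toEmbedding.trans e.symm.toEmbedding = Function.Embedding.refl ι := by ext; simp
    rw [this, ad_refl_one]
  have hinv' : ∀ T, ad e.toEmbedding W (ad e.symm.toEmbedding (legU e.symm.toEmbedding W⁻¹) T) =
      T := fun T => by
    rw [ad_ad, legU_legU]
    have : e.symm.toEmbedding.trans e.toEmbedding = Function.Embedding.refl κ := by ext; simp
    rw [this, legU_refl, mul_inv_cancel, ad_refl_one]
  refine ⟨fun a ha => ?_, fun a ha b hb hab => ?_, fun b hb => ?_⟩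
  · change f a ∈ N
    rw [← hp]; exact mem_push ha
  · rw [hφ a ha, hφ b hb] at hab
    rw [← hinv a, hab, hinv]
  · have : ad e.symm.toEmbedding (legU e.symm.toEmbedding W⁻¹) b ∈ M := by
      have hb' : b ∈ push (ad e.toEmbedding W) M := by rw [h]; exact hb
      refine cspan_induction (starHomL (ad e.symm.toEmbedding (legU e.symm.toEmbedding W⁻¹))) ?_ hb'
      rintro _ ⟨a, ha, rfl⟩
      change ad e.symm.toEmbedding _ _ ∈ M
      rw [hinv]; exact ha
    exact ⟨_, this, by rw [hφ _ this, hinv']⟩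

/-- Two `*`-homomorphisms which agree on a unitary and on the compact operators in its first leg
agree on its slices. -/
theorem eq_on_slices {u : unitary (Op n I₂)} (F G : Op n I₂ →⋆ₐ[ℂ] Op n ν)
    (hk : ∀ k ∈ cpt n Unit, F (legHom (sg (Sum.inl ())) k) = G (legHom (sg (Sum.inl ())) k))
    (hu : F u = G u) (hF : push F (kc (Sum.inl ())) * cpt n ν = cpt n ν) {a : Op n Unit}
    (ha : a ∈ sl u) : F (legHom (sg (Sum.inr ())) a) = G (legHom (sg (Sum.inr ())) a) := by
  have h0 : (Sum.inl () : I₂) ≠ Sum.inr () := by simp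
  -- `E` is the equalizer of the two homomorphisms. It is closed under products, and contains K ⊗ 1
  -- and `u`, hence also K ⊗ S, where S is the slice algebra.
  let E : CS (Op n I₂) := (⊥ : CS (Op n ν)).comap (starHomL F - starHomL G)
  have hE : ∀ T, T ∈ E ↔ F T = G T := fun T => by
    change F T - G T ∈ (⊥ : CS (Op n ν)) ↔ _
    rw [ClosedSubmodule.mem_bot, sub_eq_zero]
  have hmul : ∀ M N : CS (Op n I₂), M ≤ E → N ≤ E → M * N ≤ E := fun M N hM hN =>
    mul_le.2 fun a ha b hb => by
      rw [hE, map_mul, map_mul, (hE a).1 (hM ha), (hE b).1 (hN hb)]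
  have h1 : (kc (Sum.inl ()) : CS (Op n I₂)) ≤ E := push_le.2 fun k hk' => (hE _).2 (hk k hk')
  have h2 : kc (Sum.inl ()) * lc (Sum.inr ()) (sl u) ≤ E := by
    rw [← kc_mul_sl h0, uv_inl_inr, coe_uline]
    exact hmul _ _ (hmul _ _ h1 (line_le.2 ((hE _).2 hu))) h1
  rw [lc_comm h0] at h2
  -- The compact factor is removed by means of the nondegeneracy of F on K ⊗ 1.
  refine eq_of_mul_eq hF fun m hm => ?_
  have hle : push F (kc (Sum.inl ())) ≤ (⊥ : CS (Op n ν)).comap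
      (ContinuousLinearMap.mul ℂ (Op n ν) (F (legHom (sg (Sum.inr ())) a) -
        G (legHom (sg (Sum.inr ())) a))) := push_le.2 fun k hk => by
    change _ * _ ∈ (⊥ : CS (Op n ν))
    rw [ClosedSubmodule.mem_bot, sub_mul, sub_eq_zero, ← map_mul, (hE k).1 (h1 hk), ← map_mul]
    exact (hE _).1 (h2 (mul_mem_mul (mem_push ha) hk))
  have := hle hm
  change _ * m ∈ (⊥ : CS (Op n ν)) at this
  rwa [ClosedSubmodule.mem_bot, sub_mul, sub_eq_zero] at this

theorem kc_mul_cpt (i : κ) : kc i * cpt n κ = cpt n κ := by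
  obtain ⟨ρ, _, s, hs⟩ := exists_split (sg i)
  have h1 : embL s = sg i := by ext; exact hs ()
  rw [← cpt_sum s, h1, ← mul_assoc, kc_mul_kc]

theorem push_ad_mul_cpt (e : ι ↪ κ) (W : unitary (Op n κ)) {M : CS (Op n ι)}
    (h : legC e M * cpt n κ = cpt n κ) : push (ad e W) M * cpt n κ = cpt n κ := by
  rw [push_ad, mul_assoc, mul_assoc, uline_mul_cpt, h, uline_mul_cpt]

end Morphisms

/-! ### Bialgebras, inversions and twisted comultiplications from multiplicative unitaries -/

section Bialgebras

open Function.Embedding (inl inr)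

variable {ι κ μ ν : Type} [Fintype ι] [Fintype κ] [Fintype μ] [Fintype ν]

/-- `φ` is a `*`-homomorphism which on `M` is given by `ad e W`. -/
structure Implements (M : CS (Op n ι)) (φ : Op n ι → Op n κ) (e : ι ↪ κ)
    (W : unitary (Op n κ)) : Prop where
  isHom : ∃ f : Op n ι →⋆ₐ[ℂ] Op n κ, ∀ T, φ T = f T
  eq_ad : ∀ a ∈ M, φ a = ad e W a

theorem implements_ad (M : CS (Op n ι)) (e : ι ↪ κ) (W : unitary (Op n κ)) :
    Implements M (ad e W) e W := ⟨⟨_, fun _ => rfl⟩, fun _ _ => rfl⟩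

theorem Implements.isMorphism {M : CS (Op n ι)} {N : CS (Op n κ)} {φ : Op n ι → Op n κ} {e : ι ↪ κ}
    {W : unitary (Op n κ)} (h : Implements M φ e W) (hM : star M = M) (hN : star N = N)
    (hp : push (ad e W) M * N = N) : IsMorphism (M : Set (Op n ι)) (N : Set (Op n κ)) φ := by
  obtain ⟨⟨f, hf⟩, hφ⟩ := h
  obtain rfl : φ = f := funext hf
  refine isMorphism_of_push hM hN f ?_
  rw [push_congr hφ, hp]

theorem tenU_one_right (W : unitary (Op n ι)) : tenU W (1 : unitary (Op n κ)) = legU inl W := by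
  rw [tenU, map_one, mul_one]

theorem tenU_one_left (W : unitary (Op n ι)) : tenU (1 : unitary (Op n κ)) W = legU inr W := by
  rw [tenU, map_one, one_mul]

theorem ad_congr {e f : ι ↪ κ} {V W : unitary (Op n κ)} (h : e = f) (h' : V = W) (T : Op n ι) :
    ad e V T = ad f W T := by rw [h, h']

theorem legU_congr {e f : ι ↪ κ} (h : ∀ i, e i = f i) (W : unitary (Op n ι)) :
    legU e W = legU f W := by
  obtain rfl : e = f := Function.Embedding.ext h
  rfl

/-- A `C*`-algebra with a comultiplication implemented by a unitary `W`. -/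
theorem isCStarBialgebra_of {M : CS (Op n ι)} (hM : IsCStar M) {δ : Op n ι → Op n (ι ⊕ ι)}
    {W : unitary (Op n (ι ⊕ ι))} (hδ : Implements M δ inl W)
    (hnd : push (ad inl W) M * ten M M = ten M M)
    (hco : ∀ a ∈ M, ad (inl : ι ↪ ι ⊕ (ι ⊕ ι))
        (legU ((Function.Embedding.refl ι).sumMap inl) W *
          legU ((Function.Embedding.refl ι).sumMap inr) W) a =
      ad inl (legU inr W * legU ((Function.Embedding.refl ι).sumMap inl) W) a) :
    IsCStarBialgebra ⟨(M : Set (Op n ι)), δ⟩ := by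
  have hMM := hM.ten hM
  refine ⟨hM.isCStarAlg, ?_, ad (inl.sumMap (Function.Embedding.refl ι)) (tenU W 1),
    ad ((Function.Embedding.refl ι).sumMap inl) (tenU 1 W), ?_, ?_, fun a ha => ?_⟩
  · change IsMorphism (M : Set (Op n ι)) (tens (M : Set (Op n ι)) (M : Set (Op n ι))) δ
    rw [← coe_ten]
    exact hδ.isMorphism hM.star_eq hMM.star_eq hnd
  · change IsTensorMap (M : Set (Op n ι)) (tens (M : Set (Op n ι)) (M : Set (Op n ι))) _ _ _ _ _
    rw [← coe_ten]
    exact isTensorMap_ad hM.star_eq hMM.star_eq hM.star_eq hM.star_eq _ _ _ _ hδ.eq_ad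
      (fun b _ => (ad_refl_one b).symm) hnd (push_refl_mul hM.mul_self)
  · change IsTensorMap _ _ _ (tens (M : Set (Op n ι)) (M : Set (Op n ι))) _ _ _
    rw [← coe_ten]
    exact isTensorMap_ad hM.star_eq hM.star_eq hM.star_eq hMM.star_eq _ _ _ _
      (fun b _ => (ad_refl_one b).symm) hδ.eq_ad (push_refl_mul hM.mul_self) hnd
  · change reindex _ (ad _ _ (δ a)) = ad _ _ (δ a)
    rw [hδ.eq_ad a ha, ad_ad, ad_ad, reindex_ad, tenU_one_left, tenU_one_right, MonoidHom.map_mul,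
      legU_legU, legU_legU]
    refine Eq.trans (ad_congr ?_ ?_ a) ((hco a ha).trans (ad_congr ?_ rfl a))
    · ext; rfl
    · refine congrArg₂ (· * ·) (legU_congr ?_ W) (legU_congr ?_ W) <;> rintro (_ | _) <;> rfl
    · ext; rfl

/-- In leg notation the hypothesis is W₁₂W₁₃ = W₂₃W₁₂C₂₃. Coassociativity compares conjugates of
elements living in the first copy, so a factor C in the last two copies is lost. For a
multiplicative unitary C is its inverse, and the hypothesis is the pentagon. -/
theorem coassoc_of_mul {M : CS (Op n ι)} {W : unitary (Op n (ι ⊕ ι))}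
    (C : unitary (Op n (ι ⊕ ι)))
    (h : legU ((Function.Embedding.refl ι).sumMap inl) W *
        legU ((Function.Embedding.refl ι).sumMap inr) W =
      legU inr W * legU ((Function.Embedding.refl ι).sumMap inl) W * legU inr C) :
    ∀ a ∈ M, ad (inl : ι ↪ ι ⊕ (ι ⊕ ι))
        (legU ((Function.Embedding.refl ι).sumMap inl) W *
          legU ((Function.Embedding.refl ι).sumMap inr) W) a =
      ad inl (legU inr W * legU ((Function.Embedding.refl ι).sumMap inl) W) a := fun a _ => by
  rw [h]
  exact ad_mul_of_commute _ _ _ (legHom_commute _ _ (fun _ _ => Sum.inr_ne_inl) _ _)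

theorem legU_eq_lu (e : I₂ ↪ κ) (u : unitary (Op n I₂)) :
    legU e u = lu (e (Sum.inl ())) (e (Sum.inr ())) (e.injective.ne (by simp)) u :=
  legU_congr (f := pr _ _ (e.injective.ne (by simp))) (by rintro (_ | _) <;> rfl) u

theorem uline_mul (V W : unitary (Op n κ)) :
    (uline (V * W) : CS (Op n κ)) = uline V * uline W := by
  rw [map_mul, Units.val_mul]

theorem IsMultUnitary.isCStar {u : unitary (Op n I₂)} (hu : IsMultUnitary u) : IsCStar (sl u) :=
  ⟨hu.star_sl, hu.sl_mul_sl, sl_mul_cpt u⟩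

theorem ten_unit (M N : CS (Op n Unit)) : ten M N = lc (Sum.inl ()) M * lc (Sum.inr ()) N := rfl

theorem IsMultUnitary.push_comul {u : unitary (Op n I₂)} (hu : IsMultUnitary u) :
    push (ad (inl : Unit ↪ I₂) u) (sl u) * ten (sl u) (sl u) = ten (sl u) (sl u) := by
  have h0 : (Sum.inl () : I₂) ≠ Sum.inr () := by simp
  have := hu.comul_sl h0
  rw [uv_inl_inr, uv_inl_inr] at this
  have h1 : push (ad (inl : Unit ↪ I₂) u) (sl u) =
      (uline u : CS (Op n I₂)) * lc (Sum.inl ()) (sl u) * (uline u⁻¹ : CS (Op n I₂)) :=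
    push_ad inl u (sl u)
  rw [h1, ten_unit, lc_comm h0, ← mul_assoc, this, mul_assoc, lc_comm h0.symm, ← mul_assoc,
    ← map_mul, hu.sl_mul_sl]

theorem IsMultUnitary.isCStarBialgebra {u : unitary (Op n I₂)} (hu : IsMultUnitary u)
    {δ : Op n Unit → Op n I₂} (hδ : Implements (sl u) δ inl u) :
    IsCStarBialgebra ⟨(sl u : Set (Op n Unit)), δ⟩ := by
  refine isCStarBialgebra_of hu.isCStar hδ hu.push_comul (coassoc_of_mul u⁻¹ ?_)
  simp only [legU_eq_lu, map_inv]
  rw [eq_mul_inv_iff_mul_eq]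
  exact hu.pentagon (κ := Unit ⊕ I₂) (i := Sum.inl ()) (j := Sum.inr (Sum.inl ()))
    (k := Sum.inr (Sum.inr ())) (by simp) (by simp) (by simp)

/-- The flip of two legs. -/
def swp (ι κ : Type) : ι ⊕ κ ↪ κ ⊕ ι := (Equiv.sumComm ι κ).toEmbedding

/-- By `uv_inv_mul_tensor` and its adjoint, `u` leaves the tensor product of the two slice algebras
unchanged under multiplication from either side, so conjugating by it and flipping only exchanges
the factors. -/
theorem IsMultUnitary.push_inversion {u : unitary (Op n I₂)} (hu : IsMultUnitary u) :
    push (ad (swp Unit Unit) (dualU u)) (ten (sl (dualU u)) (sl u)) =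
      ten (sl u) (sl (dualU u)) := by
  have h0 : (Sum.inl () : I₂) ≠ Sum.inr () := by simp
  have h1 : legC (swp Unit Unit) (ten (sl (dualU u)) (sl u)) =
      lc (Sum.inl ()) (sl u) * lc (Sum.inr ()) (sl (dualU u)) := by
    rw [ten_unit, map_mul, legC_lc, legC_lc, lc_comm h0]; rfl
  rw [push_ad, h1, ← uv_inl_inr, ← uv_inl_inr, uv_dualU, uv_dualU_inv, lc_comm h0,
    hu.uv_inv_mul_tensor h0.symm, ten_unit, lc_comm h0]
  have := congrArg star (hu.uv_inv_mul_tensor h0.symm)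
  simp only [star_mul, star_lc, star_uv, inv_inv, hu.star_sl, hu.dual.star_sl] at this
  rw [lc_comm h0.symm, this]

/-- Once all maps are implemented by unitaries, a hexagon is an equality of two implementing
products. The left one is the pentagon for `dualU u`, the right one the pentagon for `u` in the legs
3, 1, 2. -/
theorem IsMultUnitary.isInversion {u : unitary (Op n I₂)} (hu : IsMultUnitary u)
    {δA δB : Op n Unit → Op n I₂} {τ : Op n I₂ → Op n I₂}
    (hA : Implements (sl (dualU u)) δA inl (dualU u)) (hB : Implements (sl u) δB inl u)
    (hτ : Implements (ten (sl (dualU u)) (sl u)) τ (swp Unit Unit) (dualU u)) :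
    IsInversion ⟨(sl (dualU u) : Set (Op n Unit)), δA⟩ ⟨(sl u : Set (Op n Unit)), δB⟩ τ := by
  have cA := hu.dual.isCStar
  have cB := hu.isCStar
  have cAB := cA.ten cB
  have cBA := cB.ten cA
  have cAA := cA.ten cA
  have cBB := cB.ten cB
  have hp := hu.push_inversion
  have hpp : push (ad (swp Unit Unit) (dualU u)) (ten (sl (dualU u)) (sl u)) *
      ten (sl u) (sl (dualU u)) = ten (sl u) (sl (dualU u)) := by rw [hp, cBA.mul_self]
  have hid : ∀ {ι : Type} [Fintype ι] (M : CS (Op n ι)), ∀ b ∈ M,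
      id b = ad (Function.Embedding.refl ι) 1 b := fun M b _ => (ad_refl_one b).symm
  refine ⟨hu.dual.isCStarBialgebra hA, hu.isCStarBialgebra hB, ?_,
    ⟨ad (inl.sumMap (Function.Embedding.refl Unit)) (tenU (dualU u) 1),
      ad ((Function.Embedding.refl Unit).sumMap (swp Unit Unit)) (tenU 1 (dualU u)),
      ad ((swp Unit Unit).sumMap (Function.Embedding.refl Unit)) (tenU (dualU u) 1),
      ad ((Function.Embedding.refl Unit).sumMap inl) (tenU 1 (dualU u)), ?_, ?_, ?_, ?_,
      fun p hp => ?_⟩,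
    ⟨ad ((Function.Embedding.refl Unit).sumMap inl) (tenU 1 u),
      ad ((swp Unit Unit).sumMap (Function.Embedding.refl Unit)) (tenU (dualU u) 1),
      ad ((Function.Embedding.refl Unit).sumMap (swp Unit Unit)) (tenU 1 (dualU u)),
      ad (inl.sumMap (Function.Embedding.refl Unit)) (tenU u 1), ?_, ?_, ?_, ?_,
      fun p hp => ?_⟩⟩
  · obtain ⟨f, hf⟩ := hτ.isHom
    simp only [← coe_ten]
    exact isIso_ad cAB.star_eq cBA.star_eq cBA.mul_self (Equiv.sumComm Unit Unit) _ hp f hf hτ.eq_ad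
  · simp only [← coe_ten]
    exact isTensorMap_ad cA.star_eq cAA.star_eq cB.star_eq cB.star_eq _ _ _ _ hA.eq_ad (hid _)
      hu.dual.push_comul (push_refl_mul cB.mul_self)
  · simp only [← coe_ten]
    exact isTensorMap_ad cA.star_eq cA.star_eq cAB.star_eq cBA.star_eq _ _ _ _ (hid _) hτ.eq_ad
      (push_refl_mul cA.mul_self) hpp
  · simp only [← coe_ten]
    exact isTensorMap_ad cAB.star_eq cBA.star_eq cA.star_eq cA.star_eq _ _ _ _ hτ.eq_ad (hid _)
      hpp (push_refl_mul cA.mul_self)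
  · simp only [← coe_ten]
    exact isTensorMap_ad cB.star_eq cB.star_eq cA.star_eq cAA.star_eq _ _ _ _ (hid _) hA.eq_ad
      (push_refl_mul cB.mul_self) hu.dual.push_comul
  · simp only [← coe_ten] at hp
    rw [hτ.eq_ad p hp]
    simp only [ad_ad, reindex_ad, tenU_one_left, tenU_one_right, MonoidHom.map_mul, legU_legU]
    refine ad_congr ?_ ?_ p
    · ext x; rcases x with _ | _ <;> rfl
    · simp only [legU_eq_lu]
      exact (mul_assoc _ _ _).symm.trans (hu.dual.pentagon (κ := Unit ⊕ I₂) (i := Sum.inl ())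
        (j := Sum.inr (Sum.inl ())) (k := Sum.inr (Sum.inr ())) (by simp) (by simp) (by simp))
  · simp only [← coe_ten]
    exact isTensorMap_ad cA.star_eq cA.star_eq cB.star_eq cBB.star_eq _ _ _ _ (hid _) hB.eq_ad
      (push_refl_mul cA.mul_self) hu.push_comul
  · simp only [← coe_ten]
    exact isTensorMap_ad cAB.star_eq cBA.star_eq cB.star_eq cB.star_eq _ _ _ _ hτ.eq_ad (hid _)
      hpp (push_refl_mul cB.mul_self)
  · simp only [← coe_ten]
    exact isTensorMap_ad cB.star_eq cB.star_eq cAB.star_eq cBA.star_eq _ _ _ _ (hid _) hτ.eq_ad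
      (push_refl_mul cB.mul_self) hpp
  · simp only [← coe_ten]
    exact isTensorMap_ad cB.star_eq cBB.star_eq cA.star_eq cA.star_eq _ _ _ _ hB.eq_ad (hid _)
      hu.push_comul (push_refl_mul cA.mul_self)
  · simp only [← coe_ten] at hp
    rw [hτ.eq_ad p hp]
    simp only [ad_ad, reindex_ad, tenU_one_left, tenU_one_right, MonoidHom.map_mul, legU_legU]
    refine ad_congr ?_ ?_ p
    · ext x; rcases x with _ | _ <;> rfl
    · simp only [legU_eq_lu]
      have h := hu.pentagon (κ := I₂ ⊕ Unit) (i := Sum.inr ())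
        (j := Sum.inl (Sum.inl ())) (k := Sum.inl (Sum.inr ())) (by simp) (by simp) (by simp)
      have key : lu (κ := I₂ ⊕ Unit) (Sum.inl (Sum.inr ())) (Sum.inr ()) (by simp) (dualU u) *
          (lu (Sum.inl (Sum.inl ())) (Sum.inr ()) (by simp) (dualU u) *
            lu (Sum.inl (Sum.inl ())) (Sum.inl (Sum.inr ())) (by simp) u) =
          lu (Sum.inl (Sum.inl ())) (Sum.inl (Sum.inr ())) (by simp) u *
            lu (Sum.inl (Sum.inl ())) (Sum.inr ()) (by simp) (dualU u) := by
        rw [lu_dualU, lu_dualU, map_inv, map_inv, inv_mul_eq_iff_eq_mul, inv_mul_eq_iff_eq_mul,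
          ← mul_assoc, ← mul_assoc, h, mul_inv_cancel_right]
      exact key

theorem ne₁₂ : ℓ₁ ≠ ℓ₂ := by decide
theorem ne₁₃ : ℓ₁ ≠ ℓ₃ := by decide
theorem ne₁₄ : ℓ₁ ≠ ℓ₄ := by decide
theorem ne₂₃ : ℓ₂ ≠ ℓ₃ := by decide
theorem ne₂₄ : ℓ₂ ≠ ℓ₄ := by decide
theorem ne₃₄ : ℓ₃ ≠ ℓ₄ := by decide

/-- The unitary implementing the twisted comultiplication. -/
def twistU (u : unitary (Op n I₂)) : unitary (Op n I₄) :=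
  lu ℓ₂ ℓ₃ ne₂₃ (dualU u) * lu ℓ₁ ℓ₃ ne₁₃ (dualU u) *
    lu ℓ₂ ℓ₄ ne₂₄ u

/-- Written in the final order of the legs, the two comultiplications contribute `dualU u` in legs
1, 3 and `u` in legs 2, 4, and the inversion inserted in the middle contributes `dualU u` in legs 2,
3. -/
theorem IsMultUnitary.isTwistedComul {u : unitary (Op n I₂)} (hu : IsMultUnitary u)
    {δA δB : Op n Unit → Op n I₂} {τ : Op n I₂ → Op n I₂}
    (hA : Implements (sl (dualU u)) δA inl (dualU u)) (hB : Implements (sl u) δB inl u)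
    (hτ : Implements (ten (sl (dualU u)) (sl u)) τ (swp Unit Unit) (dualU u)) :
    IsTwistedComul ⟨(sl (dualU u) : Set (Op n Unit)), δA⟩ ⟨(sl u : Set (Op n Unit)), δB⟩ τ
      (ad (inl : I₂ ↪ I₄) (twistU u)) := by
  have cA := hu.dual.isCStar
  have cB := hu.isCStar
  have cAB := cA.ten cB
  have cBA := cB.ten cA
  have cAA := cA.ten cA
  have cBB := cB.ten cB
  have hp := hu.push_inversion
  have hpp : push (ad (swp Unit Unit) (dualU u)) (ten (sl (dualU u)) (sl u)) *
      ten (sl u) (sl (dualU u)) = ten (sl u) (sl (dualU u)) := by rw [hp, cBA.mul_self]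
  have hid : ∀ {ι : Type} [Fintype ι] (M : CS (Op n ι)), ∀ b ∈ M,
      id b = ad (Function.Embedding.refl ι) 1 b := fun M b _ => (ad_refl_one b).symm
  refine ⟨ad (inl.sumMap inl) (tenU (dualU u) u),
    ad ((swp Unit Unit).sumMap (Function.Embedding.refl Unit)) (tenU (dualU u) 1),
    ad ((Function.Embedding.refl Unit).sumMap
      ((swp Unit Unit).sumMap (Function.Embedding.refl Unit))) (tenU 1 (tenU (dualU u) 1)),
    ?_, ?_, ?_, fun p _ => ?_⟩
  · simp only [← coe_ten]
    exact isTensorMap_ad cA.star_eq cAA.star_eq cB.star_eq cBB.star_eq _ _ _ _ hA.eq_ad hB.eq_ad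
      hu.dual.push_comul hu.push_comul
  · simp only [← coe_ten]
    exact isTensorMap_ad cAB.star_eq cBA.star_eq cB.star_eq cB.star_eq _ _ _ _ hτ.eq_ad (hid _)
      hpp (push_refl_mul cB.mul_self)
  · simp only [← coe_ten]
    refine isTensorMap_ad cA.star_eq cA.star_eq (cAB.ten cB).star_eq (cBA.ten cB).star_eq _ _ _ _
      (hid _) (fun _ _ => rfl) (push_refl_mul cA.mul_self) ?_
    rw [push_ad_ten, ten_mul_ten, hpp, push_refl_mul cB.mul_self]
  · simp only [ad_ad, reindex_ad, tenU_one_left, tenU_one_right, MonoidHom.map_mul, legU_legU]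
    simp only [tenU, MonoidHom.map_mul, legU_legU]
    simp only [legU_eq_lu]
    refine ad_congr ?_ ?_ p
    · ext x; rcases x with _ | _ <;> rfl
    · exact mul_assoc (G := unitary (Op n I₄)) _ _ _

end Bialgebras

/-! ### The twisted bialgebra -/

section Twist

open Function.Embedding (inl inr)

/-- This is nondegeneracy of the twisted comultiplication: conjugation by the outermost factor is
absorbed by the algebras in legs 2 and 3, after which the density statements for the two given
comultiplications apply separately. -/
theorem word_twist {M : Type*} [Monoid M] {x23 x23' x13 x13' y24 y24' a1 b2 a3 b4 : M}
    (h1 : x23 * (b2 * a3) = b2 * a3) (h1' : x23' * (b2 * a3) = b2 * a3)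
    (hA : x13 * a1 * x13' * a3 = a1 * a3) (hB : y24 * b2 * y24' * b4 = b2 * b4)
    (aa : a1 * a1 = a1) (bb : b2 * b2 = b2) (c12 : b2 * a1 = a1 * b2) (c13 : a3 * a1 = a1 * a3)
    (c14 : b4 * a1 = a1 * b4) (c23 : a3 * b2 = b2 * a3) (c24 : b4 * b2 = b2 * b4)
    (x1 : x23' * a1 = a1 * x23') (x1' : x23 * a1 = a1 * x23)
    (xb : b2 * x13' = x13' * b2) (ya : y24 * a1 = a1 * y24)
    (yx' : y24' * x13' = x13' * y24') (yx : y24 * x13' = x13' * y24) (ya3 : y24' * a3 = a3 * y24')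
    (yy3 : y24 * a3 = a3 * y24) :
    x23 * x13 * y24 * (a1 * b2) * (y24' * x13' * x23') * (a1 * b2 * (a3 * b4)) =
      a1 * b2 * (a3 * b4) := by
  calc _ = x23 * x13 * y24 * (a1 * b2) * (y24' * x13') * (a1 * (x23' * (b2 * a3)) * b4) := by
        simp only [mul_assoc, mul_swap x1]
    _ = x23 * x13 * y24 * (a1 * b2) * (y24' * x13') * (b2 * a3 * a1 * b4) := by
        rw [h1']; simp only [mul_assoc, mul_swap c13, mul_swap c12]
    _ = x23 * x13 * (a1 * y24 * b2 * (y24' * x13')) * (a3 * b4 * a1 * b2) := by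
        simp only [mul_assoc, mul_swap ya, c12, c14, c24, mul_swap c12, mul_swap c13,
          mul_swap c23]
    _ = x23 * (x13 * a1 * x13' * a3) * (y24 * b2 * y24' * b4) * (a1 * b2) := by
        simp only [mul_assoc, mul_swap yx', mul_swap xb, mul_swap yx, mul_swap ya3, mul_swap yy3,
          ← mul_swap c23]
    _ = a1 * (x23 * (b2 * a3)) * (b4 * a1 * b2) := by
        rw [hA, hB]; simp only [mul_assoc, mul_swap x1', mul_swap c23]
    _ = (a1 * a1) * (b2 * b2) * (a3 * b4) := by
        rw [h1]
        simp only [mul_assoc, c12, c14, c24, c13, mul_swap c12, mul_swap c13, mul_swap c14, c23,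
          mul_swap c23, mul_swap c24]
    _ = _ := by rw [aa, bb]

/-- The digits name six legs, two for each of three copies: 12, 34 and 56. The surplus factor
y₅₃y₄₆⁻¹ lies in the last two copies, so that `coassoc_of_mul` disposes of it. -/
theorem twist_coassoc {G : Type*} [Group G] {y32 y31 y24 y52 y51 y26 y54 y53 y46 : G}
    (p1 : y24 * y26 * y46 = y46 * y24) (p2 : y53 * y52 * y32 = y32 * y53)
    (p3 : y53 * y51 * y31 = y31 * y53) (p4 : y52 * y54 * y24 = y24 * y52)
    (c1 : Commute y24 y53) (c2 : Commute y46 y32) (c3 : Commute y46 y31) (c4 : Commute y46 y53)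
    (c5 : Commute y54 y32) (c6 : Commute y52 y31) (c7 : Commute y54 y31) (c8 : Commute y51 y24) :
    y32⁻¹ * y31⁻¹ * y24 * (y52⁻¹ * y51⁻¹ * y26) =
      y54⁻¹ * y53⁻¹ * y46 * (y32⁻¹ * y31⁻¹ * y24) * (y53 * y46⁻¹) := by
  have q1 : y46 * y24 * y46⁻¹ = y24 * y26 := by rw [← p1, mul_inv_cancel_right]
  have q2 : y53⁻¹ * y32⁻¹ = y32⁻¹ * y52⁻¹ * y53⁻¹ := by
    rw [← mul_inv_rev, ← p2]; group
  have q3 : y53⁻¹ * y31⁻¹ * y53 = y31⁻¹ * y51⁻¹ := by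
    rw [← mul_inv_rev, ← p3]; group
  have q4 : y54⁻¹ * y52⁻¹ * y24 = y24 * y52⁻¹ := by
    have : y54⁻¹ * y52⁻¹ = (y24 * y52 * y24⁻¹)⁻¹ := by rw [← p4]; group
    rw [this]; group
  symm
  calc _ = y54⁻¹ * y53⁻¹ * (y46 * y32⁻¹) * y31⁻¹ * (y24 * y53) * y46⁻¹ := by
        simp only [mul_assoc]
    _ = y54⁻¹ * (y53⁻¹ * y32⁻¹) * (y46 * y31⁻¹) * y53 * y24 * y46⁻¹ := by
        rw [c2.inv_right.eq, c1.eq]; simp only [mul_assoc]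
    _ = y54⁻¹ * y32⁻¹ * y52⁻¹ * (y53⁻¹ * y31⁻¹) * (y46 * y53) * y24 * y46⁻¹ := by
        rw [q2, c3.inv_right.eq]; simp only [mul_assoc]
    _ = y54⁻¹ * y32⁻¹ * y52⁻¹ * (y53⁻¹ * y31⁻¹ * y53) * (y46 * y24 * y46⁻¹) := by
        rw [c4.eq]; simp only [mul_assoc]
    _ = y54⁻¹ * y32⁻¹ * y52⁻¹ * (y31⁻¹ * y51⁻¹) * (y24 * y26) := by rw [q1, q3]
    _ = y54⁻¹ * y32⁻¹ * (y52⁻¹ * y31⁻¹) * (y51⁻¹ * y24) * y26 := by simp only [mul_assoc]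
    _ = (y54⁻¹ * y32⁻¹) * (y31⁻¹ * y52⁻¹) * (y24 * y51⁻¹) * y26 := by
        rw [c6.inv_inv.eq, c8.inv_left.eq]
    _ = y32⁻¹ * (y54⁻¹ * y31⁻¹) * (y52⁻¹ * y24) * y51⁻¹ * y26 := by
        rw [c5.inv_inv.eq]; simp only [mul_assoc]
    _ = y32⁻¹ * y31⁻¹ * (y54⁻¹ * y52⁻¹ * y24) * y51⁻¹ * y26 := by
        rw [c7.inv_inv.eq]; simp only [mul_assoc]
    _ = _ := by rw [q4]; simp only [mul_assoc]

theorem lu_commute {κ : Type} [Fintype κ] {i j k l : κ} (hij : i ≠ j) (hkl : k ≠ l) (hik : i ≠ k)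
    (hil : i ≠ l) (hjk : j ≠ k) (hjl : j ≠ l) (u v : unitary (Op n I₂)) :
    Commute (lu i j hij u) (lu k l hkl v) :=
  Subtype.ext (legHom_commute _ _ (by
    rintro (_ | _) (_ | _)
    exacts [hik, hil, hjk, hjl]) _ _)

theorem uv_comm {κ : Type} [Fintype κ] {i j k l : κ} (hij : i ≠ j) (hkl : k ≠ l) (hik : i ≠ k)
    (hil : i ≠ l) (hjk : j ≠ k) (hjl : j ≠ l) (u v : unitary (Op n I₂)) :
    uv i j hij u * uv k l hkl v = uv k l hkl v * uv i j hij u := by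
  rw [uv, uv, ← Units.val_mul, ← Units.val_mul, ← map_mul, ← map_mul,
    (lu_commute hij hkl hik hil hjk hjl u v).eq]

namespace IsMultUnitary

variable {u : unitary (Op n I₂)}

theorem push_twist (hu : IsMultUnitary u) :
    push (ad (inl : I₂ ↪ I₄) (twistU u)) (ten (sl (dualU u)) (sl u)) *
        ten (ten (sl (dualU u)) (sl u)) (ten (sl (dualU u)) (sl u)) =
      ten (ten (sl (dualU u)) (sl u)) (ten (sl (dualU u)) (sl u)) := by
  have h12 := ne₁₂
  have h13 := ne₁₃
  have h14 := ne₁₄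
  have h23 := ne₂₃
  have h24 := ne₂₄
  have h34 := ne₃₄
  have e1 : legC (inl : I₂ ↪ I₄) (ten (sl (dualU u)) (sl u)) =
      lc ℓ₁ (sl (dualU u)) * lc ℓ₂ (sl u) := by
    rw [ten_unit, map_mul, legC_lc, legC_lc]; rfl
  have e2 : legC (inr : I₂ ↪ I₄) (ten (sl (dualU u)) (sl u)) =
      lc ℓ₃ (sl (dualU u)) * lc ℓ₄ (sl u) := by
    rw [ten_unit, map_mul, legC_lc, legC_lc]; rfl
  have e3 : (uline (twistU u) : CS (Op n I₄)) =
      uv ℓ₂ ℓ₃ h23 (dualU u) * uv ℓ₁ ℓ₃ h13 (dualU u) * uv ℓ₂ ℓ₄ h24 u := by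
    simp only [twistU, uline_mul]; rfl
  have e4 : (uline (twistU u)⁻¹ : CS (Op n I₄)) =
      uv ℓ₂ ℓ₄ h24 u⁻¹ * uv ℓ₁ ℓ₃ h13 (dualU u)⁻¹ * uv ℓ₂ ℓ₃ h23 (dualU u)⁻¹ := by
    simp only [twistU, mul_inv_rev, uline_mul, ← map_inv, mul_assoc]; rfl
  have e5 : ten (ten (sl (dualU u)) (sl u)) (ten (sl (dualU u)) (sl u)) =
      lc ℓ₁ (sl (dualU u)) * lc ℓ₂ (sl u) * (lc ℓ₃ (sl (dualU u)) * lc ℓ₄ (sl u)) := by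
    rw [← e1, ← e2]; rfl
  rw [push_ad, e1, e3, e4, e5]
  refine word_twist ?_ ?_ (hu.dual.comul_sl h13) (hu.comul_sl h24) ?_ ?_ (lc_comm h12.symm _ _)
    (lc_comm h13.symm _ _) (lc_comm h14.symm _ _) (lc_comm h23.symm _ _) (lc_comm h24.symm _ _)
    (lc_uv_comm h12 h13 h23 _ _).symm (lc_uv_comm h12 h13 h23 _ _).symm
    (lc_uv_comm h12.symm h23 h13 _ _) (lc_uv_comm h12 h14 h24 _ _).symm
    (uv_comm _ _ h12.symm h23 h14.symm h34.symm _ _) (uv_comm _ _ h12.symm h23 h14.symm h34.symm _ _)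
    (lc_uv_comm h23.symm h34 h24 _ _).symm (lc_uv_comm h23.symm h34 h24 _ _).symm
  · rw [uv_dualU, lc_comm h23, hu.uv_inv_mul_tensor]
  · rw [uv_dualU_inv, lc_comm h23, hu.uv_mul_tensor]
  · rw [← map_mul, hu.dual.sl_mul_sl]
  · rw [← map_mul, hu.sl_mul_sl]

theorem legU_twistU {κ : Type} [Fintype κ] (f : I₄ ↪ κ) (u : unitary (Op n I₂)) :
    legU f (twistU u) = (lu (f ℓ₃) (f ℓ₂) (f.injective.ne ne₂₃.symm) u)⁻¹ *
      (lu (f ℓ₃) (f ℓ₁) (f.injective.ne ne₁₃.symm) u)⁻¹ *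
      lu (f ℓ₂) (f ℓ₄) (f.injective.ne ne₂₄) u := by
  rw [twistU, MonoidHom.map_mul, MonoidHom.map_mul, legU_lu, legU_lu, legU_lu, lu_dualU, lu_dualU,
    map_inv, map_inv]

theorem twist_coassoc (hu : IsMultUnitary u) :
    legU ((Function.Embedding.refl I₂).sumMap inl) (twistU u) *
        legU ((Function.Embedding.refl I₂).sumMap inr) (twistU u) =
      legU inr (twistU u) * legU ((Function.Embedding.refl I₂).sumMap inl) (twistU u) *
        legU inr (lu ℓ₃ ℓ₁ ne₁₃.symm u * lu ℓ₂ ℓ₄ ne₂₄ u⁻¹) := by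
  have e : legU (inr : I₄ ↪ I₂ ⊕ I₄)
      (lu ℓ₃ ℓ₁ ne₁₃.symm u * lu ℓ₂ ℓ₄ ne₂₄ u⁻¹) =
      lu (Sum.inr ℓ₃) (Sum.inr ℓ₁) (by simp [ℓ₁, ℓ₃]) u *
        (lu (Sum.inr ℓ₂) (Sum.inr ℓ₄) (by simp [ℓ₂, ℓ₄]) u)⁻¹ := by
    rw [MonoidHom.map_mul, legU_lu, legU_lu, map_inv]; rfl
  refine (congrArg₂ (· * ·) (legU_twistU _ u) (legU_twistU _ u)).trans (Eq.trans ?_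
    (congrArg₂ (· * ·) (congrArg₂ (· * ·) (legU_twistU _ u) (legU_twistU _ u)) e).symm)
  exact QDouble.twist_coassoc
    (hu.pentagon (κ := I₂ ⊕ I₄) (i := Sum.inl (Sum.inr ())) (j := Sum.inr ℓ₂) (k := Sum.inr ℓ₄)
      (by decide) (by decide) (by decide))
    (hu.pentagon (κ := I₂ ⊕ I₄) (i := Sum.inr ℓ₃) (j := Sum.inr ℓ₁) (k := Sum.inl (Sum.inr ()))
      (by decide) (by decide) (by decide))
    (hu.pentagon (κ := I₂ ⊕ I₄) (i := Sum.inr ℓ₃) (j := Sum.inr ℓ₁) (k := Sum.inl (Sum.inl ()))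
      (by decide) (by decide) (by decide))
    (hu.pentagon (κ := I₂ ⊕ I₄) (i := Sum.inr ℓ₃) (j := Sum.inl (Sum.inr ())) (k := Sum.inr ℓ₂)
      (by decide) (by decide) (by decide))
    (lu_commute _ _ (by decide) (by decide) (by decide) (by decide) _ _)
    (lu_commute _ _ (by decide) (by decide) (by decide) (by decide) _ _)
    (lu_commute _ _ (by decide) (by decide) (by decide) (by decide) _ _)
    (lu_commute _ _ (by decide) (by decide) (by decide) (by decide)
      _ _)
    (lu_commute _ _ (by decide) (by decide) (by decide) (by decide) _ _)
    (lu_commute _ _ (by decide) (by decide) (by decide) (by decide) _ _)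
    (lu_commute _ _ (by decide) (by decide) (by decide) (by decide) _ _)
    (lu_commute _ _ (by decide) (by decide) (by decide) (by decide) _ _)

theorem isCStarBialgebra_twist (hu : IsMultUnitary u) :
    IsCStarBialgebra ⟨(ten (sl (dualU u)) (sl u) : Set (Op n I₂)),
      ad (inl : I₂ ↪ I₄) (twistU u)⟩ :=
  isCStarBialgebra_of (hu.dual.isCStar.ten hu.isCStar) (implements_ad _ _ _) hu.push_twist
    (coassoc_of_mul _ hu.twist_coassoc)

end IsMultUnitary

end Twist

/-! ### The dual of the quantum double -/

section Double

open Function.Embedding (inl inr)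

variable {ι κ ν : Type} [Fintype ι] [Fintype κ] [Fintype ν]

theorem legHom_injective (e : ι ↪ κ) : Function.Injective (legHom (n := n) e) := by
  intro S T h
  obtain ⟨ρ, _, s, hs⟩ := exists_split e
  obtain ⟨ζ, hζ⟩ := exists_ne_zero n ρ
  ext1 ξ
  refine ext_inner_left ℂ fun η => ?_
  have := congrArg (fun X : Op n κ => inner ℂ (tensor s η ζ) (X (tensor s ξ ζ))) h
  simpa [legHom_tensor e s hs, inner_tensor, hζ] using this

/-- The first leg of `v` is placed in an auxiliary leg, where neither conjugation acts on the
compact operators, so `eq_on_slices` applies. In this way an operator identity such as the pentagon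
shows that two unitaries implement the same map on a slice algebra. -/
theorem ad_eq_on_slices {v : unitary (Op n I₂)} {i i' : ν} (W V : unitary (Op n ν))
    (h : legU (inl : ν ↪ ν ⊕ Unit) W * lu (Sum.inr ()) (Sum.inl i) (by simp) v *
        (legU (inl : ν ↪ ν ⊕ Unit) W)⁻¹ =
      legU (inl : ν ↪ ν ⊕ Unit) V * lu (Sum.inr ()) (Sum.inl i') (by simp) v *
        (legU (inl : ν ↪ ν ⊕ Unit) V)⁻¹) {a : Op n Unit} (ha : a ∈ sl v) :
    ad (sg i) W a = ad (sg i') V a := by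
  have hk : ∀ (X : unitary (Op n ν)) (i : ν) (k : Op n Unit),
      ad (pr (Sum.inr () : ν ⊕ Unit) (Sum.inl i) (by simp)) (legU inl X)
        (legHom (sg (Sum.inl ())) k) = legHom (sg (Sum.inr ())) k := fun X i k => by
    rw [← ad_one, ad_ad, map_one, mul_one, ← one_mul (legU inl X), ← ad_one]
    exact ad_mul_of_commute _ _ _ (legHom_commute _ _ (fun _ _ => Sum.inl_ne_inr) _ _)
  have hr : ∀ (X : unitary (Op n ν)) (i : ν),
      ad (pr (Sum.inr () : ν ⊕ Unit) (Sum.inl i) (by simp)) (legU inl X)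
        (legHom (sg (Sum.inr ())) a) = legHom inl (ad (sg i) X a) := fun X i => by
    rw [← ad_one, ad_ad, map_one, mul_one, legHom_ad]; rfl
  have key := eq_on_slices (u := v)
    (ad (pr (Sum.inr () : ν ⊕ Unit) (Sum.inl i) (by simp)) (legU inl W))
    (ad (pr (Sum.inr () : ν ⊕ Unit) (Sum.inl i') (by simp)) (legU inl V))
    (fun k _ => by rw [hk, hk]) (congrArg Subtype.val h)
    (push_ad_mul_cpt _ _ (by rw [legC_pr_inl, kc_mul_cpt])) ha
  rw [hr, hr] at key
  exact legHom_injective _ key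

theorem eq_on_ten {M : CS (Op n ι)} {N : CS (Op n κ)} (F G : Op n (ι ⊕ κ) →⋆ₐ[ℂ] Op n ν)
    (hM : ∀ a ∈ M, F (legHom inl a) = G (legHom inl a))
    (hN : ∀ b ∈ N, F (legHom inr b) = G (legHom inr b)) {p : Op n (ι ⊕ κ)} (hp : p ∈ ten M N) :
    F p = G p := by
  have := push_mul_push_induction (P := (⊥ : CS (Op n ν))) (starHomL F - starHomL G)
    (fun a ha b hb => by
      change F _ - G _ ∈ _
      rw [ClosedSubmodule.mem_bot, map_mul, map_mul, hM a ha, hN b hb, sub_self]) hp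
  rw [ClosedSubmodule.mem_bot] at this
  exact sub_eq_zero.1 this

/-- `j` in the leg `i`. -/
def jl (i : κ) : unitary (Op n Unit) →* unitary (Op n κ) := legU (sg i)

theorem legU_jl (f : κ ↪ ν) (i : κ) (j : unitary (Op n Unit)) : legU f (jl i j) = jl (f i) j :=
  legU_legU f (sg i) j

theorem jl_comm {i k : κ} (h : i ≠ k) (j : unitary (Op n Unit)) : Commute (jl i j) (jl k j) :=
  Subtype.ext (legHom_commute _ _ (fun _ _ => h) _ _)

theorem jl_lu_comm {i k l : κ} (hk : i ≠ k) (hl : i ≠ l) (h : k ≠ l) (j : unitary (Op n Unit))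
    (v : unitary (Op n I₂)) : Commute (jl i j) (lu k l h v) :=
  Subtype.ext (legHom_commute _ _ (by rintro _ (_ | _); exacts [hk, hl]) _ _)

/-- `(j ⊗ j) v (j ⊗ j)^*`. -/
def conjJ (j : unitary (Op n Unit)) (v : unitary (Op n I₂)) : unitary (Op n I₂) :=
  jl (Sum.inl ()) j * jl (Sum.inr ()) j * v * (jl (Sum.inl ()) j * jl (Sum.inr ()) j)⁻¹

/-- `(j ⊗ 1) v (j ⊗ 1)^*`. -/
def conjL (j : unitary (Op n Unit)) (v : unitary (Op n I₂)) : unitary (Op n I₂) :=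
  jl (Sum.inl ()) j * v * (jl (Sum.inl ()) j)⁻¹

/-- `(1 ⊗ j) v (1 ⊗ j)^*`. -/
def conjR (j : unitary (Op n Unit)) (v : unitary (Op n I₂)) : unitary (Op n I₂) :=
  jl (Sum.inr ()) j * v * (jl (Sum.inr ()) j)⁻¹

theorem lu_jl (i k : κ) (h : i ≠ k) (j : unitary (Op n Unit)) :
    legU (pr i k h) (jl (Sum.inl ()) j) = jl i j := legU_jl _ _ _

theorem lu_jr (i k : κ) (h : i ≠ k) (j : unitary (Op n Unit)) :
    legU (pr i k h) (jl (Sum.inr ()) j) = jl k j := legU_jl _ _ _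

theorem lu_eq (i k : κ) (h : i ≠ k) (v : unitary (Op n I₂)) : lu i k h v = legU (pr i k h) v := rfl

theorem lu_conjJ (i k : κ) (h : i ≠ k) (j : unitary (Op n Unit)) (v : unitary (Op n I₂)) :
    lu i k h (conjJ j v) = jl i j * jl k j * lu i k h v * (jl i j * jl k j)⁻¹ := by
  rw [lu_eq, conjJ, MonoidHom.map_mul, MonoidHom.map_mul, MonoidHom.map_inv, MonoidHom.map_mul,
    lu_jl, lu_jr]; rfl

theorem lu_conjL (i k : κ) (h : i ≠ k) (j : unitary (Op n Unit)) (v : unitary (Op n I₂)) :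
    lu i k h (conjL j v) = jl i j * lu i k h v * (jl i j)⁻¹ := by
  rw [lu_eq, conjL, MonoidHom.map_mul, MonoidHom.map_mul, MonoidHom.map_inv, lu_jl]; rfl

theorem lu_conjR (i k : κ) (h : i ≠ k) (j : unitary (Op n Unit)) (v : unitary (Op n I₂)) :
    lu i k h (conjR j v) = jl k j * lu i k h v * (jl k j)⁻¹ := by
  rw [lu_eq, conjR, MonoidHom.map_mul, MonoidHom.map_mul, MonoidHom.map_inv, lu_jr]; rfl

theorem lu_conjJ_conj {i k l : κ} (hik : i ≠ k) (hil : i ≠ l) (hkl : k ≠ l)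
    (j : unitary (Op n Unit)) (v : unitary (Op n I₂)) {T : unitary (Op n κ)}
    (hT : T = jl i j * jl k j * jl l j) : lu i k hik (conjJ j v) = T * lu i k hik v * T⁻¹ := by
  rw [lu_conjJ, hT, mul_inv_rev (jl i j * jl k j), mul_assoc (jl i j * jl k j) (jl l j),
    (jl_lu_comm hil.symm hkl.symm hik j v).eq]
  group

theorem dualU_conjJ (j : unitary (Op n Unit)) (v : unitary (Op n I₂)) :
    dualU (conjJ j v) = conjJ j (dualU v) := by
  rw [dualU, map_inv, lu_conjJ, conjJ, (jl_comm (by simp) j).eq, dualU, map_inv]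
  group

/-- The line spanned by `j` in the leg `i`. -/
def ju (i : κ) (j : unitary (Op n Unit)) : CS (Op n κ) := ↑(uline (jl i j))

theorem ju_eq (i : κ) (j : unitary (Op n Unit)) : ju i j = lc i (uline j : CS (Op n Unit)) :=
  (push_line (legHom (sg i)) (j : Op n Unit)).symm

theorem lc_mul (i : κ) (M N : CS (Op n Unit)) : lc i (M * N) = lc i M * lc i N := map_mul _ _ _

theorem ju_mul_kc (i : κ) (j : unitary (Op n Unit)) : ju i j * kc i = kc i := by
  rw [ju_eq, ← lc_mul, uline_mul_cpt]

theorem kc_mul_ju (i : κ) (j : unitary (Op n Unit)) : kc i * ju i j = kc i := by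
  rw [ju_eq, ← lc_mul, cpt_mul_uline]

theorem lc_ju_comm {i k : κ} (h : i ≠ k) (M : CS (Op n Unit)) (j : unitary (Op n Unit)) :
    lc i M * ju k j = ju k j * lc i M := by
  rw [ju_eq, lc_comm h]

theorem uline_conjJ (j : unitary (Op n Unit)) (v : unitary (Op n I₂)) :
    (uline (conjJ j v) : CS (Op n I₂)) = ju (Sum.inl ()) j * ju (Sum.inr ()) j *
      (uline v : CS (Op n I₂)) * (ju (Sum.inl ()) j⁻¹ * ju (Sum.inr ()) j⁻¹) := by
  have h : (jl (Sum.inl () : I₂) j * jl (Sum.inr ()) j)⁻¹ =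
      jl (Sum.inl ()) j⁻¹ * jl (Sum.inr ()) j⁻¹ := by
    rw [mul_inv_rev, (jl_comm (by simp) j).inv_inv.eq.symm, MonoidHom.map_inv, MonoidHom.map_inv]
  rw [conjJ, h, uline_mul, uline_mul, uline_mul, uline_mul]
  rfl

theorem conjJ_inv (j : unitary (Op n Unit)) (v : unitary (Op n I₂)) :
    (conjJ j v)⁻¹ = conjJ j v⁻¹ := by
  rw [conjJ, conjJ]; group

theorem sl_conjJ (j : unitary (Op n Unit)) (v : unitary (Op n I₂)) :
    sl (conjJ j v) = push (ad (Function.Embedding.refl Unit) j) (sl v) := by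
  have h0 : (Sum.inl () : I₂) ≠ Sum.inr () := by simp
  refine lc_cancel h0 ?_
  have hlc : lc (Sum.inr () : I₂) (push (ad (Function.Embedding.refl Unit) j) (sl v)) =
      ju (Sum.inr ()) j * lc (Sum.inr ()) (sl v) * ju (Sum.inr ()) j⁻¹ := by
    rw [push_ad, legC_refl, lc_mul, lc_mul, ju_eq, ju_eq]
  have k1 := kc_mul_ju (Sum.inl () : I₂) j
  have k2 := ju_mul_kc (Sum.inl () : I₂) j⁻¹
  have k3 := lc_ju_comm h0 (cpt n Unit) j
  have k4 := lc_ju_comm h0 (cpt n Unit) j⁻¹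
  have k5 := kc_mul_sl h0 v
  rw [uv_inl_inr] at k5
  rw [← kc_mul_sl h0, uv_inl_inr, uline_conjJ, hlc]
  calc _ = (kc (Sum.inl ()) * ju (Sum.inl ()) j) * ju (Sum.inr ()) j *
        ↑(uline v) * (ju (Sum.inl ()) j⁻¹ *
          (ju (Sum.inr ()) j⁻¹ * kc (Sum.inl ()))) := by simp only [mul_assoc]
    _ = (kc (Sum.inl ()) * ju (Sum.inr ()) j) *
        ↑(uline v) * ((ju (Sum.inl ()) j⁻¹ * kc (Sum.inl ())) *
          ju (Sum.inr ()) j⁻¹) := by rw [k1, ← k4]; simp only [mul_assoc]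
    _ = ju (Sum.inr ()) j * (kc (Sum.inl ()) * ↑(uline v) * kc (Sum.inl ())) *
          ju (Sum.inr ()) j⁻¹ := by rw [k2, k3]; simp only [mul_assoc]
    _ = _ := by rw [k5, ← mul_assoc, ← k3]; simp only [mul_assoc]

/-- Conjugating all legs by the same unitary preserves the pentagon, and regularity survives because
compact operators absorb `j`. -/
theorem IsMultUnitary.conjJ {u : unitary (Op n I₂)} (hu : IsMultUnitary u)
    (j : unitary (Op n Unit)) : IsMultUnitary (conjJ j u) where
  pentagon' := by
    have h12 : (Sum.inl (Sum.inl ()) : I₂ ⊕ Unit) ≠ Sum.inl (Sum.inr ()) := by simp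
    have h13 : (Sum.inl (Sum.inl ()) : I₂ ⊕ Unit) ≠ Sum.inr () := by simp
    have h23 : (Sum.inl (Sum.inr ()) : I₂ ⊕ Unit) ≠ Sum.inr () := by simp
    have e12 := lu_conjJ_conj h12 h13 h23 j u rfl
    have e13 := lu_conjJ_conj h13 h12 h23.symm j u (T := jl (Sum.inl (Sum.inl ())) j *
      jl (Sum.inl (Sum.inr ())) j * jl (Sum.inr ()) j) (by
        rw [mul_assoc, mul_assoc, (jl_comm h23 j).eq])
    have e23 := lu_conjJ_conj h23 h12.symm h13.symm j u (T := jl (Sum.inl (Sum.inl ())) j *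
      jl (Sum.inl (Sum.inr ())) j * jl (Sum.inr ()) j) (by
        rw [mul_assoc, ((jl_comm h12 j).mul_right (jl_comm h13 j)).eq])
    have hp := hu.pentagon h12 h13 h23
    rw [e12, e13, e23]
    have key : ∀ {G : Type} [Group G] (T a b c : G), a * b * c = c * a →
        T * a * T⁻¹ * (T * b * T⁻¹) * (T * c * T⁻¹) = T * c * T⁻¹ * (T * a * T⁻¹) := by
      intro G _ T a b c h
      calc _ = T * (a * b * c) * T⁻¹ := by group
        _ = _ := by rw [h]; group
    exact key _ _ _ _ hp
  regular' := by
    have h0 : (Sum.inl () : I₂) ≠ Sum.inr () := by simp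
    rw [conjJ_inv, uline_conjJ]
    have k1 := kc_mul_ju (Sum.inr () : I₂) j
    have k2 := ju_mul_kc (Sum.inl () : I₂) j⁻¹
    have k3 := lc_ju_comm h0 (cpt n Unit) j⁻¹
    have k4 := lc_ju_comm h0.symm (cpt n Unit) j
    have k5 := ju_mul_kc (Sum.inl () : I₂) j
    have k6 := kc_mul_ju (Sum.inr () : I₂) j⁻¹
    calc _ = (kc (Sum.inr ()) * ju (Sum.inl ()) j) * ju (Sum.inr ()) j *
          ↑(uline u⁻¹) * (ju (Sum.inl ()) j⁻¹ *
            (ju (Sum.inr ()) j⁻¹ * kc (Sum.inl ()))) := by simp only [mul_assoc]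
      _ = ju (Sum.inl ()) j * (kc (Sum.inr ()) * ju (Sum.inr ()) j) *
          ↑(uline u⁻¹) * ((ju (Sum.inl ()) j⁻¹ * kc (Sum.inl ())) *
            ju (Sum.inr ()) j⁻¹) := by rw [k4, ← k3]; simp only [mul_assoc]
      _ = ju (Sum.inl ()) j * (kc (Sum.inr ()) * ↑(uline u⁻¹) * kc (Sum.inl ())) *
            ju (Sum.inr ()) j⁻¹ := by rw [k1, k2]; simp only [mul_assoc]
      _ = _ := by
        rw [hu.regular', ← mul_assoc, k5, mul_assoc, k6]

end Double

/-! ### Relations between Y and j, and the reduction of V_D -/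

section DoubleData

open Function.Embedding (inl inr)

variable {κ : Type} [Fintype κ]

/-- The three legs of `(H ⊗ H) ⊗ H`. -/
def t₁ : I₂ ⊕ Unit := Sum.inl (Sum.inl ())
def t₂ : I₂ ⊕ Unit := Sum.inl (Sum.inr ())
def t₃ : I₂ ⊕ Unit := Sum.inr ()

theorem tne₁₂ : t₁ ≠ t₂ := by decide
theorem tne₁₃ : t₁ ≠ t₃ := by decide
theorem tne₂₃ : t₂ ≠ t₃ := by decide

/-- `(j ⊗ 1) Σ u Σ (j ⊗ 1)^*`. -/
def bigU (u : unitary (Op n I₂)) (j : unitary (Op n Unit)) : unitary (Op n I₂) :=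
  jl (Sum.inl ()) j * lu (Sum.inr ()) (Sum.inl ()) (by simp) u * (jl (Sum.inl ()) j)⁻¹

theorem lu_bigU (i k : κ) (h : i ≠ k) (u : unitary (Op n I₂)) (j : unitary (Op n Unit)) :
    lu i k h (bigU u j) = jl i j * lu k i h.symm u * (jl i j)⁻¹ := by
  rw [lu_eq, bigU, MonoidHom.map_mul, MonoidHom.map_mul, MonoidHom.map_inv, lu_jl, legU_lu]; rfl

/-- The relations between the multiplicative unitary `u` and the symmetry `j` on which the
computation of the dual of the quantum double rests. -/
structure DoubleData (u : unitary (Op n I₂)) (j : unitary (Op n Unit)) : Prop where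
  mult : IsMultUnitary u
  -- Here `bigU u j` stands for U_A. By the pentagon, u₁₃u₂₃ = u₁₂*u₂₃u₁₂, so `c₁` says that
  -- conjugation by U_A has the same effect on the first leg of `u` as the comultiplication given by
  -- `u`. The relation `c₂` is the corresponding statement for the second leg of `conjJ j u`.
  c₁ : lu t₁ t₂ tne₁₂ (bigU u j) * lu t₁ t₃ tne₁₃ u =
    lu t₁ t₃ tne₁₃ u * lu t₂ t₃ tne₂₃ u * lu t₁ t₂ tne₁₂ (bigU u j)
  c₂ : lu t₃ t₂ tne₂₃.symm (conjJ j u) * lu t₁ t₂ tne₁₂ (bigU u j) =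
    lu t₁ t₂ tne₁₂ (bigU u j) * lu t₃ t₁ tne₁₃.symm (conjJ j u) *
      lu t₃ t₂ tne₂₃.symm (conjJ j u)
  -- The relations `c₃` and `c₄` say that the first, respectively second, legs of `u` commute with
  -- their conjugates by `j`.
  c₃ : lu t₁ t₂ tne₁₂ u * lu t₁ t₃ tne₁₃ (conjL j u) = lu t₁ t₃ tne₁₃ (conjL j u) * lu t₁ t₂ tne₁₂ u
  c₄ : lu t₁ t₂ tne₁₂ u * lu t₃ t₂ tne₂₃.symm (conjR j u) =
    lu t₃ t₂ tne₂₃.symm (conjR j u) * lu t₁ t₂ tne₁₂ u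

namespace DoubleData

variable {u : unitary (Op n I₂)} {j : unitary (Op n Unit)} {i k l : κ} (hik : i ≠ k) (hil : i ≠ l)
  (hkl : k ≠ l)

theorem c₁' (h : DoubleData u j) : lu i k hik (bigU u j) * lu i l hil u =
    lu i l hil u * lu k l hkl u * lu i k hik (bigU u j) := by
  have := congrArg (legU (tri i k l hik hil hkl)) h.c₁
  simp only [MonoidHom.map_mul, legU_lu] at this
  exact this

theorem c₃' (h : DoubleData u j) (hik : i ≠ k) (hil : i ≠ l) (hkl : k ≠ l) : Commute (lu i k hik u) (lu i l hil (conjL j u)) := by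
  have := congrArg (legU (tri i k l hik hil hkl)) h.c₃
  simp only [MonoidHom.map_mul, legU_lu] at this
  exact this

theorem c₄' (h : DoubleData u j) (hik : i ≠ k) (hil : i ≠ l) (hkl : k ≠ l) : Commute (lu i k hik u) (lu l k hkl.symm (conjR j u)) := by
  have := congrArg (legU (tri i k l hik hil hkl)) h.c₄
  simp only [MonoidHom.map_mul, legU_lu] at this
  exact this

theorem lu_conjJ_eq_conjL (i k : κ) (hik : i ≠ k) : lu i k hik (conjJ j u) =
    jl k j * lu i k hik (conjL j u) * (jl k j)⁻¹ := by
  rw [lu_conjJ, lu_conjL, (jl_comm hik j).eq]; group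

theorem lu_conjJ_eq_conjR (i k : κ) (hik : i ≠ k) : lu i k hik (conjJ j u) =
    jl i j * lu i k hik (conjR j u) * (jl i j)⁻¹ := by
  rw [lu_conjJ, lu_conjR]; group

theorem commute_conj {G : Type*} [Group G] {a b t : G} (h : Commute a b) (ht : Commute t a) :
    Commute a (t * b * t⁻¹) :=
  (ht.symm.mul_right h).mul_right ht.symm.inv_right

theorem commute_conjJ_left (h : DoubleData u j) (hik : i ≠ k) (hil : i ≠ l) (hkl : k ≠ l) :
    Commute (lu i l hil u) (lu i k hik (conjJ j u)) := by
  rw [lu_conjJ_eq_conjL]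
  exact commute_conj (h.c₃' hil hik hkl.symm) (jl_lu_comm hik.symm hkl hil j u)

theorem commute_conjJ_right (h : DoubleData u j) (hik : i ≠ k) (hil : i ≠ l) (hkl : k ≠ l) :
    Commute (lu l k hkl.symm u) (lu i k hik (conjJ j u)) := by
  rw [lu_conjJ_eq_conjR]
  exact commute_conj (h.c₄' hkl.symm hil.symm hik.symm) (jl_lu_comm hil hik hkl.symm j u)

/-- On `sl (dualU u)`, the comultiplications implemented by `bigU` and `u` agree. -/
theorem ad_bigU (h : DoubleData u j) {a : Op n Unit} (ha : a ∈ sl (dualU u)) :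
    ad (inl : Unit ↪ I₂) (bigU u j) a = ad inr u⁻¹ a := by
  refine ad_eq_on_slices (i := (Sum.inl () : I₂)) (i' := Sum.inr ()) _ _ ?_ ha
  have h1 := h.c₁
  have h2 := h.mult.pentagon tne₁₂ tne₁₃ tne₂₃
  rw [legU_eq_lu, legU_eq_lu, lu_dualU, lu_dualU]
  change lu t₁ t₂ tne₁₂ (bigU u j) * lu t₁ t₃ tne₁₃ u⁻¹ * (lu t₁ t₂ tne₁₂ (bigU u j))⁻¹ =
    lu t₁ t₂ tne₁₂ u⁻¹ * lu t₂ t₃ tne₂₃ u⁻¹ * (lu t₁ t₂ tne₁₂ u⁻¹)⁻¹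
  have key : ∀ {G : Type} [Group G] (U a b c : G), U * b = b * c * U → a * b * c = c * a →
      U * b⁻¹ * U⁻¹ = a⁻¹ * c⁻¹ * a⁻¹⁻¹ := by
    intro G _ U a b c h1 h2
    have e1 : U * b⁻¹ * U⁻¹ = (U * b * U⁻¹)⁻¹ := by group
    have e2 : a⁻¹ * c⁻¹ * a⁻¹⁻¹ = (a⁻¹ * (c * a))⁻¹ := by group
    rw [e1, e2, h1, ← h2]
    group
  rw [map_inv, map_inv, map_inv]
  exact key _ _ _ _ h1 h2

/-- On `sl (conjJ j u)`, the comultiplications implemented by `bigU` and `conjJ j u` agree. -/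
theorem ad_bigU_inv (h : DoubleData u j) {b : Op n Unit} (hb : b ∈ sl (conjJ j u)) :
    ad (inr : Unit ↪ I₂) (bigU u j)⁻¹ b = ad inl (conjJ j u) b := by
  refine ad_eq_on_slices (i := (Sum.inr () : I₂)) (i' := Sum.inl ()) _ _ ?_ hb
  have h1 := h.c₂
  have h2 := (h.mult.conjJ j).pentagon tne₁₃.symm tne₂₃.symm tne₁₂
  rw [MonoidHom.map_inv, legU_eq_lu, legU_eq_lu]
  change (lu t₁ t₂ tne₁₂ (bigU u j))⁻¹ * lu t₃ t₂ tne₂₃.symm (conjJ j u) *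
      (lu t₁ t₂ tne₁₂ (bigU u j))⁻¹⁻¹ =
    lu t₁ t₂ tne₁₂ (conjJ j u) * lu t₃ t₁ tne₁₃.symm (conjJ j u) *
      (lu t₁ t₂ tne₁₂ (conjJ j u))⁻¹
  have key : ∀ {G : Type} [Group G] (U a b c : G), c * U = U * b * c → b * c * a = a * b →
      U⁻¹ * c * U⁻¹⁻¹ = a * b * a⁻¹ := by
    intro G _ U a b c h1 h2
    rw [← h2, inv_inv, mul_assoc, h1]
    group
  exact key _ _ _ _ h1 h2

theorem ad_conjJ_inl (h : DoubleData u j) {a : Op n Unit} (ha : a ∈ sl (dualU u)) :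
    ad (inl : Unit ↪ I₂) (conjJ j u) a = ad inl 1 a := by
  refine ad_eq_on_slices (i := (Sum.inl () : I₂)) (i' := Sum.inl ()) _ _ ?_ ha
  rw [legU_eq_lu, lu_dualU, map_one, one_mul, inv_one, mul_one, map_inv]
  exact mul_inv_eq_of_eq_mul (h.commute_conjJ_left (κ := I₂ ⊕ Unit) tne₁₂ tne₁₃ tne₂₃).inv_left.eq.symm

theorem ad_conjJ_inr (h : DoubleData u j) {b : Op n Unit} (hb : b ∈ sl u) :
    ad (inr : Unit ↪ I₂) (conjJ j u) b = ad inr 1 b := by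
  refine ad_eq_on_slices (i := (Sum.inr () : I₂)) (i' := Sum.inr ()) _ _ ?_ hb
  rw [legU_eq_lu, map_one, one_mul, inv_one, mul_one]
  exact mul_inv_eq_of_eq_mul (h.commute_conjJ_right (κ := I₂ ⊕ Unit) tne₁₂ tne₁₃ tne₂₃).eq.symm

/-- Each leg of `conjJ j u` commutes with the algebra in the same leg, by `c₃` and `c₄`. Hence this
factor of Z does not contribute to τ. -/
theorem ad_ten_conjJ (h : DoubleData u j) {p : Op n I₂} (hp : p ∈ ten (sl (dualU u)) (sl u)) :
    ad (Function.Embedding.refl I₂) (conjJ j u) p = p := by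
  rw [← ad_refl_one p, ad_ad, map_one, mul_one]
  refine eq_on_ten (ad (Function.Embedding.refl I₂) (conjJ j u)) (ad (Function.Embedding.refl I₂) 1)
    (fun a ha => ?_) (fun b hb => ?_) hp
  · rw [← ad_one, ad_ad, ad_ad, map_one, mul_one, mul_one]
    exact h.ad_conjJ_inl ha
  · rw [← ad_one, ad_ad, ad_ad, map_one, mul_one, mul_one]
    exact h.ad_conjJ_inr hb

theorem ad_zed (h : DoubleData u j) {p : Op n I₂} (hp : p ∈ ten (sl (dualU u)) (sl u)) :
    ad (swp Unit Unit) (legU (swp Unit Unit) (u⁻¹ * conjJ j u)) p =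
      ad (swp Unit Unit) (dualU u) p := by
  conv_rhs => rw [← h.ad_ten_conjJ hp]
  rw [ad_ad, legU_eq_lu, legU_eq_lu]
  refine ad_congr (by ext; rfl) ?_ p
  rw [MonoidHom.map_mul]; rfl

theorem ad_inl_conjJ (h : DoubleData u j) {a : Op n Unit} (ha : a ∈ sl (dualU (conjJ j u))) :
    ad (inl : Unit ↪ I₂) u a = ad inl 1 a := by
  refine ad_eq_on_slices (i := (Sum.inl () : I₂)) (i' := Sum.inl ()) _ _ ?_ ha
  rw [legU_eq_lu, lu_dualU, map_one, one_mul, inv_one, mul_one, map_inv]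
  exact mul_inv_eq_of_eq_mul
    (h.commute_conjJ_left (κ := I₂ ⊕ Unit) tne₁₃ tne₁₂ tne₂₃.symm).inv_right.eq

theorem ad_inr_conjJ (h : DoubleData u j) {b : Op n Unit} (hb : b ∈ sl (conjJ j u)) :
    ad (inr : Unit ↪ I₂) u b = ad inr 1 b := by
  refine ad_eq_on_slices (i := (Sum.inr () : I₂)) (i' := Sum.inr ()) _ _ ?_ hb
  rw [legU_eq_lu, map_one, one_mul, inv_one, mul_one]
  exact mul_inv_eq_of_eq_mul
    (h.commute_conjJ_right (κ := I₂ ⊕ Unit) tne₂₃.symm tne₁₃.symm tne₁₂.symm).eq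

theorem ad_ten (h : DoubleData u j) {p : Op n I₂}
    (hp : p ∈ ten (sl (dualU (conjJ j u))) (sl (conjJ j u))) :
    ad (Function.Embedding.refl I₂) u p = p := by
  rw [← ad_refl_one p, ad_ad, map_one, mul_one]
  refine eq_on_ten (ad (Function.Embedding.refl I₂) u) (ad (Function.Embedding.refl I₂) 1)
    (fun a ha => ?_) (fun b hb => ?_) hp
  · rw [← ad_one, ad_ad, ad_ad, map_one, mul_one, mul_one]
    exact h.ad_inl_conjJ ha
  · rw [← ad_one, ad_ad, ad_ad, map_one, mul_one, mul_one]
    exact h.ad_inr_conjJ hb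

/-- The roles of the two factors of Z are exchanged: on the tensor product built from `conjJ j u` it
is `u` that acts trivially, which leaves the inversion attached to `conjJ j u`. -/
theorem ad_zed_inv (h : DoubleData u j) {p : Op n I₂}
    (hp : p ∈ ten (sl (dualU (conjJ j u))) (sl (conjJ j u))) :
    ad (swp Unit Unit) (legU (swp Unit Unit) (u⁻¹ * conjJ j u)⁻¹) p =
      ad (swp Unit Unit) (dualU (conjJ j u)) p := by
  conv_rhs => rw [← h.ad_ten hp]
  rw [ad_ad, legU_eq_lu, legU_eq_lu]
  refine ad_congr (by ext; rfl) ?_ p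
  rw [mul_inv_rev, inv_inv, MonoidHom.map_mul]; rfl

end DoubleData

/-- The unitary `V_D`. -/
def doubleU (u : unitary (Op n I₂)) (j : unitary (Op n Unit)) : unitary (Op n I₄) :=
  lu ℓ₁ ℓ₂ ne₁₂ (u⁻¹ * conjJ j u) * lu ℓ₂ ℓ₄ ne₂₄ u * (lu ℓ₁ ℓ₂ ne₁₂ (u⁻¹ * conjJ j u))⁻¹ *
    lu ℓ₁ ℓ₃ ne₁₃ (dualU u)

/-- The twisted comultiplication, carried over along `p ↦ u p u^*`. -/
def doubleV (u : unitary (Op n I₂)) : unitary (Op n I₄) :=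
  lu ℓ₁ ℓ₄ ne₁₄ u * lu ℓ₂ ℓ₄ ne₂₄ u * (lu ℓ₃ ℓ₁ ne₁₃.symm u)⁻¹

namespace DoubleData

variable {u : unitary (Op n I₂)} {j : unitary (Op n Unit)}

/-- Conjugation by the `conjJ j u` contained in Z turns u₂₄ into u₂₄w₁₄ with w = `conjL j u`: this
is `c₁` in the legs 2, 1, 4, conjugated by `j` in leg 1. Conjugation by the remaining u₁₂* leaves
w₁₄ fixed by `c₃` and turns u₂₄ into u₁₄u₂₄ by the pentagon. -/
theorem doubleU_eq (h : DoubleData u j) : doubleU u j = lu ℓ₁ ℓ₄ ne₁₄ u * lu ℓ₂ ℓ₄ ne₂₄ u *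
    lu ℓ₁ ℓ₄ ne₁₄ (conjL j u) * (lu ℓ₃ ℓ₁ ne₁₃.symm u)⁻¹ := by
  have key : ∀ {G : Type} [Group G] (y y' B J a b : G), y' = J * B * J⁻¹ → B * b = b * a * B →
      Commute J b → y * a * b = b * y → Commute y (J * a * J⁻¹) →
      y⁻¹ * y' * b * (y⁻¹ * y')⁻¹ = a * b * (J * a * J⁻¹) := by
    intro G _ y y' B J a b e1 e2 e3 e4 e5
    have e6 : y' * b * y'⁻¹ = b * (J * a * J⁻¹) := by
      calc y' * b * y'⁻¹ = J * B * (J⁻¹ * b) * y'⁻¹ := by rw [e1]; group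
        _ = J * (B * b) * J⁻¹ * y'⁻¹ := by rw [e3.inv_left.eq]; group
        _ = (J * b) * a * (B * J⁻¹ * y'⁻¹) := by rw [e2]; group
        _ = _ := by rw [e3.eq, e1]; group
    calc y⁻¹ * y' * b * (y⁻¹ * y')⁻¹ = y⁻¹ * (y' * b * y'⁻¹) * y := by group
      _ = y⁻¹ * b * ((J * a * J⁻¹) * y) := by rw [e6]; group
      _ = y⁻¹ * (b * y) * (J * a * J⁻¹) := by rw [← e5.eq]; group
      _ = _ := by rw [← e4]; group
  have h' := key _ (lu ℓ₁ ℓ₂ ne₁₂ (conjJ j u)) (lu ℓ₂ ℓ₁ ne₁₂.symm (bigU u j)) (jl ℓ₁ j) _ _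
    (by rw [lu_conjJ, lu_bigU, mul_inv_rev]; group)
    (h.c₁' ne₁₂.symm ne₂₄ ne₁₄) (jl_lu_comm ne₁₂ ne₁₄ ne₂₄ j u)
    (h.mult.pentagon ne₁₂ ne₁₄ ne₂₄)
    (by rw [← lu_conjL _ _ ne₁₄]; exact h.c₃' ne₁₂ ne₁₄ ne₂₄)
  rw [doubleU, MonoidHom.map_mul, MonoidHom.map_inv, h', lu_dualU, ← lu_conjL, MonoidHom.map_inv]

theorem doubleU_eq_mul (h : DoubleData u j) : doubleU u j = doubleV u *
    (lu ℓ₃ ℓ₁ ne₁₃.symm u * lu ℓ₁ ℓ₄ ne₁₄ (conjL j u) * (lu ℓ₃ ℓ₁ ne₁₃.symm u)⁻¹) := by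
  rw [h.doubleU_eq, doubleV]; group

theorem ad_doubleU_inl (h : DoubleData u j) {a : Op n Unit} (ha : a ∈ sl (dualU u)) :
    ad (sg ℓ₁) (doubleU u j) a = ad (sg ℓ₁) (doubleV u) a := by
  refine ad_eq_on_slices (i := ℓ₁) (i' := ℓ₁) _ _ ?_ ha
  -- The pentagon writes x⁻¹ as y(zx)⁻¹y⁻¹, and `w` commutes with zx. So the extra factor ywy⁻¹
  -- commutes with x⁻¹, the unitary from which the algebra in leg 1 is sliced.
  have key : ∀ {G : Type} [Group G] (V y w x z : G), y * z * x = x * y → Commute w z →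
      Commute w x → V * (y * w * y⁻¹) * x⁻¹ * (V * (y * w * y⁻¹))⁻¹ = V * x⁻¹ * V⁻¹ := by
    intro G _ V y w x z e1 e2 e3
    have e4 : x⁻¹ = y * (z * x)⁻¹ * y⁻¹ := by
      have : z * x = y⁻¹ * (x * y) := by rw [← e1]; group
      rw [this]; group
    have e5 : Commute w (z * x)⁻¹ := (e2.mul_right e3).inv_right
    calc V * (y * w * y⁻¹) * x⁻¹ * (V * (y * w * y⁻¹))⁻¹ =
        V * y * (w * (z * x)⁻¹) * w⁻¹ * y⁻¹ * V⁻¹ := by rw [e4]; group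
      _ = V * (y * (z * x)⁻¹ * y⁻¹) * V⁻¹ := by rw [e5.eq]; group
      _ = _ := by rw [← e4]
  rw [h.doubleU_eq_mul, lu_dualU, map_inv, MonoidHom.map_mul, MonoidHom.map_mul,
    MonoidHom.map_mul, MonoidHom.map_inv, legU_lu, legU_lu]
  exact key _ _ _ _ (lu (Sum.inl ℓ₃) (Sum.inr ()) (by simp) u)
    (h.mult.pentagon (κ := I₄ ⊕ Unit) (i := Sum.inl ℓ₃) (j := Sum.inl ℓ₁) (k := Sum.inr ())
      (by decide) (by decide) (by decide))
    (lu_commute _ _ (by decide) (by decide) (by decide) (by decide) _ _)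
    (h.c₃' (κ := I₄ ⊕ Unit) (i := Sum.inl ℓ₁) (k := Sum.inr ()) (l := Sum.inl ℓ₄) (by decide)
      (by decide) (by decide)).symm

/-- The right factor split off in `doubleU_eq_mul` is invisible to the algebra in leg 1 by
`ad_doubleU_inl`, and to leg 2 because it does not act there. -/
theorem ad_doubleU (h : DoubleData u j) {p : Op n I₂} (hp : p ∈ ten (sl (dualU u)) (sl u)) :
    ad (inl : I₂ ↪ I₄) (doubleU u j) p = ad inl (doubleV u) p := by
  refine eq_on_ten (ad (inl : I₂ ↪ I₄) (doubleU u j)) (ad inl (doubleV u)) (fun a ha => ?_)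
    (fun b _ => ?_) hp
  · rw [← ad_one, ad_ad, ad_ad, map_one, mul_one, mul_one]
    exact h.ad_doubleU_inl ha
  · rw [← ad_one, ad_ad, ad_ad, map_one, mul_one, mul_one, h.doubleU_eq_mul]
    refine ad_mul_of_commute _ _ _ ?_
    have c1 : ∀ (i k : I₄) (hik : i ≠ k) (hi : ℓ₂ ≠ i) (hk : ℓ₂ ≠ k) (v : unitary (Op n I₂)),
        Commute (lu i k hik v : Op n I₄) (legHom ((inr : Unit ↪ I₂).trans inl) b) :=
      fun i k hik hi hk v => (legHom_commute _ _ (by rintro _ (_ | _); exacts [hi, hk]) _ _).symm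
    have c2 := c1 ℓ₃ ℓ₁ ne₁₃.symm ne₂₃ ne₁₂.symm
    rw [← MonoidHom.map_inv]
    exact ((c2 u).mul_left (c1 ℓ₁ ℓ₄ ne₁₄ ne₁₂.symm ne₂₄ _)).mul_left (c2 u⁻¹)

theorem word_double {M : Type*} [Monoid M] {k1 k2 v14 v24 w14 x13 a3 b4 : M}
    (h24 : k2 * v24 * k2 = k2 * b4) (h14 : k1 * v14 * b4 = k1 * b4)
    (hw : b4 * k1 * w14 = b4 * k1) (h13 : k1 * x13 * k1 = k1 * a3) (c1 : k2 * v14 = v14 * k2)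
    (c2 : k2 * w14 = w14 * k2) (c3 : k2 * x13 = x13 * k2) (c4 : k2 * b4 = b4 * k2)
    (c5 : k2 * k1 = k1 * k2) (c6 : k1 * b4 = b4 * k1) (c7 : b4 * a3 = a3 * b4)
    (c8 : k2 * a3 = a3 * k2) :
    k1 * k2 * (v14 * v24 * w14 * x13) * (k1 * k2) = k1 * k2 * (a3 * b4) := by
  calc _ = k1 * v14 * (k2 * v24 * k2) * w14 * x13 * k1 := by
        simp only [mul_assoc, mul_swap c1, mul_swap c2, mul_swap c3, c5]
    _ = (k1 * v14 * b4) * (w14 * x13 * k1) * k2 := by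
        rw [h24]; simp only [mul_assoc, mul_swap c4, mul_swap c2, mul_swap c3, c5]
    _ = (b4 * k1 * w14) * x13 * k1 * k2 := by rw [h14, c6]; simp only [mul_assoc]
    _ = b4 * (k1 * x13 * k1) * k2 := by rw [hw]; simp only [mul_assoc]
    _ = k1 * k2 * (a3 * b4) := by
      rw [h13]; simp only [mul_assoc, ← mul_swap c6, mul_swap c7, c4, mul_swap c8]

/-- Compressed by compact operators in leg 2, u₂₄ produces `sl u` in leg 4. That algebra, together
with the compact operators in leg 1, absorbs both unitaries in legs 1, 4, one from either side. Only
`dualU u` in legs 1, 3 is left, and it produces the algebra in leg 3. -/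
theorem slices_doubleU (h : DoubleData u j) :
    slices (Equiv.refl (I₂ ⊕ I₂)) (doubleU u j : Op n I₄) = ten (sl (dualU u)) (sl u) := by
  refine slices_eq _ ?_
  have e1 : legC (embL (Equiv.refl (I₂ ⊕ I₂))) (cpt n I₂) = kc ℓ₁ * kc ℓ₂ := by
    rw [← ten_cpt, ten_unit, map_mul, legC_lc, legC_lc]; rfl
  have e2 : legC (embR (Equiv.refl (I₂ ⊕ I₂))) (ten (sl (dualU u)) (sl u)) =
      lc ℓ₃ (sl (dualU u)) * lc ℓ₄ (sl u) := by
    rw [ten_unit, map_mul, legC_lc, legC_lc]; rfl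
  have e3 : line (doubleU u j : Op n I₄) = uv ℓ₁ ℓ₄ ne₁₄ u * uv ℓ₂ ℓ₄ ne₂₄ u *
      uv ℓ₁ ℓ₄ ne₁₄ (conjL j u) * uv ℓ₁ ℓ₃ ne₁₃ (dualU u) := by
    rw [← coe_uline, h.doubleU_eq, uline_mul, uline_mul, uline_mul, ← map_inv, ← lu_dualU]; rfl
  have hw : lc ℓ₄ (sl u) * kc ℓ₁ * uv ℓ₁ ℓ₄ ne₁₄ u = lc ℓ₄ (sl u) * kc ℓ₁ := by
    have := congrArg star (h.mult.uv_inv_mul_lc ne₁₄)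
    simpa only [star_mul, star_lc, star_uv, inv_inv, star_cpt, h.mult.star_sl] using this
  have hw' : lc ℓ₄ (sl u) * kc ℓ₁ * uv ℓ₁ ℓ₄ ne₁₄ (conjL j u) = lc ℓ₄ (sl u) * kc ℓ₁ := by
    have e : uv ℓ₁ ℓ₄ ne₁₄ (conjL j u) = ju ℓ₁ j * uv ℓ₁ ℓ₄ ne₁₄ u * ju ℓ₁ j⁻¹ := by
      rw [uv, lu_conjL, uline_mul, uline_mul, ← MonoidHom.map_inv]; rfl
    rw [e, ← mul_assoc, ← mul_assoc, mul_assoc _ (kc ℓ₁), kc_mul_ju, hw, mul_assoc, kc_mul_ju]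
  rw [e1, e2, e3]
  exact word_double (kc_mul_sl ne₂₄ u) (h.mult.kc_mul_uv_mul_lc ne₁₄) hw'
    (kc_mul_sl ne₁₃ (dualU u)) (lc_uv_comm ne₁₂.symm ne₂₄ ne₁₄ _ _)
    (lc_uv_comm ne₁₂.symm ne₂₄ ne₁₄ _ _) (lc_uv_comm ne₁₂.symm ne₂₃ ne₁₃ _ _)
    (lc_comm ne₂₄ _ _) (lc_comm ne₁₂.symm _ _) (lc_comm ne₁₄ _ _) (lc_comm ne₃₄.symm _ _)
    (lc_comm ne₂₃ _ _)

/-- Three pentagons and one commutation. Read on elements of the first copy, the identity says that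
p ↦ upu* intertwines the comultiplications implemented by `doubleV u` and `twistU u`. -/
theorem doubleV_eq (h : DoubleData u j) :
    tenU u u * doubleV u = twistU u * legU (inl : I₂ ↪ I₄) u := by
  have key : ∀ {G : Type} [Group G] (y12 y34 y14 y24 y31 y32 : G), y12 * y14 * y24 = y24 * y12 →
      y31 * y32 * y12 = y12 * y31 → y31 * y34 * y14 = y14 * y31 → Commute y24 y31 →
      y12 * y34 * (y14 * y24 * y31⁻¹) = y32⁻¹ * y31⁻¹ * y24 * y12 := by
    intro G _ y12 y34 y14 y24 y31 y32 p1 p2 p3 c1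
    have e1 : y32⁻¹ * y31⁻¹ = y12 * y31⁻¹ * y12⁻¹ := by
      rw [← mul_inv_rev, show y31 * y32 = y12 * y31 * y12⁻¹ by rw [← p2]; group]; group
    have e2 : y34 * y14 = y31⁻¹ * y14 * y31 := by
      rw [mul_assoc y31⁻¹, ← p3]; group
    calc _ = y12 * (y34 * y14) * (y24 * y31⁻¹) := by group
      _ = y12 * y31⁻¹ * y14 * y31 * (y31⁻¹ * y24) := by rw [e2, c1.inv_right.eq]; group
      _ = y12 * y31⁻¹ * y12⁻¹ * (y12 * y14 * y24) := by group
      _ = _ := by rw [p1, e1]; group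
  rw [doubleV, twistU, tenU, legU_eq_lu, legU_eq_lu, lu_dualU, lu_dualU, map_inv, map_inv]
  exact key _ _ _ _ _ _ (h.mult.pentagon ne₁₂ ne₁₄ ne₂₄)
    (h.mult.pentagon ne₁₃.symm ne₂₃.symm ne₁₂) (h.mult.pentagon ne₁₃.symm ne₃₄ ne₁₄)
    (lu_commute _ _ ne₂₃ ne₁₂.symm ne₃₄.symm ne₁₄.symm _ _)

theorem push_refl (h : DoubleData u j) : push (ad (Function.Embedding.refl I₂) u)
    (ten (sl (dualU u)) (sl u)) = ten (sl (dualU u)) (sl u) := by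
  have h0 : (Sum.inl () : I₂) ≠ Sum.inr () := by simp
  have h1 := congrArg star (h.mult.uv_mul_tensor h0)
  simp only [star_mul, star_lc, star_uv, h.mult.star_sl, h.mult.dual.star_sl] at h1
  rw [push_ad, legC_refl, ten_unit, ← uv_inl_inr, ← uv_inl_inr, h.mult.uv_mul_tensor h0,
    lc_comm h0, h1]

theorem ad_tenU_doubleV (h : DoubleData u j) (p : Op n I₂) :
    ad (Function.Embedding.refl I₄) (tenU u u) (ad (inl : I₂ ↪ I₄) (doubleV u) p) =
      ad inl (twistU u) (ad (Function.Embedding.refl I₂) u p) := by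
  rw [ad_ad, ad_ad, legU_refl, h.doubleV_eq]
  exact ad_congr (by ext; rfl) rfl p

theorem push_ad_ad {ι κ ν : Type} [Fintype ι] [Fintype κ] [Fintype ν] (f : κ ↪ ν)
    (V : unitary (Op n ν)) (e : ι ↪ κ) (W : unitary (Op n κ)) (M : CS (Op n ι)) :
    push (ad f V) (push (ad e W) M) = push (ad (e.trans f) (V * legU f W)) M := by
  rw [push_push]
  exact push_congr fun a _ => ad_ad f V e W a

theorem push_ad_refl_one {ι : Type} [Fintype ι] (M : CS (Op n ι)) :
    push (ad (Function.Embedding.refl ι) 1) M = M := by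
  rw [push_ad, legC_refl, inv_one, coe_uline, OneMemClass.coe_one, map_one, one_mul, mul_one]

theorem push_ad_refl_injective {ι : Type} [Fintype ι] (W : unitary (Op n ι)) :
    Function.Injective (push (ad (Function.Embedding.refl ι) W)) := by
  refine Function.LeftInverse.injective (g := push (ad (Function.Embedding.refl ι) W⁻¹))
    fun N => ?_
  rw [push_ad_ad, legU_refl, inv_mul_cancel]
  exact push_ad_refl_one N

theorem sumMap_refl (ι κ : Type) : (Function.Embedding.refl ι).sumMap (Function.Embedding.refl κ) =
    Function.Embedding.refl (ι ⊕ κ) := by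
  ext x; rcases x with _ | _ <;> rfl

theorem push_tenU (h : DoubleData u j) : push (ad (Function.Embedding.refl I₄) (tenU u u))
    (ten (ten (sl (dualU u)) (sl u)) (ten (sl (dualU u)) (sl u))) =
      ten (ten (sl (dualU u)) (sl u)) (ten (sl (dualU u)) (sl u)) := by
  have := push_ad_ten (Function.Embedding.refl I₂) (Function.Embedding.refl I₂) u u
    (ten (sl (dualU u)) (sl u)) (ten (sl (dualU u)) (sl u))
  rwa [h.push_refl, sumMap_refl] at this

theorem push_doubleV (h : DoubleData u j) :
    push (ad (inl : I₂ ↪ I₄) (doubleV u)) (ten (sl (dualU u)) (sl u)) *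
        ten (ten (sl (dualU u)) (sl u)) (ten (sl (dualU u)) (sl u)) =
      ten (ten (sl (dualU u)) (sl u)) (ten (sl (dualU u)) (sl u)) := by
  -- Nondegeneracy is transported from `push_twist` by conjugation with u ⊗ u, which preserves the
  -- tensor square of the algebra.
  refine push_ad_refl_injective (tenU u u) ?_
  have e2 : push (ad (Function.Embedding.refl I₄) (tenU u u))
      (push (ad (inl : I₂ ↪ I₄) (doubleV u)) (ten (sl (dualU u)) (sl u))) =
      push (ad (inl : I₂ ↪ I₄) (twistU u)) (ten (sl (dualU u)) (sl u)) := by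
    conv_rhs => rw [← h.push_refl]
    rw [push_ad_ad, push_ad_ad, legU_refl, h.doubleV_eq]; rfl
  rw [MonoidHom.map_mul, h.push_tenU]
  refine (congrArg (· * _) e2).trans h.mult.push_twist

/-- Coassociativity up to `C` is stable under the change V = (a ⊗ a)⁻¹W(a ⊗ 1), provided that `C`
has no leg in the first copy. It is applied with W = `twistU u`, V = `doubleV u` and a = `u`. -/
theorem word_transport {G : Type*} [Group G] {V12 V13 V23 W12 W13 W23 a1 a2 a3 C : G}
    (h12 : a1 * a2 * V12 = W12 * a1) (h13 : a1 * a3 * V13 = W13 * a1)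
    (h23 : a2 * a3 * V23 = W23 * a2) (h : W12 * W13 = W23 * W12 * C) (c1 : Commute a3 W12)
    (c2 : Commute a1 W23) (c3 : Commute a1 C) (c4 : Commute a1 a3) (c5 : Commute a2 a3) : V12 * V13 = V23 * V12 * C := by
  have e12 : V12 = a2⁻¹ * a1⁻¹ * W12 * a1 := by
    rw [mul_assoc _ W12, ← h12]; group
  have e13 : V13 = a1⁻¹ * a3⁻¹ * W13 * a1 := by
    rw [mul_assoc _ W13, ← h13, c4.eq]; group
  have e23 : V23 = a3⁻¹ * a2⁻¹ * W23 * a2 := by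
    rw [mul_assoc _ W23, ← h23]; group
  calc V12 * V13 = a2⁻¹ * a1⁻¹ * (W12 * a3⁻¹) * W13 * a1 := by rw [e12, e13]; group
    _ = (a2⁻¹ * (a1⁻¹ * a3⁻¹)) * (W12 * W13) * a1 := by rw [c1.symm.inv_right.eq]; group
    _ = (a2⁻¹ * a3⁻¹) * a1⁻¹ * W23 * W12 * (C * a1) := by rw [h, c4.inv_inv.eq]; group
    _ = a3⁻¹ * a2⁻¹ * (a1⁻¹ * W23) * W12 * a1 * C := by rw [c5.inv_inv.eq, ← c3.eq]; group
    _ = _ := by rw [c2.inv_left.eq, e23, e12]; group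

theorem isCStarBialgebra_double (h : DoubleData u j) {δ : Op n I₂ → Op n I₄}
    (hδ : ∀ T, δ T = ad inl (doubleU u j) T) :
    IsCStarBialgebra ⟨(ten (sl (dualU u)) (sl u) : Set (Op n I₂)), δ⟩ := by
  refine isCStarBialgebra_of (h.mult.dual.isCStar.ten h.mult.isCStar) (W := doubleV u)
    ⟨⟨_, hδ⟩, fun a ha => (hδ a).trans (h.ad_doubleU ha)⟩ h.push_doubleV
    (coassoc_of_mul (lu ℓ₃ ℓ₁ ne₁₃.symm u * lu ℓ₂ ℓ₄ ne₂₄ u⁻¹) ?_)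
  have hV := h.doubleV_eq
  have key : ∀ (f : I₂ ⊕ I₂ ↪ I₂ ⊕ (I₂ ⊕ I₂)), legU (inl.trans f) u * legU (inr.trans f) u *
      legU f (doubleV u) = legU f (twistU u) * legU (inl.trans f) u := fun f => by
    have := congrArg (legU f) hV
    rwa [MonoidHom.map_mul, MonoidHom.map_mul, tenU, MonoidHom.map_mul, legU_legU, legU_legU]
      at this
  have hc : ∀ {ι ρ : Type} [Fintype ι] [Fintype ρ] (e : ι ↪ I₂ ⊕ (I₂ ⊕ I₂))
      (f : ρ ↪ I₂ ⊕ (I₂ ⊕ I₂)) (_ : ∀ i k, e i ≠ f k) (S : unitary (Op n ι))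
      (T : unitary (Op n ρ)), Commute (legU e S) (legU f T) := fun e f hef S T =>
    Subtype.ext (legHom_commute e f hef _ _)
  exact word_transport (key ((Function.Embedding.refl I₂).sumMap inl))
    (key ((Function.Embedding.refl I₂).sumMap inr)) (key inr) h.mult.twist_coassoc
    (hc _ _ (by rintro _ (_ | _) <;> simp) _ _) (hc _ _ (by simp) _ _) (hc _ _ (by simp) _ _)
    (hc _ _ (by simp) _ _) (hc _ _ (by simp) _ _)

theorem bialgIso_double (h : DoubleData u j) {δ : Op n I₂ → Op n I₄}
    (hδ : ∀ T, δ T = ad inl (doubleU u j) T) :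
    BialgIso ⟨(ten (sl (dualU u)) (sl u) : Set (Op n I₂)), δ⟩
      ⟨(ten (sl (dualU u)) (sl u) : Set (Op n I₂)), ad (inl : I₂ ↪ I₄) (twistU u)⟩ := by
  have hM := h.mult.dual.isCStar.ten h.mult.isCStar
  refine ⟨ad (Function.Embedding.refl I₂) u, ad (Function.Embedding.refl I₄) (tenU u u), ?_, ?_,
    fun a ha => ?_⟩
  · exact isIso_ad hM.star_eq hM.star_eq hM.mul_self (Equiv.refl I₂) u h.push_refl _
      (fun _ => rfl) (fun _ _ => rfl)
  · have := isTensorMap_ad hM.star_eq hM.star_eq hM.star_eq hM.star_eq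
      (φ := ad (Function.Embedding.refl I₂) u) (ψ := ad (Function.Embedding.refl I₂) u)
      (Function.Embedding.refl I₂) (Function.Embedding.refl I₂) u u (fun _ _ => rfl)
      (fun _ _ => rfl) (by rw [h.push_refl, hM.mul_self]) (by rw [h.push_refl, hM.mul_self])
    rwa [sumMap_refl] at this
  · change ad _ _ (δ a) = _
    rw [hδ, h.ad_doubleU ha, h.ad_tenU_doubleV]

end DoubleData
end DoubleData

/-! ### Conjugation by j ⊗ j -/

section Conjugate

open Function.Embedding (inl inr)

theorem conj_of_eq {κ : Type} [Fintype κ] {i k : κ} (h : i ≠ k) (j : unitary (Op n Unit))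
    (v : unitary (Op n I₂)) {T R : unitary (Op n κ)} (hT : T = jl i j * jl k j * R)
    (hR : Commute R (lu i k h v)) : lu i k h (conjJ j v) = T * lu i k h v * T⁻¹ := by
  rw [lu_conjJ, hT, mul_inv_rev (jl i j * jl k j), mul_assoc (jl i j * jl k j) R, hR.eq]
  group

theorem twistU_conjJ (u : unitary (Op n I₂)) (j : unitary (Op n Unit)) :
    twistU (conjJ j u) =
      tenU (tenU j j) (tenU j j) * twistU u * (tenU (tenU j j) (tenU j j))⁻¹ := by
  have hT : tenU (tenU j j) (tenU j j) = jl ℓ₁ j * jl ℓ₂ j * (jl ℓ₃ j * jl ℓ₄ j) := by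
    rw [tenU, tenU, MonoidHom.map_mul, MonoidHom.map_mul, legU_legU, legU_legU, legU_legU,
      legU_legU]; rfl
  have c := fun {i k : I₄} (h : i ≠ k) => (jl_comm h j).eq
  have e1 := conj_of_eq ne₂₃ j (dualU u) (T := tenU (tenU j j) (tenU j j))
    (R := jl ℓ₁ j * jl ℓ₄ j) (by
      rw [hT]
      simp only [mul_assoc, mul_swap (c ne₁₂), mul_swap (c ne₁₃)])
    ((jl_lu_comm ne₁₂ ne₁₃ ne₂₃ j _).mul_left (jl_lu_comm ne₂₄.symm ne₃₄.symm ne₂₃ j _))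
  have e2 := conj_of_eq ne₁₃ j (dualU u) (T := tenU (tenU j j) (tenU j j))
    (R := jl ℓ₂ j * jl ℓ₄ j) (by
      rw [hT]
      simp only [mul_assoc, mul_swap (c ne₂₃)])
    ((jl_lu_comm ne₁₂.symm ne₂₃ ne₁₃ j _).mul_left (jl_lu_comm ne₁₄.symm ne₃₄.symm ne₁₃ j _))
  have e3 := conj_of_eq ne₂₄ j u (T := tenU (tenU j j) (tenU j j))
    (R := jl ℓ₁ j * jl ℓ₃ j) (by
      rw [hT]
      simp only [mul_assoc, mul_swap (c ne₁₂), mul_swap (c ne₁₄), c ne₃₄])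
    ((jl_lu_comm ne₁₂ ne₁₄ ne₂₄ j _).mul_left (jl_lu_comm ne₂₃.symm ne₃₄ ne₂₄ j _))
  rw [twistU, twistU, dualU_conjJ, e1, e2, e3]
  group

theorem ten_conjJ (u : unitary (Op n I₂)) (j : unitary (Op n Unit)) :
    push (ad (Function.Embedding.refl I₂) (tenU j j)) (ten (sl (dualU u)) (sl u)) =
      ten (sl (dualU (conjJ j u))) (sl (conjJ j u)) := by
  have := push_ad_ten (Function.Embedding.refl Unit) (Function.Embedding.refl Unit) j j
    (sl (dualU u)) (sl u)
  rwa [DoubleData.sumMap_refl, ← sl_conjJ, ← sl_conjJ, ← dualU_conjJ] at this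

theorem IsMultUnitary.bialgIso_conjJ {u : unitary (Op n I₂)} (hu : IsMultUnitary u)
    (j : unitary (Op n Unit)) :
    BialgIso ⟨(ten (sl (dualU u)) (sl u) : Set (Op n I₂)), ad (inl : I₂ ↪ I₄) (twistU u)⟩
      ⟨(ten (sl (dualU (QDouble.conjJ j u))) (sl (QDouble.conjJ j u)) : Set (Op n I₂)),
        ad (inl : I₂ ↪ I₄) (twistU (QDouble.conjJ j u))⟩ := by
  have hM := hu.dual.isCStar.ten hu.isCStar
  have hN := (hu.conjJ j).dual.isCStar.ten (hu.conjJ j).isCStar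
  have hp := ten_conjJ u j
  refine ⟨ad (Function.Embedding.refl I₂) (tenU j j),
    ad (Function.Embedding.refl I₄) (tenU (tenU j j) (tenU j j)), ?_, ?_, fun a _ => ?_⟩
  · exact isIso_ad hM.star_eq hN.star_eq hN.mul_self (Equiv.refl I₂) (tenU j j) hp _
      (fun _ => rfl) (fun _ _ => rfl)
  · have := isTensorMap_ad hM.star_eq hN.star_eq hM.star_eq hN.star_eq
      (φ := ad (Function.Embedding.refl I₂) (tenU j j))
      (ψ := ad (Function.Embedding.refl I₂) (tenU j j))
      (Function.Embedding.refl I₂) (Function.Embedding.refl I₂) (tenU j j) (tenU j j)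
      (fun _ _ => rfl) (fun _ _ => rfl) (by rw [hp, hN.mul_self]) (by rw [hp, hN.mul_self])
    rwa [DoubleData.sumMap_refl] at this
  · change ad _ _ (ad _ _ a) = ad _ _ (ad _ _ a)
    rw [ad_ad, ad_ad, legU_refl, twistU_conjJ]
    -- Conjugating `twistU u` uses j in all four legs, and the isomorphism itself accounts for the
    -- first two. The leftover pair acts on the second copy and commutes with `a`.
    have e : (tenU (tenU j j) (tenU j j))⁻¹ * legU (inl : I₂ ↪ I₄) (tenU j j) =
        (legU (inr : I₂ ↪ I₄) (tenU j j))⁻¹ := by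
      have hc : Commute (legU (inl : I₂ ↪ I₄) (tenU j j)) (legU (inr : I₂ ↪ I₄) (tenU j j)) :=
        Subtype.ext (legHom_commute _ _ (fun _ _ => Sum.inl_ne_inr) _ _)
      have hT : tenU (tenU j j) (tenU j j) =
          legU (inl : I₂ ↪ I₄) (tenU j j) * legU (inr : I₂ ↪ I₄) (tenU j j) := rfl
      rw [hT, mul_inv_rev, inv_mul_cancel_right]
    rw [mul_assoc _ _ (legU (inl : I₂ ↪ I₄) (tenU j j)), e, ← MonoidHom.map_inv]
    exact (ad_mul_of_commute _ _ _ (legHom_commute _ _ (fun _ _ => Sum.inr_ne_inl) _ _)).symm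

end Conjugate

/-! ### Monomial operators -/

section Monomial

open scoped ENNReal

/-- A weighted change of variables `f ↦ w · (f ∘ θ)` which is isometric on `L²`. -/
@[ext]
structure Mon (n : ℕ) (κ : Type) [Fintype κ] where
  w : (κ → G n) → ℂ
  θ : (κ → G n) → κ → G n
  measurable_w : Measurable w
  measurable_θ : Measurable θ
  ne_zero : ∀ p, w p ≠ 0
  lintegral_eq : ∀ f : (κ → G n) → ℝ≥0∞, Measurable f →
    ∫⁻ p, ‖w p‖ₑ ^ 2 * f (θ p) = ∫⁻ p, f p

namespace Mon

variable {ι κ ρ : Type} [Fintype ι] [Fintype κ] [Fintype ρ]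

/-- For the indicator of a null set the change of variables formula has right-hand side zero, and
the weight never vanishes, so the preimage is null. Composition with θ is thus well defined on
classes of functions. -/
theorem quasi (m : Mon n κ) : Measure.QuasiMeasurePreserving m.θ := by
  refine ⟨m.measurable_θ, Measure.AbsolutelyContinuous.mk fun N hN h0 => ?_⟩
  rw [Measure.map_apply m.measurable_θ hN]
  have h := m.lintegral_eq (N.indicator 1) (measurable_one.indicator hN)
  rw [lintegral_indicator_one hN, h0, lintegral_eq_zero_iff] at h
  · refine measure_mono_null (fun p hp => ?_) (ae_iff.1 h)
    have : m.θ p ∈ N := hp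
    simp [this, m.ne_zero p]
  · exact (m.measurable_w.enorm.pow_const 2).mul
      ((measurable_one.indicator hN).comp m.measurable_θ)

/-- The action on functions. -/
def act (m : Mon n κ) (f : (κ → G n) → ℂ) (p : κ → G n) : ℂ := m.w p * f (m.θ p)

theorem act_congr (m : Mon n κ) {f g : (κ → G n) → ℂ} (h : f =ᵐ[volume] g) :
    m.act f =ᵐ[volume] m.act g := by
  filter_upwards [m.quasi.ae_eq_comp h] with p hp
  exact congrArg (m.w p * ·) hp

theorem eLpNorm_two_sq (f : (κ → G n) → ℂ) :
    eLpNorm f 2 volume = (∫⁻ p, ‖f p‖ₑ ^ 2) ^ (1 / 2 : ℝ) := by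
  rw [eLpNorm_eq_lintegral_rpow_enorm_toReal (by norm_num) (by norm_num)]
  simp

theorem eLpNorm_act (m : Mon n κ) (ξ : HH n κ) :
    eLpNorm (m.act ξ) 2 volume = eLpNorm ξ 2 volume := by
  rw [eLpNorm_two_sq, eLpNorm_two_sq, ← m.lintegral_eq (fun p => ‖ξ p‖ₑ ^ 2)
    ((Lp.stronglyMeasurable ξ).measurable.enorm.pow_const 2)]
  simp only [act, enorm_mul, mul_pow]

theorem memLp_act (m : Mon n κ) (ξ : HH n κ) : MemLp (m.act ξ) 2 volume :=
  ⟨(m.measurable_w.mul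
      ((Lp.stronglyMeasurable ξ).measurable.comp m.measurable_θ)).aestronglyMeasurable,
    by rw [m.eLpNorm_act]; exact Lp.eLpNorm_lt_top ξ⟩

/-- The isometry of `L²` given by a monomial. -/
def toIsometry (m : Mon n κ) : HH n κ →ₗᵢ[ℂ] HH n κ where
  toFun ξ := toL2 (m.act ξ)
  map_add' ξ η := Lp.ext <| by
    filter_upwards [coeFn_toL2 (m.memLp_act (ξ + η)), coeFn_toL2 (m.memLp_act ξ),
      coeFn_toL2 (m.memLp_act η), Lp.coeFn_add (toL2 (m.act ξ)) (toL2 (m.act η)),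
      m.act_congr (Lp.coeFn_add ξ η)] with p h1 h2 h3 h4 h5
    rw [h1, h4, Pi.add_apply, h2, h3, h5]
    simp only [act, Pi.add_apply, mul_add]
  map_smul' c ξ := Lp.ext <| by
    filter_upwards [coeFn_toL2 (m.memLp_act (c • ξ)), coeFn_toL2 (m.memLp_act ξ),
      Lp.coeFn_smul c (toL2 (m.act ξ)), m.act_congr (Lp.coeFn_smul c ξ)] with p h1 h2 h3 h4
    rw [h1, RingHom.id_apply, h3, Pi.smul_apply, h2, h4]
    simp only [act, Pi.smul_apply, smul_eq_mul, mul_left_comm]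
  norm_map' ξ := by
    change ‖toL2 (m.act ξ)‖ = ‖ξ‖
    rw [toL2_of_memLp (m.memLp_act ξ), Lp.norm_toLp, m.eLpNorm_act, Lp.norm_def]

/-- The bounded operator given by a monomial. -/
def toOp (m : Mon n κ) : Op n κ := m.toIsometry.toContinuousLinearMap

theorem toOp_apply (m : Mon n κ) (ξ : HH n κ) : m.toOp ξ = toL2 (m.act ξ) := rfl

theorem coeFn_toOp (m : Mon n κ) (ξ : HH n κ) : ⇑(m.toOp ξ) =ᵐ[volume] m.act ξ :=
  coeFn_toL2 (m.memLp_act ξ)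

theorem toOp_eq_opOf (m : Mon n κ) {F : HH n κ → HH n κ} (h : ∀ ξ, m.toOp ξ = F ξ) :
    opOf F = m.toOp := by
  have hex : ∃ T : Op n κ, ∀ ξ, T ξ = F ξ := ⟨_, h⟩
  rw [opOf, dif_pos hex]
  ext1 ξ
  rw [hex.choose_spec, h]

/-- Point maps compose in the opposite order, since operators act on functions by pullback. With
this convention `toOp` is multiplicative. -/
instance : Monoid (Mon n κ) where
  mul a b :=
    { w := fun p => a.w p * b.w (a.θ p)
      θ := fun p => b.θ (a.θ p)
      measurable_w := a.measurable_w.mul (b.measurable_w.comp a.measurable_θ)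
      measurable_θ := b.measurable_θ.comp a.measurable_θ
      ne_zero := fun p => mul_ne_zero (a.ne_zero p) (b.ne_zero _)
      lintegral_eq := fun f hf => by
        rw [← b.lintegral_eq f hf, ← a.lintegral_eq (fun p => ‖b.w p‖ₑ ^ 2 * f (b.θ p))
          ((b.measurable_w.enorm.pow_const 2).mul (hf.comp b.measurable_θ))]
        simp only [enorm_mul, mul_pow, mul_assoc] }
  one :=
    { w := fun _ => 1
      θ := id
      measurable_w := measurable_const
      measurable_θ := measurable_id
      ne_zero := fun _ => one_ne_zero
      lintegral_eq := fun f _ => by simp }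
  mul_assoc a b c := Mon.ext (funext fun p => mul_assoc _ _ _) rfl
  one_mul a := Mon.ext (funext fun p => one_mul _) rfl
  mul_one a := Mon.ext (funext fun p => mul_one _) rfl

theorem mul_w (a b : Mon n κ) (p : κ → G n) : (a * b).w p = a.w p * b.w (a.θ p) := rfl
theorem mul_θ (a b : Mon n κ) (p : κ → G n) : (a * b).θ p = b.θ (a.θ p) := rfl

theorem act_mul (a b : Mon n κ) (f : (κ → G n) → ℂ) : (a * b).act f = a.act (b.act f) :=
  funext fun p => by simp only [act, mul_w, mul_θ, mul_assoc]

/-- `toOp` as a homomorphism. -/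
def toOpHom : Mon n κ →* Op n κ where
  toFun := toOp
  map_one' := by
    ext1 ξ
    rw [toOp_apply]
    exact (toL2_congr (Filter.Eventually.of_forall fun p => one_mul (ξ p))).trans (toL2_coeFn ξ)
  map_mul' a b := by
    ext1 ξ
    rw [mul_apply_eq_comp, toOp_apply, toOp_apply, act_mul]
    exact toL2_congr (a.act_congr (b.coeFn_toOp ξ).symm)

theorem star_toOp_mul (m : Mon n κ) : star m.toOp * m.toOp = 1 :=
  m.toIsometry.adjoint_comp_self

/-- The unitary given by an invertible monomial. -/
def toU : (Mon n κ)ˣ →* unitary (Op n κ) where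
  toFun m := ⟨toOp m.1, Unitary.mem_iff.2 ⟨star_toOp_mul m.1, by
    have h : toOp m.1 * toOp (m⁻¹).1 = 1 := by
      rw [← map_one (toOpHom (n := n) (κ := κ)), ← m.mul_inv]; exact (toOpHom.map_mul _ _).symm
    -- An isometry with a right inverse has that inverse as its adjoint.
    have : star (toOp m.1) = toOp (m⁻¹).1 := by
      rw [← mul_one (star _), ← h, ← mul_assoc, star_toOp_mul, one_mul]
    rw [this, h]⟩⟩
  map_one' := Subtype.ext toOpHom.map_one
  map_mul' a b := Subtype.ext (toOpHom.map_mul a.1 b.1)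

theorem coe_toU (m : (Mon n κ)ˣ) : (toU m : Op n κ) = toOp m.1 := rfl

open scoped Classical in
/-- Transformation of the coordinates in the range of `e`. -/
def legMap (e : ι ↪ κ) (θ : (ι → G n) → ι → G n) (p : κ → G n) : κ → G n :=
  Function.extend e (θ fun i => p (e i)) p

theorem legMap_apply (e : ι ↪ κ) (θ : (ι → G n) → ι → G n) (p : κ → G n) (i : ι) :
    legMap e θ p (e i) = θ (fun i => p (e i)) i := e.injective.extend_apply _ _ _

theorem legMap_of_ne (e : ι ↪ κ) (θ : (ι → G n) → ι → G n) (p : κ → G n) {k : κ}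
    (h : ∀ i, e i ≠ k) : legMap e θ p k = p k :=
  Function.extend_apply' _ _ _ fun ⟨i, hi⟩ => h i hi

theorem legMap_split (e : ι ↪ κ) (s : ι ⊕ ρ ≃ κ) (h : ∀ i, s (Sum.inl i) = e i)
    (θ : (ι → G n) → ι → G n) (p : κ → G n) :
    legMap e θ p = (split n s).symm (θ (split n s p).1, (split n s p).2) := by
  refine (split n s).injective ?_
  rw [(split n s).apply_symm_apply, split_apply, split_apply]
  refine Prod.ext (funext fun i => ?_) (funext fun k => ?_)
  · simp only [h, legMap_apply]
  · exact legMap_of_ne _ _ _ fun i hi => by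
      rw [← h] at hi; exact Sum.inl_ne_inr (s.injective hi)

/-- The leg embedding of monomials. -/
def leg (e : ι ↪ κ) : Mon n ι →* Mon n κ where
  toFun m :=
    { w := fun p => m.w fun i => p (e i)
      θ := legMap e m.θ
      measurable_w := m.measurable_w.comp (by fun_prop)
      measurable_θ := by
        obtain ⟨ρ, _, s, hs⟩ := exists_split e
        rw [funext (legMap_split e s hs m.θ)]
        exact (split n s).symm.measurable.comp
          (((m.measurable_θ.comp measurable_fst).prodMk measurable_snd).comp
            (split n s).measurable)
      ne_zero := fun p => m.ne_zero _
      lintegral_eq := fun f hf => by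
        obtain ⟨ρ, _, s, hs⟩ := exists_split e
        have hmp := measurePreserving_split (n := n) s
        have hf' : Measurable fun z => f ((split n s).symm z) :=
          hf.comp (split n s).symm.measurable
        have hw : Measurable fun z : (ι → G n) × (ρ → G n) =>
            ‖m.w z.1‖ₑ ^ 2 * f ((split n s).symm (m.θ z.1, z.2)) :=
          ((m.measurable_w.comp measurable_fst).enorm.pow_const 2).mul
            (hf'.comp ((m.measurable_θ.comp measurable_fst).prodMk measurable_snd))
        -- By Tonelli, the integral over the transformed block of legs is taken first, with the
        -- other coordinates fixed. There the formula for `m` applies.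
        have e1 : ∀ g : (κ → G n) → ℝ≥0∞, Measurable g →
            ∫⁻ p, g p = ∫⁻ b, ∫⁻ a, g ((split n s).symm (a, b)) := fun g hg => by
          rw [← lintegral_prod_symm' (fun z => g ((split n s).symm z))
            (hg.comp (split n s).symm.measurable)]
          exact (hmp.symm.lintegral_comp hg).symm
        have e2 : (fun p => ‖m.w fun i => p (e i)‖ₑ ^ 2 * f (legMap e m.θ p)) =
            fun p => (fun z : (ι → G n) × (ρ → G n) =>
              ‖m.w z.1‖ₑ ^ 2 * f ((split n s).symm (m.θ z.1, z.2))) (split n s p) := by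
          funext p
          simp only [legMap_split e s hs, split_apply, hs]
        rw [e2, e1 f hf]
        refine (e1 _ (hw.comp (split n s).measurable)).trans ?_
        refine lintegral_congr fun b => ?_
        simp only [Function.comp_apply, (split n s).apply_symm_apply]
        exact m.lintegral_eq (fun a => f ((split n s).symm (a, b)))
          (hf'.comp (measurable_id.prodMk measurable_const)) }
  map_one' := by
    refine Mon.ext rfl (funext fun p => funext fun k => ?_)
    by_cases h : ∃ i, e i = k
    · obtain ⟨i, rfl⟩ := h
      exact legMap_apply _ _ _ _
    · exact legMap_of_ne _ _ _ (not_exists.1 h)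
  map_mul' a b := by
    have key : ∀ p : κ → G n, (fun i => legMap e a.θ p (e i)) = a.θ fun i => p (e i) :=
      fun p => funext fun i => legMap_apply _ _ _ _
    refine Mon.ext (funext fun p => ?_) (funext fun p => funext fun k => ?_)
    · change a.w _ * b.w _ = a.w _ * b.w fun i => legMap e a.θ p (e i)
      rw [key]
    · change legMap e (fun p => b.θ (a.θ p)) p k = legMap e b.θ (legMap e a.θ p) k
      by_cases h : ∃ i, e i = k
      · obtain ⟨i, rfl⟩ := h
        rw [legMap_apply, legMap_apply, key]
      · have h := not_exists.1 h
        rw [legMap_of_ne _ _ _ h, legMap_of_ne _ _ _ h, legMap_of_ne _ _ _ h]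

theorem leg_w (e : ι ↪ κ) (m : Mon n ι) (p : κ → G n) : (leg e m).w p = m.w fun i => p (e i) :=
  rfl

theorem leg_θ (e : ι ↪ κ) (m : Mon n ι) : (leg e m).θ = legMap e m.θ := rfl

theorem toOp_leg (e : ι ↪ κ) (m : Mon n ι) : toOp (leg e m) = legHom e (toOp m) := by
  obtain ⟨ρ, _, s, hs⟩ := exists_split e
  refine ext_tensor s fun ξ ζ => ?_
  rw [legHom_tensor e s hs, toOp_apply]
  refine toL2_congr ?_
  filter_upwards [(leg e m).act_congr (coeFn_tensor s ξ ζ),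
    (quasi_inl s).ae_eq_comp (m.coeFn_toOp ξ)] with p h1 h2
  simp only [Function.comp_apply] at h2
  rw [h1, h2]
  have h3 : ∀ k, legMap e m.θ p (s (Sum.inr k)) = p (s (Sum.inr k)) := fun k =>
    legMap_of_ne _ _ _ fun i hi => by rw [← hs] at hi; exact Sum.inl_ne_inr (s.injective hi)
  simp only [act, leg_w, leg_θ, hs, legMap_apply, h3, mul_assoc]

theorem legU_toU (e : ι ↪ κ) (m : (Mon n ι)ˣ) :
    legU e (toU m) = toU (Units.map (leg e) m) := Subtype.ext (toOp_leg e m.1).symm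

/-- A measure preserving transformation with unimodular weight. -/
def ofMP (w : (κ → G n) → ℂ) (hw : Measurable w) (hw' : ∀ p, ‖w p‖ = 1)
    (θ : (κ → G n) → κ → G n) (hθ : MeasurePreserving θ) : Mon n κ where
  w := w
  θ := θ
  measurable_w := hw
  measurable_θ := hθ.measurable
  ne_zero p h := by simpa [h] using hw' p
  lintegral_eq f hf := by
    have : ∀ p, ‖w p‖ₑ = 1 := fun p => by rw [← ofReal_norm, hw', ENNReal.ofReal_one]
    simp only [this, one_pow, one_mul]
    exact hθ.lintegral_comp hf

end Mon

end Monomial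

/-! ### Characters and the function η -/

section Scalars

theorem ch_add (s t : ℝ) : ch (s + t) = ch s * ch t := by
  simp only [ch, ← Complex.exp_add, Complex.ofReal_add, mul_add]

theorem ch_zero : ch 0 = 1 := by simp [ch]

theorem conj_ch (t : ℝ) : starRingEnd ℂ (ch t) = ch (-t) := by
  simp only [ch, ← Complex.exp_conj, map_mul, Complex.conj_ofReal, Complex.conj_I,
    Complex.ofReal_neg, map_ofNat]
  congr 1
  ring

theorem norm_ch (t : ℝ) : ‖ch t‖ = 1 := by
  have : ch t = Complex.exp ((2 * Real.pi * t : ℝ) * Complex.I) := by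
    rw [ch]; congr 1; push_cast; ring
  rw [this, Complex.norm_exp_ofReal_mul_I]

theorem continuous_ch : Continuous ch := by unfold ch; fun_prop

/-- `e^{λ r}`. -/
def expo (lam r : ℝ) : ℝ := Real.exp (lam * r)

variable (lam r s : ℝ)

theorem expo_pos : 0 < expo lam r := Real.exp_pos _
theorem expo_ne_zero : expo lam r ≠ 0 := (expo_pos lam r).ne'
theorem expo_neg : expo lam (-r) = (expo lam r)⁻¹ := by
  rw [expo, expo, ← Real.exp_neg, mul_neg]
theorem expo_add : expo lam (r + s) = expo lam r * expo lam s := by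
  rw [expo, expo, expo, ← Real.exp_add, mul_add]
theorem expo_sub : expo lam (r - s) = expo lam r * (expo lam s)⁻¹ := by
  rw [sub_eq_add_neg, expo_add, expo_neg]
theorem continuous_expo : Continuous (expo lam) := by unfold expo; fun_prop

theorem two_mul_eta : 2 * lam * eta lam r = expo lam r ^ 2 - 1 := by
  rw [eta, expo, ← Real.exp_nat_mul]
  split_ifs with h
  · simp [h]
  · rw [mul_div_cancel₀ _ (by simpa using h)]
    push_cast
    ring_nf

theorem eta_add : eta lam (r + s) = eta lam r + expo lam r ^ 2 * eta lam s := by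
  by_cases h : lam = 0
  · simp [eta, expo, h]
  · refine mul_left_cancel₀ (a := 2 * lam) (by simpa using h) ?_
    rw [mul_add, mul_left_comm, two_mul_eta, two_mul_eta, two_mul_eta, expo_add]
    ring

theorem eta_zero : eta lam 0 = 0 := by simp [eta]

theorem eta_neg : eta lam (-r) = -((expo lam r)⁻¹ ^ 2 * eta lam r) := by
  have h := eta_add lam (-r) r
  rw [neg_add_cancel, eta_zero, expo_neg] at h
  linarith

theorem eta_sub : eta lam (r - s) =
    eta lam r - expo lam r ^ 2 * ((expo lam s)⁻¹ ^ 2 * eta lam s) := by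
  rw [sub_eq_add_neg, eta_add, eta_neg]; ring

/-- Both sides equal 2λη(r)η(s). The identity is the comparison of the two expansions of η(r + s),
and it is the extra relation on which three of the weight comparisons below depend. -/
theorem eta_comm : (expo lam r ^ 2 - 1) * eta lam s = (expo lam s ^ 2 - 1) * eta lam r := by
  have h := eta_add lam r s
  have h' := eta_add lam s r
  rw [add_comm, h] at h'
  linarith

theorem continuous_eta : Continuous (eta lam) := by
  unfold eta
  split_ifs <;> fun_prop

end Scalars

/-! ### Elementary monomials: phases, shears, reflections, dilations -/

section Elementary

open scoped ENNReal

variable {κ : Type} [Fintype κ]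

namespace Mon

/-- Multiplication by `e(f)`. -/
def phase (f : (κ → G n) → ℝ) (hf : Measurable f) : (Mon n κ)ˣ where
  val := ofMP (fun p => ch (f p)) (continuous_ch.measurable.comp hf) (fun _ => norm_ch _) id
    (MeasurePreserving.id _)
  inv := ofMP (fun p => ch (-f p)) (continuous_ch.measurable.comp hf.neg) (fun _ => norm_ch _) id
    (MeasurePreserving.id _)
  val_inv := Mon.ext (funext fun p => (ch_add (f p) (-f p)).symm.trans (by rw [add_neg_cancel, ch_zero]; rfl)) rfl
  inv_val := Mon.ext (funext fun p => (ch_add (-f p) (f p)).symm.trans (by rw [neg_add_cancel, ch_zero]; rfl)) rfl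

/-- The two-legged point `(P, Q)`. -/
def pt (P Q : G n) : I₂ → G n := Sum.elim (fun _ => P) fun _ => Q

theorem pt_eta (p : I₂ → G n) : pt (p (Sum.inl ())) (p (Sum.inr ())) = p := by
  funext i; rcases i with _ | _ <;> rfl

/-- The points of `Unit ⊕ Unit → G` as pairs. -/
def pairEquiv (n : ℕ) : (I₂ → G n) ≃ᵐ G n × G n :=
  (MeasurableEquiv.sumPiEquivProdPi fun _ => G n).trans
    ((MeasurableEquiv.funUnique Unit (G n)).prodCongr (MeasurableEquiv.funUnique Unit (G n)))

theorem measurePreserving_pairEquiv : MeasurePreserving (pairEquiv n) volume volume :=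
  ((volume_preserving_funUnique Unit (G n)).prod (volume_preserving_funUnique Unit (G n))).comp
    (measurePreserving_sumPiEquivProdPi fun _ => volume)

theorem pairEquiv_apply (p : I₂ → G n) :
    pairEquiv n p = (p (Sum.inl ()), p (Sum.inr ())) := rfl

theorem pairEquiv_symm (z : G n × G n) : (pairEquiv n).symm z = pt z.1 z.2 :=
  (pairEquiv n).injective ((pairEquiv n).apply_symm_apply z)

theorem measurePreserving_shear {φ : G n → G n} (hφ : Measurable φ) :
    MeasurePreserving (fun p : I₂ → G n =>
      pt (p (Sum.inl ())) (p (Sum.inr ()) + φ (p (Sum.inl ())))) := by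
  have ht : ∀ a : G n, MeasurePreserving (fun b : G n => b + a) := fun a =>
    (measurePreserving_add_right volume a.1).prod
      ((measurePreserving_add_right volume a.2.1).prod (measurePreserving_add_right volume a.2.2))
  have h : MeasurePreserving (fun z : G n × G n => (z.1, z.2 + φ z.1)) volume volume :=
    (MeasurePreserving.id volume).skew_product (g := fun a b => b + φ a) (by fun_prop)
      (Filter.Eventually.of_forall fun a => (ht (φ a)).map_eq)
  have e : (fun p : I₂ → G n => pt (p (Sum.inl ())) (p (Sum.inr ()) + φ (p (Sum.inl ())))) =
      ((pairEquiv n).symm ∘ fun z : G n × G n => (z.1, z.2 + φ z.1)) ∘ pairEquiv n := by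
    funext p
    simp only [Function.comp_apply, pairEquiv_symm, pairEquiv_apply]
  rw [e]
  exact (measurePreserving_pairEquiv.symm.comp h).comp measurePreserving_pairEquiv

/-- Translation of the second leg by a function of the first one. -/
def shearMon (φ : G n → G n) (hφ : Measurable φ) : Mon n I₂ :=
  ofMP (fun _ => 1) measurable_const (fun _ => norm_one) _ (measurePreserving_shear hφ)

theorem shearMon_mul (φ ψ : G n → G n) (hφ : Measurable φ) (hψ : Measurable ψ)
    (h : ∀ x, φ x + ψ x = 0) : shearMon φ hφ * shearMon ψ hψ = 1 := by
  refine Mon.ext (funext fun p => one_mul _) (funext fun p => ?_)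
  refine Eq.trans ?_ (pt_eta p)
  change pt _ _ = pt _ _
  congr 1
  change (p (Sum.inr ()) + φ (p (Sum.inl ()))) + ψ (p (Sum.inl ())) = _
  rw [add_assoc, h, add_zero]

/-- Translation of the second leg by a function of the first one, as a unit. -/
def shear (φ : G n → G n) (hφ : Measurable φ) : (Mon n I₂)ˣ where
  val := shearMon φ hφ
  inv := shearMon (fun x => -φ x) hφ.neg
  val_inv := shearMon_mul _ _ _ _ fun _ => add_neg_cancel _
  inv_val := shearMon_mul _ _ _ _ fun _ => neg_add_cancel _

/-- Translation of the first leg by a function of the second one. -/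
def shear' (φ : G n → G n) (hφ : Measurable φ) : (Mon n I₂)ˣ :=
  Units.map (leg (pr (Sum.inr ()) (Sum.inl ()) (by simp))) (shear φ hφ)

theorem shear_θ (φ : G n → G n) (hφ : Measurable φ) (p : I₂ → G n) :
    (shear φ hφ).1.θ p = pt (p (Sum.inl ())) (p (Sum.inr ()) + φ (p (Sum.inl ()))) := rfl

theorem shear_inv (φ : G n → G n) (hφ : Measurable φ) :
    (shear φ hφ)⁻¹ = shear (fun x => -φ x) hφ.neg := Units.ext rfl

theorem shear'_inv (φ : G n → G n) (hφ : Measurable φ) :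
    (shear' φ hφ)⁻¹ = shear' (fun x => -φ x) hφ.neg := Units.ext rfl

theorem shear'_θ (φ : G n → G n) (hφ : Measurable φ) (p : I₂ → G n) :
    (shear' φ hφ).1.θ p =
      pt (p (Sum.inl ()) + φ (p (Sum.inr ()))) (p (Sum.inr ())) := by
  refine (pt_eta _).symm.trans ?_
  congr 1
  · exact legMap_apply (pr (Sum.inr ()) (Sum.inl ()) (by simp)) _ p (Sum.inr ())
  · exact legMap_apply (pr (Sum.inr ()) (Sum.inl ()) (by simp)) _ p (Sum.inl ())

/-- The flip. -/
def flip (n : ℕ) : Mon n I₂ :=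
  ofMP (fun _ => 1) measurable_const (fun _ => norm_one) (fun p i => p i.swap)
    (volume_preserving_arrowCongr' (Equiv.sumComm Unit Unit) (MeasurableEquiv.refl (G n))
      (MeasurePreserving.id volume))

/-- The reflection `(x, y, r) ↦ (-x, -y, r)`. -/
def refl (P : G n) : G n := (-P.1, -P.2.1, P.2.2)

theorem measurePreserving_refl : MeasurePreserving (refl (n := n)) :=
  (Measure.measurePreserving_neg volume).prod
    ((Measure.measurePreserving_neg volume).prod (MeasurePreserving.id volume))

/-- The reflection `(x, y, r) ↦ (-x, -y, r)` in each leg. -/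
def reflMon (n : ℕ) (κ : Type) [Fintype κ] : Mon n κ :=
  ofMP (fun _ => 1) measurable_const (fun _ => norm_one) (fun p i => refl (p i))
    (volume_preserving_pi fun _ => measurePreserving_refl)

/-- The scaling factor is -s because the dilation in j is combined with the reflection of x and y.
-/
theorem lintegral_smul (g : EuclideanSpace ℝ (Fin n) → ℝ≥0∞) {s : ℝ} (hs : 0 < s) :
    ENNReal.ofReal (s ^ n) * ∫⁻ x, g (-(s • x)) = ∫⁻ x, g x := by
  have hs' : -s ≠ 0 := by simpa using hs.ne'
  have h := lintegral_map_equiv (μ := volume) g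
    (Homeomorph.smulOfNeZero (α := EuclideanSpace ℝ (Fin n)) (-s) hs').toMeasurableEquiv
  have e : ⇑(Homeomorph.smulOfNeZero (α := EuclideanSpace ℝ (Fin n)) (-s) hs').toMeasurableEquiv =
      ((-s) • ·) := rfl
  rw [e, Measure.map_addHaar_smul volume hs', lintegral_smul_measure, finrank_euclideanSpace,
    Fintype.card_fin] at h
  simp only [neg_smul] at h
  rw [← h, smul_eq_mul, ← mul_assoc, ← ENNReal.ofReal_mul (by positivity), abs_inv, abs_pow,
    abs_neg, abs_of_pos hs, mul_inv_cancel₀ (by positivity), ENNReal.ofReal_one, one_mul]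

theorem lintegral_G {f : G n → ℝ≥0∞} (hf : Measurable f) :
    ∫⁻ z, f z = ∫⁻ r : ℝ, ∫⁻ y, ∫⁻ x, f (x, y, r) := by
  refine (lintegral_prod_symm' f hf).trans ?_
  exact lintegral_prod_symm' (fun z => ∫⁻ x, f (x, z)) hf.lintegral_prod_left'

/-- `f ↦ e^{nλr} f(-e^{λr} x, -e^{λr} y, -r)`. -/
def dilMon (n : ℕ) (lam : ℝ) : Mon n I₁ where
  w p := ((expo lam (p ()).2.2 ^ n : ℝ) : ℂ)
  θ p _ := (-(expo lam (p ()).2.2 • (p ()).1), -(expo lam (p ()).2.2 • (p ()).2.1), -(p ()).2.2)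
  measurable_w := by
    have := continuous_expo lam
    fun_prop
  measurable_θ := by
    have := continuous_expo lam
    fun_prop
  ne_zero p := by simpa using fun h => absurd h (expo_ne_zero _ _)
  lintegral_eq f hf := by
    have h1 : ∀ g : (I₁ → G n) → ℝ≥0∞, Measurable g →
        ∫⁻ p, g p = ∫⁻ r : ℝ, ∫⁻ y, ∫⁻ x, g fun _ => (x, y, r) := fun g hg => by
      rw [← lintegral_G (f := fun z => g fun _ => z) (by fun_prop)]
      exact ((volume_preserving_funUnique Unit (G n)).symm.lintegral_comp hg).symm
    have hE := continuous_expo lam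
    rw [h1 f hf, h1 _ (by fun_prop), ← lintegral_neg_eq_self
      (fun r => ∫⁻ y, ∫⁻ x, f fun _ => (x, y, r))]
    refine lintegral_congr fun r => ?_
    have hs := expo_pos lam r
    -- The integrals over y and over x each have Jacobian e^{nλr}. Together these make up the
    -- squared modulus of the weight.
    rw [← lintegral_smul (fun y => ∫⁻ x, f fun _ => (x, y, -r)) hs,
      ← lintegral_const_mul _ (by fun_prop)]
    refine lintegral_congr fun y => ?_
    rw [← lintegral_smul (fun x => f fun _ => (x, -(expo lam r • y), -r)) hs, ← mul_assoc,
      ← lintegral_const_mul _ (by fun_prop)]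
    refine lintegral_congr fun x => ?_
    have : ‖((expo lam r ^ n : ℝ) : ℂ)‖ₑ = ENNReal.ofReal (expo lam r ^ n) := by
      rw [← ofReal_norm, Complex.norm_real, Real.norm_of_nonneg (by positivity)]
    simp only [this, sq]

end Mon
end Elementary

set_option linter.unusedSimpArgs false

/-! ### U_A, Y and j as monomials, and their relations -/

section Heisenberg

variable {κ : Type} [Fintype κ]

namespace Mon

/-- The general form of the weights: `a^n e(t)`. -/
def wt (n : ℕ) (a t : ℝ) : ℂ := ((a ^ n : ℝ) : ℂ) * ch t

theorem wt_mul (a t b s : ℝ) : wt n a t * wt n b s = wt n (a * b) (t + s) := by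
  rw [wt, wt, wt, ch_add, mul_pow, Complex.ofReal_mul]; ring

theorem wt_one_zero : wt n 1 0 = 1 := by simp [wt, ch_zero]

theorem wt_one (t : ℝ) : wt n 1 t = ch t := by simp [wt]

theorem wt_congr {a t b s : ℝ} (h : a = b) (h' : t = s) : wt n a t = wt n b s := by rw [h, h']

/-- The three-legged point `(P, Q, S)`. -/
def pt₃ (P Q S : G n) : I₂ ⊕ Unit → G n := Sum.elim (pt P Q) fun _ => S

theorem pt₃_eta (p : I₂ ⊕ Unit → G n) : pt₃ (p t₁) (p t₂) (p t₃) = p := by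
  funext i; rcases i with (_ | _) | _ <;> rfl

theorem comp_pr (i j : κ) (h : i ≠ j) (p : κ → G n) :
    (fun k => p (pr i j h k)) = pt (p i) (p j) := by
  funext k; rcases k with _ | _ <;> rfl

@[simp] theorem pt_inl (P Q : G n) : pt P Q (Sum.inl ()) = P := rfl
@[simp] theorem pt_inr (P Q : G n) : pt P Q (Sum.inr ()) = Q := rfl
@[simp] theorem pt₃_t₁ (P Q S : G n) : pt₃ P Q S t₁ = P := rfl
@[simp] theorem pt₃_t₂ (P Q S : G n) : pt₃ P Q S t₂ = Q := rfl
@[simp] theorem pt₃_t₃ (P Q S : G n) : pt₃ P Q S t₃ = S := rfl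

theorem ext_pt {a b : Mon n I₂} (hw : ∀ P Q, a.w (pt P Q) = b.w (pt P Q))
    (hθ : ∀ P Q, a.θ (pt P Q) = b.θ (pt P Q)) : a = b :=
  Mon.ext (funext fun p => by rw [← pt_eta p, hw]) (funext fun p => by rw [← pt_eta p, hθ])

theorem ext_pt₃ {a b : Mon n (I₂ ⊕ Unit)} (hw : ∀ P Q S, a.w (pt₃ P Q S) = b.w (pt₃ P Q S))
    (hθ : ∀ P Q S, a.θ (pt₃ P Q S) = b.θ (pt₃ P Q S)) : a = b :=
  Mon.ext (funext fun p => by rw [← pt₃_eta p, hw]) (funext fun p => by rw [← pt₃_eta p, hθ])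

theorem legMap_sg_inl (θ : (Unit → G n) → Unit → G n) (P Q : G n) :
    legMap (sg (Sum.inl () : I₂)) θ (pt P Q) = pt (θ (fun _ => P) ()) Q := by
  refine (pt_eta _).symm.trans ?_
  congr 1
  · exact legMap_apply (sg (Sum.inl () : I₂)) θ (pt P Q) ()
  · exact legMap_of_ne _ _ _ fun _ => Sum.inl_ne_inr

theorem legMap_sg_inr (θ : (Unit → G n) → Unit → G n) (P Q : G n) :
    legMap (sg (Sum.inr () : I₂)) θ (pt P Q) = pt P (θ (fun _ => Q) ()) := by
  refine (pt_eta _).symm.trans ?_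
  congr 1
  · exact legMap_of_ne _ _ _ fun _ => Sum.inr_ne_inl
  · exact legMap_apply (sg (Sum.inr () : I₂)) θ (pt P Q) ()

theorem legMap_pr_left (i j : κ) (h : i ≠ j) (θ : (I₂ → G n) → I₂ → G n) (p : κ → G n) :
    legMap (pr i j h) θ p i = θ (pt (p i) (p j)) (Sum.inl ()) := by
  rw [← comp_pr i j h]; exact legMap_apply (pr i j h) θ p (Sum.inl ())

theorem legMap_pr_right (i j : κ) (h : i ≠ j) (θ : (I₂ → G n) → I₂ → G n) (p : κ → G n) :
    legMap (pr i j h) θ p j = θ (pt (p i) (p j)) (Sum.inr ()) := by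
  rw [← comp_pr i j h]; exact legMap_apply (pr i j h) θ p (Sum.inr ())

theorem legMap_pr_ne (i j k : κ) (h : i ≠ j) (hi : i ≠ k) (hj : j ≠ k)
    (θ : (I₂ → G n) → I₂ → G n) (p : κ → G n) : legMap (pr i j h) θ p k = p k :=
  legMap_of_ne _ _ _ (by rintro (_ | _); exacts [hi, hj])

section Legs

variable (θ : (I₂ → G n) → I₂ → G n) (P Q S : G n)

theorem legMap_swap (h : (Sum.inr () : I₂) ≠ Sum.inl ()) :
    legMap (pr (Sum.inr () : I₂) (Sum.inl ()) h) θ (pt P Q) =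
      pt (θ (pt Q P) (Sum.inr ())) (θ (pt Q P) (Sum.inl ())) := by
  refine (pt_eta _).symm.trans ?_
  rw [legMap_pr_left, legMap_pr_right]; rfl

theorem legMap₁₂ (h : t₁ ≠ t₂) : legMap (pr t₁ t₂ h) θ (pt₃ P Q S) =
    pt₃ (θ (pt P Q) (Sum.inl ())) (θ (pt P Q) (Sum.inr ())) S := by
  refine (pt₃_eta _).symm.trans ?_
  rw [legMap_pr_left, legMap_pr_right, legMap_pr_ne _ _ _ _ tne₁₃ tne₂₃]; rfl

theorem legMap₁₃ (h : t₁ ≠ t₃) : legMap (pr t₁ t₃ h) θ (pt₃ P Q S) =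
    pt₃ (θ (pt P S) (Sum.inl ())) Q (θ (pt P S) (Sum.inr ())) := by
  refine (pt₃_eta _).symm.trans ?_
  rw [legMap_pr_left, legMap_pr_right, legMap_pr_ne _ _ _ _ tne₁₂ tne₂₃.symm]; rfl

theorem legMap₂₃ (h : t₂ ≠ t₃) : legMap (pr t₂ t₃ h) θ (pt₃ P Q S) =
    pt₃ P (θ (pt Q S) (Sum.inl ())) (θ (pt Q S) (Sum.inr ())) := by
  refine (pt₃_eta _).symm.trans ?_
  rw [legMap_pr_left, legMap_pr_right, legMap_pr_ne _ _ _ _ tne₁₂.symm tne₁₃.symm]; rfl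

theorem legMap₃₂ (h : t₃ ≠ t₂) : legMap (pr t₃ t₂ h) θ (pt₃ P Q S) =
    pt₃ P (θ (pt S Q) (Sum.inr ())) (θ (pt S Q) (Sum.inl ())) := by
  refine (pt₃_eta _).symm.trans ?_
  rw [legMap_pr_left, legMap_pr_right, legMap_pr_ne _ _ _ _ tne₁₃.symm tne₁₂.symm]; rfl

theorem legMap₃₁ (h : t₃ ≠ t₁) : legMap (pr t₃ t₁ h) θ (pt₃ P Q S) =
    pt₃ (θ (pt S P) (Sum.inr ())) Q (θ (pt S P) (Sum.inl ())) := by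
  refine (pt₃_eta _).symm.trans ?_
  rw [legMap_pr_left, legMap_pr_right, legMap_pr_ne _ _ _ _ tne₂₃.symm tne₁₂]; rfl

end Legs

/-- A unit that is its own inverse. -/
def ofInvolution {M : Type*} [Monoid M] (a : M) (h : a * a = 1) : Mˣ := ⟨a, a, h, h⟩

/-- The flip, as a unit. -/
def flipUnit (n : ℕ) : (Mon n I₂)ˣ :=
  ofInvolution (flip n) (Mon.ext (funext fun _ => one_mul _)
    (funext fun p => funext fun i => congrArg p (Sum.swap_swap i)))

section Concrete

variable (lam : ℝ)

theorem dilMon_mul_self : dilMon n lam * dilMon n lam = 1 := by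
  refine Mon.ext (funext fun p => ?_) (funext fun p => funext fun _ => ?_)
  · change ((expo lam (p ()).2.2 ^ n : ℝ) : ℂ) * ((expo lam (-(p ()).2.2) ^ n : ℝ) : ℂ) = 1
    rw [expo_neg, ← Complex.ofReal_mul, ← mul_pow, mul_inv_cancel₀ (expo_ne_zero _ _), one_pow,
      Complex.ofReal_one]
  · change (_, _, _) = p ()
    simp only [dilMon, expo_neg, smul_neg, neg_neg, smul_smul,
      inv_mul_cancel₀ (expo_ne_zero _ _), one_smul]

theorem measurable_phi {α : Type*} [MeasurableSpace α] {x y : α → EuclideanSpace ℝ (Fin n)}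
    {r : α → ℝ} (hx : Measurable x) (hy : Measurable y) (hr : Measurable r) :
    Measurable fun a => eta lam (r a) * inner ℝ (x a) (y a) :=
  ((continuous_eta lam).measurable.comp hr).mul (hx.inner hy)

/-- `jξ(x,y,r) = e^{nλr} ē[η(r)β(x,y)] ξ(-e^{λr}x, -e^{λr}y, -r)`. -/
def jMon (n : ℕ) (lam : ℝ) : (Mon n I₁)ˣ :=
  phase (fun p => -(eta lam (p ()).2.2 * inner ℝ (p ()).1 (p ()).2.1))
    (measurable_phi lam (by fun_prop) (by fun_prop) (by fun_prop)).neg *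
  ofInvolution (dilMon n lam) (dilMon_mul_self lam)

theorem jMon_w (P : G n) : (jMon n lam).1.w (fun _ => P) =
    wt n (expo lam P.2.2) (-(eta lam P.2.2 * inner ℝ P.1 P.2.1)) := mul_comm _ _

theorem jMon_θ (P : G n) : (jMon n lam).1.θ (fun _ => P) =
    fun _ => (-(expo lam P.2.2 • P.1), -(expo lam P.2.2 • P.2.1), -P.2.2) := rfl

/-- The first part of the change of variables of `Y`. -/
def aShear (n : ℕ) : (Mon n I₂)ˣ := shear (fun P => (0, 0, -P.2.2)) (by fun_prop)

/-- The second part of the change of variables of `Y`. -/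
def bShear (n : ℕ) (lam : ℝ) : (Mon n I₂)ˣ :=
  shear' (fun Q => (expo lam Q.2.2 • Q.1, expo lam Q.2.2 • Q.2.1, 0))
    (by have := continuous_expo lam; fun_prop)

/-- The phase of `Y`. -/
def yPhase (n : ℕ) (lam : ℝ) : (Mon n I₂)ˣ :=
  phase (fun p => eta lam (p (Sum.inl ())).2.2 *
      inner ℝ (expo lam ((p (Sum.inr ())).2.2 - (p (Sum.inl ())).2.2) • (p (Sum.inr ())).1)
        (p (Sum.inl ())).2.1)
    (by
      have := continuous_expo lam
      exact measurable_phi lam (by fun_prop) (by fun_prop) (by fun_prop))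

/-- The unitary `Y`. -/
def yMon (n : ℕ) (lam : ℝ) : (Mon n I₂)ˣ := yPhase n lam * aShear n * bShear n lam

theorem yMon_w (P Q : G n) : (yMon n lam).1.w (pt P Q) =
    wt n 1 (eta lam P.2.2 * (expo lam (Q.2.2 - P.2.2) * inner ℝ Q.1 P.2.1)) := by
  rw [wt_one, ← real_inner_smul_left]
  exact (mul_one _).trans (mul_one _)

theorem yMon_θ (P Q : G n) : (yMon n lam).1.θ (pt P Q) =
    pt (P.1 + expo lam (Q.2.2 - P.2.2) • Q.1, P.2.1 + expo lam (Q.2.2 - P.2.2) • Q.2.1, P.2.2)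
      (Q.1, Q.2.1, Q.2.2 - P.2.2) := by
  refine (shear'_θ _ _ _).trans ?_
  have h : (yPhase n lam * aShear n).1.θ (pt P Q) = pt P (Q + (0, 0, -P.2.2)) := rfl
  rw [h, pt_inl, pt_inr]
  simp only [Prod.snd_add, Prod.fst_add, add_zero, ← sub_eq_add_neg]
  exact congrArg₂ pt (Prod.ext rfl (Prod.ext rfl (add_zero _)))
    (Prod.ext (add_zero _) (Prod.ext (add_zero _) rfl))

theorem jMon_mul_self : jMon n lam * jMon n lam = 1 := by
  refine Units.ext (Mon.ext (funext fun p => ?_) (funext fun p => funext fun i => ?_))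
  · obtain ⟨P, rfl⟩ : ∃ P, p = fun _ => P := ⟨p (), rfl⟩
    rw [Units.val_mul, mul_w, jMon_θ, jMon_w, jMon_w, wt_mul]
    refine Eq.trans (wt_congr ?_ ?_) wt_one_zero
    · rw [expo_neg, mul_inv_cancel₀ (expo_ne_zero _ _)]
    · have := expo_ne_zero lam P.2.2
      simp only [eta_neg, inner_neg_neg, real_inner_smul_left, real_inner_smul_right]
      field_simp
      ring
  · obtain ⟨P, rfl⟩ : ∃ P, p = fun _ => P := ⟨p (), rfl⟩
    rw [Units.val_mul, mul_θ, jMon_θ, jMon_θ]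
    simp only [expo_neg, smul_neg, neg_neg, smul_smul,
      inv_mul_cancel₀ (expo_ne_zero _ _), one_smul]
    rfl

theorem jMon_inv : (jMon n lam)⁻¹ = jMon n lam := inv_eq_of_mul_eq_one_right (jMon_mul_self lam)

/-- `j` on one of two legs. -/
def jLeg (n : ℕ) (lam : ℝ) (i : I₂) : (Mon n I₂)ˣ := Units.map (leg (sg i)) (jMon n lam)

theorem jLeg_inv (i : I₂) : (jLeg n lam i)⁻¹ = jLeg n lam i := by
  rw [jLeg, ← map_inv, jMon_inv]

theorem jLeg_inl_w (P Q : G n) : (jLeg n lam (Sum.inl ())).1.w (pt P Q) =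
    wt n (expo lam P.2.2) (-(eta lam P.2.2 * inner ℝ P.1 P.2.1)) := jMon_w lam P

theorem jLeg_inr_w (P Q : G n) : (jLeg n lam (Sum.inr ())).1.w (pt P Q) =
    wt n (expo lam Q.2.2) (-(eta lam Q.2.2 * inner ℝ Q.1 Q.2.1)) := jMon_w lam Q

theorem jLeg_inl_θ (P Q : G n) : (jLeg n lam (Sum.inl ())).1.θ (pt P Q) =
    pt (-(expo lam P.2.2 • P.1), -(expo lam P.2.2 • P.2.1), -P.2.2) Q := legMap_sg_inl _ _ _

theorem jLeg_inr_θ (P Q : G n) : (jLeg n lam (Sum.inr ())).1.θ (pt P Q) =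
    pt P (-(expo lam Q.2.2 • Q.1), -(expo lam Q.2.2 • Q.2.1), -Q.2.2) := legMap_sg_inr _ _ _

/-- The flip of `Y`. -/
def ySwap (n : ℕ) (lam : ℝ) : (Mon n I₂)ˣ :=
  Units.map (leg (pr (Sum.inr ()) (Sum.inl ()) (by simp))) (yMon n lam)

theorem ySwap_w (P Q : G n) : (ySwap n lam).1.w (pt P Q) = (yMon n lam).1.w (pt Q P) := by
  rw [ySwap, Units.coe_map, leg_w, comp_pr, pt_inl, pt_inr]

theorem ySwap_θ (P Q : G n) : (ySwap n lam).1.θ (pt P Q) =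
    pt (P.1, P.2.1, P.2.2 - Q.2.2)
      (Q.1 + expo lam (P.2.2 - Q.2.2) • P.1, Q.2.1 + expo lam (P.2.2 - Q.2.2) • P.2.1, Q.2.2) := by
  refine (legMap_swap _ _ _ _).trans ?_
  rw [yMon_θ]; rfl

/-- `U_A`. -/
def uMon (n : ℕ) (lam : ℝ) : (Mon n I₂)ˣ :=
  jLeg n lam (Sum.inl ()) * ySwap n lam * (jLeg n lam (Sum.inl ()))⁻¹

/-- `(j ⊗ j) Y (j ⊗ j)`. -/
def jyjMon (n : ℕ) (lam : ℝ) : (Mon n I₂)ˣ :=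
  jLeg n lam (Sum.inl ()) * jLeg n lam (Sum.inr ()) * yMon n lam *
    (jLeg n lam (Sum.inl ()) * jLeg n lam (Sum.inr ()))⁻¹

/-- `(j ⊗ 1) Y (j ⊗ 1)`. -/
def jyMon (n : ℕ) (lam : ℝ) : (Mon n I₂)ˣ :=
  jLeg n lam (Sum.inl ()) * yMon n lam * (jLeg n lam (Sum.inl ()))⁻¹

/-- `(1 ⊗ j) Y (1 ⊗ j)`. -/
def yjMon (n : ℕ) (lam : ℝ) : (Mon n I₂)ˣ :=
  jLeg n lam (Sum.inr ()) * yMon n lam * (jLeg n lam (Sum.inr ()))⁻¹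

/-- Y is the primary object here and U_A is recovered from it by flipping and conjugating with j.
The weight and point map computed from this recipe are those in the definition of `UA`, as `UA_eq`
confirms. -/
theorem uMon_w (P Q : G n) : (uMon n lam).1.w (pt P Q) =
    wt n (expo lam Q.2.2)⁻¹ (-(eta lam Q.2.2 * ((expo lam Q.2.2)⁻¹ * (inner ℝ P.1 Q.2.1 -
      (expo lam Q.2.2)⁻¹ * inner ℝ P.1 P.2.1)))) := by
  have hP := expo_ne_zero lam P.2.2
  have hQ := expo_ne_zero lam Q.2.2
  rw [uMon, jLeg_inv]
  simp only [Units.val_mul, mul_w, mul_θ, jLeg_inl_w, jLeg_inl_θ, ySwap_w, ySwap_θ, yMon_w, wt_mul]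
  refine wt_congr ?_ ?_
  · simp only [expo_sub, expo_neg]
    field_simp
  · simp only [expo_sub, expo_neg, eta_sub, eta_neg, inner_neg_left, inner_neg_right,
      real_inner_smul_left, real_inner_smul_right]
    field_simp
    ring

theorem uMon_θ (P Q : G n) : (uMon n lam).1.θ (pt P Q) =
    pt ((expo lam Q.2.2)⁻¹ • P.1, (expo lam Q.2.2)⁻¹ • P.2.1, P.2.2 + Q.2.2)
      (Q.1 - (expo lam Q.2.2)⁻¹ • P.1, Q.2.1 - (expo lam Q.2.2)⁻¹ • P.2.1, Q.2.2) := by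
  have hP := expo_ne_zero lam P.2.2
  have hQ := expo_ne_zero lam Q.2.2
  rw [uMon, jLeg_inv]
  simp only [Units.val_mul, mul_θ, jLeg_inl_θ, ySwap_θ]
  simp only [expo_sub, expo_neg]
  refine congrArg₂ pt (Prod.ext ?_ (Prod.ext ?_ ?_)) (Prod.ext ?_ (Prod.ext ?_ ?_)) <;>
    dsimp only <;> first | ring1 | (match_scalars <;> field_simp)

theorem jyjMon_w (P Q : G n) : (jyjMon n lam).1.w (pt P Q) =
    wt n (expo lam P.2.2) (eta lam P.2.2 * inner ℝ P.1 Q.2.1) := by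
  have hP := expo_ne_zero lam P.2.2
  have hQ := expo_ne_zero lam Q.2.2
  rw [jyjMon, mul_inv_rev, jLeg_inv, jLeg_inv]
  simp only [Units.val_mul, mul_w, mul_θ, jLeg_inl_w, jLeg_inr_w, jLeg_inl_θ, jLeg_inr_θ, yMon_w, yMon_θ, wt_mul]
  refine wt_congr ?_ ?_
  · simp only [expo_sub, expo_neg]
    field_simp
  · simp only [expo_sub, expo_neg, eta_sub, eta_neg, inner_neg_left, inner_neg_right,
      inner_add_left, inner_add_right, real_inner_smul_left, real_inner_smul_right]
    field_simp
    ring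

theorem jyjMon_θ (P Q : G n) : (jyjMon n lam).1.θ (pt P Q) =
    pt (P.1 + Q.1, P.2.1 + Q.2.1, P.2.2)
      (expo lam P.2.2 • Q.1, expo lam P.2.2 • Q.2.1, Q.2.2 - P.2.2) := by
  have hP := expo_ne_zero lam P.2.2
  have hQ := expo_ne_zero lam Q.2.2
  rw [jyjMon, mul_inv_rev, jLeg_inv, jLeg_inv]
  simp only [Units.val_mul, mul_θ, jLeg_inl_θ, jLeg_inr_θ, yMon_θ]
  simp only [expo_sub, expo_neg]
  refine congrArg₂ pt (Prod.ext ?_ (Prod.ext ?_ ?_)) (Prod.ext ?_ (Prod.ext ?_ ?_)) <;>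
    dsimp only <;> first | ring1 | (match_scalars <;> field_simp)

theorem jyMon_w (P Q : G n) : (jyMon n lam).1.w (pt P Q) =
    wt n 1 (eta lam P.2.2 * expo lam Q.2.2 * (expo lam Q.2.2 * inner ℝ Q.1 Q.2.1 - inner ℝ P.1 Q.2.1)) := by
  have hP := expo_ne_zero lam P.2.2
  have hQ := expo_ne_zero lam Q.2.2
  rw [jyMon, jLeg_inv]
  simp only [Units.val_mul, mul_w, mul_θ, jLeg_inl_w, jLeg_inl_θ, yMon_w, yMon_θ, wt_mul]
  refine wt_congr ?_ ?_
  · simp only [expo_sub, expo_neg]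
    field_simp
  · simp only [expo_sub, expo_neg, eta_sub, eta_neg, inner_neg_left, inner_neg_right,
      inner_add_left, inner_add_right, real_inner_smul_left, real_inner_smul_right]
    field_simp
    ring

theorem jyMon_θ (P Q : G n) : (jyMon n lam).1.θ (pt P Q) =
    pt (P.1 - expo lam Q.2.2 • Q.1, P.2.1 - expo lam Q.2.2 • Q.2.1, P.2.2)
      (Q.1, Q.2.1, Q.2.2 + P.2.2) := by
  have hP := expo_ne_zero lam P.2.2
  have hQ := expo_ne_zero lam Q.2.2
  rw [jyMon, jLeg_inv]
  simp only [Units.val_mul, mul_θ, jLeg_inl_θ, yMon_θ]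
  simp only [expo_sub, expo_neg]
  refine congrArg₂ pt (Prod.ext ?_ (Prod.ext ?_ ?_)) (Prod.ext ?_ (Prod.ext ?_ ?_)) <;>
    dsimp only <;> first | ring1 | (match_scalars <;> field_simp)

theorem yjMon_w (P Q : G n) : (yjMon n lam).1.w (pt P Q) =
    wt n (expo lam P.2.2)⁻¹ (eta lam P.2.2 * (expo lam P.2.2)⁻¹ * ((expo lam P.2.2)⁻¹ * inner ℝ Q.1 Q.2.1 - inner ℝ Q.1 P.2.1)) := by
  have hP := expo_ne_zero lam P.2.2
  have hQ := expo_ne_zero lam Q.2.2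
  rw [yjMon, jLeg_inv]
  simp only [Units.val_mul, mul_w, mul_θ, jLeg_inr_w, jLeg_inr_θ, yMon_w, yMon_θ, wt_mul]
  refine wt_congr ?_ ?_
  · simp only [expo_sub, expo_neg]
    field_simp
  · simp only [expo_sub, expo_neg, eta_sub, eta_neg, inner_neg_left, inner_neg_right,
      inner_add_left, inner_add_right, real_inner_smul_left, real_inner_smul_right]
    field_simp
    ring

theorem yjMon_θ (P Q : G n) : (yjMon n lam).1.θ (pt P Q) =
    pt (P.1 - (expo lam P.2.2)⁻¹ • Q.1, P.2.1 - (expo lam P.2.2)⁻¹ • Q.2.1, P.2.2)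
      ((expo lam P.2.2)⁻¹ • Q.1, (expo lam P.2.2)⁻¹ • Q.2.1, P.2.2 + Q.2.2) := by
  have hP := expo_ne_zero lam P.2.2
  have hQ := expo_ne_zero lam Q.2.2
  rw [yjMon, jLeg_inv]
  simp only [Units.val_mul, mul_θ, jLeg_inr_θ, yMon_θ]
  simp only [expo_sub, expo_neg]
  refine congrArg₂ pt (Prod.ext ?_ (Prod.ext ?_ ?_)) (Prod.ext ?_ (Prod.ext ?_ ?_)) <;>
    dsimp only <;> first | ring1 | (match_scalars <;> field_simp)

theorem congrArg₃ {α β γ δ : Type*} (f : α → β → γ → δ) {a a' : α} {b b' : β} {c c' : γ}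
    (ha : a = a') (hb : b = b') (hc : c = c') : f a b c = f a' b' c' := by rw [ha, hb, hc]

/-- Two monomials coincide when their weights and point maps do. After expanding exponentials, η and
inner products, the powers, phases and coordinates are compared algebraically. -/
theorem yMon_pentagon : leg (pr t₁ t₂ tne₁₂) (yMon n lam).1 *
    leg (pr t₁ t₃ tne₁₃) (yMon n lam).1 *
    leg (pr t₂ t₃ tne₂₃) (yMon n lam).1 =
    leg (pr t₂ t₃ tne₂₃) (yMon n lam).1 *
    leg (pr t₁ t₂ tne₁₂) (yMon n lam).1 := by
  refine ext_pt₃ (fun P Q S => ?_) fun P Q S => ?_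
  all_goals
    have hP := expo_ne_zero lam P.2.2
    have hQ := expo_ne_zero lam Q.2.2
    have hS := expo_ne_zero lam S.2.2
  · simp only [mul_w, mul_θ, leg_w, leg_θ, comp_pr, legMap₁₂, legMap₁₃, legMap₂₃, legMap₃₂, legMap₃₁,
      pt_inl, pt_inr, pt₃_t₁, pt₃_t₂, pt₃_t₃, yMon_w, yMon_θ, uMon_w, uMon_θ, jyjMon_w, jyjMon_θ,
      jyMon_w, jyMon_θ, yjMon_w, yjMon_θ, wt_mul]
    refine wt_congr ?_ ?_
    · try simp only [expo_sub, expo_add, expo_neg]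
      field_simp
    · simp only [expo_sub, expo_add, expo_neg, eta_sub, eta_add, eta_neg, inner_add_left,
        inner_add_right, inner_sub_left, inner_sub_right, real_inner_smul_left,
        real_inner_smul_right]
      field_simp
      ring
  · simp only [mul_θ, leg_θ, legMap₁₂, legMap₁₃, legMap₂₃, legMap₃₂, legMap₃₁, pt_inl, pt_inr,
      yMon_θ, uMon_θ, jyjMon_θ, jyMon_θ, yjMon_θ]
    simp only [expo_sub, expo_add, expo_neg]
    refine congrArg₃ pt₃ (Prod.ext ?_ (Prod.ext ?_ ?_)) (Prod.ext ?_ (Prod.ext ?_ ?_))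
      (Prod.ext ?_ (Prod.ext ?_ ?_)) <;>
      dsimp only <;> first | ring1 | (match_scalars <;> field_simp <;> ring1)

theorem uMon_yMon : leg (pr t₁ t₂ tne₁₂) (uMon n lam).1 *
    leg (pr t₁ t₃ tne₁₃) (yMon n lam).1 =
    leg (pr t₁ t₃ tne₁₃) (yMon n lam).1 *
    leg (pr t₂ t₃ tne₂₃) (yMon n lam).1 *
    leg (pr t₁ t₂ tne₁₂) (uMon n lam).1 := by
  refine ext_pt₃ (fun P Q S => ?_) fun P Q S => ?_
  all_goals
    have hP := expo_ne_zero lam P.2.2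
    have hQ := expo_ne_zero lam Q.2.2
    have hS := expo_ne_zero lam S.2.2
  · simp only [mul_w, mul_θ, leg_w, leg_θ, comp_pr, legMap₁₂, legMap₁₃, legMap₂₃, legMap₃₂, legMap₃₁,
      pt_inl, pt_inr, pt₃_t₁, pt₃_t₂, pt₃_t₃, yMon_w, yMon_θ, uMon_w, uMon_θ, jyjMon_w, jyjMon_θ,
      jyMon_w, jyMon_θ, yjMon_w, yjMon_θ, wt_mul]
    refine wt_congr ?_ ?_
    · try simp only [expo_sub, expo_add, expo_neg]
      field_simp
    · simp only [expo_sub, expo_add, expo_neg, eta_sub, eta_add, eta_neg, inner_add_left,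
        inner_add_right, inner_sub_left, inner_sub_right, real_inner_smul_left,
        real_inner_smul_right]
      field_simp
      -- The two phases differ by a multiple of the relation between η and e^{2λr} at the two times
      -- involved.
      linear_combination expo lam P.2.2 * expo lam S.2.2 * inner ℝ S.1 P.2.1 *
        eta_comm lam P.2.2 Q.2.2
  · simp only [mul_θ, leg_θ, legMap₁₂, legMap₁₃, legMap₂₃, legMap₃₂, legMap₃₁, pt_inl, pt_inr,
      yMon_θ, uMon_θ, jyjMon_θ, jyMon_θ, yjMon_θ]
    simp only [expo_sub, expo_add, expo_neg]
    refine congrArg₃ pt₃ (Prod.ext ?_ (Prod.ext ?_ ?_)) (Prod.ext ?_ (Prod.ext ?_ ?_))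
      (Prod.ext ?_ (Prod.ext ?_ ?_)) <;>
      dsimp only <;> first | ring1 | (match_scalars <;> field_simp <;> ring1)

theorem jyjMon_uMon : leg (pr t₃ t₂ tne₂₃.symm) (jyjMon n lam).1 *
    leg (pr t₁ t₂ tne₁₂) (uMon n lam).1 =
    leg (pr t₁ t₂ tne₁₂) (uMon n lam).1 *
    leg (pr t₃ t₁ tne₁₃.symm) (jyjMon n lam).1 *
    leg (pr t₃ t₂ tne₂₃.symm) (jyjMon n lam).1 := by
  refine ext_pt₃ (fun P Q S => ?_) fun P Q S => ?_
  all_goals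
    have hP := expo_ne_zero lam P.2.2
    have hQ := expo_ne_zero lam Q.2.2
    have hS := expo_ne_zero lam S.2.2
  · simp only [mul_w, mul_θ, leg_w, leg_θ, comp_pr, legMap₁₂, legMap₁₃, legMap₂₃, legMap₃₂, legMap₃₁,
      pt_inl, pt_inr, pt₃_t₁, pt₃_t₂, pt₃_t₃, yMon_w, yMon_θ, uMon_w, uMon_θ, jyjMon_w, jyjMon_θ,
      jyMon_w, jyMon_θ, yjMon_w, yjMon_θ, wt_mul]
    refine wt_congr ?_ ?_
    · try simp only [expo_sub, expo_add, expo_neg]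
      field_simp
    · simp only [expo_sub, expo_add, expo_neg, eta_sub, eta_add, eta_neg, inner_add_left,
        inner_add_right, inner_sub_left, inner_sub_right, real_inner_smul_left,
        real_inner_smul_right]
      field_simp
      linear_combination (expo lam Q.2.2 * inner ℝ P.1 Q.2.1 - inner ℝ P.1 P.2.1) *
        eta_comm lam Q.2.2 S.2.2
  · simp only [mul_θ, leg_θ, legMap₁₂, legMap₁₃, legMap₂₃, legMap₃₂, legMap₃₁, pt_inl, pt_inr,
      yMon_θ, uMon_θ, jyjMon_θ, jyMon_θ, yjMon_θ]
    simp only [expo_sub, expo_add, expo_neg]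
    refine congrArg₃ pt₃ (Prod.ext ?_ (Prod.ext ?_ ?_)) (Prod.ext ?_ (Prod.ext ?_ ?_))
      (Prod.ext ?_ (Prod.ext ?_ ?_)) <;>
      dsimp only <;> first | ring1 | (match_scalars <;> field_simp <;> ring1)

theorem yMon_jyMon : leg (pr t₁ t₂ tne₁₂) (yMon n lam).1 *
    leg (pr t₁ t₃ tne₁₃) (jyMon n lam).1 =
    leg (pr t₁ t₃ tne₁₃) (jyMon n lam).1 *
    leg (pr t₁ t₂ tne₁₂) (yMon n lam).1 := by
  refine ext_pt₃ (fun P Q S => ?_) fun P Q S => ?_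
  all_goals
    have hP := expo_ne_zero lam P.2.2
    have hQ := expo_ne_zero lam Q.2.2
    have hS := expo_ne_zero lam S.2.2
  · simp only [mul_w, mul_θ, leg_w, leg_θ, comp_pr, legMap₁₂, legMap₁₃, legMap₂₃, legMap₃₂, legMap₃₁,
      pt_inl, pt_inr, pt₃_t₁, pt₃_t₂, pt₃_t₃, yMon_w, yMon_θ, uMon_w, uMon_θ, jyjMon_w, jyjMon_θ,
      jyMon_w, jyMon_θ, yjMon_w, yjMon_θ, wt_mul]
    refine wt_congr ?_ ?_
    · try simp only [expo_sub, expo_add, expo_neg]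
    · simp only [expo_sub, expo_add, expo_neg, eta_sub, eta_add, eta_neg, inner_add_left,
        inner_add_right, inner_sub_left, inner_sub_right, real_inner_smul_left,
        real_inner_smul_right]
      field_simp
      ring
  · simp only [mul_θ, leg_θ, legMap₁₂, legMap₁₃, legMap₂₃, legMap₃₂, legMap₃₁, pt_inl, pt_inr,
      yMon_θ, uMon_θ, jyjMon_θ, jyMon_θ, yjMon_θ]
    simp only [expo_sub, expo_add, expo_neg]
    refine congrArg₃ pt₃ (Prod.ext ?_ (Prod.ext ?_ ?_)) (Prod.ext ?_ (Prod.ext ?_ ?_))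
      (Prod.ext ?_ (Prod.ext ?_ ?_)) <;>
      dsimp only <;> first | ring1 | (match_scalars <;> field_simp <;> ring1)

theorem yMon_yjMon : leg (pr t₁ t₂ tne₁₂) (yMon n lam).1 *
    leg (pr t₃ t₂ tne₂₃.symm) (yjMon n lam).1 =
    leg (pr t₃ t₂ tne₂₃.symm) (yjMon n lam).1 *
    leg (pr t₁ t₂ tne₁₂) (yMon n lam).1 := by
  refine ext_pt₃ (fun P Q S => ?_) fun P Q S => ?_
  all_goals
    have hP := expo_ne_zero lam P.2.2
    have hQ := expo_ne_zero lam Q.2.2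
    have hS := expo_ne_zero lam S.2.2
  · simp only [mul_w, mul_θ, leg_w, leg_θ, comp_pr, legMap₁₂, legMap₁₃, legMap₂₃, legMap₃₂, legMap₃₁,
      pt_inl, pt_inr, pt₃_t₁, pt₃_t₂, pt₃_t₃, yMon_w, yMon_θ, uMon_w, uMon_θ, jyjMon_w, jyjMon_θ,
      jyMon_w, jyMon_θ, yjMon_w, yjMon_θ, wt_mul]
    refine wt_congr ?_ ?_
    · try simp only [expo_sub, expo_add, expo_neg]
      field_simp
    · simp only [expo_sub, expo_add, expo_neg, eta_sub, eta_add, eta_neg, inner_add_left,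
        inner_add_right, inner_sub_left, inner_sub_right, real_inner_smul_left,
        real_inner_smul_right]
      field_simp
      ring
  · simp only [mul_θ, leg_θ, legMap₁₂, legMap₁₃, legMap₂₃, legMap₃₂, legMap₃₁, pt_inl, pt_inr,
      yMon_θ, uMon_θ, jyjMon_θ, jyMon_θ, yjMon_θ]
    simp only [expo_sub, expo_add, expo_neg]
    refine congrArg₃ pt₃ (Prod.ext ?_ (Prod.ext ?_ ?_)) (Prod.ext ?_ (Prod.ext ?_ ?_))
      (Prod.ext ?_ (Prod.ext ?_ ?_)) <;>
      dsimp only <;> first | ring1 | (match_scalars <;> field_simp <;> ring1)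

end Concrete
end Mon
end Heisenberg

/-! ### Pointwise complex conjugation -/

section Conjugation

variable {ι κ ρ : Type} [Fintype ι] [Fintype κ] [Fintype ρ]

theorem memLp_conj (ξ : HH n κ) : MemLp (fun p => starRingEnd ℂ (ξ p)) 2 volume :=
  ⟨(Lp.aestronglyMeasurable ξ).star, by
    have : eLpNorm (fun p => starRingEnd ℂ (ξ p)) 2 volume = eLpNorm ξ 2 volume :=
      eLpNorm_congr_norm_ae (Filter.Eventually.of_forall fun p => RCLike.norm_conj _)
    rw [this]; exact Lp.eLpNorm_lt_top ξ⟩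

/-- Pointwise complex conjugation. -/
def cj (n : ℕ) (κ : Type) [Fintype κ] : HH n κ →ₗᵢ⋆[ℂ] HH n κ where
  toFun ξ := toL2 fun p => starRingEnd ℂ (ξ p)
  map_add' ξ η := Lp.ext <| by
    filter_upwards [coeFn_toL2 (memLp_conj (ξ + η)), coeFn_toL2 (memLp_conj ξ),
      coeFn_toL2 (memLp_conj η), Lp.coeFn_add (toL2 fun p => starRingEnd ℂ (ξ p))
        (toL2 fun p => starRingEnd ℂ (η p)), Lp.coeFn_add ξ η] with p h1 h2 h3 h4 h5
    rw [h1, h4, Pi.add_apply, h2, h3, h5, Pi.add_apply, map_add]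
  map_smul' c ξ := Lp.ext <| by
    filter_upwards [coeFn_toL2 (memLp_conj (c • ξ)), coeFn_toL2 (memLp_conj ξ),
      Lp.coeFn_smul (starRingEnd ℂ c) (toL2 fun p => starRingEnd ℂ (ξ p)),
      Lp.coeFn_smul c ξ] with p h1 h2 h3 h4
    rw [h1, h3, Pi.smul_apply, h2, h4, Pi.smul_apply, smul_eq_mul, smul_eq_mul, map_mul]
  norm_map' ξ := by
    change ‖toL2 fun p => starRingEnd ℂ (ξ p)‖ = ‖ξ‖
    rw [toL2_of_memLp (memLp_conj ξ), Lp.norm_toLp, Lp.norm_def]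
    congr 1
    exact eLpNorm_congr_norm_ae (Filter.Eventually.of_forall fun p => RCLike.norm_conj _)

theorem coeFn_cj (ξ : HH n κ) : ⇑(cj n κ ξ) =ᵐ[volume] fun p => starRingEnd ℂ (ξ p) :=
  coeFn_toL2 (memLp_conj ξ)

theorem cj_cj (ξ : HH n κ) : cj n κ (cj n κ ξ) = ξ := Lp.ext <| by
  filter_upwards [coeFn_cj (cj n κ ξ), coeFn_cj ξ] with p h1 h2
  rw [h1, h2, Complex.conj_conj]

theorem inner_cj_cj (ξ η : HH n κ) : inner ℂ (cj n κ ξ) (cj n κ η) = inner ℂ η ξ := by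
  rw [L2.inner_def, L2.inner_def]
  refine integral_congr_ae ?_
  filter_upwards [coeFn_cj ξ, coeFn_cj η] with p h1 h2
  rw [h1, h2]
  simp only [RCLike.inner_apply, Complex.conj_conj, mul_comm]

theorem cj_tensor (s : ι ⊕ ρ ≃ κ) (ξ : HH n ι) (ζ : HH n ρ) :
    cj n κ (tensor s ξ ζ) = tensor s (cj n ι ξ) (cj n ρ ζ) := Lp.ext <| by
  filter_upwards [coeFn_cj (tensor s ξ ζ), coeFn_tensor s ξ ζ,
    coeFn_tensor s (cj n ι ξ) (cj n ρ ζ), (quasi_inl s).ae_eq_comp (coeFn_cj ξ),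
    (quasi_inr s).ae_eq_comp (coeFn_cj ζ)] with p h1 h2 h3 h4 h5
  simp only [Function.comp_apply] at h4 h5
  rw [h1, h2, h3, h4, h5, map_mul]

end Conjugation

/-! ### Hilbert–Schmidt kernels and regularity -/

section HilbertSchmidt

open InnerProductSpace (rankOne)

/-- The Hilbert--Schmidt operator with the given kernel. -/
def hs (n : ℕ) : HH n I₂ →L[ℂ] Op n Unit :=
  -- The adjoint and the conjugation of the argument are both conjugate-linear, so the resulting
  -- operator is linear.
  ((ContinuousLinearMap.adjoint (𝕜 := ℂ) (E := HH n Unit) (F := HH n I₂)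
      ).toContinuousLinearEquiv.toContinuousLinearMap.comp
    ((tensorL (n := n) (Equiv.refl I₂)).flip.comp (cj n Unit).toContinuousLinearMap)).flip

theorem hs_apply (k : HH n I₂) (ζ : HH n Unit) : hs n k ζ =
    ContinuousLinearMap.adjoint ((tensorL (Equiv.refl I₂)).flip (cj n Unit ζ)) k := rfl

theorem inner_hs (k : HH n I₂) (ζ ζ' : HH n Unit) :
    inner ℂ ζ' (hs n k ζ) = inner ℂ (tensor (Equiv.refl I₂) ζ' (cj n Unit ζ)) k := by
  rw [hs_apply, ContinuousLinearMap.adjoint_inner_right]; rfl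

theorem hs_tensor (a b : HH n Unit) :
    hs n (tensor (Equiv.refl I₂) a b) = rankOne ℂ a (cj n Unit b) := by
  ext1 ζ
  refine ext_inner_left ℂ fun ζ' => ?_
  rw [inner_hs, inner_tensor, InnerProductSpace.rankOne_apply, inner_smul_right, mul_comm,
    ← inner_cj_cj, cj_cj]

theorem mem_of_tensor {ι κ ρ : Type} [Fintype ι] [Fintype κ] [Fintype ρ] (s : ι ⊕ ρ ≃ κ)
    {A : Type*} [CStarAlgebra A] {M : CS A} (f : HH n κ →L[ℂ] A)
    (h : ∀ ξ ζ, f (tensor s ξ ζ) ∈ M) (v : HH n κ) : f v ∈ M := by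
  have h1 : (Submodule.span ℂ {v : HH n κ | ∃ ξ ζ, v = tensor s ξ ζ}).topologicalClosure ≤
      (M.comap f).toSubmodule :=
    Submodule.topologicalClosure_minimal _
      (Submodule.span_le.2 (by rintro _ ⟨x, y, rfl⟩; exact h x y)) (M.comap f).isClosed
  rw [dense_tensor] at h1
  exact h1 trivial

/-- Kernels that are simple tensors give rank-one operators, and all kernels are limits of sums of
these. The unitary changes nothing, because the vectors to which it is applied are total. -/
theorem cspan_hs (v : unitary (Op n I₂)) :
    cspan {T | ∃ η ξ, T = hs n (v.1 (tensor (Equiv.refl I₂) ξ (cj n Unit η)))} =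
      cpt n Unit := by
  refine le_antisymm (cspan_le.2 ?_) (cspan_le.2 ?_)
  · rintro _ ⟨η, ξ, rfl⟩
    exact mem_of_tensor (Equiv.refl I₂) (hs n) (fun a b => by
      rw [hs_tensor]; exact rankOne_mem_cpt _ _) _
  · rintro _ ⟨a, b, rfl⟩
    have h1 : (rankOne ℂ a b : Op n Unit) = ((hs n).comp v.1) ((v⁻¹).1
        (tensor (Equiv.refl I₂) a (cj n Unit b))) := by
      have : v.1 ((v⁻¹).1 (tensor (Equiv.refl I₂) a (cj n Unit b))) =
          tensor (Equiv.refl I₂) a (cj n Unit b) :=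
        congrArg (fun w : unitary (Op n I₂) => w.1 (tensor (Equiv.refl I₂) a (cj n Unit b)))
          (mul_inv_cancel v)
      rw [ContinuousLinearMap.comp_apply, this, hs_tensor, cj_cj]
    rw [h1]
    refine mem_of_tensor (Equiv.refl I₂) ((hs n).comp v.1) (fun a b => ?_) _
    exact subset_cspan ⟨cj n Unit b, a, by rw [cj_cj]; rfl⟩

/-- The flip unitary. -/
def flipU (n : ℕ) : unitary (Op n I₂) := Mon.toU (Mon.flipUnit n)

theorem flipU_tensor (a b : HH n Unit) :
    (flipU n).1 (tensor (Equiv.refl I₂) a b) = tensor (Equiv.refl I₂) b a := by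
  refine (toL2_congr ((Mon.flip n).act_congr (coeFn_tensor _ a b))).trans ?_
  refine toL2_congr (Filter.Eventually.of_forall fun p => ?_)
  change (1 : ℂ) * (a _ * b _) = b _ * a _
  rw [one_mul, mul_comm]; rfl

/-- A criterion for regularity. -/
theorem regular_of_kernel (u v : unitary (Op n I₂))
    (h : ∀ a b c d : HH n Unit, inner ℂ (u.1 (tensor (Equiv.refl I₂) a b))
        (tensor (Equiv.refl I₂) c d) =
      inner ℂ (tensor (Equiv.refl I₂) a (cj n Unit d))
        (v.1 (tensor (Equiv.refl I₂) c (cj n Unit b)))) :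
    kc (Sum.inr ()) * (uline u⁻¹ : CS (Op n I₂)) * kc (Sum.inl ()) =
      kc (Sum.inl ()) * kc (Sum.inr ()) := by
  have hsum : (kc (Sum.inl ()) : CS (Op n I₂)) * kc (Sum.inr ()) = cpt n I₂ :=
    cpt_sum (Equiv.refl I₂)
  -- Compressing u* by rank-one operators in opposite legs gives, up to the flip, a rank-one
  -- operator tensored with the Hilbert–Schmidt operator of kernel v(ξ ⊗ η̄). As v is unitary these
  -- operators span all compact ones, and the flip is absorbed.
  have hgen : ∀ f η ξ g : HH n Unit,
      legHom (sg (Sum.inr ())) (rankOne ℂ f η) * (u⁻¹).1 *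
        legHom (sg (Sum.inl ())) (rankOne ℂ ξ g) =
      (flipU n).1 * (legHom (sg (Sum.inl ())) (rankOne ℂ f g) *
        legHom (sg (Sum.inr ())) (hs n (v.1 (tensor (Equiv.refl I₂) ξ (cj n Unit η))))) := by
    intro f η ξ g
    have hL : ∀ (T : Op n Unit) a b, legHom (sg (Sum.inl ())) T (tensor (Equiv.refl I₂) a b) =
      tensor (Equiv.refl I₂) (T a) b := legHom_embL_tensor (Equiv.refl I₂)
    have hR : ∀ (T : Op n Unit) a b, legHom (sg (Sum.inr ())) T (tensor (Equiv.refl I₂) a b) =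
      tensor (Equiv.refl I₂) a (T b) := legHom_embR_tensor (Equiv.refl I₂)
    refine ext_inner_tensor (Equiv.refl I₂) fun a b a' b' => ?_
    simp only [mul_apply_eq_comp]
    have hu : (u⁻¹).1 = star u.1 := rfl
    rw [inner_apply_eq_star, ← map_star, star_rankOne, hL, hR, hR, hL, flipU_tensor, hu,
      inner_apply_eq_star, star_star]
    simp only [InnerProductSpace.rankOne_apply, tensor_smul_left, tensor_smul_right,
      inner_smul_left, inner_smul_right, map_smul, inner_tensor, h, inner_hs]
    rw [inner_conj_symm]
    ring
  have hK : (kc (Sum.inl ()) : CS (Op n I₂)) * kc (Sum.inr ()) = (uline (flipU n) : CS (Op n I₂)) *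
      (kc (Sum.inl ()) * lc (Sum.inr ()) (cspan
        {T | ∃ η ξ, T = hs n (v.1 (tensor (Equiv.refl I₂) ξ (cj n Unit η)))})) := by
    rw [cspan_hs, hsum, uline_mul_cpt]
  rw [hK]
  simp only [kc, lc, cpt, coe_uline, push_cspan, line_apply, cspan_mul_cspan]
  congr 1
  ext T
  constructor
  · rintro ⟨_, ⟨_, ⟨_, ⟨f, η, rfl⟩, rfl⟩, _, rfl, rfl⟩, _, ⟨_, ⟨ξ, g, rfl⟩, rfl⟩, rfl⟩
    exact ⟨_, rfl, _, ⟨_, ⟨_, ⟨f, g, rfl⟩, rfl⟩, _, ⟨_, ⟨η, ξ, rfl⟩, rfl⟩, rfl⟩, hgen f η ξ g⟩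
  · rintro ⟨_, rfl, _, ⟨_, ⟨_, ⟨f, g, rfl⟩, rfl⟩, _, ⟨_, ⟨η, ξ, rfl⟩, rfl⟩, rfl⟩, rfl⟩
    exact ⟨_, ⟨_, ⟨_, ⟨f, η, rfl⟩, rfl⟩, _, rfl, rfl⟩, _, ⟨_, ⟨ξ, g, rfl⟩, rfl⟩, (hgen f η ξ g).symm⟩

end HilbertSchmidt

/-! ### Regularity of Y and verification of the relations -/

namespace Mon

variable (lam : ℝ)

theorem act_tensor (m : Mon n I₂) (a b : HH n Unit) :
    ⇑(m.toOp (tensor (Equiv.refl I₂) a b)) =ᵐ[volume] fun p =>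
      m.w p * (a (fun _ => m.θ p (Sum.inl ())) * b fun _ => m.θ p (Sum.inr ())) :=
  (m.coeFn_toOp _).trans (m.act_congr (coeFn_tensor _ a b))

/-- A pairing of simple tensors as a matrix coefficient of another monomial. -/
theorem inner_toOp_tensor {s m v : Mon n I₂} (hs : ∀ p, s.w p = 1)
    (hw : ∀ p, v.w p = starRingEnd ℂ ((s * m).w p))
    (h₁ : ∀ p, (s * m).θ p (Sum.inl ()) = p (Sum.inl ()))
    (h₂ : ∀ p, (s * m).θ p (Sum.inr ()) = v.θ p (Sum.inr ()))
    (h₃ : ∀ p, s.θ p (Sum.inl ()) = v.θ p (Sum.inl ()))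
    (h₄ : ∀ p, s.θ p (Sum.inr ()) = p (Sum.inr ())) (a b c d : HH n Unit) :
    inner ℂ (m.toOp (tensor (Equiv.refl I₂) a b)) (tensor (Equiv.refl I₂) c d) =
      inner ℂ (tensor (Equiv.refl I₂) a (cj n Unit d))
        (v.toOp (tensor (Equiv.refl I₂) c (cj n Unit b))) := by
  -- Applying the isometry `s` to both vectors leaves the pairing unchanged. It is the change of
  -- variables after which `a` and `d` depend only on the first and the second coordinate,
  -- respectively.
  rw [← s.toIsometry.inner_map_map]
  change inner ℂ (s.toOp (m.toOp _)) (s.toOp _) = _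
  have hsm : s.toOp (m.toOp (tensor (Equiv.refl I₂) a b)) =
      (s * m).toOp (tensor (Equiv.refl I₂) a b) :=
    congrArg (fun T : Op n I₂ => T (tensor (Equiv.refl I₂) a b)) (toOpHom.map_mul s m).symm
  rw [hsm, L2.inner_def, L2.inner_def]
  refine integral_congr_ae ?_
  filter_upwards [act_tensor (s * m) a b, act_tensor s c d, act_tensor v c (cj n Unit b),
    coeFn_tensor (Equiv.refl I₂) a (cj n Unit d),
    (quasi_inr (Equiv.refl I₂)).ae_eq_comp (coeFn_cj d),
    v.quasi.ae_eq_comp ((quasi_inr (Equiv.refl I₂)).ae_eq_comp (coeFn_cj b))]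
    with p e1 e2 e3 e4 e5 e6
  have e5' : cj n Unit d (fun _ => p (Sum.inr ())) = starRingEnd ℂ (d fun _ => p (Sum.inr ())) := e5
  have e6' : cj n Unit b (fun _ => v.θ p (Sum.inr ())) =
    starRingEnd ℂ (b fun _ => v.θ p (Sum.inr ())) := e6
  have e4' : tensor (Equiv.refl I₂) a (cj n Unit d) p =
    a (fun _ => p (Sum.inl ())) * cj n Unit d (fun _ => p (Sum.inr ())) := e4
  rw [e1, e2, e3, e4', e5', e6', h₁, h₂, h₃, h₄, hs, hw]
  simp only [RCLike.inner_apply, map_mul, Complex.conj_conj]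
  ring

/-- The change of variables by which `Y` becomes the multiplication by a function of the first
leg. -/
def sMon (n : ℕ) (lam : ℝ) : (Mon n I₂)ˣ := aShear n * (bShear n lam)⁻¹ * (aShear n)⁻¹

/-- The phase of the kernel of `Y`. -/
def vPhase (n : ℕ) (lam : ℝ) : (Mon n I₂)ˣ :=
  phase (fun p => -(eta lam (p (Sum.inl ())).2.2 *
      inner ℝ (expo lam ((p (Sum.inr ())).2.2 - (p (Sum.inl ())).2.2) • (p (Sum.inr ())).1)
        ((p (Sum.inl ())).2.1 -
          expo lam ((p (Sum.inr ())).2.2 - (p (Sum.inl ())).2.2) • (p (Sum.inr ())).2.1)))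
    (by
      have := continuous_expo lam
      exact (measurable_phi lam (by fun_prop) (by fun_prop) (by fun_prop)).neg)

/-- The kernel of `Y`. -/
def vMon (n : ℕ) (lam : ℝ) : (Mon n I₂)ˣ := vPhase n lam * aShear n * (bShear n lam)⁻¹

theorem aShear_θ (P Q : G n) : (aShear n).1.θ (pt P Q) = pt P (Q.1, Q.2.1, Q.2.2 - P.2.2) := by
  refine (shear_θ _ _ _).trans (congrArg₂ pt rfl ?_)
  exact Prod.ext (add_zero _) (Prod.ext (add_zero _) (sub_eq_add_neg _ _).symm)

theorem aShear_inv_θ (P Q : G n) :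
    ((aShear n)⁻¹).1.θ (pt P Q) = pt P (Q.1, Q.2.1, Q.2.2 + P.2.2) := by
  rw [aShear, shear_inv]
  refine (shear_θ _ _ _).trans (congrArg₂ pt rfl ?_)
  refine Prod.ext ?_ (Prod.ext ?_ ?_) <;> simp

theorem bShear_inv_θ (P Q : G n) : ((bShear n lam)⁻¹).1.θ (pt P Q) =
    pt (P.1 - expo lam Q.2.2 • Q.1, P.2.1 - expo lam Q.2.2 • Q.2.1, P.2.2) Q := by
  rw [bShear, shear'_inv]
  refine (shear'_θ _ _ _).trans (congrArg₂ pt ?_ rfl)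
  refine Prod.ext ?_ (Prod.ext ?_ ?_) <;> simp [sub_eq_add_neg]

theorem sMon_w (P Q : G n) : (sMon n lam).1.w (pt P Q) = 1 := by
  change (1 : ℂ) * 1 * 1 = 1
  simp

theorem sMon_θ (P Q : G n) : (sMon n lam).1.θ (pt P Q) =
    pt (P.1 - expo lam (Q.2.2 - P.2.2) • Q.1, P.2.1 - expo lam (Q.2.2 - P.2.2) • Q.2.1, P.2.2)
      Q := by
  simp only [sMon, Units.val_mul, mul_θ, aShear_θ, bShear_inv_θ, aShear_inv_θ, sub_add_cancel]

theorem vMon_w (P Q : G n) : (vMon n lam).1.w (pt P Q) =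
    wt n 1 (-(eta lam P.2.2 * inner ℝ (expo lam (Q.2.2 - P.2.2) • Q.1)
      (P.2.1 - expo lam (Q.2.2 - P.2.2) • Q.2.1))) := by
  rw [wt_one]
  exact (mul_one _).trans (mul_one _)

theorem vMon_θ (P Q : G n) : (vMon n lam).1.θ (pt P Q) =
    pt (P.1 - expo lam (Q.2.2 - P.2.2) • Q.1, P.2.1 - expo lam (Q.2.2 - P.2.2) • Q.2.1, P.2.2)
      (Q.1, Q.2.1, Q.2.2 - P.2.2) := by
  have h : (vPhase n lam).1.θ (pt P Q) = pt P Q := rfl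
  simp only [vMon, Units.val_mul, mul_θ, h, aShear_θ, bShear_inv_θ]

theorem sMon_mul_yMon_θ (P Q : G n) : ((sMon n lam).1 * (yMon n lam).1).θ (pt P Q) =
    pt P (Q.1, Q.2.1, Q.2.2 - P.2.2) := by
  simp only [mul_θ, sMon_θ, yMon_θ, sub_add_cancel]

theorem yMon_kernel (a b c d : HH n Unit) :
    inner ℂ ((yMon n lam).1.toOp (tensor (Equiv.refl I₂) a b)) (tensor (Equiv.refl I₂) c d) =
      inner ℂ (tensor (Equiv.refl I₂) a (cj n Unit d))
        ((vMon n lam).1.toOp (tensor (Equiv.refl I₂) c (cj n Unit b))) := by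
  refine inner_toOp_tensor (s := (sMon n lam).1) ?_ ?_ ?_ ?_ ?_ ?_ a b c d <;> intro p <;>
    obtain ⟨P, Q, rfl⟩ : ∃ P Q, p = pt P Q := ⟨_, _, (pt_eta p).symm⟩
  · exact sMon_w lam P Q
  · rw [mul_w, sMon_w, sMon_θ, yMon_w, vMon_w, one_mul, wt_one, wt_one, conj_ch,
      real_inner_smul_left]
  · rw [sMon_mul_yMon_θ]; rfl
  · rw [sMon_mul_yMon_θ, vMon_θ]; rfl
  · rw [sMon_θ, vMon_θ]; rfl
  · rw [sMon_θ]; rfl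

/-- The unitary operator `Y`. -/
def yU (n : ℕ) (lam : ℝ) : unitary (Op n I₂) := toU (yMon n lam)

/-- The unitary operator `j`. -/
def jU (n : ℕ) (lam : ℝ) : unitary (Op n Unit) := toU (jMon n lam)

variable {κ : Type} [Fintype κ]

theorem lu_toU (i k : κ) (h : i ≠ k) (m : (Mon n I₂)ˣ) :
    lu i k h (toU m) = toU (Units.map (leg (pr i k h)) m) := legU_toU (pr i k h) m

theorem jl_toU (i : κ) (m : (Mon n Unit)ˣ) : jl i (toU m) = toU (Units.map (leg (sg i)) m) :=
  legU_toU (sg i) m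

theorem jU_mul_self : jU n lam * jU n lam = 1 := by
  rw [jU, ← map_mul, jMon_mul_self, map_one]

theorem bigU_yU : bigU (yU n lam) (jU n lam) = toU (uMon n lam) := by
  rw [bigU, yU, jU, lu_toU, jl_toU, uMon, MonoidHom.map_mul, MonoidHom.map_mul, map_inv]; rfl

theorem conjJ_yU : conjJ (jU n lam) (yU n lam) = toU (jyjMon n lam) := by
  rw [conjJ, yU, jU, jl_toU, jl_toU, jyjMon]
  simp only [MonoidHom.map_mul, map_inv]; rfl

theorem conjL_yU : conjL (jU n lam) (yU n lam) = toU (jyMon n lam) := by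
  rw [conjL, yU, jU, jl_toU, jyMon]
  simp only [MonoidHom.map_mul, map_inv]; rfl

theorem conjR_yU : conjR (jU n lam) (yU n lam) = toU (yjMon n lam) := by
  rw [conjR, yU, jU, jl_toU, yjMon]
  simp only [MonoidHom.map_mul, map_inv]; rfl

theorem isMultUnitary_yU : IsMultUnitary (yU n lam) where
  pentagon' := by
    rw [yU, lu_toU, lu_toU, lu_toU, ← MonoidHom.map_mul, ← MonoidHom.map_mul, ← MonoidHom.map_mul]
    exact congrArg toU (Units.ext (yMon_pentagon lam))
  regular' := regular_of_kernel (yU n lam) (toU (vMon n lam)) (yMon_kernel lam)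

theorem doubleData_yU : DoubleData (yU n lam) (jU n lam) where
  mult := isMultUnitary_yU lam
  c₁ := by
    rw [bigU_yU, yU, lu_toU, lu_toU, lu_toU, ← MonoidHom.map_mul, ← MonoidHom.map_mul,
      ← MonoidHom.map_mul]
    exact congrArg toU (Units.ext (uMon_yMon lam))
  c₂ := by
    rw [bigU_yU, conjJ_yU, lu_toU, lu_toU, lu_toU, ← MonoidHom.map_mul, ← MonoidHom.map_mul,
      ← MonoidHom.map_mul]
    exact congrArg toU (Units.ext (jyjMon_uMon lam))
  c₃ := by
    rw [conjL_yU, yU, lu_toU, lu_toU, ← MonoidHom.map_mul, ← MonoidHom.map_mul]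
    exact congrArg toU (Units.ext (yMon_jyMon lam))
  c₄ := by
    rw [conjR_yU, yU, lu_toU, lu_toU, ← MonoidHom.map_mul, ← MonoidHom.map_mul]
    exact congrArg toU (Units.ext (yMon_yjMon lam))

end Mon

/-! ### The antiunitary J, and agreement with the defining formulas -/

namespace Mon

variable {ι κ ρ : Type} [Fintype ι] [Fintype κ] [Fintype ρ] (lam : ℝ)

/-- The complex conjugate of a monomial. -/
def bar : Mon n κ →* Mon n κ where
  toFun m :=
    { m with
      w := fun p => starRingEnd ℂ (m.w p)
      measurable_w := Complex.continuous_conj.measurable.comp m.measurable_w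
      ne_zero := fun p => (map_ne_zero _).2 (m.ne_zero p)
      lintegral_eq := fun f hf => by
        have : ∀ p, ‖starRingEnd ℂ (m.w p)‖ₑ = ‖m.w p‖ₑ := fun p => by
          rw [← ofReal_norm, RCLike.norm_conj, ofReal_norm]
        simp only [this]
        exact m.lintegral_eq f hf }
  map_one' := Mon.ext (funext fun _ => map_one _) rfl
  map_mul' a b := Mon.ext (funext fun _ => map_mul _ _ _) rfl

theorem bar_w (m : Mon n κ) (p : κ → G n) : (bar m).w p = starRingEnd ℂ (m.w p) := rfl
theorem bar_θ (m : Mon n κ) : (bar m).θ = m.θ := rfl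

theorem cj_toOp (m : Mon n κ) (ξ : HH n κ) : cj n κ (m.toOp ξ) = (bar m).toOp (cj n κ ξ) :=
  Lp.ext <| by
    filter_upwards [coeFn_cj (m.toOp ξ), m.coeFn_toOp ξ, (bar m).coeFn_toOp (cj n κ ξ),
      (bar m).act_congr (coeFn_cj ξ)] with p h1 h2 h3 h4
    rw [h1, h2, h3, h4, act, act, map_mul]; rfl

/-- The linear part of `J`. -/
def rMon (n : ℕ) (lam : ℝ) (κ : Type) [Fintype κ] : Mon n κ :=
  ofMP (fun p => ∏ i, ch (-(eta lam (p i).2.2 * inner ℝ (p i).1 (p i).2.1)))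
    (Finset.univ.measurable_fun_prod fun i _ => continuous_ch.measurable.comp
      (measurable_phi lam (by fun_prop) (by fun_prop) (by fun_prop)).neg)
    (fun p => by rw [norm_prod]; exact Finset.prod_eq_one fun i _ => norm_ch _)
    (fun p i => refl (p i)) (volume_preserving_pi fun _ => measurePreserving_refl)

theorem rMon_w (p : κ → G n) : (rMon n lam κ).w p =
    ∏ i, ch (-(eta lam (p i).2.2 * inner ℝ (p i).1 (p i).2.1)) := rfl

theorem rMon_θ (p : κ → G n) : (rMon n lam κ).θ p = fun i => (-(p i).1, -(p i).2.1, (p i).2.2) :=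
  rfl

theorem rMon_mul_bar : rMon n lam κ * bar (rMon n lam κ) = 1 := by
  refine Mon.ext (funext fun p => ?_) (funext fun p => ?_)
  · rw [mul_w, bar_w, rMon_w, rMon_w, rMon_θ, map_prod, ← Finset.prod_mul_distrib]
    refine Finset.prod_eq_one fun i _ => ?_
    rw [conj_ch, ← ch_add, inner_neg_neg]
    simp [ch_zero]
  · rw [mul_θ, bar_θ, rMon_θ, rMon_θ]
    simp only [neg_neg]
    rfl

/-- `J`, as an antiunitary operator. -/
def jay (n : ℕ) (lam : ℝ) (κ : Type) [Fintype κ] : HH n κ →ₗᵢ⋆[ℂ] HH n κ :=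
  (rMon n lam κ).toIsometry.comp (cj n κ)

theorem jay_apply (ξ : HH n κ) : jay n lam κ ξ = (rMon n lam κ).toOp (cj n κ ξ) := rfl

theorem J_eq (ξ : HH n κ) : J lam ξ = jay n lam κ ξ :=
  toL2_congr ((rMon n lam κ).act_congr (coeFn_cj ξ).symm)

theorem Jhat_eq (ξ : HH n I₁) : Jhat lam ξ = (dilMon n lam * reflMon n I₁).toOp (cj n I₁ ξ) := by
  refine Eq.trans ?_ (toL2_congr ((dilMon n lam * reflMon n I₁).act_congr (coeFn_cj ξ)).symm)
  refine congrArg toL2 (funext fun p => ?_)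
  change ((_ : ℝ) : ℂ) * _ = ((_ : ℝ) : ℂ) * 1 * _
  rw [mul_one, mul_θ]
  change _ * starRingEnd ℂ (ξ _) = _ * starRingEnd ℂ (ξ fun _ =>
    (- -(expo lam (p ()).2.2 • (p ()).1), - -(expo lam (p ()).2.2 • (p ()).2.1), -(p ()).2.2))
  rw [neg_neg, neg_neg]; rfl

theorem toOp_mul_apply (a b : Mon n κ) (ξ : HH n κ) : (a * b).toOp ξ = a.toOp (b.toOp ξ) :=
  congrArg (fun T : Op n κ => T ξ) (toOpHom.map_mul a b)

theorem toOp_one_apply (ξ : HH n κ) : (1 : Mon n κ).toOp ξ = ξ :=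
  congrArg (fun T : Op n κ => T ξ) (toOpHom (n := n) (κ := κ)).map_one

theorem jOp_eq : jOp n lam = (jU n lam).1 := by
  refine toOp_eq_opOf _ fun ξ => ?_
  rw [J_eq, Jhat_eq, jay_apply, cj_toOp, cj_cj, ← toOp_mul_apply]
  congr 2
  refine Mon.ext (funext fun p => ?_) (funext fun p => ?_)
  · obtain ⟨P, rfl⟩ : ∃ P, p = fun _ => P := ⟨p (), rfl⟩
    have hP := expo_ne_zero lam P.2.2
    rw [jMon_w, mul_w, bar_w, rMon_w]
    change _ = ((_ : ℝ) : ℂ) * 1 * starRingEnd ℂ (∏ i, ch (-(eta lam (-P.2.2) *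
      inner ℝ (- -(expo lam P.2.2 • P.1)) (- -(expo lam P.2.2 • P.2.1)))))
    rw [Fintype.prod_unique, conj_ch, wt, mul_one]
    congr 2
    simp only [eta_neg, neg_neg, real_inner_smul_left, real_inner_smul_right]
    field_simp
  · obtain ⟨P, rfl⟩ : ∃ P, p = fun _ => P := ⟨p (), rfl⟩
    rw [jMon_θ]
    change _ = fun _ => (- - -(expo lam P.2.2 • P.1), - - -(expo lam P.2.2 • P.2.1), -P.2.2)
    rw [neg_neg, neg_neg]

theorem UA_eq : UA n lam = (bigU (yU n lam) (jU n lam)).1 := by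
  rw [bigU_yU]
  refine toOp_eq_opOf _ fun ξ => congrArg toL2 (funext fun p => ?_)
  obtain ⟨P, Q, rfl⟩ : ∃ P Q, p = pt P Q := ⟨_, _, (pt_eta p).symm⟩
  have hs : Real.exp (-lam * Q.2.2) = (expo lam Q.2.2)⁻¹ := by
    rw [expo, ← Real.exp_neg, neg_mul]
  simp only [act, uMon_w, uMon_θ, pt_inl, pt_inr, hs, real_inner_smul_left, inner_sub_right,
    real_inner_smul_right, mul_sub]
  rfl

theorem flipOp_eq : flipOp n = (flipU n).1 := by
  refine toOp_eq_opOf _ fun ξ => congrArg toL2 (funext fun p => ?_)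
  exact one_mul _

theorem flipU_mul_self : flipU n * flipU n = 1 := by
  rw [flipU, ← map_mul]
  exact (congrArg toU (Units.ext (flipUnit n).val_inv)).trans (map_one _)

theorem flip_mul_mul_flip (T : Op n I₂) :
    flipOp n * T * flipOp n = legHom (swp Unit Unit) T := by
  -- With `Empty` as complement, tensoring along `s` is the flip followed by a scalar.
  let s : I₂ ⊕ Empty ≃ I₂ := (Equiv.sumEmpty I₂ Empty).trans (Equiv.sumComm Unit Unit)
  have hF : ∀ ξ, flipOp n (flipOp n ξ) = ξ := fun ξ => by
    rw [flipOp_eq]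
    exact congrArg (fun w : unitary (Op n I₂) => w.1 ξ) flipU_mul_self
  refine ext_tensor s fun ξ ζ => ?_
  have key : ∀ ξ : HH n I₂, tensor s ξ ζ = ζ default • flipOp n ξ := by
    intro ξ
    rw [flipOp_eq]
    refine Lp.ext ?_
    filter_upwards [coeFn_tensor s ξ ζ, Lp.coeFn_smul (ζ default) ((flipU n).1 ξ),
      (flip n).coeFn_toOp ξ] with p h1 h2 h3
    rw [h1, h2, Pi.smul_apply]
    change _ = ζ default * (flip n).toOp ξ p
    rw [h3]
    change _ = _ * (1 * ξ fun i => p i.swap)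
    rw [one_mul, mul_comm]
    congr 2
    exact Subsingleton.elim _ _
  rw [legHom_tensor _ s (fun _ => rfl), key, key, mul_apply_eq_comp, mul_apply_eq_comp, map_smul,
    hF, map_smul, map_smul]

theorem jay_jay (ξ : HH n κ) : jay n lam κ (jay n lam κ ξ) = ξ := by
  rw [jay_apply, jay_apply, cj_toOp, cj_cj, ← toOp_mul_apply, rMon_mul_bar, toOp_one_apply]

theorem inner_jay_jay (ξ η : HH n κ) :
    inner ℂ (jay n lam κ ξ) (jay n lam κ η) = inner ℂ η ξ :=
  ((rMon n lam κ).toIsometry.inner_map_map _ _).trans (inner_cj_cj ξ η)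

theorem inner_jay_right (ξ η : HH n κ) :
    inner ℂ ξ (jay n lam κ η) = inner ℂ η (jay n lam κ ξ) := by
  have h := inner_jay_jay lam (jay n lam κ η) ξ
  rwa [jay_jay, eq_comm] at h

theorem inner_jay_left (ξ η : HH n κ) :
    inner ℂ (jay n lam κ ξ) η = inner ℂ (jay n lam κ η) ξ := by
  have h := inner_jay_jay lam ξ (jay n lam κ η)
  rwa [jay_jay] at h

theorem jay_tensor (s : ι ⊕ ρ ≃ κ) (ξ : HH n ι) (ζ : HH n ρ) :
    jay n lam κ (tensor s ξ ζ) = tensor s (jay n lam ι ξ) (jay n lam ρ ζ) := by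
  rw [jay_apply, cj_tensor]
  refine Lp.ext ?_
  filter_upwards [(rMon n lam κ).coeFn_toOp (tensor s (cj n ι ξ) (cj n ρ ζ)),
    (rMon n lam κ).act_congr (coeFn_tensor s (cj n ι ξ) (cj n ρ ζ)),
    coeFn_tensor s (jay n lam ι ξ) (jay n lam ρ ζ),
    (quasi_inl s).ae_eq_comp ((rMon n lam ι).coeFn_toOp (cj n ι ξ)),
    (quasi_inr s).ae_eq_comp ((rMon n lam ρ).coeFn_toOp (cj n ρ ζ))] with p h1 h2 h3 h4 h5
  simp only [Function.comp_apply] at h4 h5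
  rw [h1, h2, h3, jay_apply, jay_apply, h4, h5]
  simp only [act, rMon_w, rMon_θ]
  rw [← Fintype.prod_equiv s (fun i => ch (-(eta lam (p (s i)).2.2 *
    inner ℝ (p (s i)).1 (p (s i)).2.1))) _ (fun _ => rfl), Fintype.prod_sum_type]
  ring

/-- `T ↦ J T J`. -/
def conjOp (n : ℕ) (lam : ℝ) (κ : Type) [Fintype κ] (T : Op n κ) : Op n κ :=
  ((jay n lam κ).toContinuousLinearMap.comp T).comp (jay n lam κ).toContinuousLinearMap

theorem conjOp_apply (T : Op n κ) (ξ : HH n κ) :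
    conjOp n lam κ T ξ = jay n lam κ (T (jay n lam κ ξ)) := rfl

theorem opp_eq (T : Op n κ) : opp lam T = conjOp n lam κ (star T) := by
  have hex : ∃ S : Op n κ, ∀ ξ, S ξ = J lam (star T (J lam ξ)) :=
    ⟨conjOp n lam κ (star T), fun ξ => by rw [J_eq, J_eq]; rfl⟩
  rw [opp, opOf, dif_pos hex]
  ext1 ξ
  rw [hex.choose_spec, J_eq, J_eq]; rfl

theorem conjOp_conjOp (T : Op n κ) : conjOp n lam κ (conjOp n lam κ T) = T := by
  ext1 ξ
  simp only [conjOp_apply, jay_jay]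

theorem conjOp_mul (S T : Op n κ) :
    conjOp n lam κ (S * T) = conjOp n lam κ S * conjOp n lam κ T := by
  ext1 ξ
  simp only [mul_apply_eq_comp, conjOp_apply, jay_jay]

theorem star_conjOp (T : Op n κ) : star (conjOp n lam κ T) = conjOp n lam κ (star T) := by
  ext1 ξ
  refine ext_inner_left ℂ fun η => ?_
  rw [inner_apply_eq_star, star_star, conjOp_apply, conjOp_apply, inner_jay_right, inner_jay_left,
    ContinuousLinearMap.star_eq_adjoint, ContinuousLinearMap.adjoint_inner_left]

theorem conjOp_leg (e : ι ↪ κ) (T : Op n ι) :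
    conjOp n lam κ (legHom e T) = legHom e (conjOp n lam ι T) := by
  obtain ⟨ρ, _, s, hs⟩ := exists_split e
  refine ext_tensor s fun ξ ζ => ?_
  rw [legHom_tensor e s hs, conjOp_apply, jay_tensor, legHom_tensor e s hs, jay_tensor, jay_jay,
    conjOp_apply]

theorem conjOp_toOp (m : Mon n κ) : conjOp n lam κ m.toOp =
    (rMon n lam κ * bar m * bar (rMon n lam κ)).toOp := by
  ext1 ξ
  rw [conjOp_apply, jay_apply, jay_apply, cj_toOp, cj_toOp, cj_cj, toOp_mul_apply, toOp_mul_apply]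

/-- The flip of `(j ⊗ j) Y (j ⊗ j)`. -/
def jyjSwap (n : ℕ) (lam : ℝ) : (Mon n I₂)ˣ :=
  Units.map (leg (pr (Sum.inr ()) (Sum.inl ()) (by simp))) (jyjMon n lam)

theorem jyjSwap_w (P Q : G n) : (jyjSwap n lam).1.w (pt P Q) =
    wt n (expo lam Q.2.2) (eta lam Q.2.2 * inner ℝ Q.1 P.2.1) := by
  rw [← jyjMon_w, jyjSwap, Units.coe_map, leg_w, comp_pr, pt_inl, pt_inr]

theorem jyjSwap_θ (P Q : G n) : (jyjSwap n lam).1.θ (pt P Q) =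
    pt (expo lam Q.2.2 • P.1, expo lam Q.2.2 • P.2.1, P.2.2 - Q.2.2)
      (Q.1 + P.1, Q.2.1 + P.2.1, Q.2.2) := by
  refine (legMap_swap _ _ _ _).trans ?_
  rw [jyjMon_θ]; rfl

theorem conj_wt (a t : ℝ) : starRingEnd ℂ (wt n a t) = wt n a (-t) := by
  rw [wt, wt, map_mul, conj_ch, Complex.conj_ofReal]

theorem rMon_w_pt (P Q : G n) : (rMon n lam I₂).w (pt P Q) =
    wt n 1 (-(eta lam P.2.2 * inner ℝ P.1 P.2.1) - eta lam Q.2.2 * inner ℝ Q.1 Q.2.1) := by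
  rw [rMon_w, Fintype.prod_sum_type, Fintype.prod_unique, Fintype.prod_unique, wt_one,
    sub_eq_add_neg, ch_add]
  rfl

theorem rMon_θ_pt (P Q : G n) : (rMon n lam I₂).θ (pt P Q) =
    pt (-P.1, -P.2.1, P.2.2) (-Q.1, -Q.2.1, Q.2.2) := (pt_eta _).symm

/-- This is (J ⊗ J)U_A(J ⊗ J) = ΣŶ*Σ with Ŷ = (j ⊗ j)Y(j ⊗ j), rearranged so that no inverse has to
be computed. It identifies A^op. -/
theorem jyjSwap_mul : (jyjSwap n lam).1 * rMon n lam I₂ * bar (uMon n lam).1 = rMon n lam I₂ := by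
  refine ext_pt (fun P Q => ?_) fun P Q => ?_
  all_goals
    have hP := expo_ne_zero lam P.2.2
    have hQ := expo_ne_zero lam Q.2.2
  · simp only [mul_w, mul_θ, bar_w, jyjSwap_w, jyjSwap_θ, rMon_w_pt, rMon_θ_pt, uMon_w, conj_wt,
      wt_mul]
    refine wt_congr ?_ ?_
    · field_simp
    · simp only [eta_sub, inner_neg_left, inner_neg_right, inner_add_left,
        inner_add_right, real_inner_smul_left, real_inner_smul_right]
      field_simp
      linear_combination inner ℝ P.1 P.2.1 * eta_comm lam P.2.2 Q.2.2
  · simp only [mul_θ, bar_θ, jyjSwap_θ, rMon_θ_pt, uMon_θ]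
    refine congrArg₂ pt (Prod.ext ?_ (Prod.ext ?_ ?_)) (Prod.ext ?_ (Prod.ext ?_ ?_)) <;>
      dsimp only <;> first | ring1 | (match_scalars <;> field_simp <;> ring1)

theorem toU_jyjSwap : toU (jyjSwap n lam) = (dualU (conjJ (jU n lam) (yU n lam)))⁻¹ := by
  rw [dualU, conjJ_yU, map_inv, inv_inv, lu_toU]; rfl

theorem opp_UA : opp lam (UA n lam) =
    star (dualU (conjJ (jU n lam) (yU n lam)) : Op n I₂) := by
  have h : conjOp n lam I₂ (UA n lam) = (dualU (conjJ (jU n lam) (yU n lam))).1 := by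
    have h₁ : (jyjSwap n lam).1 *
        (rMon n lam I₂ * bar (uMon n lam).1 * bar (rMon n lam I₂)) = 1 := by
      rw [← mul_assoc, ← mul_assoc, jyjSwap_mul, rMon_mul_bar]
    rw [UA_eq, bigU_yU, coe_toU, conjOp_toOp, Units.eq_inv_of_mul_eq_one_left h₁, ← coe_toU,
      map_inv, toU_jyjSwap, inv_inv]
  rw [opp_eq, ← star_conjOp, h]

end Mon

/-! ### The algebras of slices -/

section Slices

variable {ι κ : Type} [Fintype ι] [Fintype κ]

theorem tmulVec_eq (ξ : HH n ι) (ζ : HH n κ) : tmulVec ξ ζ = tensor (Equiv.refl (ι ⊕ κ)) ξ ζ := rfl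

theorem norm_slice_le {ρ : Type} [Fintype ρ] (s : ι ⊕ ρ ≃ κ) (η ξ : HH n ι) (V : Op n κ) :
    ‖slice s η ξ V‖ ≤ ‖η‖ * ‖V‖ * ‖ξ‖ := by
  refine ContinuousLinearMap.opNorm_le_bound _ (by positivity) fun ζ => ?_
  set w := slice s η ξ V ζ with hw
  have h1 : ‖w‖ * ‖w‖ ≤ ‖η‖ * ‖w‖ * (‖V‖ * (‖ξ‖ * ‖ζ‖)) := by
    calc ‖w‖ * ‖w‖
      _ = ‖inner ℂ w w‖ := by
        rw [inner_self_eq_norm_sq_to_K, norm_pow, RCLike.norm_ofReal, abs_norm, sq]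
      _ = ‖inner ℂ (tensor s η w) (V (tensor s ξ ζ))‖ := by rw [← inner_slice, ← hw]
      _ ≤ ‖tensor s η w‖ * ‖V (tensor s ξ ζ)‖ := norm_inner_le_norm _ _
      _ ≤ _ := by
        rw [norm_tensor, ← norm_tensor s ξ ζ]
        gcongr
        exact V.le_opNorm _
  rcases (norm_nonneg w).eq_or_lt with h | h
  · rw [← h]; positivity
  · refine le_of_mul_le_mul_right (h1.trans_eq ?_) h
    ring

/-- A normal functional is a series of vector functionals, and square summability makes the
corresponding series of slices converge in norm. -/
theorem leftSlices_subset (V : Op n (ι ⊕ κ)) :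
    leftSlices V ⊆ (slices (Equiv.refl (ι ⊕ κ)) V : Set (Op n κ)) := by
  rintro S ⟨ξ, η, hξ, hη, hS⟩
  have hsum : Summable fun i => slice (Equiv.refl (ι ⊕ κ)) (η i) (ξ i) V := by
    refine Summable.of_norm_bounded ((hη.add hξ).mul_left ‖V‖) fun i =>
      (norm_slice_le _ _ _ _).trans ?_
    nlinarith [norm_nonneg V, sq_nonneg (‖η i‖ - ‖ξ i‖), norm_nonneg (η i), norm_nonneg (ξ i),
      mul_nonneg (norm_nonneg V) (sq_nonneg (‖η i‖ - ‖ξ i‖)),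
      mul_nonneg (norm_nonneg V) (add_nonneg (sq_nonneg ‖η i‖) (sq_nonneg ‖ξ i‖))]
  obtain ⟨S', hS'⟩ := hsum
  have hmem : S' ∈ slices (Equiv.refl (ι ⊕ κ)) V :=
    (slices (Equiv.refl (ι ⊕ κ)) V).isClosed.mem_of_tendsto hS'
      (Filter.Eventually.of_forall fun t => sum_mem fun i _ => subset_cspan ⟨η i, ξ i, rfl⟩)
  have : S = S' := by
    ext1 ζ
    refine ext_inner_left ℂ fun ζ' => (hS ζ ζ').unique ?_
    have h := hS'.mapL ((innerSL ℂ ζ').comp (ContinuousLinearMap.apply ℂ (HH n κ) ζ))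
    exact (funext fun i => inner_slice (Equiv.refl (ι ⊕ κ)) (η i) (ξ i) V ζ ζ') ▸ h
  rwa [this]

/-- A finite combination of vector functionals is normal: the coefficients are absorbed into the
vectors ξ and both sequences are continued by zero. -/
theorem span_subset_leftSlices (V : Op n (ι ⊕ κ)) :
    (Submodule.span ℂ {T | ∃ η ξ, T = slice (Equiv.refl (ι ⊕ κ)) η ξ V} : Set (Op n κ)) ⊆
      leftSlices V := by
  intro S hS
  obtain ⟨N, c, g, rfl⟩ := Submodule.mem_span_set'.1 hS
  choose η ξ hg using fun i => (g i).2
  let ξ' : ℕ → HH n ι := fun i => if h : i < N then c ⟨i, h⟩ • ξ ⟨i, h⟩ else 0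
  let η' : ℕ → HH n ι := fun i => if h : i < N then η ⟨i, h⟩ else 0
  have h0 : ∀ i ∉ Finset.range N, ξ' i = 0 ∧ η' i = 0 := fun i hi => by
    have : ¬ i < N := fun h => hi (Finset.mem_range.2 h)
    simp [ξ', η', this]
  refine ⟨ξ', η', summable_of_ne_finset_zero (s := Finset.range N) fun i hi => ?_,
    summable_of_ne_finset_zero (s := Finset.range N) fun i hi => ?_, fun ζ ζ' => ?_⟩
  · rw [(h0 i hi).1, norm_zero, zero_pow two_ne_zero]
  · rw [(h0 i hi).2, norm_zero, zero_pow two_ne_zero]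
  · have key : ∀ i, inner ℂ (tmulVec (η' i) ζ') (V (tmulVec (ξ' i) ζ)) =
        inner ℂ ζ' (slice (Equiv.refl (ι ⊕ κ)) (η' i) (ξ' i) V ζ) := fun i =>
      (inner_slice (Equiv.refl (ι ⊕ κ)) (η' i) (ξ' i) V ζ ζ').symm
    have hs := hasSum_sum_of_ne_finset_zero (L := .unconditional ℕ) (s := Finset.range N)
      (f := fun i => inner ℂ (tmulVec (η' i) ζ') (V (tmulVec (ξ' i) ζ))) fun i hi => by
        rw [tmulVec_eq, tmulVec_eq, (h0 i hi).1]
        have := tensor_smul_left (Equiv.refl (ι ⊕ κ)) 0 (0 : HH n ι) ζ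
        rw [zero_smul, zero_smul] at this
        rw [this, map_zero, inner_zero_right]
    convert hs using 1
    rw [Finset.sum_range, sum_apply, inner_sum]
    refine Finset.sum_congr rfl fun i _ => ?_
    rw [key, hg, smul_apply, inner_smul_right, inner_slice, inner_slice]
    simp only [ξ', η', i.2, dif_pos, Fin.eta, tensor_smul_left, map_smul, inner_smul_right]

theorem closure_leftSlices (V : Op n (ι ⊕ κ)) :
    closure (leftSlices V) = (slices (Equiv.refl (ι ⊕ κ)) V : Set (Op n κ)) :=
  Set.Subset.antisymm
    (closure_minimal (leftSlices_subset V) (slices (Equiv.refl (ι ⊕ κ)) V).isClosed)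
    ((coe_cspan _).trans_subset (closure_mono (span_subset_leftSlices V)))

theorem rightSlices_eq (V : Op n I₂) : rightSlices V = leftSlices (legHom (swp Unit Unit) V) := by
  have h : ∀ ζ ζ' η ξ : HH n Unit,
      inner ℂ (tmulVec η ζ') (legHom (swp Unit Unit) V (tmulVec ξ ζ)) =
        inner ℂ (tmulVec ζ' η) (V (tmulVec ζ ξ)) := fun ζ ζ' η ξ => by
    rw [← Mon.flip_mul_mul_flip, Mon.flipOp_eq, mul_apply_eq_comp, mul_apply_eq_comp,
      tmulVec_eq, tmulVec_eq, flipU_tensor, inner_apply_eq_star]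
    have hs : star (flipU n).1 = (flipU n).1 :=
      congrArg Subtype.val (inv_eq_of_mul_eq_one_left (Mon.flipU_mul_self (n := n)))
    rw [hs, flipU_tensor]; rfl
  unfold rightSlices leftSlices
  simp only [h]

/-- An antiunitary reverses inner products, so the two sequences defining the functional change
places. -/
theorem opp_mem_leftSlices (lam : ℝ) {V : Op n I₂} {S : Op n Unit} (hS : S ∈ leftSlices V) :
    opp lam S ∈ leftSlices (opp lam V) := by
  obtain ⟨ξ, η, hξ, hη, h⟩ := hS
  refine ⟨fun i => Mon.jay n lam Unit (η i), fun i => Mon.jay n lam Unit (ξ i), ?_, ?_,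
    fun ζ ζ' => ?_⟩
  · simpa only [LinearIsometry.norm_map] using hη
  · simpa only [LinearIsometry.norm_map] using hξ
  · have key : ∀ {μ : Type} [Fintype μ] (T : Op n μ) (x y : HH n μ),
        inner ℂ x (opp lam T y) = inner ℂ (Mon.jay n lam μ y) (T (Mon.jay n lam μ x)) := by
      intro μ _ T x y
      rw [Mon.opp_eq, Mon.conjOp_apply, Mon.inner_jay_right, ContinuousLinearMap.star_eq_adjoint,
        ContinuousLinearMap.adjoint_inner_left]
    have := h (Mon.jay n lam Unit ζ') (Mon.jay n lam Unit ζ)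
    rw [key]
    convert this using 2 with i
    rw [tmulVec_eq, tmulVec_eq, tmulVec_eq, tmulVec_eq, key, Mon.jay_tensor, Mon.jay_tensor,
      Mon.jay_jay, Mon.jay_jay]

theorem opp_opp (lam : ℝ) (T : Op n κ) : opp lam (opp lam T) = T := by
  rw [Mon.opp_eq, Mon.opp_eq, Mon.star_conjOp, star_star, Mon.conjOp_conjOp]

theorem norm_conjOp_le (lam : ℝ) (T : Op n κ) : ‖Mon.conjOp n lam κ T‖ ≤ ‖T‖ :=
  ContinuousLinearMap.opNorm_le_bound _ (norm_nonneg _) fun ξ => by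
    rw [Mon.conjOp_apply, LinearIsometry.norm_map]
    exact (T.le_opNorm _).trans_eq (by rw [LinearIsometry.norm_map])

theorem continuous_opp (lam : ℝ) : Continuous (opp lam : Op n κ → Op n κ) := by
  have h : LipschitzWith 1 (opp lam : Op n κ → Op n κ) := LipschitzWith.of_dist_le_mul fun S T => by
    have e : opp lam S - opp lam T = Mon.conjOp n lam κ (star (S - T)) := by
      ext1 ξ
      rw [Mon.opp_eq, Mon.opp_eq, star_sub]
      simp only [sub_apply, Mon.conjOp_apply, map_sub]
    rw [dist_eq_norm, dist_eq_norm, e, NNReal.coe_one, one_mul]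
    exact (norm_conjOp_le lam _).trans_eq
      (LinearIsometryEquiv.norm_map ContinuousLinearMap.adjoint (S - T))
  exact h.continuous

theorem opp_image (lam : ℝ) (V : Op n I₂) :
    opp lam '' closure (leftSlices V) = closure (leftSlices (opp lam V)) := by
  let F : Op n Unit ≃ₜ Op n Unit :=
    { toFun := opp lam, invFun := opp lam, left_inv := opp_opp lam, right_inv := opp_opp lam
      continuous_toFun := continuous_opp lam, continuous_invFun := continuous_opp lam }
  have hF : opp lam '' closure (leftSlices V) = closure (opp lam '' leftSlices V) :=
    F.image_closure _
  rw [hF]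
  congr 1
  refine Set.Subset.antisymm ?_ fun S hS => ⟨opp lam S, ?_, opp_opp lam S⟩
  · rintro _ ⟨S, hS, rfl⟩
    exact opp_mem_leftSlices lam hS
  · have := opp_mem_leftSlices lam hS
    rwa [opp_opp] at this

end Slices

/-! ### Identification of the operators and algebras of the statement -/

section SliceAlgebras

/-- A unitary acting on the leg that is sliced away is absorbed into the functionals. -/
theorem sl_conjL (j : unitary (Op n Unit)) (v : unitary (Op n I₂)) : sl (conjL j v) = sl v := by
  have h0 : (Sum.inl () : I₂) ≠ Sum.inr () := by simp
  refine lc_cancel h0 ?_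
  have k5 := kc_mul_sl h0 v
  rw [uv_inl_inr] at k5
  rw [← kc_mul_sl h0, uv_inl_inr, ← k5, conjL, ← map_inv, uline_mul, uline_mul]
  change kc (Sum.inl ()) * (ju (Sum.inl ()) j * _ * ju (Sum.inl ()) j⁻¹) * _ = _
  rw [mul_assoc, mul_assoc _ (ju _ _), ju_mul_kc, ← mul_assoc, ← mul_assoc, kc_mul_ju]

theorem sl_inv (v : unitary (Op n I₂)) : sl v⁻¹ = star (sl v) := by
  have h0 : (Sum.inl () : I₂) ≠ Sum.inr () := by simp
  exact lc_cancel h0 ((kc_mul_sl h0 _).symm.trans (kc_mul_star_sl h0 v))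

theorem bigU_eq (u : unitary (Op n I₂)) (j : unitary (Op n Unit)) :
    bigU u j = conjL j (dualU u)⁻¹ := by
  rw [bigU, conjL, dualU, map_inv, inv_inv]

theorem IsMultUnitary.sl_bigU {u : unitary (Op n I₂)} (hu : IsMultUnitary u)
    (j : unitary (Op n Unit)) : sl (bigU u j) = sl (dualU u) := by
  rw [bigU_eq, sl_conjL, sl_inv, hu.dual.star_sl]

theorem legU_swp (u : unitary (Op n I₂)) : legU (swp Unit Unit) u = (dualU u)⁻¹ := by
  rw [dualU, map_inv, inv_inv, legU_eq_lu]; rfl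

theorem legU_swp_bigU (u : unitary (Op n I₂)) (j : unitary (Op n Unit)) :
    legU (swp Unit Unit) (bigU u j) = conjR j u := by
  rw [bigU, MonoidHom.map_mul, MonoidHom.map_mul, MonoidHom.map_inv, legU_jl, legU_lu]
  change jl (Sum.inr ()) j * lu (Sum.inl ()) (Sum.inr ()) (by simp) u * (jl (Sum.inr ()) j)⁻¹ = _
  rw [lu_inl_inr, conjR]

theorem sl_conjR (j : unitary (Op n Unit)) (v : unitary (Op n I₂)) :
    sl (conjR j v) = sl (conjJ j v) := by
  rw [← sl_conjL j (conjR j v)]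
  congr 1
  rw [conjL, conjR, conjJ]; group

variable (lam : ℝ)

theorem leg_inl_jOp : leg Sum.inl (jOp n lam) = (jl (Sum.inl () : I₂) (Mon.jU n lam)).1 := by
  rw [Mon.jOp_eq]; rfl

theorem leg_inr_jOp : leg Sum.inr (jOp n lam) = (jl (Sum.inr () : I₂) (Mon.jU n lam)).1 := by
  rw [Mon.jOp_eq]; rfl

theorem jl_mul_self {κ : Type} [Fintype κ] (i : κ) : jl i (Mon.jU n lam) * jl i (Mon.jU n lam) = 1 := by
  rw [← MonoidHom.map_mul, Mon.jU_mul_self, MonoidHom.map_one]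

theorem UAhat_eq : UAhat n lam = (Mon.yU n lam).1 := by
  have h : UAhat n lam = flipOp n * (jl (Sum.inl () : I₂) (Mon.jU n lam) *
      bigU (Mon.yU n lam) (Mon.jU n lam) * jl (Sum.inl () : I₂) (Mon.jU n lam)).1 * flipOp n := by
    rw [UAhat, leg_inl_jOp, Mon.UA_eq]
    simp only [Submonoid.coe_mul, mul_assoc]
  have e : jl (Sum.inl () : I₂) (Mon.jU n lam) * bigU (Mon.yU n lam) (Mon.jU n lam) *
      jl (Sum.inl () : I₂) (Mon.jU n lam) = (dualU (Mon.yU n lam))⁻¹ := by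
    rw [bigU_eq, conjL, ← mul_assoc, ← mul_assoc, jl_mul_self, inv_mul_cancel_right, one_mul]
  rw [h, e, Mon.flip_mul_mul_flip, ← coe_legU, MonoidHom.map_inv, legU_swp, inv_inv, dualU_dualU]

theorem X_eq : X n lam = (dualU (Mon.yU n lam)).1 := by
  rw [X, UAhat_eq, Mon.flip_mul_mul_flip]
  change (legU (swp Unit Unit) (Mon.yU n lam)⁻¹).1 = _
  rw [MonoidHom.map_inv, legU_swp, inv_inv]

theorem Y_eq : Y n lam = (Mon.yU n lam).1 := by
  rw [Y, X_eq, Mon.flip_mul_mul_flip]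
  change (legU (swp Unit Unit) (dualU (Mon.yU n lam))⁻¹).1 = _
  rw [MonoidHom.map_inv, legU_swp, inv_inv, dualU_dualU]

theorem Yhathat_eq : Yhathat n lam = (conjJ (Mon.jU n lam) (Mon.yU n lam)).1 := by
  have e : (jl (Sum.inl () : I₂) (Mon.jU n lam) * jl (Sum.inr ()) (Mon.jU n lam))⁻¹ =
      jl (Sum.inl () : I₂) (Mon.jU n lam) * jl (Sum.inr ()) (Mon.jU n lam) := by
    rw [mul_inv_rev, inv_eq_of_mul_eq_one_left (jl_mul_self lam _),
      inv_eq_of_mul_eq_one_left (jl_mul_self lam _), (jl_comm (by simp) _).eq]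
  rw [Yhathat, tmulOp, leg_inl_jOp, leg_inr_jOp, Y_eq, conjJ, e]
  rfl

theorem Z_eq : Z n lam = ((Mon.yU n lam)⁻¹ * conjJ (Mon.jU n lam) (Mon.yU n lam)).1 := by
  rw [Z, Y_eq, Yhathat_eq]; rfl

theorem legs_eq {k l : I₄} (h : k ≠ l) (u : unitary (Op n I₂)) :
    legs k l u.1 = (lu k l h u).1 := rfl

theorem VD_eq : VD n lam = (doubleU (Mon.yU n lam) (Mon.jU n lam)).1 := by
  rw [VD, Z_eq, Y_eq, X_eq, legs_eq ne₁₂, legs_eq ne₂₄, legs_eq ne₁₃]; rfl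

theorem alg_bA : (bA n lam).alg = sl (dualU (Mon.yU n lam)) := by
  change closure (leftSlices (UA n lam)) = _
  rw [Mon.UA_eq, closure_leftSlices, ← (Mon.isMultUnitary_yU lam).sl_bigU (Mon.jU n lam)]
  rfl

theorem alg_bAhatOp : (bAhatOp n lam).alg = sl (Mon.yU n lam) := by
  change closure (rightSlices (X n lam)) = _
  rw [X_eq, rightSlices_eq, closure_leftSlices, ← coe_legU, legU_swp, dualU_dualU,
    ← (Mon.isMultUnitary_yU lam).star_sl, ← sl_inv]
  rfl

theorem alg_bAhat : (bAhat n lam).alg = sl (conjJ (Mon.jU n lam) (Mon.yU n lam)) := by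
  change closure (rightSlices (UA n lam)) = _
  rw [Mon.UA_eq, rightSlices_eq, closure_leftSlices, ← coe_legU, legU_swp_bigU, ← sl_conjR]
  rfl

theorem alg_bAop :
    (bAop n lam).alg = sl (dualU (conjJ (Mon.jU n lam) (Mon.yU n lam))) := by
  change opp lam '' closure (leftSlices (UA n lam)) = _
  rw [opp_image, Mon.opp_UA, closure_leftSlices,
    ← ((Mon.isMultUnitary_yU lam).conjJ (Mon.jU n lam)).dual.star_sl, ← sl_inv]
  rfl

theorem alg_bADhat :
    (bADhat n lam).alg = ten (sl (dualU (Mon.yU n lam))) (sl (Mon.yU n lam)) := by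
  change closure (leftSlices (VD n lam)) = _
  rw [VD_eq, closure_leftSlices, (Mon.doubleData_yU lam).slices_doubleU]

end SliceAlgebras

/-! ### The comultiplications and inversions -/

section Comultiplications

open Function.Embedding (inl inr)

theorem ad_inv (u : unitary (Op n I₂)) {κ : Type} [Fintype κ] (e : κ ↪ I₂) (T : Op n κ) :
    star u.1 * legHom e T * u.1 = ad e u⁻¹ T := by
  rw [ad_apply]
  change _ = star u.1 * _ * star (star u.1)
  rw [star_star]

theorem legHom_swp_ad_refl (W : unitary (Op n I₂)) (p : Op n I₂) :
    legHom (swp Unit Unit) (W.1 * p * star W.1) =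
      ad (swp Unit Unit) (legU (swp Unit Unit) W) p := by
  have := legHom_ad (swp Unit Unit) (Function.Embedding.refl I₂) W p
  rw [ad_apply, legHom_refl] at this
  exact this

variable (lam : ℝ)

/-- The definition uses U_A, which differs from the unitary required here. On A the two implement
the same map by `ad_bigU`, and the flip then turns Y* into X. -/
theorem implements_cop_bA : Implements (sl (dualU (Mon.yU n lam))) (cop (bA n lam)).comul inl
    (dualU (Mon.yU n lam)) := by
  have h : ∀ T, (cop (bA n lam)).comul T =
      legHom (swp Unit Unit) (ad inl (bigU (Mon.yU n lam) (Mon.jU n lam)) T) := fun T => by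
    rw [← Mon.flip_mul_mul_flip, ad_apply, ← Mon.UA_eq]; rfl
  refine ⟨⟨(legHom (swp Unit Unit)).comp (ad inl (bigU (Mon.yU n lam) (Mon.jU n lam))), h⟩,
    fun a ha => ?_⟩
  rw [h, (Mon.doubleData_yU lam).ad_bigU ha, legHom_ad]
  refine ad_congr rfl ?_ a
  rw [MonoidHom.map_inv, legU_swp, inv_inv]

theorem implements_cop_bAhatOp : Implements (sl (Mon.yU n lam)) (cop (bAhatOp n lam)).comul inl
    (Mon.yU n lam) := by
  have h : ∀ T, (cop (bAhatOp n lam)).comul T = ad inl (Mon.yU n lam) T := fun T => by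
    change flipOp n * (star (X n lam) * legHom inr T * X n lam) * flipOp n = _
    rw [X_eq, ad_inv, Mon.flip_mul_mul_flip, legHom_ad, MonoidHom.map_inv, legU_swp, inv_inv,
      dualU_dualU]
    rfl
  exact ⟨⟨ad inl (Mon.yU n lam), h⟩, fun a _ => h a⟩

theorem implements_tau : Implements (ten (sl (dualU (Mon.yU n lam))) (sl (Mon.yU n lam)))
    (tau n lam) (swp Unit Unit) (dualU (Mon.yU n lam)) := by
  have h : ∀ p, tau n lam p = ad (swp Unit Unit) (legU (swp Unit Unit)
      ((Mon.yU n lam)⁻¹ * conjJ (Mon.jU n lam) (Mon.yU n lam))) p := fun p => by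
    rw [← legHom_swp_ad_refl, ← Z_eq, ← Mon.flip_mul_mul_flip]
    simp only [tau, mul_assoc]
  exact ⟨⟨_, h⟩, fun p hp => (h p).trans ((Mon.doubleData_yU lam).ad_zed hp)⟩

theorem implements_tau' : Implements (ten (sl (dualU (conjJ (Mon.jU n lam) (Mon.yU n lam))))
    (sl (conjJ (Mon.jU n lam) (Mon.yU n lam)))) (tau' n lam) (swp Unit Unit)
      (dualU (conjJ (Mon.jU n lam) (Mon.yU n lam))) := by
  have h : ∀ p, tau' n lam p = ad (swp Unit Unit) (legU (swp Unit Unit)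
      ((Mon.yU n lam)⁻¹ * conjJ (Mon.jU n lam) (Mon.yU n lam))⁻¹) p := fun p => by
    rw [← legHom_swp_ad_refl]
    change _ = legHom _ (star ((Mon.yU n lam)⁻¹ * conjJ (Mon.jU n lam) (Mon.yU n lam)).1 * p *
      star (star ((Mon.yU n lam)⁻¹ * conjJ (Mon.jU n lam) (Mon.yU n lam)).1))
    rw [star_star, ← Z_eq, ← Mon.flip_mul_mul_flip]
    simp only [tau', mul_assoc]
  exact ⟨⟨_, h⟩, fun p hp => (h p).trans ((Mon.doubleData_yU lam).ad_zed_inv hp)⟩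

/-- Since `opp` reverses products, U_A and its adjoint change places. Their images are given by
`opp_UA`, so here the formula holds for all operators. -/
theorem implements_bAop : Implements (sl (dualU (conjJ (Mon.jU n lam) (Mon.yU n lam))))
    (bAop n lam).comul inl (dualU (conjJ (Mon.jU n lam) (Mon.yU n lam))) := by
  have h : ∀ a, (bAop n lam).comul a =
      ad inl (dualU (conjJ (Mon.jU n lam) (Mon.yU n lam))) a := fun a => by
    have hs : ∀ S T : Op n I₂, opp lam (S * T) = opp lam T * opp lam S := fun S T => by
      rw [Mon.opp_eq, star_mul, Mon.conjOp_mul, ← Mon.opp_eq, ← Mon.opp_eq]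
    have hl : opp lam (legHom (inl : Unit ↪ I₂) (opp lam a)) = legHom inl a := by
      rw [Mon.opp_eq, ← map_star, Mon.conjOp_leg, ← Mon.opp_eq, opp_opp]
    have hst : opp lam (star (UA n lam)) =
        (dualU (conjJ (Mon.jU n lam) (Mon.yU n lam))).1 := by
      rw [Mon.opp_eq, ← Mon.star_conjOp, ← Mon.opp_eq, Mon.opp_UA, star_star]
    change opp lam (UA n lam * legHom inl (opp lam a) * star (UA n lam)) = _
    rw [hs, hs, hl, hst, Mon.opp_UA, ad_apply, mul_assoc]
  exact ⟨⟨_, h⟩, fun a _ => h a⟩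

theorem implements_bAhat : Implements (sl (conjJ (Mon.jU n lam) (Mon.yU n lam)))
    (bAhat n lam).comul inl (conjJ (Mon.jU n lam) (Mon.yU n lam)) := by
  have h : ∀ T, (bAhat n lam).comul T =
      ad inr (bigU (Mon.yU n lam) (Mon.jU n lam))⁻¹ T := fun T => by
    rw [← ad_inv, ← Mon.UA_eq]; rfl
  exact ⟨⟨_, h⟩, fun b hb => (h b).trans ((Mon.doubleData_yU lam).ad_bigU_inv hb)⟩

theorem bADhat_comul (T : Op n I₂) :
    (bADhat n lam).comul T = ad inl (doubleU (Mon.yU n lam) (Mon.jU n lam)) T := by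
  rw [ad_apply, ← VD_eq]; rfl

theorem cop_bA_eq :
    cop (bA n lam) = ⟨sl (dualU (Mon.yU n lam)), (cop (bA n lam)).comul⟩ :=
  congrArg (fun A => (⟨A, (cop (bA n lam)).comul⟩ : BialgData n I₁)) (alg_bA lam)

theorem cop_bAhatOp_eq :
    cop (bAhatOp n lam) = ⟨sl (Mon.yU n lam), (cop (bAhatOp n lam)).comul⟩ :=
  congrArg (fun A => (⟨A, (cop (bAhatOp n lam)).comul⟩ : BialgData n I₁)) (alg_bAhatOp lam)

theorem bAop_eq : bAop n lam =
    ⟨sl (dualU (conjJ (Mon.jU n lam) (Mon.yU n lam))), (bAop n lam).comul⟩ :=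
  congrArg (fun A => (⟨A, (bAop n lam).comul⟩ : BialgData n I₁)) (alg_bAop lam)

theorem bAhat_eq :
    bAhat n lam = ⟨sl (conjJ (Mon.jU n lam) (Mon.yU n lam)), (bAhat n lam).comul⟩ :=
  congrArg (fun A => (⟨A, (bAhat n lam).comul⟩ : BialgData n I₁)) (alg_bAhat lam)

theorem bADhat_eq : bADhat n lam =
    ⟨ten (sl (dualU (Mon.yU n lam))) (sl (Mon.yU n lam)), (bADhat n lam).comul⟩ :=
  congrArg (fun A => (⟨A, (bADhat n lam).comul⟩ : BialgData n I₂)) (alg_bADhat lam)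

end Comultiplications

end QDouble

end

theorem mainTheorem6 (n : ℕ) (lam : ℝ) :
    IsInversion (cop (bA n lam)) (cop (bAhatOp n lam)) (tau n lam) ∧
    IsInversion (bAop n lam) (bAhat n lam) (tau' n lam) ∧
    IsCStarBialgebra (bADhat n lam) ∧
    ∃ δτ δτ' : Op n I₂ → Op n (I₂ ⊕ I₂),
      IsTwistedComul (cop (bA n lam)) (cop (bAhatOp n lam)) (tau n lam) δτ ∧
      IsTwistedComul (bAop n lam) (bAhat n lam) (tau' n lam) δτ' ∧
      IsCStarBialgebra ⟨tens (bA n lam).alg (bAhatOp n lam).alg, δτ⟩ ∧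
      IsCStarBialgebra ⟨tens (bAop n lam).alg (bAhat n lam).alg, δτ'⟩ ∧
      BialgIso (bADhat n lam) ⟨tens (bA n lam).alg (bAhatOp n lam).alg, δτ⟩ ∧
      BialgIso ⟨tens (bA n lam).alg (bAhatOp n lam).alg, δτ⟩
        ⟨tens (bAop n lam).alg (bAhat n lam).alg, δτ'⟩ := by
  have h := Mon.doubleData_yU (n := n) lam
  have hu := h.mult
  -- The statements about A^op and Â are those about A and Â^op with (j ⊗ j)Y(j ⊗ j) in place of Y.
  have hv := hu.conjJ (Mon.jU n lam)
  rw [alg_bA, alg_bAhatOp, alg_bAop, alg_bAhat, ← coe_ten, ← coe_ten, cop_bA_eq, cop_bAhatOp_eq,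
    bAop_eq, bAhat_eq, bADhat_eq]
  exact ⟨hu.isInversion (implements_cop_bA lam) (implements_cop_bAhatOp lam) (implements_tau lam),
    hv.isInversion (implements_bAop lam) (implements_bAhat lam) (implements_tau' lam),
    h.isCStarBialgebra_double (bADhat_comul lam), _, _,
    hu.isTwistedComul (implements_cop_bA lam) (implements_cop_bAhatOp lam) (implements_tau lam),
    hv.isTwistedComul (implements_bAop lam) (implements_bAhat lam) (implements_tau' lam),
    hu.isCStarBialgebra_twist, hv.isCStarBialgebra_twist,
    h.bialgIso_double (bADhat_comul lam), hu.bialgIso_conjJ (Mon.jU n lam)⟩
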